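/- Let $\mathbb F_q$ be a finite field, $n\ge 0$, $r\ge 1$, $G=\mathrm{GL}_n(\mathbb F_q)$, $T\le G$ the diagonal matrices, and $U=U_+$ (resp. $U_-$) the upper (resp. lower) triangular matrices with $1$'s on the diagonal. For $v\in T$ and $g\in G$ let $$N^r_v(g)=\Bigl|\Bigl\{(a,S_1,\dots,S_{2r})\in G\times(U_+\times U_-)^r \;:\; a g a^{-1}=v\prod_{i=1}^r \bigl(S_{2(r+1-i)}\,S_{2(r-i)+1}\bigr)\Bigr\}\Bigr| ,$$ so $S_j\in U_+$ for odd $j$ and $S_j\in U_-$ for even $j$. Let $\Gamma_1=\mathrm{Hom}(\mathbb F_q^\times,\mathbb C^\times)$ and let $\mathcal Q_n$ be the set of maps $\Lambda$ from $\Gamma_1$ to partitions with $\sum_{\psi}|\Lambda(\psi)|=n$. For $\Lambda\in\mathcal Q_n$ let $\psi_1,\dots,\psi_k$ be the distinct characters with $n_i:=|\Lambda(\psi_i)|>0$, and put $\lambda_i=\Lambda(\psi_i)$. * $V_\Lambda$ is the representation of $G$ obtained by parabolic induction, from the Levi subgroup $\prod_i \mathrm{GL}_{n_i}(\mathbb F_q)$,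 of $\bigotimes_i\bigl(\chi_{\lambda_i}\otimes(\psi_i\circ\det)\bigr)$; here $\chi_\lambda$ ($\lambda\vdash m$) are the unipotent representations of $\mathrm{GL}_m(\mathbb F_q)$, labelled so that $\mathrm{Ind}_{P_\nu}^{\mathrm{GL}_m(\mathbb F_q)}1=\sum_\lambda K_{\lambda\nu}\chi_\lambda$ with the Kostka numbers $K_{\lambda\nu}$ (so $\chi_{(m)}$ is trivial). $\chi^G_\Lambda$ is the character of $V_\Lambda$. * $\mathscr H(G,U)$ is the algebra of $U$-bi-invariant functions $G\to\mathbb C$, $T_v$ is the indicator function of $UvU$, and $\mathscr H(G,U)$ acts on $M=\mathrm{Ind}_U^G 1=\{f:G\to\mathbb C \mid f(ux)=f(x)\}$ (on which $G$ acts by right translation) by $(\varphi.f)(x)=|U|^{-1}\sum_{y\in G}\varphi(y)f(y^{-1}x)$, commuting with $G$. $\chi^{\mathscr H}_\Lambda$ is the character of $\mathscr H(G,U)$ on the multiplicity space $\mathrm{Hom}_G(V_\Lambda,M)$. * $f_\Lambda=\binom n2\bigl(1+\chi^N_\Lambda(s)/\chi^N_\Lambda(1)\bigr)$ (and $f_\Lambda=0$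 if $n<2$), where $s\in\mathfrak S_n$ is a transposition and $\chi^N_\Lambda$ is the character of $N=(\mathbb F_q^\times)^n\rtimes\mathfrak S_n$ induced from $\bigotimes_i(\chi^{\mathfrak S}_{\lambda_i}\otimes\psi_i)$ on $\prod_i\bigl((\mathbb F_q^\times)^{n_i}\rtimes\mathfrak S_{n_i}\bigr)$, with $\chi^{\mathfrak S}_\lambda$ the irreducible character of the left ideal generated by the Young symmetrizer of $\lambda$. Then $$N^r_v(g)=\sum_{\Lambda\in\mathcal Q_n}\chi^G_\Lambda(g)\,\chi^{\mathscr H}_\Lambda(T_v)\,q^{r f_\Lambda}.$$ In terms of the $\mathscr H(G,U)$-module $V_\Lambda^U$ of $U$-invariants, with action $\varphi.x=|U|^{-1}\sum_{a\in G}\varphi(a)\,a x$, this reads $$N^r_v(g)=\sum_{\Lambda\in\mathcal Q_n}\chi^G_\Lambda(g)\,\mathrm{tr}\bigl(T_{v^{-1}}\mid V_\Lambda^U\bigr)\,q^{r f_\Lambda}.$$ -/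

import Mathlib

open scoped MatrixGroups

noncomputable section

namespace WildCount

/-! ### Hecke algebras of a finite group relative to a subgroup -/

section Hecke

variable {G : Type*} [Group G] [Fintype G]

/-- The Hecke algebra `ℋ(G, H)`: complex functions on `G` that are bi-invariant under `H`. -/
def heckeAlgebra (H : Subgroup G) : Submodule ℂ (G → ℂ) where
  carrier := {φ | ∀ h₁ ∈ H, ∀ h₂ ∈ H, ∀ g, φ (h₁ * g * h₂) = φ g}
  add_mem' := by
    intro φ φ' hφ hφ' h₁ hh₁ h₂ hh₂ g
    simp [hφ h₁ hh₁ h₂ hh₂ g, hφ' h₁ hh₁ h₂ hh₂ g]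
  zero_mem' := by intro h₁ _ h₂ _ g; rfl
  smul_mem' := by
    intro c φ hφ h₁ hh₁ h₂ hh₂ g
    simp [hφ h₁ hh₁ h₂ hh₂ g]

/-- `T_v`, the indicator function of the double coset `H v H`. -/
def heckeT (H : Subgroup G) (v : G) : heckeAlgebra H :=
  ⟨(DoubleCoset.doubleCoset v (H : Set G) (H : Set G)).indicator 1, by
    intro h₁ hh₁ h₂ hh₂ g
    have : h₁ * g * h₂ ∈ DoubleCoset.doubleCoset v (H : Set G) (H : Set G) ↔
        g ∈ DoubleCoset.doubleCoset v (H : Set G) (H : Set G) := by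
      simp only [DoubleCoset.mem_doubleCoset]
      constructor
      · rintro ⟨x, hx, y, hy, e⟩
        refine ⟨h₁⁻¹ * x, H.mul_mem (H.inv_mem hh₁) hx, y * h₂⁻¹,
          H.mul_mem hy (H.inv_mem hh₂), ?_⟩
        have : g = h₁⁻¹ * (h₁ * g * h₂) * h₂⁻¹ := by group
        rw [this, e]; group
      · rintro ⟨x, hx, y, hy, rfl⟩
        exact ⟨h₁ * x, H.mul_mem hh₁ hx, y * h₂, H.mul_mem hy hh₂, by group⟩
    by_cases hg : g ∈ DoubleCoset.doubleCoset v (H : Set G) (H : Set G)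
    · rw [Set.indicator_of_mem (this.2 hg), Set.indicator_of_mem hg]; rfl
    · rw [Set.indicator_of_notMem (fun h => hg (this.1 h)), Set.indicator_of_notMem hg]⟩

/-- `Ind_H^G 1_H`: functions `f : G → ℂ` with `f (h x) = f x`, and `(g • f) x = f (x g)`. -/
abbrev indTrivial (H : Subgroup G) :
    Representation ℂ G
      (Representation.coindV H.subtype (Representation.trivial ℂ H ℂ)) :=
  Representation.coind H.subtype (Representation.trivial ℂ H ℂ)

/-- The action `(φ.f)(g) = |H|⁻¹ ∑ₓ φ(x) f(x⁻¹ g)` of `ℋ(G, H)` on `Ind_H^G 1_H`,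
which identifies `ℋ(G, H)` with the algebra of `G`-endomorphisms of `Ind_H^G 1_H`. -/
def heckeOnInd (H : Subgroup G) (φ : heckeAlgebra H) :
    (indTrivial H).IntertwiningMap (indTrivial H) where
  toFun f := ⟨fun g => (Nat.card H : ℂ)⁻¹ * ∑ x : G, φ.1 x * f.1 (x⁻¹ * g), by
    intro h g
    simp only [Representation.trivial_apply, Subgroup.coe_subtype]
    congr 1
    refine Fintype.sum_equiv (Equiv.mulLeft (h : G)⁻¹) _ _ fun x => ?_
    have h1 := φ.2 (h : G)⁻¹ (H.inv_mem h.2) 1 H.one_mem x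
    rw [mul_one] at h1
    rw [Equiv.coe_mulLeft, h1]
    congr 2
    group⟩
  map_add' f f' := by
    ext g
    simp [mul_add, Finset.sum_add_distrib]
  map_smul' c f := by
    ext g
    simp only [SetLike.val_smul, Pi.smul_apply, smul_eq_mul, RingHom.id_apply, Finset.mul_sum]
    exact Finset.sum_congr rfl fun x _ => by ring
  isIntertwining' g := by
    ext f x
    change (Nat.card H : ℂ)⁻¹ * ∑ y : G, φ.1 y * f.1 (y⁻¹ * x * g) =
      (Nat.card H : ℂ)⁻¹ * ∑ y : G, φ.1 y * f.1 (y⁻¹ * (x * g))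
    simp only [mul_assoc]

/-- The `G`-homomorphisms `V → Ind_H^G 1_H`: the multiplicity space of `V` in `Ind_H^G 1_H`. -/
def multSpace (H : Subgroup G) {V : Type*} [AddCommGroup V] [Module ℂ V]
    (ρ : Representation ℂ G V) :
    Submodule ℂ
      (V →ₗ[ℂ] Representation.coindV H.subtype (Representation.trivial ℂ H ℂ)) where
  carrier := {A | ∀ g, A ∘ₗ ρ g = indTrivial H g ∘ₗ A}
  add_mem' := by
    intro A B hA hB g
    rw [LinearMap.add_comp, LinearMap.comp_add, hA g, hB g]
  zero_mem' := by intro g; simp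
  smul_mem' := by
    intro c A hA g
    rw [LinearMap.smul_comp, LinearMap.comp_smul, hA g]

/-- `ℋ(G, H)` acts on the multiplicity space by composition with its action on
`Ind_H^G 1_H`. -/
def heckeOnMult (H : Subgroup G) {V : Type*} [AddCommGroup V] [Module ℂ V]
    (ρ : Representation ℂ G V) (φ : heckeAlgebra H) :
    multSpace H ρ →ₗ[ℂ] multSpace H ρ :=
  LinearMap.restrict (p := multSpace H ρ) (q := multSpace H ρ)
    (LinearMap.compRight ℂ (heckeOnInd H φ).toLinearMap) (by
    intro A hA g
    have h1 := (heckeOnInd H φ).isIntertwining' g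
    rw [LinearMap.compRight_apply, LinearMap.comp_assoc, hA g, ← LinearMap.comp_assoc, h1,
      LinearMap.comp_assoc])

/-- The character of the `ℋ(G, H)`-module that is paired with `V` when `Ind_H^G 1_H` is
decomposed under `G × ℋ(G, H)`. -/
def heckeCharacter (H : Subgroup G) {V : Type*} [AddCommGroup V] [Module ℂ V]
    (ρ : Representation ℂ G V) (φ : heckeAlgebra H) : ℂ :=
  LinearMap.trace ℂ (multSpace H ρ) (heckeOnMult H ρ φ)

/-- The action `φ.x = |H|⁻¹ ∑ₐ φ(a) ρ(a) x` of `ℋ(G, H)` on the space `V^H` of `H`-invariants. -/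
def heckeOnInvariants (H : Subgroup G) {V : Type*} [AddCommGroup V] [Module ℂ V]
    (ρ : Representation ℂ G V) (φ : heckeAlgebra H) :
    Representation.invariants (ρ.comp H.subtype) →ₗ[ℂ]
      Representation.invariants (ρ.comp H.subtype) :=
  LinearMap.restrict ((Nat.card H : ℂ)⁻¹ • ∑ a : G, φ.1 a • ρ a) (by
    intro x _ h
    simp only [LinearMap.smul_apply, LinearMap.sum_apply, MonoidHom.comp_apply, map_smul,
      map_sum, Subgroup.coe_subtype]
    congr 1
    refine Fintype.sum_equiv (Equiv.mulLeft (h : G)) _ _ fun a => ?_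
    have h1 := φ.2 (h : G) h.2 1 H.one_mem a
    rw [mul_one] at h1
    rw [Equiv.coe_mulLeft, h1, map_mul]
    rfl)

/-- The character of `ℋ(G, H)` on `V^H`. -/
def invariantsCharacter (H : Subgroup G) {V : Type*} [AddCommGroup V] [Module ℂ V]
    (ρ : Representation ℂ G V) (φ : heckeAlgebra H) : ℂ :=
  LinearMap.trace ℂ (Representation.invariants (ρ.comp H.subtype)) (heckeOnInvariants H ρ φ)

end Hecke

/-! ### Block structures, parabolic and unipotent subgroups -/

/-- Consecutive blocks of sizes `d 0, d 1, …` in `{0, …, n - 1}`. -/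
def blockEquiv {k n : ℕ} (d : Fin k → ℕ) (h : ∑ i, d i = n) : (Σ i, Fin (d i)) ≃ Fin n :=
  finSigmaFinEquiv.trans (finCongr h)

/-- The number of the block that contains an index. -/
def blockOf {k n : ℕ} (d : Fin k → ℕ) (h : ∑ i, d i = n) (a : Fin n) : Fin k :=
  ((blockEquiv d h).symm a).1

section Groups

variable {F : Type*} [Field F]

lemma blockTriangular_inv {n : ℕ} {α : Type*} [LinearOrder α] (b : Fin n → α) (g : GL (Fin n) F)
    (hg : (g : Matrix (Fin n) (Fin n) F).BlockTriangular b) :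
    ((g⁻¹ : GL (Fin n) F) : Matrix (Fin n) (Fin n) F).BlockTriangular b := by
  let _ : Invertible (g : Matrix (Fin n) (Fin n) F) := Units.invertible g
  rw [Matrix.coe_units_inv]
  exact Matrix.blockTriangular_inv_of_blockTriangular hg

/-- Within a diagonal block, the product of block triangular matrices is computed in that
block. -/
lemma blockTriangular_mul_apply {n : ℕ} {α : Type*} [LinearOrder α] (b : Fin n → α)
    (M N : Matrix (Fin n) (Fin n) F) (hM : M.BlockTriangular b) (hN : N.BlockTriangular b)
    {x y : Fin n} (hxy : b x = b y) :
    (M * N) x y = ∑ z, if b z = b x then M x z * N z y else 0 := by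
  rw [Matrix.mul_apply]
  refine Finset.sum_congr rfl fun z _ => ?_
  split_ifs with hz
  · rfl
  · rcases lt_or_gt_of_ne hz with h | h
    · rw [hM h, zero_mul]
    · rw [hN (hxy ▸ h), mul_zero]

/-- The parabolic subgroup of block upper triangular matrices with blocks `d 0, d 1, …`. -/
def parabolic (F : Type*) [Field F] {k n : ℕ} (d : Fin k → ℕ) (h : ∑ i, d i = n) :
    Subgroup (GL (Fin n) F) where
  carrier := {g | (g : Matrix (Fin n) (Fin n) F).BlockTriangular (blockOf d h)}
  mul_mem' := by
    intro g g' hg hg'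
    exact Matrix.BlockTriangular.mul hg hg'
  one_mem' := Matrix.blockTriangular_one
  inv_mem' := by
    intro g hg
    exact blockTriangular_inv _ g hg

/-- The projection of the parabolic subgroup to the `i`-th diagonal block, as matrices. -/
def diagBlock {k n : ℕ} (d : Fin k → ℕ) (h : ∑ i, d i = n) (i : Fin k) :
    parabolic F d h →* Matrix (Fin (d i)) (Fin (d i)) F where
  toFun p := (p.1 : Matrix (Fin n) (Fin n) F).submatrix
    (fun a => blockEquiv d h ⟨i, a⟩) (fun a => blockEquiv d h ⟨i, a⟩)
  map_one' := by
    refine Matrix.submatrix_one _ ?_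
    intro a b hab
    simpa using hab
  map_mul' := by
    intro p p'
    ext a b
    have hb : ∀ x : Σ i, Fin (d i), blockOf d h (blockEquiv d h x) = x.1 := by
      intro x; simp [blockOf]
    have := blockTriangular_mul_apply (blockOf d h) _ _ p.2 p'.2
      (x := blockEquiv d h ⟨i, a⟩) (y := blockEquiv d h ⟨i, b⟩) (by rw [hb, hb])
    simp only [Matrix.submatrix_apply, Matrix.mul_apply, Subgroup.coe_mul, Units.val_mul] at this ⊢
    rw [this, ← Equiv.sum_comp (blockEquiv d h), Fintype.sum_sigma, Finset.sum_eq_single i]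
    · refine Finset.sum_congr rfl fun c _ => ?_
      rw [if_pos (by rw [hb, hb])]
    · intro j _ hj
      refine Finset.sum_eq_zero fun c _ => ?_
      rw [if_neg (by rw [hb, hb]; exact hj)]
    · intro hi; exact absurd (Finset.mem_univ i) hi

/-- The projection of the parabolic subgroup to the `i`-th factor of its Levi quotient. -/
def leviBlock {k n : ℕ} (d : Fin k → ℕ) (h : ∑ i, d i = n) (i : Fin k) :
    parabolic F d h →* GL (Fin (d i)) F :=
  (diagBlock d h i).toHomUnits

/-- Unitriangular matrices for a total order on the indices, given by an injective labelling. -/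
def unitriangular (F : Type*) [Field F] {n : ℕ} {α : Type*} [LinearOrder α] (b : Fin n ↪ α) :
    Subgroup (GL (Fin n) F) where
  carrier := {g | (g : Matrix (Fin n) (Fin n) F).BlockTriangular b ∧
    ∀ i, (g : Matrix (Fin n) (Fin n) F) i i = 1}
  mul_mem' := by
    rintro g g' ⟨hg, h1⟩ ⟨hg', h1'⟩
    refine ⟨Matrix.BlockTriangular.mul hg hg', fun i => ?_⟩
    rw [Units.val_mul, blockTriangular_mul_apply b _ _ hg hg' rfl]
    simp [h1, h1']
  one_mem' := ⟨Matrix.blockTriangular_one, fun i => by simp⟩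
  inv_mem' := by
    rintro g ⟨hg, h1⟩
    refine ⟨blockTriangular_inv _ g hg, fun i => ?_⟩
    have h2 := blockTriangular_mul_apply b _ _ hg (blockTriangular_inv _ g hg)
      (rfl : b i = b i)
    rw [← Units.val_mul, mul_inv_cancel] at h2
    simpa [h1] using h2.symm

/-- `U = U₊`: upper triangular matrices with `1`s on the diagonal. -/
abbrev upperU (F : Type*) [Field F] (n : ℕ) : Subgroup (GL (Fin n) F) :=
  unitriangular F (Function.Embedding.refl (Fin n))

/-- `U₋`: lower triangular matrices with `1`s on the diagonal. -/
abbrev lowerU (F : Type*) [Field F] (n : ℕ) : Subgroup (GL (Fin n) F) :=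
  unitriangular F (OrderDual.toDual.toEmbedding : Fin n ↪ (Fin n)ᵒᵈ)

end Groups

/-! ### Partitions -/

/-- The parts of a partition in decreasing order. -/
def rows {n : ℕ} (lam : n.Partition) : List ℕ := lam.parts.sort (· ≥ ·)

/-- The length of the `i`-th row. -/
def rowLen {n : ℕ} (lam : n.Partition) (i : Fin (rows lam).length) : ℕ := (rows lam).get i

lemma sum_rowLen {n : ℕ} (lam : n.Partition) : ∑ i, rowLen lam i = n := by
  have h : (rows lam).sum = n := by
    have h1 : ((rows lam : List ℕ) : Multiset ℕ) = lam.parts := Multiset.sort_eq _ _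
    rw [← Multiset.sum_coe, h1, lam.parts_sum]
  refine Eq.trans ?_ h
  simp only [rowLen, List.get_eq_getElem]
  exact Fin.sum_univ_getElem (rows lam)

/-- `mu` dominates `lam`. -/
def Dominates {n : ℕ} (mu lam : n.Partition) : Prop :=
  ∀ k, ((rows lam).take k).sum ≤ ((rows mu).take k).sum

/-! ### Irreducible representations of symmetric groups -/

/-- The row of the entry `a` in the tableau filled row by row. -/
def rowOf {n : ℕ} (lam : n.Partition) (a : Fin n) : ℕ :=
  ((blockEquiv (rowLen lam) (sum_rowLen lam)).symm a).1

/-- The column of the entry `a` in the tableau filled row by row. -/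
def colOf {n : ℕ} (lam : n.Partition) (a : Fin n) : ℕ :=
  ((blockEquiv (rowLen lam) (sum_rowLen lam)).symm a).2

/-- The Young symmetrizer `c_λ = a_λ b_λ`: the sum over the permutations that preserve the rows,
times the signed sum over the permutations that preserve the columns. -/
def youngSymmetrizer {n : ℕ} (lam : n.Partition) : MonoidAlgebra ℂ (Equiv.Perm (Fin n)) :=
  (∑ s : Equiv.Perm (Fin n) with ∀ a, rowOf lam (s a) = rowOf lam a, MonoidAlgebra.single s 1) *
  (∑ s : Equiv.Perm (Fin n) with ∀ a, colOf lam (s a) = colOf lam a,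
    MonoidAlgebra.single s ((Equiv.Perm.sign s : ℤ) : ℂ))

/-- The left ideal `ℂ[𝔖_n] c_λ`. -/
abbrev SpechtIdeal {n : ℕ} (lam : n.Partition) : Type :=
  RestrictScalars ℂ (MonoidAlgebra ℂ (Equiv.Perm (Fin n))) (Ideal.span {youngSymmetrizer lam})

/-- The irreducible representation of `𝔖_n` attached to `λ`. -/
def specht {n : ℕ} (lam : n.Partition) :
    Representation ℂ (Equiv.Perm (Fin n)) (SpechtIdeal lam) :=
  Representation.ofModule (Ideal.span {youngSymmetrizer lam})

/-! ### Unipotent representations of `GL_n(F)` -/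

section Unipotent

variable (F : Type*) [Field F]

/-- The standard parabolic subgroup `P_ν` of type `ν`. -/
abbrev partitionParabolic {n : ℕ} (nu : n.Partition) : Subgroup (GL (Fin n) F) :=
  parabolic F (rowLen nu) (sum_rowLen nu)

/-- `τ_ν = Ind_{P_ν}^G 1`. -/
abbrev tau {n : ℕ} (nu : n.Partition) :
    Representation ℂ (GL (Fin n) F)
      (Representation.coindV (partitionParabolic F nu).subtype
        (Representation.trivial ℂ (partitionParabolic F nu) ℂ)) :=
  Representation.coind (partitionParabolic F nu).subtype
    (Representation.trivial ℂ (partitionParabolic F nu) ℂ)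

/-- The unipotent representation attached to `λ`: the part of `τ_λ` that is killed by every
`G`-homomorphism to `τ_μ` for every `μ ≠ λ` that dominates `λ`. Since `τ_ν` is the sum of the
unipotent representations `χ_κ` with the Kostka numbers `K_{κν}` as multiplicities, this is the
irreducible representation `χ_λ` which occurs in `τ_λ` once and in no such `τ_μ`. -/
def unipotent {n : ℕ} (lam : n.Partition) : Subrepresentation (tau F lam) where
  toSubmodule :=
    { carrier := {f | ∀ mu : n.Partition, Dominates mu lam → mu ≠ lam →
        ∀ A : (tau F lam).IntertwiningMap (tau F mu), A f = 0}
      add_mem' := by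
        intro f f' hf hf' mu h1 h2 A
        rw [map_add, hf mu h1 h2 A, hf' mu h1 h2 A, add_zero]
      zero_mem' := by intro mu _ _ A; exact map_zero A
      smul_mem' := by
        intro c f hf mu h1 h2 A
        rw [map_smul, hf mu h1 h2 A, smul_zero] }
  apply_mem_toSubmodule := by
    intro g f hf mu h1 h2 A
    rw [A.isIntertwining, hf mu h1 h2 A, map_zero]

/-- The unipotent representation as a representation of `GL_n(F)`. -/
abbrev unipotentRep {n : ℕ} (lam : n.Partition) :
    Representation ℂ (GL (Fin n) F) (unipotent F lam).toSubmodule :=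
  (unipotent F lam).toRepresentation

end Unipotent

/-! ### The parameter set `𝒬_n` and the attached representations -/

section Parameters

variable (F : Type*) [Field F] [Fintype F]

/-- The character group `Γ₁` of `Fˣ` is finite. -/
instance instFintypeMulChar : Fintype (MulChar F ℂ) := Fintype.ofFinite _

/-- `𝒬_n`: maps `Λ` from the characters of `Fˣ` to the set of all partitions, of total
size `n`. A partition is given together with its size. -/
def QSet (n : ℕ) : Type _ :=
  {L : MulChar F ℂ → Σ m : ℕ, m.Partition // ∑ psi, (L psi).1 = n}

instance instFiniteQSet (n : ℕ) : Finite (QSet F n) := by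
  have hle : ∀ (L : QSet F n) (psi : MulChar F ℂ), (L.1 psi).1 < n + 1 := fun L psi =>
    Nat.lt_succ_of_le ((Finset.single_le_sum (f := fun p => (L.1 p).1)
      (fun _ _ => Nat.zero_le _) (Finset.mem_univ psi)).trans_eq L.2)
  let c : QSet F n → (MulChar F ℂ → Σ m : Fin (n + 1), (m : ℕ).Partition) :=
    fun L psi => ⟨⟨(L.1 psi).1, hle L psi⟩, (L.1 psi).2⟩
  refine Finite.of_injective c ?_
  intro L L' h
  refine Subtype.ext (funext fun psi => ?_)
  have h1 := congrArg (fun x : Σ m : Fin (n + 1), (m : ℕ).Partition =>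
    (⟨(x.1 : ℕ), x.2⟩ : Σ m : ℕ, m.Partition)) (congrFun h psi)
  exact h1

instance instFintypeQSet (n : ℕ) : Fintype (QSet F n) := Fintype.ofFinite _

variable {F} {n : ℕ}

/-- The characters of `Fˣ`, listed in some fixed order. -/
def charAt (F : Type*) [Field F] [Fintype F] (i : Fin (Fintype.card (MulChar F ℂ))) :
    MulChar F ℂ :=
  (Fintype.equivFin (MulChar F ℂ)).symm i

/-- `n_i = |Λ(ψ_i)|`. -/
def QSet.size (L : QSet F n) (i : Fin (Fintype.card (MulChar F ℂ))) : ℕ := (L.1 (charAt F i)).1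

/-- `λ_i = Λ(ψ_i)`. -/
def QSet.part (L : QSet F n) (i : Fin (Fintype.card (MulChar F ℂ))) : (L.size i).Partition :=
  (L.1 (charAt F i)).2

lemma QSet.sum_size (L : QSet F n) : ∑ i, L.size i = n := by
  exact (Equiv.sum_comp (Fintype.equivFin (MulChar F ℂ)).symm fun psi => (L.1 psi).1).trans L.2

/-- The parabolic subgroup with Levi quotient `∏ GL_{n_i}(F)`. -/
abbrev QSet.parabolic (L : QSet F n) : Subgroup (GL (Fin n) F) :=
  WildCount.parabolic F L.size L.sum_size

/-- The tensor product of the spaces of the unipotent representations `χ_{λ_i}`. -/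
def QSet.LeviSpace (L : QSet F n) : Type _ :=
  PiTensorProduct ℂ fun i => (unipotent F (L.part i)).toSubmodule

instance QSet.instAddCommGroupLeviSpace (L : QSet F n) : AddCommGroup L.LeviSpace :=
  Module.addCommMonoidToAddCommGroup ℂ
    (M := PiTensorProduct ℂ fun i => (unipotent F (L.part i)).toSubmodule)

instance QSet.instModuleLeviSpace (L : QSet F n) : Module ℂ L.LeviSpace :=
  inferInstanceAs (Module ℂ (PiTensorProduct ℂ fun i => (unipotent F (L.part i)).toSubmodule))

/-- The representation `⨂ᵢ (χ_{λ_i} ⊗ (ψ_i ∘ det))` of the Levi quotient, inflated to the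
parabolic subgroup. -/
def QSet.leviRep (L : QSet F n) :
    Representation ℂ L.parabolic L.LeviSpace where
  toFun p := PiTensorProduct.map fun i =>
    charAt F i (leviBlock L.size L.sum_size i p).det.val •
      unipotentRep F (L.part i) (leviBlock L.size L.sum_size i p)
  map_one' := by
    simp only [map_one, Units.val_one, one_smul]
    exact PiTensorProduct.map_one
  map_mul' p p' := by
    refine Eq.trans ?_ (PiTensorProduct.map_mul _ _)
    congr 1
    funext i
    simp only [map_mul, Units.val_mul]
    rw [smul_mul_smul_comm]

/-- The representation `V_Λ` of `GL_n(F)`: the parabolic induction of the representation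
`⨂ᵢ (χ_{λ_i} ⊗ (ψ_i ∘ det))` of the Levi subgroup `∏ GL_{n_i}(F)`. -/
def QSet.repG (L : QSet F n) :
    Representation ℂ (GL (Fin n) F) (Representation.coindV L.parabolic.subtype L.leviRep) :=
  Representation.coind L.parabolic.subtype L.leviRep

/-- `χ_Λ^G`. -/
def QSet.chiG (L : QSet F n) (g : GL (Fin n) F) : ℂ := L.repG.character g

/-- `χ_Λ^ℋ`, the character of the Yokonuma–Hecke algebra `ℋ(G, U)` on the multiplicity space of
`V_Λ` in `Ind_U^G 1`. -/
def QSet.chiH [DecidableEq F] (L : QSet F n) (φ : heckeAlgebra (upperU F n)) : ℂ :=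
  heckeCharacter (upperU F n) L.repG φ

/-- The character of `ℋ(G, U)` on the invariants `V_Λ^U`. -/
def QSet.chiInv [DecidableEq F] (L : QSet F n) (φ : heckeAlgebra (upperU F n)) : ℂ :=
  invariantsCharacter (upperU F n) L.repG φ

/-! ### The normalizer of the torus and the exponents `f_Λ` -/

/-- `N = (Fˣ)^n ⋊ 𝔖_n`, the group of monomial matrices. -/
abbrev Monomial (F : Type*) [Field F] (n : ℕ) : Type _ :=
  (Fin n → Fˣ) ⋊[mulAutArrow] Equiv.Perm (Fin n)

/-- The embedding of `∏ 𝔖_{n_i}` in `𝔖_n` along consecutive blocks. -/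
def QSet.youngHom (L : QSet F n) :
    (∀ i, Equiv.Perm (Fin (L.size i))) →* Equiv.Perm (Fin n) :=
  (blockEquiv L.size L.sum_size).permCongrHom.toMonoidHom.comp
    (Equiv.Perm.sigmaCongrRightHom fun i => Fin (L.size i))

/-- `∏ N_i = (Fˣ)^n ⋊ ∏ 𝔖_{n_i}`. -/
abbrev QSet.MonomialLevi (L : QSet F n) : Type _ :=
  (Fin n → Fˣ) ⋊[(mulAutArrow : Equiv.Perm (Fin n) →* MulAut (Fin n → Fˣ)).comp L.youngHom]
    (∀ i, Equiv.Perm (Fin (L.size i)))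

/-- The embedding of `∏ N_i` in `N`. -/
def QSet.monomialHom (L : QSet F n) : L.MonomialLevi →* Monomial F n :=
  SemidirectProduct.map (MonoidHom.id _) L.youngHom (fun _ => rfl)

/-- The character `(ψ_i)` of the torus `(Fˣ)^n`, with `ψ_i` on the `i`-th block. -/
def QSet.torusChar (L : QSet F n) : (Fin n → Fˣ) →* ℂ where
  toFun t := ∏ a, charAt F (blockOf L.size L.sum_size a) (t a : F)
  map_one' := by simp
  map_mul' t t' := by simp [Finset.prod_mul_distrib]

lemma QSet.torusChar_smul (L : QSet F n) (s : ∀ i, Equiv.Perm (Fin (L.size i)))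
    (t : Fin n → Fˣ) :
    L.torusChar ((mulAutArrow : Equiv.Perm (Fin n) →* MulAut (Fin n → Fˣ)) (L.youngHom s) t) =
      L.torusChar t := by
  have hb : ∀ a, blockOf L.size L.sum_size (L.youngHom s a) = blockOf L.size L.sum_size a := by
    intro a
    simp [QSet.youngHom, blockOf, Equiv.Perm.sigmaCongrRightHom, Equiv.permCongrHom]
  change (∏ a, charAt F (blockOf L.size L.sum_size a) (t ((L.youngHom s)⁻¹ a) : F)) =
    ∏ a, charAt F (blockOf L.size L.sum_size a) (t a : F)
  rw [← Equiv.prod_comp (L.youngHom s)]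
  refine Finset.prod_congr rfl fun a _ => ?_
  rw [hb]
  congr 3
  exact (L.youngHom s).symm_apply_apply a

/-- The tensor product of the spaces of the representations `χ_{λ_i}^𝔖`. -/
def QSet.MonomialLeviSpace (L : QSet F n) : Type :=
  PiTensorProduct ℂ fun i => SpechtIdeal (L.part i)

instance QSet.instAddCommGroupMonomialLeviSpace (L : QSet F n) :
    AddCommGroup L.MonomialLeviSpace :=
  Module.addCommMonoidToAddCommGroup ℂ (M := PiTensorProduct ℂ fun i => SpechtIdeal (L.part i))

instance QSet.instModuleMonomialLeviSpace (L : QSet F n) : Module ℂ L.MonomialLeviSpace :=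
  inferInstanceAs (Module ℂ (PiTensorProduct ℂ fun i => SpechtIdeal (L.part i)))

/-- The representation `⨂ᵢ (χ_{λ_i}^𝔖 ⊗ ψ_i)` of `∏ N_i`. -/
def QSet.monomialLeviRep (L : QSet F n) :
    Representation ℂ L.MonomialLevi L.MonomialLeviSpace where
  toFun x := L.torusChar x.left •
    (PiTensorProduct.map fun i => specht (L.part i) (x.right i) :
      PiTensorProduct ℂ (fun i => SpechtIdeal (L.part i)) →ₗ[ℂ]
        PiTensorProduct ℂ (fun i => SpechtIdeal (L.part i)))
  map_one' := by
    simp only [SemidirectProduct.one_left, SemidirectProduct.one_right, map_one, one_smul,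
      Pi.one_apply]
    exact PiTensorProduct.map_one
  map_mul' x y := by
    simp only [SemidirectProduct.mul_left, SemidirectProduct.mul_right, map_mul, Pi.mul_apply]
    rw [MonoidHom.comp_apply, L.torusChar_smul, PiTensorProduct.map_mul]
    exact (smul_mul_smul_comm (β := Module.End ℂ (PiTensorProduct ℂ fun i =>
      SpechtIdeal (L.part i))) _ _ _ _).symm

/-- `χ_Λ^N`, the character of `Ind_{∏ N_i}^N ⨂ᵢ (χ_{λ_i}^𝔖 ⊗ ψ_i)`. -/
def QSet.chiN (L : QSet F n) (x : Monomial F n) : ℂ :=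
  (Representation.coind L.monomialHom L.monomialLeviRep).character x

/-- `f_Λ = (n choose 2) (1 + χ_Λ^N(s) / χ_Λ^N(1))` with `s` a transposition, which is `0` if
`n < 2`. -/
def QSet.f (L : QSet F n) : ℂ :=
  if h : 2 ≤ n then
    (n.choose 2 : ℂ) *
      (1 + L.chiN (SemidirectProduct.inr (Equiv.swap ⟨0, by omega⟩ ⟨1, by omega⟩)) / L.chiN 1)
  else 0

end Parameters

/-! ### The count -/

/-- `N_v^r(g)`: the number of tuples `(a, S_1, …, S_{2r})` with `a ∈ G`, `S_j ∈ U₊` for odd `j`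
and `S_j ∈ U₋` for even `j`, and `a g a⁻¹ = v (S_{2r} S_{2r-1}) ⋯ (S_2 S_1)`. The pair `S j`, for
`j = 0, …, r - 1`, stands for `(S_{2j+1}, S_{2j+2})`. -/
def stokesCount {F : Type*} [Field F] {n : ℕ} (r : ℕ) (v g : GL (Fin n) F) : ℕ :=
  Nat.card {x : GL (Fin n) F × (Fin r → upperU F n × lowerU F n) //
    x.1 * g * x.1⁻¹ =
      v * (List.ofFn fun i : Fin r =>
        ((x.2 i.rev).2 : GL (Fin n) F) * ((x.2 i.rev).1 : GL (Fin n) F)).prod}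

end WildCount

end

/-! Let ζ(h) be the number of tuples S with `v` · ∏ S = h (`stokesFun`), so that N(g) = Σ_x ζ(x g
x⁻¹). Since r > 0, the rightmost factor S_1 runs through U, and ζ is right U-invariant. The χ_Λ are
distinct irreducible characters that exhaust the constituents of Ind_U^G 1, so ζ is fixed by the sum
of their isotypic projections, and `sum_conj_eq_sum_irrChar` gives N(g) = Σ_Λ χ_Λ(g) Σ_h ζ(h)
χ_Λ(h⁻¹).

For the inner sum, let e and f be the averaging projections of U₊ and U₋ on V_Λ. Summing the
inverses of `v` · ∏ S over all S turns it into |U|^{2r} tr((ef)^r v⁻¹). With w₀ the longest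
permutation, f = w₀ e w₀, hence efe = (e w₀ e)². This square commutes with every e g e, because w₀
permutes the simple reflections under conjugation (`permOp_rev_sq_central`). By Schur's lemma it
equals c e (`eq_smul_of_corner_central`), and the trace becomes |U|^{2r} c^r tr(e v⁻¹), where tr(e
v⁻¹) is the trace of T_{v⁻¹} on V_Λ^U (`trace_avgOp_pow`, `invariantsCharacter_heckeT`). The version
with the multiplicity space follows by Frobenius reciprocity (`heckeCharacter_eq`).

It remains to see that |U|² c = q^{f_Λ} (`QSet.exists_scalar`). Take determinants on V_Λ^U, of
dimension d = χ^N_Λ(1). The element w₀ is a reduced product of (n choose 2) simple reflections s,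
and the quadratic relation `heckeOp_adj_sq_eq` writes q² (e s e)² in terms of nested projections e ≥
e_H ≥ e_Q, with eigenvalues q, 1 and q² on the successive pieces. Its determinant therefore involves
2 tr e_Q − tr e_H, which Mackey's formula identifies with χ^N_Λ(s) (`avg_mergeIdx_levChar`,
`QSet.chiN_inr`). This yields (|U|² c)^d = q^{d f_Λ}. An invariant Hermitian form shows c ≥ 0
(`nonneg_of_sq_eq_smul`), which singles out the right d-th root.

The character theory is transported from symmetric groups. By the Bruhat decomposition, double
cosets of block triangular groups correspond to double cosets of Young subgroups, so the
intertwining numbers of the induced characters agree (`sum_stabCard_eq`, `charPair_tauFun`). Young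
symmetrizers show that the Kostka matrix is unitriangular for dominance. Its inverse turns flag
characters into the orthonormal family `uniChar`, and peeling off constituents along the dominance
order (`trace_restrict_eq_of_unitriangular`) identifies these with the characters of the spaces
`unipotent`. Parabolic induction of their twisted products gives `levChar`, orthonormal by the same
computation. Completeness is the numerical identity Σ_Λ χ_Λ(1) dim V_Λ^U = |G|/|U|
(`QSet.sum_chiG_one_mul`), a consequence of the multinomial theorem. -/

noncomputable section

namespace WildCount

/-! ### Characters of finite groups -/

section Traces

/-- The trace of an operator on functions that is given by an operator-valued kernel. -/
lemma trace_pi_kernel {X A : Type*} [Fintype X] [AddCommGroup A] [Module ℂ A]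
    [FiniteDimensional ℂ A] (K : X → X → A →ₗ[ℂ] A) (f : (X → A) →ₗ[ℂ] (X → A))
    (hf : ∀ φ x, f φ x = ∑ y, K x y (φ y)) :
    LinearMap.trace ℂ (X → A) f = ∑ x, LinearMap.trace ℂ A (K x x) := by
  classical
  let b := Module.finBasis ℂ A
  rw [LinearMap.trace_eq_matrix_trace ℂ (Pi.basis fun _ : X => b) f]
  simp only [Matrix.trace, Matrix.diag_apply, LinearMap.toMatrix_apply, Fintype.sum_sigma,
    Pi.basis_apply, Pi.basis_repr]
  refine Finset.sum_congr rfl fun x _ => ?_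
  rw [LinearMap.trace_eq_matrix_trace ℂ b (K x x)]
  simp only [Matrix.trace, Matrix.diag_apply, LinearMap.toMatrix_apply]
  refine Finset.sum_congr rfl fun i _ => ?_
  rw [hf, Finset.sum_eq_single x]
  · simp
  · intro y _ hy
    rw [Pi.single_eq_of_ne hy, map_zero]
  · simp

/-- In a product basis the diagonal entries are products of diagonal entries, and the sum over
multi-indices factors. -/
lemma trace_piTensorProduct_map {ι : Type*} [Fintype ι] {M : ι → Type*}
    [∀ i, AddCommGroup (M i)] [∀ i, Module ℂ (M i)] [∀ i, FiniteDimensional ℂ (M i)]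
    (f : ∀ i, M i →ₗ[ℂ] M i) :
    LinearMap.trace ℂ (PiTensorProduct ℂ M) (PiTensorProduct.map f) =
      ∏ i, LinearMap.trace ℂ (M i) (f i) := by
  classical
  let b := fun i => Module.finBasis ℂ (M i)
  rw [LinearMap.trace_eq_matrix_trace ℂ (Basis.piTensorProduct b)]
  simp only [Matrix.trace, Matrix.diag_apply, LinearMap.toMatrix_apply,
    Basis.piTensorProduct_apply, PiTensorProduct.map_tprod,
    Basis.piTensorProduct_repr_tprod_apply]
  refine (Fintype.prod_sum fun i j => (b i).repr (f i (b i j)) j).symm.trans ?_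
  refine Finset.prod_congr rfl fun i _ => ?_
  rw [LinearMap.trace_eq_matrix_trace ℂ (b i)]
  simp [Matrix.trace, LinearMap.toMatrix_apply]

/-- An idempotent operator of trace zero vanishes. -/
lemma eq_zero_of_idempotent_of_trace_eq_zero {V : Type*} [AddCommGroup V] [Module ℂ V]
    [FiniteDimensional ℂ V] (f : V →ₗ[ℂ] V) (hf : f * f = f)
    (h : LinearMap.trace ℂ V f = 0) : f = 0 := by
  have h1 : LinearMap.IsProj (LinearMap.range f) f :=
    ⟨fun x => ⟨x, rfl⟩, by
      rintro _ ⟨y, rfl⟩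
      exact LinearMap.congr_fun hf y⟩
  rw [h1.trace] at h
  have h2 : Module.finrank ℂ (LinearMap.range f) = 0 := by exact_mod_cast h
  rw [Submodule.finrank_eq_zero] at h2
  exact LinearMap.range_eq_bot.1 h2

end Traces

/-! ### Characters of coinduced representations. -/

section Coinduction

variable {H G A : Type*} [Group H] [Group G] [Fintype H] [Fintype G] [AddCommGroup A]
  [Module ℂ A] [FiniteDimensional ℂ A]

instance instFiniteCoind (φ : H →* G) (σ : Representation ℂ H A) :
    FiniteDimensional ℂ (Representation.coindV φ σ) :=
  FiniteDimensional.finiteDimensional_submodule _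

open scoped Classical in
/-- The character of a coinduced representation. -/
lemma character_coind (φ : H →* G) (σ : Representation ℂ H A) (g : G) :
    (Representation.coind φ σ).character g =
      (Fintype.card H : ℂ)⁻¹ * ∑ x : G, ∑ h : H,
        if φ h = x * g * x⁻¹ then σ.character h else 0 := by
  have hH : (Fintype.card H : ℂ) ≠ 0 := by exact_mod_cast Fintype.card_ne_zero
  -- `f` is right translation by `g` followed by the averaging projection of all functions `G → A`
  -- onto the coinduced space. It lands in that space and agrees there with the action of `g`, so
  -- the trace can be taken over all functions, where `K` is an explicit kernel.
  let K : G → G → A →ₗ[ℂ] A := fun x y =>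
    (Fintype.card H : ℂ)⁻¹ • ∑ h : H, if φ h * (x * g) = y then σ h⁻¹ else 0
  let f : (G → A) →ₗ[ℂ] (G → A) := LinearMap.pi fun x =>
    (Fintype.card H : ℂ)⁻¹ • ∑ h : H, σ h⁻¹ ∘ₗ LinearMap.proj (φ h * (x * g))
  have hfa : ∀ u x, f u x = (Fintype.card H : ℂ)⁻¹ • ∑ h : H, σ h⁻¹ (u (φ h * (x * g))) := by
    intro u x
    simp [f]
  have hf : ∀ u x, f u x = ∑ y, K x y (u y) := by
    intro u x
    rw [hfa]
    simp only [K, LinearMap.smul_apply, LinearMap.sum_apply, ← Finset.smul_sum]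
    rw [Finset.sum_comm]
    congr 1
    refine Finset.sum_congr rfl fun h _ => ?_
    rw [Finset.sum_eq_single (φ h * (x * g))]
    · simp
    · intro y _ hy
      rw [if_neg (Ne.symm hy), LinearMap.zero_apply]
    · simp
  have hmem : ∀ u, f u ∈ Representation.coindV φ σ := by
    intro u k x
    rw [hfa, hfa, map_smul, map_sum]
    congr 1
    refine Fintype.sum_equiv (Equiv.mulRight k) _ _ fun h => ?_
    simp only [Equiv.coe_mulRight, map_mul φ, mul_inv_rev, mul_assoc]
    rw [← LinearMap.comp_apply, ← Module.End.mul_eq_comp, ← map_mul, mul_inv_cancel_left]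
  have h1 : (Representation.coind φ σ) g = f.restrict fun u _ => hmem u := by
    ext u x
    have hu := u.2
    rw [LinearMap.coe_restrict_apply, hfa]
    have : ∀ h : H, σ h⁻¹ (u.1 (φ h * (x * g))) = u.1 (x * g) := by
      intro h
      rw [hu h, ← LinearMap.comp_apply, ← Module.End.mul_eq_comp, ← map_mul]
      simp
    simp only [this]
    rw [Finset.sum_const, Finset.card_univ, ← Nat.cast_smul_eq_nsmul ℂ, smul_smul,
      inv_mul_cancel₀ hH, one_smul]
    rfl
  rw [Representation.character, h1, LinearMap.trace_restrict_eq_of_forall_mem _ _ hmem,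
    trace_pi_kernel K f hf, Finset.mul_sum]
  refine Finset.sum_congr rfl fun x _ => ?_
  simp only [K, map_smul, map_sum, smul_eq_mul]
  congr 1
  refine Fintype.sum_equiv (Equiv.inv H) _ _ fun h => ?_
  have : φ h * (x * g) = x ↔ φ h⁻¹ = x * g * x⁻¹ := by
    rw [map_inv, inv_eq_iff_eq_inv]
    constructor
    · intro e
      rw [eq_inv_iff_mul_eq_one, mul_assoc, ← mul_assoc x, ← mul_assoc (φ h), e, mul_inv_cancel]
    · intro e
      rw [e]; group
  simp only [Equiv.inv_apply, this]
  split_ifs <;> simp [Representation.character]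

end Coinduction

/-! ### Averaging projections of subgroups. -/

section Average

variable {G : Type*} [Group G] [Fintype G] {V : Type*} [AddCommGroup V] [Module ℂ V]

open scoped Classical in
/-- The averaging operator of a subgroup. -/
def avgOp (ρ : Representation ℂ G V) (K : Subgroup G) : V →ₗ[ℂ] V :=
  (Nat.card K : ℂ)⁻¹ • ∑ g : G, if g ∈ K then ρ g else 0

open scoped Classical in
lemma sum_ite_mem_const {E : Type*} [AddCommGroup E] [Module ℂ E] (K : Subgroup G) (c : E) :
    (∑ g : G, if g ∈ K then c else 0) = (Nat.card K : ℂ) • c := by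
  rw [← Finset.sum_filter, Finset.sum_const, ← Nat.cast_smul_eq_nsmul ℂ]
  congr 2
  rw [Nat.card_eq_fintype_card, Fintype.card_subtype]

lemma card_subgroup_ne_zero (K : Subgroup G) : (Nat.card K : ℂ) ≠ 0 := by
  exact_mod_cast Nat.card_pos.ne'

/-- Averages of functions on a subgroup that take a constant value. -/
lemma avg_const {E : Type*} [AddCommGroup E] [Module ℂ E] (K : Subgroup G) (f : G → E) (c : E)
    (h : ∀ g ∈ K, f g = c) :
    (Nat.card K : ℂ)⁻¹ • (∑ g : G, open scoped Classical in if g ∈ K then f g else 0) = c := by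
  classical
  rw [← inv_smul_smul₀ (card_subgroup_ne_zero K) c, ← sum_ite_mem_const]
  congr 1
  refine Finset.sum_congr rfl fun g _ => ?_
  split_ifs with hg
  · exact h g hg
  · rfl

variable (ρ : Representation ℂ G V) (K : Subgroup G)

lemma mul_avgOp (A : V →ₗ[ℂ] V) : A * avgOp ρ K =
    (Nat.card K : ℂ)⁻¹ • ∑ g : G, open scoped Classical in if g ∈ K then A * ρ g else 0 := by
  classical
  simp only [avgOp, mul_smul_comm, Finset.mul_sum, mul_ite, mul_zero]

lemma avgOp_mul (A : V →ₗ[ℂ] V) : avgOp ρ K * A =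
    (Nat.card K : ℂ)⁻¹ • ∑ g : G, open scoped Classical in if g ∈ K then ρ g * A else 0 := by
  classical
  simp only [avgOp, smul_mul_assoc, Finset.sum_mul, ite_mul, zero_mul]

variable {K}

lemma rho_mul_avgOp {k : G} (hk : k ∈ K) : ρ k * avgOp ρ K = avgOp ρ K := by
  classical
  rw [mul_avgOp, avgOp]
  congr 1
  refine Fintype.sum_equiv (Equiv.mulLeft k) _ _ fun g => ?_
  simp only [Equiv.coe_mulLeft, K.mul_mem_cancel_left hk, map_mul]

lemma avgOp_mul_rho {k : G} (hk : k ∈ K) : avgOp ρ K * ρ k = avgOp ρ K := by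
  classical
  rw [avgOp_mul, avgOp]
  congr 1
  refine Fintype.sum_equiv (Equiv.mulRight k) _ _ fun g => ?_
  simp only [Equiv.coe_mulRight, K.mul_mem_cancel_right hk, map_mul]

/-- The average over `K` absorbs each element of `K'`. With the mirrored statement, nested subgroups
give commuting projections, the larger subgroup having the smaller range; this is used for the chain
of groups attached to a simple reflection. -/
lemma avgOp_mul_avgOp {K' : Subgroup G} (h : K' ≤ K) : avgOp ρ K * avgOp ρ K' = avgOp ρ K := by
  rw [mul_avgOp]
  exact avg_const _ _ _ fun g hg => avgOp_mul_rho ρ (h hg)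

lemma avgOp_mul_avgOp' {K' : Subgroup G} (h : K' ≤ K) : avgOp ρ K' * avgOp ρ K = avgOp ρ K := by
  rw [avgOp_mul]
  exact avg_const _ _ _ fun g hg => rho_mul_avgOp ρ (h hg)

lemma avgOp_idem : avgOp ρ K * avgOp ρ K = avgOp ρ K := avgOp_mul_avgOp ρ le_rfl

open scoped Classical in
lemma trace_avgOp_mul (K : Subgroup G) (g : G) : LinearMap.trace ℂ V (avgOp ρ K * ρ g) =
    (Nat.card K : ℂ)⁻¹ * ∑ k : G, if k ∈ K then ρ.character (k * g) else 0 := by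
  rw [avgOp_mul, map_smul, map_sum, smul_eq_mul]
  congr 1
  refine Finset.sum_congr rfl fun k _ => ?_
  split_ifs
  · rw [← map_mul]; rfl
  · exact map_zero _

open scoped Classical in
lemma trace_avgOp (K : Subgroup G) : LinearMap.trace ℂ V (avgOp ρ K) =
    (Nat.card K : ℂ)⁻¹ * ∑ k : G, if k ∈ K then ρ.character k else 0 := by
  have := trace_avgOp_mul ρ K 1
  simpa using this

lemma avgOp_comm_of_normalizes {g : G} (h : ∀ k, k ∈ K ↔ g * k * g⁻¹ ∈ K) :
    avgOp ρ K * ρ g = ρ g * avgOp ρ K := by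
  classical
  rw [mul_avgOp, avgOp_mul]
  congr 1
  refine Fintype.sum_equiv (MulAut.conj g⁻¹).toEquiv _ _ fun k => ?_
  change _ = if g⁻¹ * k * g⁻¹⁻¹ ∈ K then ρ g * ρ (g⁻¹ * k * g⁻¹⁻¹) else 0
  have e : g * (g⁻¹ * k * g⁻¹⁻¹) * g⁻¹ = k := by group
  rw [h (g⁻¹ * k * g⁻¹⁻¹), e]
  simp only [← map_mul]
  congr 2
  group

end Average

/-! ### Schur's lemma, isotypic projections and class functions. -/

section Irreducible

variable {G : Type*} [Group G] [Fintype G]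

/-- The pairing of class functions. -/
def charPair (f f' : G → ℂ) : ℂ := (Nat.card G : ℂ)⁻¹ * ∑ g, f g * f' g⁻¹

lemma card_ne_zero' : (Nat.card G : ℂ) ≠ 0 := by
  exact_mod_cast Nat.card_pos.ne'

instance instInvertibleCard : Invertible (Nat.card G : ℂ) := invertibleOfNonzero card_ne_zero'

lemma charPair_comm (f f' : G → ℂ) : charPair f f' = charPair f' f := by
  unfold charPair
  congr 1
  exact Fintype.sum_equiv (Equiv.inv G) _ _ fun g => by simp [mul_comm]

lemma charPair_sum_left {ι : Type*} (s : Finset ι) (c : ι → ℂ) (f : ι → G → ℂ) (f' : G → ℂ) :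
    charPair (fun g => ∑ i ∈ s, c i * f i g) f' = ∑ i ∈ s, c i * charPair (f i) f' := by
  simp only [charPair, Finset.sum_mul, Finset.mul_sum]
  rw [Finset.sum_comm]
  exact Finset.sum_congr rfl fun i _ => Finset.sum_congr rfl fun g _ => by ring

lemma charPair_sum_right {ι : Type*} (s : Finset ι) (c : ι → ℂ) (f : ι → G → ℂ) (φ : G → ℂ) :
    charPair φ (fun g => ∑ i ∈ s, c i * f i g) = ∑ i ∈ s, c i * charPair φ (f i) := by
  rw [charPair_comm, charPair_sum_left]
  simp only [charPair_comm φ]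

/-- The properties of the character of an irreducible representation on which the orthogonality
relations rest. -/
structure IsIrrChar (χ : G → ℂ) : Prop where
  one_ne_zero : χ 1 ≠ 0
  conj : ∀ x g, χ (x * g * x⁻¹) = χ g
  average : ∀ k g, (∑ x, χ (k * (x * g * x⁻¹))) * χ 1 = Nat.card G * χ k * χ g

variable {V : Type*} [AddCommGroup V] [Module ℂ V] [FiniteDimensional ℂ V]

/-- A representation whose character has norm one has only scalar endomorphisms. -/
lemma eq_smul_one_of_charPair_eq_one (ρ : Representation ℂ G V)
    (h : charPair ρ.character ρ.character = 1) (A : V →ₗ[ℂ] V)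
    (hA : ∀ g, A * ρ g = ρ g * A) : ∃ c : ℂ, A = c • 1 := by
  -- The norm of the character is the dimension of the space of self-intertwiners, which is
  -- therefore spanned by the identity.
  have h1 : Module.finrank ℂ (ρ.IntertwiningMap ρ) = 1 := by
    have := Representation.card_inv_mul_sum_char_mul_char_eq_finrank ρ ρ
    rw [charPair] at h
    rw [h] at this
    exact_mod_cast this.symm
  have h2 : (Representation.IntertwiningMap.id ρ) ≠ 0 := by
    intro h0
    have : Subsingleton (ρ.IntertwiningMap ρ) := by
      refine ⟨fun B C => ?_⟩
      have hz : ∀ B : ρ.IntertwiningMap ρ, B = 0 := by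
        intro B
        ext v
        have hv : v = 0 := congrArg (fun C : ρ.IntertwiningMap ρ => C v) h0
        rw [hv, map_zero, map_zero]
      rw [hz B, hz C]
    rw [Module.finrank_zero_of_subsingleton] at h1
    exact absurd h1 (by norm_num)
  obtain ⟨c, hc⟩ := (finrank_eq_one_iff_of_nonzero' _ h2).1 h1 ⟨A, hA⟩
  refine ⟨c, ?_⟩
  ext v
  exact (congrArg (fun C : ρ.IntertwiningMap ρ => C v) hc).symm

lemma eq_trace_smul_one_of_charPair_eq_one (ρ : Representation ℂ G V)
    (h : charPair ρ.character ρ.character = 1) (A : V →ₗ[ℂ] V)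
    (hA : ∀ g, A * ρ g = ρ g * A) :
    ρ.character 1 • A = LinearMap.trace ℂ V A • 1 := by
  obtain ⟨c, rfl⟩ := eq_smul_one_of_charPair_eq_one ρ h A hA
  rw [map_smul, LinearMap.trace_one, Representation.char_one, smul_smul, smul_eq_mul, _root_.mul_comm]

/-- The content is the field `average`: by Schur's lemma the sum of the ρ(x g x⁻¹) is a scalar,
determined by its trace |G| χ(g). Multiplying by ρ(k) and taking traces gives the relation. -/
lemma isIrrChar_character (ρ : Representation ℂ G V)
    (h : charPair ρ.character ρ.character = 1) : IsIrrChar ρ.character := by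
  refine ⟨fun h0 => ?_, fun x g => ρ.char_conj g x, fun k g => ?_⟩
  · have hV : Subsingleton V := by
      rw [Representation.char_one] at h0
      exact Module.finrank_zero_iff.1 (by exact_mod_cast h0)
    have : ∀ g, ρ.character g = 0 := fun g => by
      rw [Representation.character, Subsingleton.elim (ρ g) 0, map_zero]
    simp [charPair, this] at h
  · have h1 := eq_trace_smul_one_of_charPair_eq_one ρ h (∑ x, ρ (x * g * x⁻¹)) (fun y => by
      rw [Finset.sum_mul, Finset.mul_sum]
      refine Fintype.sum_equiv (Equiv.mulLeft y⁻¹) _ _ fun x => ?_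
      rw [← map_mul, ← map_mul]
      congr 1
      simp only [Equiv.coe_mulLeft]
      group)
    have h2 := congrArg (fun B => LinearMap.trace ℂ V (ρ k * B)) h1
    simp only [Algebra.mul_smul_comm, mul_one, map_smul, smul_eq_mul, map_sum,
      Finset.mul_sum, ← map_mul] at h2
    have h3 : ∀ x : G, LinearMap.trace ℂ V (ρ (x * g * x⁻¹)) = ρ.character g :=
      fun x => ρ.char_conj g x
    simp only [h3, Finset.sum_const, Finset.card_univ, nsmul_eq_mul] at h2
    rw [Nat.card_eq_fintype_card]
    rw [Finset.sum_mul]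
    refine Eq.trans ?_ (h2.trans ?_)
    · exact Finset.sum_congr rfl fun x _ => by rw [_root_.mul_comm]; rfl
    · change _ * LinearMap.trace ℂ V (ρ k) = _ * LinearMap.trace ℂ V (ρ k) * _
      ring

/-- Convolution of an irreducible character with a class function. -/
lemma IsIrrChar.convolution {χ f : G → ℂ} (hχ : IsIrrChar χ) (hf : ∀ x g, f (x * g * x⁻¹) = f g)
    (g : G) : (∑ m, χ (g * m⁻¹) * f m) * χ 1 = Nat.card G * charPair f χ * χ g := by
  -- Since `f` is a class function, `m` may be conjugated by any `x`; averaging over `x` puts the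
  -- sum into the form to which `average` applies.
  have h1 : ∀ x : G, ∑ m, χ (g * m⁻¹) * f m = ∑ m, χ (g * (x * m⁻¹ * x⁻¹)) * f m := by
    intro x
    refine Fintype.sum_equiv (MulAut.conj x⁻¹).toEquiv _ _ fun m => ?_
    have e1 : x * (x⁻¹ * m * x⁻¹⁻¹)⁻¹ * x⁻¹ = m⁻¹ := by group
    change _ = χ (g * (x * (x⁻¹ * m * x⁻¹⁻¹)⁻¹ * x⁻¹)) * f (x⁻¹ * m * x⁻¹⁻¹)
    rw [e1, hf]
  have h2 : (Nat.card G : ℂ) * ∑ m, χ (g * m⁻¹) * f m =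
      ∑ x : G, ∑ m, χ (g * (x * m⁻¹ * x⁻¹)) * f m := by
    rw [← Finset.sum_congr rfl fun x _ => h1 x, Finset.sum_const, Finset.card_univ, nsmul_eq_mul,
      Nat.card_eq_fintype_card]
  have h3 : (Nat.card G : ℂ) * ((∑ m, χ (g * m⁻¹) * f m) * χ 1) =
      Nat.card G * ∑ m, χ g * χ m⁻¹ * f m := by
    rw [← mul_assoc, h2, Finset.sum_comm, Finset.sum_mul, Finset.mul_sum]
    refine Finset.sum_congr rfl fun m _ => ?_
    rw [← Finset.sum_mul, mul_right_comm, hχ.average]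
    ring
  have h4 := mul_left_cancel₀ card_ne_zero' h3
  rw [h4, charPair, ← mul_assoc, mul_inv_cancel₀ card_ne_zero', one_mul, Finset.sum_mul]
  exact Finset.sum_congr rfl fun m _ => by ring

variable {W : Type*} [AddCommGroup W] [Module ℂ W] [FiniteDimensional ℂ W]

/-- The projection to the isotypic component of an irreducible character. -/
def isoProj (ρ : Representation ℂ G W) (χ : G → ℂ) : W →ₗ[ℂ] W :=
  (χ 1 * (Nat.card G : ℂ)⁻¹) • ∑ h, χ h⁻¹ • ρ h

omit [FiniteDimensional ℂ W] in
lemma isoProj_comm (ρ : Representation ℂ G W) {χ : G → ℂ} (hχ : ∀ x g, χ (x * g * x⁻¹) = χ g)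
    (g : G) : isoProj ρ χ * ρ g = ρ g * isoProj ρ χ := by
  simp only [isoProj, smul_mul_assoc, mul_smul_comm, Finset.sum_mul, Finset.mul_sum, ← map_mul]
  congr 1
  refine Fintype.sum_equiv (MulAut.conj g⁻¹).toEquiv _ _ fun h => ?_
  change _ = χ (g⁻¹ * h * g⁻¹⁻¹)⁻¹ • ρ (g * (g⁻¹ * h * g⁻¹⁻¹))
  have e : (g⁻¹ * h * g⁻¹⁻¹)⁻¹ = g⁻¹ * h⁻¹ * g⁻¹⁻¹ := by group
  rw [e, hχ]
  congr 2
  group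

omit [FiniteDimensional ℂ V] [FiniteDimensional ℂ W] in
lemma isoProj_intertwining (ρ : Representation ℂ G W) (σ : Representation ℂ G V) (χ : G → ℂ)
    (A : ρ.IntertwiningMap σ) (w : W) : A (isoProj ρ χ w) = isoProj σ χ (A w) := by
  simp only [isoProj, LinearMap.smul_apply, LinearMap.sum_apply, map_smul, map_sum,
    A.isIntertwining]

-- The product is a convolution of `χ` with a class function, hence a multiple of `χ`. Leaving the
-- pairing in the scalar makes idempotency (pairing 1) and orthogonality (pairing 0) two cases of
-- one formula.
omit [FiniteDimensional ℂ W] in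
lemma isoProj_mul (ρ : Representation ℂ G W) {χ χ' : G → ℂ} (hχ : IsIrrChar χ)
    (hχ' : ∀ x g, χ' (x * g * x⁻¹) = χ' g) :
    isoProj ρ χ * isoProj ρ χ' = (χ' 1 * (χ 1)⁻¹ * charPair χ' χ) • isoProj ρ χ := by
  have key : (∑ h, χ h⁻¹ • ρ h) * (∑ h, χ' h⁻¹ • ρ h) =
      (Nat.card G * charPair χ' χ * (χ 1)⁻¹) • ∑ h, χ h⁻¹ • ρ h := by
    rw [Finset.sum_mul]
    simp only [Finset.mul_sum, smul_mul_smul_comm, ← map_mul]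
    have : ∀ h : G, ∑ k, (χ h⁻¹ * χ' k⁻¹) • ρ (h * k) =
        ∑ m, (χ h⁻¹ * χ' (m⁻¹ * h)) • ρ m := fun h =>
      Fintype.sum_equiv (Equiv.mulLeft h) _ _ fun k => by simp
    rw [Finset.sum_congr rfl fun h _ => this h, Finset.sum_comm, Finset.smul_sum]
    refine Finset.sum_congr rfl fun m _ => ?_
    rw [← Finset.sum_smul, smul_smul]
    congr 1
    have h1 := hχ.convolution hχ' m⁻¹
    have h2 : ∑ h, χ h⁻¹ * χ' (m⁻¹ * h) = ∑ k, χ (m⁻¹ * k⁻¹) * χ' k := by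
      refine Fintype.sum_equiv (Equiv.mulLeft m⁻¹) _ _ fun h => ?_
      simp only [Equiv.coe_mulLeft, mul_inv_rev, inv_inv]
      congr 1
      rw [← hχ.conj m⁻¹ h⁻¹]
      congr 1
      group
    rw [h2]
    field_simp [hχ.one_ne_zero]
    rw [h1]
  rw [isoProj, isoProj, smul_mul_smul_comm, key, smul_smul, smul_smul]
  congr 1
  field_simp [hχ.one_ne_zero, card_ne_zero' (G := G)]

-- The isotypic component carries `χ` with multiplicity `charPair ρ.character χ`. The convolution
-- formula gives this without decomposing `W`.
omit [FiniteDimensional ℂ W] in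
lemma trace_isoProj_mul (ρ : Representation ℂ G W) {χ : G → ℂ} (hχ : IsIrrChar χ) (g : G) :
    LinearMap.trace ℂ W (isoProj ρ χ * ρ g) = charPair ρ.character χ * χ g := by
  have h1 := hχ.convolution (fun x g => ρ.char_conj g x) g
  have h2 : ∑ h, χ h⁻¹ * ρ.character (h * g) = ∑ m, χ (g * m⁻¹) * ρ.character m := by
    refine Fintype.sum_equiv (Equiv.mulRight g) _ _ fun h => ?_
    simp
  rw [isoProj, smul_mul_assoc, map_smul, Finset.sum_mul, map_sum]
  simp only [smul_mul_assoc, map_smul, smul_eq_mul, ← map_mul]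
  change χ 1 * (Nat.card G : ℂ)⁻¹ * ∑ h, χ h⁻¹ * ρ.character (h * g) = _
  rw [h2]
  have h3 := card_ne_zero' (G := G)
  field_simp
  linear_combination h1

open scoped Classical in
/-- A complete family of irreducible characters of `Ind_U^G 1` reconstructs the class functions
that are averages of `U`-invariant functions. -/
lemma sum_conj_eq_sum_irrChar {ι : Type*} [Fintype ι] (χ : ι → G → ℂ) (hχ : ∀ i, IsIrrChar (χ i))
    (horth : ∀ i j, i ≠ j → charPair (χ i) (χ j) = 0) (hnorm : ∀ i, charPair (χ i) (χ i) = 1)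
    (U : Subgroup G)
    (hU : ∑ i, χ i 1 * (∑ u : G, if u ∈ U then χ i u else 0) = Nat.card G)
    (ζ : G → ℂ) (hζ : ∀ g, ∀ u ∈ U, ζ (g * u) = ζ g) (g : G) :
    ∑ x, ζ (x * g * x⁻¹) = ∑ i, χ i g * ∑ h, ζ h * χ i h⁻¹ := by
  let R : Representation ℂ G (G → ℂ) :=
    { toFun := fun m => LinearMap.funLeft ℂ ℂ (· * m)
      map_one' := by ext; simp
      map_mul' := by intro a b; ext; simp [mul_assoc] }
  have hR : ∀ m f y, R m f y = f (y * m) := fun m f y => rfl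
  let e : (G → ℂ) →ₗ[ℂ] (G → ℂ) := avgOp R U
  have hcG := card_ne_zero' (G := G)
  have hRtr : ∀ m, R.character m = if m = 1 then (Nat.card G : ℂ) else 0 := by
    intro m
    rw [Representation.character,
      trace_pi_kernel (fun x y => if x * m = y then (1 : ℂ →ₗ[ℂ] ℂ) else 0) (R m) (by
        intro f x
        rw [hR, Finset.sum_eq_single (x * m)]
        · simp
        · intro y _ hy
          rw [if_neg (Ne.symm hy), LinearMap.zero_apply]
        · simp)]
    by_cases hm : m = 1
    · simp [hm, Nat.card_eq_fintype_card]
    · simp [hm]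
  let E : (G → ℂ) →ₗ[ℂ] (G → ℂ) := ∑ i, isoProj R (χ i)
  have hE : E * E = E := by
    simp only [E, Finset.sum_mul, Finset.mul_sum]
    refine Finset.sum_congr rfl fun i _ => ?_
    rw [Finset.sum_eq_single i]
    · rw [isoProj_mul R (hχ i) (hχ i).conj, hnorm, mul_one,
        mul_inv_cancel₀ (hχ i).one_ne_zero, one_smul]
    · intro j _ hj
      rw [isoProj_mul R (hχ j) (hχ i).conj, horth i j hj.symm, mul_zero, zero_smul]
    · simp
  have he : e * e = e := avgOp_idem R
  have hcomm : E * e = e * E := by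
    simp only [E, e, Finset.sum_mul, Finset.mul_sum]
    refine Finset.sum_congr rfl fun i _ => ?_
    rw [mul_avgOp, avgOp_mul]
    congr 1
    exact Finset.sum_congr rfl fun g _ => by rw [isoProj_comm R (hχ i).conj]
  -- `e - E * e` is the part of the `U`-invariants that the given characters miss. It is idempotent,
  -- and `hU` says exactly that its trace vanishes, because each `χ i` occurs `χ i 1` times in the
  -- regular representation.
  have hzero : e - E * e = 0 := by
    refine eq_zero_of_idempotent_of_trace_eq_zero _ ?_ ?_
    · have h1 : e * (E * e) = E * e := by rw [← mul_assoc, ← hcomm, mul_assoc, he]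
      have h2 : E * e * e = E * e := by rw [mul_assoc, he]
      have h3 : E * e * (E * e) = E * e := by rw [mul_assoc, h1, ← mul_assoc, hE]
      rw [mul_sub, sub_mul, sub_mul, he, h2, h1, h3]
      abel
    · have t1 : LinearMap.trace ℂ (G → ℂ) e = (Nat.card U : ℂ)⁻¹ * Nat.card G := by
        rw [trace_avgOp]
        congr 1
        simp only [hRtr]
        rw [Finset.sum_eq_single 1]
        · simp [U.one_mem]
        · intro u _ hu
          simp [hu]
        · simp
      have t2 : ∀ i, charPair R.character (χ i) = χ i 1 := by
        intro i
        rw [charPair, Finset.sum_eq_single 1]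
        · rw [hRtr, if_pos rfl, inv_one, ← mul_assoc, inv_mul_cancel₀ hcG, one_mul]
        · intro m _ hm
          rw [hRtr, if_neg hm, zero_mul]
        · simp
      have t3 : ∀ i, LinearMap.trace ℂ (G → ℂ) (isoProj R (χ i) * e) =
          (Nat.card U : ℂ)⁻¹ * (χ i 1 * ∑ u : G, if u ∈ U then χ i u else 0) := by
        intro i
        rw [mul_avgOp, map_smul, map_sum, smul_eq_mul]
        congr 1
        rw [Finset.mul_sum]
        refine Finset.sum_congr rfl fun u _ => ?_
        split_ifs
        · rw [trace_isoProj_mul R (hχ i), t2]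
        · rw [map_zero, mul_zero]
      rw [map_sub, t1]
      simp only [E, Finset.sum_mul, map_sum, t3]
      rw [← Finset.mul_sum, hU, sub_self]
  have hζe : e ζ = ζ := by
    ext y
    have h1 : e ζ = (Nat.card U : ℂ)⁻¹ • ∑ g : G, if g ∈ U then R g ζ else 0 := by
      simp only [e, avgOp, LinearMap.smul_apply, LinearMap.sum_apply]
      congr 1
      refine Finset.sum_congr rfl fun g _ => ?_
      split_ifs <;> rfl
    rw [h1, avg_const (E := G → ℂ) U (fun g => R g ζ) ζ fun u hu => funext fun y => hζ y u hu]
  -- `ζ` is fixed by `e`, hence by `E`; this writes it as a sum of convolutions with the characters.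
  have hζE : ∀ y, ζ y = ∑ i, χ i 1 * (Nat.card G : ℂ)⁻¹ * ∑ h, ζ h * χ i (h⁻¹ * y) := by
    intro y
    have h1 : E ζ = ζ := by
      have := LinearMap.congr_fun hzero ζ
      rw [LinearMap.sub_apply, Module.End.mul_apply, hζe, LinearMap.zero_apply, sub_eq_zero]
        at this
      exact this.symm
    conv_lhs => rw [← h1]
    simp only [E, isoProj, LinearMap.sum_apply, LinearMap.smul_apply, Finset.sum_apply,
      Pi.smul_apply, smul_eq_mul, hR]
    refine Finset.sum_congr rfl fun i _ => ?_
    congr 1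
    refine Fintype.sum_equiv (Equiv.mulLeft y) _ _ fun h => ?_
    simp [_root_.mul_comm]
  rw [Finset.sum_congr rfl fun x _ => hζE (x * g * x⁻¹), Finset.sum_comm]
  refine Finset.sum_congr rfl fun i _ => ?_
  rw [← Finset.mul_sum, Finset.sum_comm, Finset.mul_sum, Finset.mul_sum]
  refine Finset.sum_congr rfl fun h _ => ?_
  rw [← Finset.mul_sum]
  -- The sum over conjugates separates the dependence on `h` from that on `g`.
  have h1 := (hχ i).average h⁻¹ g
  field_simp
  linear_combination ζ h * h1

end Irreducible

end WildCount

end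

noncomputable section

namespace WildCount

/-! ### Induced class functions and double cosets -/

section Induction

variable {G : Type*} [Group G] [Fintype G]

open scoped Classical in
/-- The induction formula for class functions. -/
def indFun (H : Subgroup G) (φ : G → ℂ) (g : G) : ℂ :=
  (Nat.card H : ℂ)⁻¹ * ∑ x : G, if x * g * x⁻¹ ∈ H then φ (x * g * x⁻¹) else 0

lemma indFun_conj (H : Subgroup G) (φ : G → ℂ) (y g : G) :
    indFun H φ (y * g * y⁻¹) = indFun H φ g := by
  unfold indFun
  congr 1
  refine Fintype.sum_equiv (Equiv.mulRight y) _ _ fun x => ?_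
  have : x * (y * g * y⁻¹) * x⁻¹ = x * y * g * (x * y)⁻¹ := by group
  rw [Equiv.coe_mulRight, this]

open scoped Classical in
lemma indFun_one (H : Subgroup G) (φ : G → ℂ) (h : φ 1 = 1) :
    indFun H φ 1 = (Nat.card G : ℂ) / Nat.card H := by
  simp [indFun, H.one_mem, h, div_eq_inv_mul, Nat.card_eq_fintype_card]

open scoped Classical in
/-- Frobenius reciprocity for class functions. -/
lemma charPair_indFun (H : Subgroup G) (φ f : G → ℂ) (hf : ∀ x g, f (x * g * x⁻¹) = f g) :
    charPair (indFun H φ) f =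
      (Nat.card H : ℂ)⁻¹ * ∑ h : G, if h ∈ H then φ h * f h⁻¹ else 0 := by
  have h1 : ∀ g : G, indFun H φ g * f g⁻¹ = (Nat.card H : ℂ)⁻¹ *
      ∑ x : G, if x * g * x⁻¹ ∈ H then φ (x * g * x⁻¹) * f (x * g * x⁻¹)⁻¹ else 0 := by
    intro g
    rw [indFun, mul_assoc, Finset.sum_mul]
    congr 1
    refine Finset.sum_congr rfl fun x _ => ?_
    have : (x * g * x⁻¹)⁻¹ = x * g⁻¹ * x⁻¹ := by group
    rw [this, hf, ite_mul, zero_mul]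
  rw [charPair, Finset.sum_congr rfl fun g _ => h1 g, ← Finset.mul_sum, Finset.sum_comm]
  have h2 : ∀ x : G, (∑ g : G, if x * g * x⁻¹ ∈ H then φ (x * g * x⁻¹) * f (x * g * x⁻¹)⁻¹ else 0)
      = ∑ h : G, if h ∈ H then φ h * f h⁻¹ else 0 := fun x =>
    Fintype.sum_equiv (MulAut.conj x).toEquiv _ _ fun g => rfl
  rw [Finset.sum_congr rfl fun x _ => h2 x, Finset.sum_const, Finset.card_univ, nsmul_eq_mul,
    ← Nat.card_eq_fintype_card,
    mul_left_comm, ← mul_assoc (Nat.card G : ℂ)⁻¹, inv_mul_cancel₀ card_ne_zero', one_mul]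

open scoped Classical in
/-- Induction in stages. -/
lemma indFun_stages {H P : Subgroup G} (hHP : H ≤ P) (φ : G → ℂ) (g : G) :
    indFun P (fun p => (Nat.card H : ℂ)⁻¹ *
      ∑ y : G, if y ∈ P then (if y * p * y⁻¹ ∈ H then φ (y * p * y⁻¹) else 0) else 0) g =
      indFun H φ g := by
  have h1 : ∀ x : G, (if x * g * x⁻¹ ∈ P then ((Nat.card H : ℂ)⁻¹ *
      ∑ y : G, if y ∈ P then (if y * (x * g * x⁻¹) * y⁻¹ ∈ H then φ (y * (x * g * x⁻¹) * y⁻¹)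
        else 0) else 0) else 0) = (Nat.card H : ℂ)⁻¹ *
      ∑ y : G, if y ∈ P then (if (y * x) * g * (y * x)⁻¹ ∈ H then φ ((y * x) * g * (y * x)⁻¹)
        else 0) else 0 := by
    intro x
    have e : ∀ y : G, y * (x * g * x⁻¹) * y⁻¹ = (y * x) * g * (y * x)⁻¹ := fun y => by group
    simp only [e]
    split_ifs with hx
    · rfl
    · symm
      rw [mul_eq_zero]
      right
      refine Finset.sum_eq_zero fun y _ => ?_
      split_ifs with hy hyx
      · exfalso
        apply hx
        rw [← e] at hyx
        have h3 := P.mul_mem (P.mul_mem (P.inv_mem hy) (hHP hyx)) hy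
        have : y⁻¹ * (y * (x * g * x⁻¹) * y⁻¹) * y = x * g * x⁻¹ := by group
        rwa [this] at h3
      · rfl
      · rfl
  rw [indFun, Finset.sum_congr rfl fun x _ => h1 x, ← Finset.mul_sum, Finset.sum_comm]
  have h2 : ∀ y : G, (∑ x : G, if y ∈ P then (if (y * x) * g * (y * x)⁻¹ ∈ H then
      φ ((y * x) * g * (y * x)⁻¹) else 0) else 0) = if y ∈ P then
        (∑ x : G, if x * g * x⁻¹ ∈ H then φ (x * g * x⁻¹) else 0) else 0 := by
    intro y
    split_ifs
    · exact Fintype.sum_equiv (Equiv.mulLeft y) _ _ fun x => rfl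
    · simp
  rw [Finset.sum_congr rfl fun y _ => h2 y, sum_ite_mem_const, smul_eq_mul, indFun,
    mul_left_comm, ← mul_assoc (Nat.card P : ℂ)⁻¹, inv_mul_cancel₀ (card_subgroup_ne_zero P),
    one_mul]

end Induction

/-! ### Double cosets and intertwining numbers of induced linear characters. -/

section DoubleCoset

variable {G : Type*} [Group G]

/-- The number of elements of `P ∩ z Q z⁻¹`. -/
def stabCard (P Q : Subgroup G) (z : G) : ℕ := Nat.card {r : G // r ∈ P ∧ z⁻¹ * r * z ∈ Q}

/-- `z'` lies in the double coset `P z Q`. -/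
def SameCoset (P Q : Subgroup G) (z z' : G) : Prop := ∃ p ∈ P, ∃ q ∈ Q, z' = p * z * q

lemma SameCoset.refl (P Q : Subgroup G) (z : G) : SameCoset P Q z z :=
  ⟨1, P.one_mem, 1, Q.one_mem, by simp⟩

lemma SameCoset.symm {P Q : Subgroup G} {z z' : G} (h : SameCoset P Q z z') :
    SameCoset P Q z' z := by
  obtain ⟨p, hp, q, hq, rfl⟩ := h
  exact ⟨p⁻¹, P.inv_mem hp, q⁻¹, Q.inv_mem hq, by group⟩

lemma SameCoset.trans {P Q : Subgroup G} {z z' z'' : G} (h : SameCoset P Q z z')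
    (h' : SameCoset P Q z' z'') : SameCoset P Q z z'' := by
  obtain ⟨p, hp, q, hq, rfl⟩ := h
  obtain ⟨p', hp', q', hq', rfl⟩ := h'
  exact ⟨p' * p, P.mul_mem hp' hp, q * q', Q.mul_mem hq hq', by group⟩

variable [Fintype G]

lemma stabCard_pos (P Q : Subgroup G) (z : G) : 0 < stabCard P Q z := by
  have : Nonempty {r : G // r ∈ P ∧ z⁻¹ * r * z ∈ Q} :=
    ⟨⟨1, P.one_mem, by simp [Q.one_mem]⟩⟩
  exact Nat.card_pos

/-- The orbit formula for double cosets. -/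
lemma card_sameCoset_mul_stabCard (P Q : Subgroup G) (z : G) :
    Nat.card {z' : G // SameCoset P Q z z'} * stabCard P Q z = Nat.card P * Nat.card Q := by
  classical
  let f : P × Q → {z' : G // SameCoset P Q z z'} :=
    fun x => ⟨x.1 * z * x.2, x.1, x.1.2, x.2, x.2.2, rfl⟩
  -- The fibres of (p, q) ↦ p z q are torsors under P ∩ z Q z⁻¹, acting by (p r, (z⁻¹ r z)⁻¹ q)
  -- after a base point is chosen.
  have hfib : ∀ c, Nat.card {x // f x = c} = stabCard P Q z := by
    intro c
    obtain ⟨p₀, hp₀, q₀, hq₀, e⟩ := c.2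
    refine Nat.card_congr
      { toFun := fun x => ⟨p₀⁻¹ * x.1.1, P.mul_mem (P.inv_mem hp₀) x.1.1.2, ?_⟩
        invFun := fun r => ⟨(⟨p₀ * r.1, P.mul_mem hp₀ r.2.1⟩,
          ⟨(z⁻¹ * r.1 * z)⁻¹ * q₀, Q.mul_mem (Q.inv_mem r.2.2) hq₀⟩), ?_⟩
        left_inv := ?_
        right_inv := ?_ }
    · have h := congrArg Subtype.val x.2
      simp only [f, e] at h
      have : z⁻¹ * (p₀⁻¹ * (x.1.1 : G)) * z = q₀ * (x.1.2 : G)⁻¹ := by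
        have h' : (x.1.1 : G) * z = p₀ * z * q₀ * (x.1.2 : G)⁻¹ := by
          rw [← h]; group
        rw [mul_assoc, mul_assoc, h']; group
      rw [this]
      exact Q.mul_mem hq₀ (Q.inv_mem x.1.2.2)
    · refine Subtype.ext ?_
      rw [e]
      change p₀ * r.1 * z * ((z⁻¹ * r.1 * z)⁻¹ * q₀) = p₀ * z * q₀
      group
    · intro x
      have h := congrArg Subtype.val x.2
      simp only [f, e] at h
      refine Subtype.ext (Prod.ext (Subtype.ext ?_) (Subtype.ext ?_))
      · simp
      · change (z⁻¹ * (p₀⁻¹ * (x.1.1 : G)) * z)⁻¹ * q₀ = x.1.2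
        have h' : (x.1.2 : G) = z⁻¹ * (x.1.1 : G)⁻¹ * (p₀ * z * q₀) := by rw [← h]; group
        rw [h']; group
    · intro r
      refine Subtype.ext ?_
      simp
  have h1 : Nat.card (P × Q) = Nat.card (Σ c, {x // f x = c}) :=
    Nat.card_congr (Equiv.sigmaFiberEquiv f).symm
  rw [Nat.card_prod] at h1
  rw [h1, Nat.card_sigma, Finset.sum_congr rfl fun c _ => hfib c, Finset.sum_const,
    Finset.card_univ, smul_eq_mul, Nat.card_eq_fintype_card]

/-- Comparison of double coset sums in two groups whose double cosets correspond. -/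
lemma sum_stabCard_eq {W : Type*} [Group W] [Fintype W] (P Q : Subgroup G) (P' Q' : Subgroup W)
    (ι : W → G) (hsurj : ∀ z, ∃ w, SameCoset P Q z (ι w))
    (hiff : ∀ w w', SameCoset P Q (ι w) (ι w') ↔ SameCoset P' Q' w w')
    (f : G → ℂ) (hf : ∀ z z', SameCoset P Q z z' → f z = f z') :
    ((Nat.card P : ℂ) * Nat.card Q)⁻¹ * ∑ z, stabCard P Q z * f z =
      ((Nat.card P' : ℂ) * Nat.card Q')⁻¹ * ∑ w, stabCard P' Q' w * f (ι w) := by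
  classical
  let d : G → ℂ := fun z => (Nat.card {z' : G // SameCoset P Q z z'} : ℂ)
  let k : G → ℂ := fun z => (Nat.card {w : W // SameCoset P Q z (ι w)} : ℂ)
  have hd0 : ∀ z, d z ≠ 0 := by
    intro z
    have : Nonempty {z' : G // SameCoset P Q z z'} := ⟨⟨z, SameCoset.refl P Q z⟩⟩
    exact Nat.cast_ne_zero.2 Nat.card_pos.ne'
  have hk0 : ∀ z, k z ≠ 0 := by
    intro z
    obtain ⟨w, hw⟩ := hsurj z
    have : Nonempty {w : W // SameCoset P Q z (ι w)} := ⟨⟨w, hw⟩⟩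
    exact Nat.cast_ne_zero.2 Nat.card_pos.ne'
  have hP := card_subgroup_ne_zero P
  have hQ := card_subgroup_ne_zero Q
  have hP' := card_subgroup_ne_zero P'
  have hQ' := card_subgroup_ne_zero Q'
  have hcongr : ∀ z z', SameCoset P Q z z' → d z = d z' ∧ k z = k z' := by
    intro z z' h
    constructor
    · exact congrArg Nat.cast (Nat.card_congr (Equiv.subtypeEquivRight fun y =>
        ⟨fun h' => h.symm.trans h', fun h' => h.trans h'⟩))
    · exact congrArg Nat.cast (Nat.card_congr (Equiv.subtypeEquivRight fun y =>
        ⟨fun h' => h.symm.trans h', fun h' => h.trans h'⟩))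
  -- By the orbit formula the normalized weight is the inverse of the size of the double coset, so
  -- each side of the claim is the sum of `f` with one term per double coset.
  have h1 : ∀ z, ((Nat.card P : ℂ) * Nat.card Q)⁻¹ * (stabCard P Q z * f z) = (d z)⁻¹ * f z := by
    intro z
    have : d z * stabCard P Q z = Nat.card P * Nat.card Q := by
      simp only [d]
      exact_mod_cast card_sameCoset_mul_stabCard P Q z
    have hd := hd0 z
    rw [← this, mul_inv]
    have hs : (stabCard P Q z : ℂ) ≠ 0 := Nat.cast_ne_zero.2 (stabCard_pos P Q z).ne'
    field_simp
  have h2 : ∀ w, ((Nat.card P' : ℂ) * Nat.card Q')⁻¹ * (stabCard P' Q' w * f (ι w)) =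
      (k (ι w))⁻¹ * f (ι w) := by
    intro w
    have e : k (ι w) = (Nat.card {w' : W // SameCoset P' Q' w w'} : ℂ) :=
      congrArg Nat.cast (Nat.card_congr (Equiv.subtypeEquivRight fun w' => hiff w w'))
    have : k (ι w) * stabCard P' Q' w = Nat.card P' * Nat.card Q' := by
      rw [e]
      exact_mod_cast card_sameCoset_mul_stabCard P' Q' w
    have hk := hk0 (ι w)
    rw [← this, mul_inv]
    have hs : (stabCard P' Q' w : ℂ) ≠ 0 := Nat.cast_ne_zero.2 (stabCard_pos P' Q' w).ne'
    field_simp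
  rw [Finset.mul_sum, Finset.mul_sum, Finset.sum_congr rfl fun z _ => h1 z,
    Finset.sum_congr rfl fun w _ => h2 w]
  have hcountW : (∀ z, (∑ w, if SameCoset P Q z (ι w) then (1 : ℂ) else 0) = k z) := by
    intro z
    rw [Finset.sum_boole, ← Fintype.card_subtype, ← Nat.card_eq_fintype_card]
  have hcountG : (∀ z, (∑ z', if SameCoset P Q z' z then (1 : ℂ) else 0) = d z) := by
    intro z
    rw [Finset.sum_boole, ← Fintype.card_subtype, ← Nat.card_eq_fintype_card]
    exact congrArg Nat.cast (Nat.card_congr (Equiv.subtypeEquivRight fun w' =>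
      ⟨fun h => h.symm, fun h => h.symm⟩))
  -- Double count the pairs (z, w) for which `z` and `ι w` lie in the same double coset.
  calc ∑ z, (d z)⁻¹ * f z
      = ∑ z, ∑ w, if SameCoset P Q z (ι w) then (d z)⁻¹ * f z * (k z)⁻¹ else 0 := by
        refine Finset.sum_congr rfl fun z _ => ?_
        have : ∀ w, (if SameCoset P Q z (ι w) then (d z)⁻¹ * f z * (k z)⁻¹ else 0) =
          (d z)⁻¹ * f z * (k z)⁻¹ * (if SameCoset P Q z (ι w) then (1 : ℂ) else 0) := by
          intro w; split_ifs <;> simp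
        rw [Finset.sum_congr rfl fun w _ => this w, ← Finset.mul_sum, hcountW,
          mul_assoc, inv_mul_cancel₀ (hk0 z), mul_one]
    _ = ∑ w, ∑ z, if SameCoset P Q z (ι w) then (d z)⁻¹ * f z * (k z)⁻¹ else 0 :=
        Finset.sum_comm
    _ = ∑ w, (k (ι w))⁻¹ * f (ι w) := by
        refine Finset.sum_congr rfl fun w _ => ?_
        have : ∀ z, (if SameCoset P Q z (ι w) then (d z)⁻¹ * f z * (k z)⁻¹ else 0) =
          (d (ι w))⁻¹ * f (ι w) * (k (ι w))⁻¹ *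
            (if SameCoset P Q z (ι w) then (1 : ℂ) else 0) := by
          intro z
          split_ifs with h
          · rw [(hcongr _ _ h).1, (hcongr _ _ h).2, hf _ _ h, mul_one]
          · simp
        rw [Finset.sum_congr rfl fun z _ => this z, ← Finset.mul_sum, hcountG]
        have := hd0 (ι w)
        field_simp

/-- `φ` is a multiplicative character on the subgroup `P`. -/
structure IsCharOn (P : Subgroup G) (φ : G → ℂ) : Prop where
  one : φ 1 = 1
  mul : ∀ p ∈ P, ∀ p' ∈ P, φ (p * p') = φ p * φ p'

omit [Fintype G] in
lemma IsCharOn.conj {P : Subgroup G} {φ : G → ℂ} (h : IsCharOn P φ) {p x : G} (hp : p ∈ P)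
    (hx : x ∈ P) : φ (p⁻¹ * x * p) = φ x := by
  rw [h.mul _ (P.mul_mem (P.inv_mem hp) hx) _ hp, h.mul _ (P.inv_mem hp) _ hx, mul_right_comm,
    ← h.mul _ (P.inv_mem hp) _ hp, inv_mul_cancel, h.one, one_mul]

/-- The characters `φ` of `P` and `φ'` of `z⁻¹`-conjugated `Q` agree on `P ∩ z Q z⁻¹`. -/
def Compat (P Q : Subgroup G) (φ φ' : G → ℂ) (z : G) : Prop :=
  ∀ p ∈ P, z⁻¹ * p * z ∈ Q → φ p * φ' (z⁻¹ * p⁻¹ * z) = 1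

-- A linear character of a subgroup is invariant under conjugation by that subgroup. Moving `z`
-- within P z Q only conjugates the arguments of the two characters inside their own groups.
omit [Fintype G] in
lemma compat_of_sameCoset {P Q : Subgroup G} {φ φ' : G → ℂ} (hφ : IsCharOn P φ)
    (hφ' : IsCharOn Q φ') {z z' : G} (h : SameCoset P Q z z') (hz : Compat P Q φ φ' z) :
    Compat P Q φ φ' z' := by
  obtain ⟨p₀, hp₀, q₀, hq₀, rfl⟩ := h
  intro p hp hq
  have hq' : z⁻¹ * (p₀⁻¹ * p * p₀) * z ∈ Q := by
    have := Q.mul_mem (Q.mul_mem hq₀ hq) (Q.inv_mem hq₀)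
    have e : q₀ * ((p₀ * z * q₀)⁻¹ * p * (p₀ * z * q₀)) * q₀⁻¹ = z⁻¹ * (p₀⁻¹ * p * p₀) * z := by
      group
    rwa [e] at this
  have h1 := hz (p₀⁻¹ * p * p₀) (P.mul_mem (P.mul_mem (P.inv_mem hp₀) hp) hp₀) hq'
  rw [hφ.conj hp₀ hp] at h1
  have e2 : (p₀ * z * q₀)⁻¹ * p⁻¹ * (p₀ * z * q₀) =
      q₀⁻¹ * (z⁻¹ * (p₀⁻¹ * p * p₀)⁻¹ * z) * q₀ := by group
  have e3 : z⁻¹ * (p₀⁻¹ * p * p₀)⁻¹ * z = (z⁻¹ * (p₀⁻¹ * p * p₀) * z)⁻¹ := by group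
  rw [e2, hφ'.conj hq₀ (by rw [e3]; exact Q.inv_mem hq'), h1]

open scoped Classical in
/-- The intertwining number of two induced one-dimensional characters. -/
lemma charPair_indFun_indFun (P Q : Subgroup G) (φ φ' : G → ℂ) (hφ : IsCharOn P φ)
    (hφ' : IsCharOn Q φ') :
    charPair (indFun P φ) (indFun Q φ') = ((Nat.card P : ℂ) * Nat.card Q)⁻¹ *
      ∑ z, (stabCard P Q z : ℂ) * (if Compat P Q φ φ' z then (1 : ℂ) else 0) := by
  rw [charPair_indFun P φ _ (indFun_conj Q φ'), mul_inv, mul_assoc (Nat.card P : ℂ)⁻¹]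
  congr 1
  have h1 : ∀ p : G, (if p ∈ P then φ p * indFun Q φ' p⁻¹ else 0) = (Nat.card Q : ℂ)⁻¹ *
      ∑ z : G, if p ∈ P ∧ z⁻¹ * p * z ∈ Q then φ p * φ' (z⁻¹ * p⁻¹ * z) else 0 := by
    intro p
    split_ifs with hp
    · rw [indFun, mul_left_comm, Finset.mul_sum]
      congr 1
      refine Fintype.sum_equiv (Equiv.inv G) _ _ fun x => ?_
      have e : x * p⁻¹ * x⁻¹ ∈ Q ↔ x⁻¹⁻¹ * p * x⁻¹ ∈ Q := by
        rw [← Q.inv_mem_iff]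
        have : (x * p⁻¹ * x⁻¹)⁻¹ = x⁻¹⁻¹ * p * x⁻¹ := by group
        rw [this]
      simp only [Equiv.inv_apply, hp, true_and, e, mul_ite, mul_zero, inv_inv]
    · simp [hp]
  rw [Finset.sum_congr rfl fun p _ => h1 p, ← Finset.mul_sum, Finset.sum_comm]
  congr 1
  refine Finset.sum_congr rfl fun z _ => ?_
  by_cases hz : Compat P Q φ φ' z
  · rw [if_pos hz, mul_one]
    have : ∀ p : G, (if p ∈ P ∧ z⁻¹ * p * z ∈ Q then φ p * φ' (z⁻¹ * p⁻¹ * z) else 0) =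
        if p ∈ P ∧ z⁻¹ * p * z ∈ Q then (1 : ℂ) else 0 := by
      intro p
      split_ifs with hp
      · exact hz p hp.1 hp.2
      · rfl
    rw [Finset.sum_congr rfl fun p _ => this p, Finset.sum_boole, stabCard,
      Nat.card_eq_fintype_card, Fintype.card_subtype]
  · rw [if_neg hz, mul_zero]
    simp only [Compat, not_forall] at hz
    obtain ⟨r, hr, hr', hne⟩ := hz
    set J := ∑ p : G, if p ∈ P ∧ z⁻¹ * p * z ∈ Q then φ p * φ' (z⁻¹ * p⁻¹ * z) else 0 with hJ
    -- `J` sums a linear character over the group P ∩ z Q z⁻¹; translation by an element `r` on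
    -- which it is not 1 forces the sum to vanish.
    have h2 : J = φ r * φ' (z⁻¹ * r⁻¹ * z) * J := by
      conv_lhs => rw [hJ]
      rw [hJ, Finset.mul_sum]
      refine (Fintype.sum_equiv (Equiv.mulLeft r) _ _ fun p => ?_).symm
      have e1 : z⁻¹ * (r * p) * z = (z⁻¹ * r * z) * (z⁻¹ * p * z) := by group
      have e2 : z⁻¹ * (r * p)⁻¹ * z = (z⁻¹ * p⁻¹ * z) * (z⁻¹ * r⁻¹ * z) := by group
      have e3 : ∀ p, z⁻¹ * p⁻¹ * z = (z⁻¹ * p * z)⁻¹ := fun p => by group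
      simp only [Equiv.coe_mulLeft, P.mul_mem_cancel_left hr, e1, Q.mul_mem_cancel_left hr', e2]
      split_ifs with hp
      · rw [hφ.mul r hr p hp.1, hφ'.mul (z⁻¹ * p⁻¹ * z) (by rw [e3]; exact Q.inv_mem hp.2)
          (z⁻¹ * r⁻¹ * z) (by rw [e3]; exact Q.inv_mem hr')]
        ring
      · simp
    have h3 : (1 - φ r * φ' (z⁻¹ * r⁻¹ * z)) * J = 0 := by rw [sub_mul, one_mul, ← h2, sub_self]
    exact (mul_eq_zero.1 h3).resolve_left (sub_ne_zero.2 (Ne.symm hne))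

end DoubleCoset

end WildCount

end

noncomputable section

namespace WildCount

/-! ### Permutation matrices, the torus and block triangular groups -/

section MatrixGroups

variable {F : Type*} [Field F] {n : ℕ}

lemma gl_ext {g h : GL (Fin n) F}
    (e : ∀ i j, (g : Matrix (Fin n) (Fin n) F) i j = (h : Matrix (Fin n) (Fin n) F) i j) : g = h :=
  Units.ext (Matrix.ext e)

/-- The permutation matrix of `w`, with entries `1` at `(w j, j)`. -/
def permMat (F : Type*) [Field F] {n : ℕ} (w : Equiv.Perm (Fin n)) : Matrix (Fin n) (Fin n) F :=
  Matrix.of fun i j => if i = w j then 1 else 0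

lemma mul_permMat_apply (M : Matrix (Fin n) (Fin n) F) (w : Equiv.Perm (Fin n)) (i j : Fin n) :
    (M * permMat F w) i j = M i (w j) := by
  simp [Matrix.mul_apply, permMat]

lemma permMat_mul_apply (M : Matrix (Fin n) (Fin n) F) (w : Equiv.Perm (Fin n)) (i j : Fin n) :
    (permMat F w * M) i j = M (w⁻¹ i) j := by
  rw [Matrix.mul_apply, Finset.sum_eq_single (w⁻¹ i)]
  · simp [permMat]
  · intro k _ hk
    have : i ≠ w k := fun h => hk (by rw [h]; simp)
    simp [permMat, this]
  · simp

lemma permMat_mul (w w' : Equiv.Perm (Fin n)) :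
    permMat F (w * w') = permMat F w * permMat F w' := by
  ext i j
  rw [mul_permMat_apply]
  rfl

lemma permMat_one : permMat F (1 : Equiv.Perm (Fin n)) = 1 := by
  ext i j
  by_cases h : i = j
  · subst h
    simp [permMat]
  · simp [permMat, h]

/-- The permutation matrices as a homomorphism. -/
def permGL (F : Type*) [Field F] (n : ℕ) : Equiv.Perm (Fin n) →* GL (Fin n) F where
  toFun w := ⟨permMat F w, permMat F w⁻¹, by rw [← permMat_mul, mul_inv_cancel, permMat_one],
    by rw [← permMat_mul, inv_mul_cancel, permMat_one]⟩
  map_one' := Units.ext permMat_one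
  map_mul' w w' := Units.ext (permMat_mul w w')

lemma mul_permGL_apply (g : GL (Fin n) F) (w : Equiv.Perm (Fin n)) (i j : Fin n) :
    ((g * permGL F n w : GL (Fin n) F) : Matrix (Fin n) (Fin n) F) i j = g.1 i (w j) :=
  mul_permMat_apply g.1 w i j

lemma permGL_mul_apply (g : GL (Fin n) F) (w : Equiv.Perm (Fin n)) (i j : Fin n) :
    ((permGL F n w * g : GL (Fin n) F) : Matrix (Fin n) (Fin n) F) i j = g.1 (w⁻¹ i) j :=
  permMat_mul_apply g.1 w i j

lemma permGL_conj_apply (g : GL (Fin n) F) (w : Equiv.Perm (Fin n)) (i j : Fin n) :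
    (((permGL F n w)⁻¹ * g * permGL F n w : GL (Fin n) F) : Matrix (Fin n) (Fin n) F) i j =
      g.1 (w i) (w j) := by
  rw [mul_permGL_apply, ← map_inv, permGL_mul_apply, inv_inv]

/-- The diagonal torus. -/
def torusGL (F : Type*) [Field F] (n : ℕ) : (Fin n → Fˣ) →* GL (Fin n) F where
  toFun t := ⟨Matrix.diagonal fun i => (t i : F), Matrix.diagonal fun i => ((t i)⁻¹ : Fˣ),
    by simp, by simp⟩
  map_one' := Units.ext (by simp)
  map_mul' t t' := Units.ext (by simp)

lemma torusGL_apply (t : Fin n → Fˣ) (i j : Fin n) :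
    (torusGL F n t : Matrix (Fin n) (Fin n) F) i j = if i = j then (t i : F) else 0 := by
  simp [torusGL, Matrix.diagonal_apply]

lemma torusGL_mul_apply (g : GL (Fin n) F) (t : Fin n → Fˣ) (i j : Fin n) :
    ((torusGL F n t * g : GL (Fin n) F) : Matrix (Fin n) (Fin n) F) i j = t i * g.1 i j := by
  rw [Units.val_mul]
  exact Matrix.diagonal_mul _ _ _ _

lemma mul_torusGL_apply (g : GL (Fin n) F) (t : Fin n → Fˣ) (i j : Fin n) :
    ((g * torusGL F n t : GL (Fin n) F) : Matrix (Fin n) (Fin n) F) i j = g.1 i j * t j := by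
  rw [Units.val_mul]
  exact Matrix.mul_diagonal _ _ _ _

/-- Block upper triangular matrices for a labelling of the indices. -/
def blockGroup (F : Type*) [Field F] {n : ℕ} {α : Type*} [LinearOrder α] (b : Fin n → α) :
    Subgroup (GL (Fin n) F) where
  carrier := {g | (g : Matrix (Fin n) (Fin n) F).BlockTriangular b}
  mul_mem' hg hg' := Matrix.BlockTriangular.mul hg hg'
  one_mem' := Matrix.blockTriangular_one
  inv_mem' {g} hg := blockTriangular_inv _ g hg

/-- The permutations that preserve a labelling. -/
def permBlock {n : ℕ} {α : Type*} (b : Fin n → α) : Subgroup (Equiv.Perm (Fin n)) where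
  carrier := {σ | ∀ i, b (σ i) = b i}
  mul_mem' {σ τ} hσ hτ i := by rw [Equiv.Perm.mul_apply, hσ, hτ]
  one_mem' i := rfl
  inv_mem' {σ} hσ i := by
    have h := hσ (σ⁻¹ i)
    have e : σ (σ⁻¹ i) = i := σ.apply_symm_apply i
    rw [e] at h
    exact h.symm

variable {α : Type*} [LinearOrder α] {b : Fin n → α}

lemma permGL_mem_blockGroup {σ : Equiv.Perm (Fin n)} (hσ : σ ∈ permBlock b) :
    permGL F n σ ∈ blockGroup F b := by
  intro i j hij
  change (if i = σ j then (1 : F) else 0) = 0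
  rw [if_neg]
  rintro rfl
  rw [hσ] at hij
  exact lt_irrefl _ hij

lemma torusGL_mem_blockGroup (t : Fin n → Fˣ) : torusGL F n t ∈ blockGroup F b :=
  Matrix.blockTriangular_diagonal _

lemma mem_upperU {g : GL (Fin n) F} : g ∈ upperU F n ↔
    (∀ i j, j < i → (g : Matrix (Fin n) (Fin n) F) i j = 0) ∧
      ∀ i, (g : Matrix (Fin n) (Fin n) F) i i = 1 :=
  ⟨fun h => ⟨fun _ _ hij => h.1 hij, h.2⟩, fun h => ⟨fun _ _ hij => h.1 _ _ hij, h.2⟩⟩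

lemma upperU_le_blockGroup (hb : Monotone b) : upperU F n ≤ blockGroup F b := by
  intro g hg i j hij
  exact hg.1 (lt_of_not_ge fun h => absurd (hb h) (not_le.2 hij))

/-- A permutation that never increases the labels preserves them. -/
lemma label_eq_of_le (b : Fin n → α) (σ : Equiv.Perm (Fin n)) (h : ∀ i, b (σ i) ≤ b i)
    (i : Fin n) : b (σ i) = b i := by
  -- Labels cannot increase along the cycle through `i`, and the cycle returns to `i`.
  have h1 : ∀ m : ℕ, b ((σ ^ m) (σ i)) ≤ b (σ i) := by
    intro m
    induction m with
    | zero => simp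
    | succ m ih =>
      rw [pow_succ', Equiv.Perm.mul_apply]
      exact (h _).trans ih
  refine le_antisymm (h i) ?_
  have h2 := h1 (orderOf σ - 1)
  have : (σ ^ (orderOf σ - 1)) (σ i) = i := by
    rw [← Equiv.Perm.mul_apply, ← pow_succ, Nat.sub_add_cancel (orderOf_pos σ), pow_orderOf_eq_one]
    rfl
  rwa [this] at h2

/-- Permutation matrices in the same double coset of block triangular groups come from the same
double coset of permutations. -/
lemma sameCoset_perm {β : Type*} [LinearOrder β] {b' : Fin n → β} {w w' : Equiv.Perm (Fin n)} :
    SameCoset (blockGroup F b) (blockGroup F b') (permGL F n w) (permGL F n w') ↔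
      SameCoset (permBlock b) (permBlock b') w w' := by
  constructor
  · rintro ⟨p, hp, q, hq, e⟩
    have hq' := (blockGroup F b').inv_mem hq
    have e1 : permGL F n w' * q⁻¹ = p * permGL F n w := by rw [e]; group
    have e2 : ∀ i j, (q⁻¹ : GL (Fin n) F).1 (w'⁻¹ i) j = p.1 i (w j) := by
      intro i j
      rw [← mul_permGL_apply, ← e1, permGL_mul_apply]
    have hdet : p.1.det ≠ 0 := (Matrix.GeneralLinearGroup.det p).ne_zero
    -- A nonzero determinant has a nonzero term, given by `σ`. Block triangularity of `p` says that
    -- `σ` never raises the labels `b`; block triangularity of `q⁻¹`, whose entries are those of `p`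
    -- with permuted indices, says the same of `w'⁻¹ * σ * w` for `b'`. Neither permutation can then
    -- lower a label.
    obtain ⟨σ, hσ⟩ : ∃ σ : Equiv.Perm (Fin n), ∀ i, p.1 (σ i) i ≠ 0 := by
      by_contra hcon
      push Not at hcon
      apply hdet
      rw [Matrix.det_apply]
      refine Finset.sum_eq_zero fun σ _ => ?_
      obtain ⟨i, hi⟩ := hcon σ
      have h0 : ∏ i, p.1 (σ i) i = 0 := Finset.prod_eq_zero (Finset.mem_univ i) hi
      exact (congrArg _ h0).trans (smul_zero _)
    have h1 : σ ∈ permBlock b := label_eq_of_le b σ fun i => by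
      by_contra hlt
      exact hσ i (hp (not_le.1 hlt))
    have h2 : w'⁻¹ * σ * w ∈ permBlock b' := label_eq_of_le b' (w'⁻¹ * σ * w) fun j => by
      by_contra hlt
      have := hq' (not_le.1 hlt)
      rw [Equiv.Perm.mul_apply, Equiv.Perm.mul_apply, e2] at this
      exact hσ (w j) this
    exact ⟨σ, h1, (w'⁻¹ * σ * w)⁻¹, (permBlock b').inv_mem h2, by group⟩
  · rintro ⟨σ, hσ, τ, hτ, rfl⟩
    exact ⟨_, permGL_mem_blockGroup hσ, _, permGL_mem_blockGroup hτ, by simp⟩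

end MatrixGroups

/-! ### Bruhat decomposition -/

section Bruhat

variable {F : Type*} [Field F] {n : ℕ}

/-- An upper unitriangular matrix as an element of `U`. -/
lemma exists_upperU (M : Matrix (Fin n) (Fin n) F) (h0 : ∀ i j, j < i → M i j = 0)
    (h1 : ∀ i, M i i = 1) : ∃ u ∈ upperU F n, (u : Matrix (Fin n) (Fin n) F) = M := by
  have hM : M.BlockTriangular id := fun i j hij => h0 i j hij
  have hdet : M.det ≠ 0 := by
    rw [hM.det_fintype]
    simp only [Matrix.det_toSquareBlock_id, h1, Finset.prod_const_one]
    exact one_ne_zero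
  exact ⟨Matrix.GeneralLinearGroup.mkOfDetNeZero M hdet, ⟨fun i j hij => h0 i j hij, h1⟩, rfl⟩

/-- Row operations that clear the entries above a given one. -/
lemma exists_clear_above (g : GL (Fin n) F) (i : Fin n) (c : Fin n → F) :
    ∃ u ∈ upperU F n, ∀ a j, (u * g : GL (Fin n) F).1 a j =
      g.1 a j - (if a < i then c a * g.1 i j else 0) := by
  classical
  obtain ⟨u, hu, hM⟩ := exists_upperU
    (Matrix.of fun a k : Fin n => (if a = k then 1 else 0) - if k = i ∧ a < i then c a else 0)
    (by
      intro a k hka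
      simp only [Matrix.of_apply]
      rw [if_neg hka.ne', if_neg, sub_zero]
      rintro ⟨rfl, h⟩
      exact lt_asymm hka h)
    (by
      intro a
      simp only [Matrix.of_apply, if_true]
      rw [if_neg, sub_zero]
      rintro ⟨rfl, h⟩
      exact lt_irrefl _ h)
  refine ⟨u, hu, fun a j => ?_⟩
  rw [Units.val_mul, hM, Matrix.mul_apply]
  simp only [Matrix.of_apply, sub_mul, Finset.sum_sub_distrib, ite_mul, one_mul, zero_mul,
    Finset.sum_ite_eq, Finset.mem_univ, if_true]
  congr 1
  rw [Finset.sum_eq_single i]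
  · simp
  · intro k _ hk
    rw [if_neg (fun h => hk h.1)]
  · simp

/-- Column operations that clear the entries to the right of a given one. -/
lemma exists_clear_right (g : GL (Fin n) F) (j : Fin n) (c : Fin n → F) :
    ∃ u ∈ upperU F n, ∀ a k, (g * u : GL (Fin n) F).1 a k =
      g.1 a k - (if j < k then g.1 a j * c k else 0) := by
  classical
  obtain ⟨u, hu, hM⟩ := exists_upperU
    (Matrix.of fun l k : Fin n => (if l = k then 1 else 0) - if l = j ∧ j < k then c k else 0)
    (by
      intro a k hka
      simp only [Matrix.of_apply]
      rw [if_neg hka.ne', if_neg, sub_zero]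
      rintro ⟨rfl, h⟩
      exact lt_asymm hka h)
    (by
      intro a
      simp only [Matrix.of_apply, if_true]
      rw [if_neg, sub_zero]
      rintro ⟨rfl, h⟩
      exact lt_irrefl _ h)
  refine ⟨u, hu, fun a k => ?_⟩
  rw [Units.val_mul, hM, Matrix.mul_apply]
  simp only [Matrix.of_apply, mul_sub, Finset.sum_sub_distrib, mul_ite, mul_one, mul_zero,
    Finset.sum_ite_eq', Finset.mem_univ, if_true]
  congr 1
  rw [Finset.sum_eq_single j]
  · simp
  · intro l _ hl
    rw [if_neg (fun h => hl h.1)]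
  · simp

/-- Row `i` and column `j` vanish away from `(i, j)`, where the entry is not zero. -/
def IsPivot (g : GL (Fin n) F) (i j : Fin n) : Prop :=
  g.1 i j ≠ 0 ∧ (∀ i', i' ≠ i → g.1 i' j = 0) ∧ ∀ j', j' ≠ j → g.1 i j' = 0

/-- Gaussian elimination column by column, with only the row operations that add a row to higher
rows and the column operations that add a column to later ones. The pivot in column `k` is its
lowest nonzero entry. The rows and columns of earlier pivots are already cleared, so the new
operations leave these pivots intact. -/
lemma exists_pivots (g : GL (Fin n) F) (k : ℕ) (hk : k ≤ n) :
    ∃ u ∈ upperU F n, ∃ u' ∈ upperU F n, ∀ j : Fin n, (j : ℕ) < k →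
      ∃ i, IsPivot (u * g * u') i j := by
  classical
  induction k with
  | zero => exact ⟨1, one_mem _, 1, one_mem _, fun j hj => absurd hj (Nat.not_lt_zero _)⟩
  | succ k ih =>
    obtain ⟨u, hu, u', hu', hpiv⟩ := ih (Nat.le_of_succ_le hk)
    set M := u * g * u' with hM
    let j : Fin n := ⟨k, hk⟩
    have hcol : ∃ i, M.1 i j ≠ 0 := by
      by_contra hcon
      push Not at hcon
      exact (Matrix.GeneralLinearGroup.det M).ne_zero (Matrix.det_eq_zero_of_column_eq_zero j hcon)
    let S : Finset (Fin n) := Finset.univ.filter fun i => M.1 i j ≠ 0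
    have hS : S.Nonempty := by
      obtain ⟨i, hi⟩ := hcol
      exact ⟨i, by simp [S, hi]⟩
    let i := S.max' hS
    have hij : M.1 i j ≠ 0 := (Finset.mem_filter.1 (S.max'_mem hS)).2
    have hbelow : ∀ a, i < a → M.1 a j = 0 := by
      intro a ha
      by_contra h
      exact absurd (S.le_max' a (by simp [S, h])) (not_le.2 ha)
    have hold : ∀ j' : Fin n, (j' : ℕ) < k → ∃ i', IsPivot M i' j' ∧ i' ≠ i := by
      intro j' hj'
      obtain ⟨i', hi'⟩ := hpiv j' hj'
      refine ⟨i', hi', ?_⟩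
      rintro rfl
      exact hij (hi'.2.2 j (fun h => by
        have := congrArg Fin.val h
        simp only [j] at this
        omega))
    have hleft : ∀ j' : Fin n, (j' : ℕ) < k → M.1 i j' = 0 := by
      intro j' hj'
      obtain ⟨i', hi', hne⟩ := hold j' hj'
      exact hi'.2.1 i hne.symm
    obtain ⟨v, hv, hvM⟩ := exists_clear_above M i fun a => M.1 a j / M.1 i j
    have hcolj : ∀ a, a ≠ i → (v * M : GL (Fin n) F).1 a j = 0 := by
      intro a ha
      rw [hvM]
      rcases lt_or_gt_of_ne ha with h | h
      · rw [if_pos h, div_mul_cancel₀ _ hij, sub_self]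
      · rw [if_neg (not_lt.2 h.le), hbelow a h, sub_zero]
    have hrowi : ∀ c, (v * M : GL (Fin n) F).1 i c = M.1 i c := by
      intro c
      rw [hvM, if_neg (lt_irrefl i), sub_zero]
    obtain ⟨v', hv', hvM'⟩ := exists_clear_right (v * M) j fun c => M.1 i c / M.1 i j
    refine ⟨v * u, mul_mem hv hu, u' * v', mul_mem hu' hv', fun j' hj' => ?_⟩
    have hassoc : v * u * g * (u' * v') = v * M * v' := by rw [hM]; group
    rw [hassoc]
    rcases Nat.lt_succ_iff_lt_or_eq.1 hj' with h | h
    · obtain ⟨i', hi', hne⟩ := hold j' h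
      have hnj : ¬ j < j' := by
        rw [not_lt, Fin.le_def]
        exact h.le
      have hM1 : ∀ a, (v * M : GL (Fin n) F).1 a j' = M.1 a j' := by
        intro a
        rw [hvM, hleft j' h]
        simp
      have hM2 : ∀ c, (v * M : GL (Fin n) F).1 i' c = M.1 i' c := by
        intro c
        rw [hvM, hi'.2.2 j (fun e => by
          have := congrArg Fin.val e
          simp only [j] at this
          omega)]
        simp
      refine ⟨i', ?_, ?_, ?_⟩
      · rw [hvM', if_neg hnj, sub_zero, hM1]
        exact hi'.1
      · intro a ha
        rw [hvM', if_neg hnj, sub_zero, hM1]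
        exact hi'.2.1 a ha
      · intro c hc
        rw [hvM', hcolj i' hne, zero_mul, ite_self, sub_zero, hM2]
        exact hi'.2.2 c hc
    · have hjj : j' = j := Fin.ext h
      subst hjj
      refine ⟨i, ?_, ?_, ?_⟩
      · rw [hvM', if_neg (lt_irrefl _), sub_zero, hrowi]
        exact hij
      · intro a ha
        rw [hvM', if_neg (lt_irrefl _), sub_zero]
        exact hcolj a ha
      · intro c hc
        rw [hvM', hrowi, hrowi]
        rcases lt_or_gt_of_ne hc with h' | h'
        · rw [if_neg (not_lt.2 h'.le), sub_zero]
          exact hleft c (by simpa [j, Fin.lt_def] using h')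
        · rw [if_pos h', mul_div_cancel₀ _ hij, sub_self]

/-- Every invertible matrix lies in `U n U` for a monomial matrix `n`. -/
lemma exists_bruhat (g : GL (Fin n) F) : ∃ u ∈ upperU F n, ∃ u' ∈ upperU F n, ∃ t w,
    g = u * (torusGL F n t * permGL F n w) * u' := by
  obtain ⟨u, hu, u', hu', h⟩ := exists_pivots g n le_rfl
  choose w hw using fun j : Fin n => h j j.2
  have hinj : Function.Injective w := by
    intro j j' e
    by_contra hne
    have := (hw j).2.2 j' (Ne.symm hne)
    rw [e] at this
    exact (hw j').1 this
  let σ : Equiv.Perm (Fin n) := Equiv.ofBijective w (Finite.injective_iff_bijective.1 hinj)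
  refine ⟨u⁻¹, inv_mem hu, u'⁻¹, inv_mem hu',
    fun i => Units.mk0 ((u * g * u').1 i (σ⁻¹ i)) ?_, σ, ?_⟩
  · have := (hw (σ⁻¹ i)).1
    have e : w (σ⁻¹ i) = i := σ.apply_symm_apply i
    rwa [e] at this
  · have : u * g * u' = torusGL F n (fun i => Units.mk0 ((u * g * u').1 i (σ⁻¹ i)) (by
        have := (hw (σ⁻¹ i)).1
        have e : w (σ⁻¹ i) = i := σ.apply_symm_apply i
        rwa [e] at this)) * permGL F n σ := by
      refine gl_ext fun i j => ?_
      rw [mul_permGL_apply, torusGL_apply]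
      split_ifs with hij
      · subst hij
        simp
      · exact (hw j).2.1 i hij
    rw [← this]
    group

/-- Monotone labels put `U` into both block triangular groups, which contain the torus anyway, so
only the permutation in the Bruhat decomposition survives. -/
lemma exists_sameCoset_perm {α β : Type*} [LinearOrder α] [LinearOrder β] {b : Fin n → α}
    {b' : Fin n → β} (hb : Monotone b) (hb' : Monotone b') (g : GL (Fin n) F) :
    ∃ w, SameCoset (blockGroup F b) (blockGroup F b') g (permGL F n w) := by
  obtain ⟨u, hu, u', hu', t, w, rfl⟩ := exists_bruhat g
  refine ⟨w, SameCoset.symm ⟨u * torusGL F n t, mul_mem (upperU_le_blockGroup hb hu)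
    (torusGL_mem_blockGroup t), u', upperU_le_blockGroup hb' hu', by group⟩⟩

end Bruhat

/-! ### Characters of block triangular groups -/

section DetChar

variable {F : Type*} [Field F] {n : ℕ}

/-- The block diagonal part of a matrix. -/
def blockDiagPart {m α : Type*} [DecidableEq α] (b : m → α) (M : Matrix m m F) : Matrix m m F :=
  Matrix.of fun i j => if b i = b j then M i j else 0

lemma det_blockDiagPart {m α : Type*} [Fintype m] [DecidableEq m] [LinearOrder α] (b : m → α)
    (M : Matrix m m F) (hM : M.BlockTriangular b) : (blockDiagPart b M).det = M.det := by
  have h1 : (blockDiagPart b M).BlockTriangular b := by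
    intro i j hij
    simp [blockDiagPart, hij.ne']
  rw [h1.det, hM.det]
  refine Finset.prod_congr rfl fun k _ => ?_
  congr 1
  ext i j
  simp [blockDiagPart, Matrix.toSquareBlock_def, i.2, j.2]

/-- The determinant of the diagonal part belonging to a set of blocks is multiplicative. -/
lemma det_toSquareBlock_mul {α Θ : Type*} [LinearOrder α] [DecidableEq Θ] {b : Fin n → α} {θ : Fin n → Θ}
    (hθ : ∀ i j, b i = b j → θ i = θ j) (ψ : Θ) {M N : Matrix (Fin n) (Fin n) F}
    (hM : M.BlockTriangular b) (hN : N.BlockTriangular b) :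
    ((M * N).toSquareBlock θ ψ).det = (M.toSquareBlock θ ψ).det * (N.toSquareBlock θ ψ).det := by
  let c : {a // θ a = ψ} → α := fun a => b a
  -- Extracting the indices with `θ = ψ` need not be multiplicative when these indices meet several
  -- blocks with others in between. Block diagonal parts do multiply, and they have the same
  -- determinants.
  have key : ∀ L : Matrix (Fin n) (Fin n) F, L.BlockTriangular b →
      (blockDiagPart c (L.toSquareBlock θ ψ)).det = (L.toSquareBlock θ ψ).det := by
    intro L hL
    exact det_blockDiagPart c _ fun i j hij => hL hij
  rw [← key M hM, ← key N hN, ← key (M * N) (hM.mul hN), ← Matrix.det_mul]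
  congr 1
  ext i j
  rw [Matrix.mul_apply]
  simp only [blockDiagPart, Matrix.toSquareBlock_def, Matrix.of_apply, c]
  split_ifs with hij
  · rw [blockTriangular_mul_apply b M N hM hN hij]
    have e1 : ∑ z, (if b z = b i then M i z * N z j else 0) =
        ∑ z ∈ Finset.univ.filter (fun z => θ z = ψ), if b z = b i then M i z * N z j else 0 := by
      refine (Finset.sum_filter_of_ne fun z _ hz => ?_).symm
      by_contra hne
      exact hz (if_neg fun h => hne ((hθ _ _ h).trans i.2))
    rw [e1, Finset.sum_subtype (p := fun z => θ z = ψ) _ (by simp)]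
    refine Finset.sum_congr rfl fun z _ => ?_
    by_cases h : b z = b i
    · rw [if_pos h, if_pos h.symm, if_pos (h.trans hij)]
    · rw [if_neg h, if_neg (Ne.symm h), zero_mul]
  · refine (Finset.sum_eq_zero fun k _ => ?_).symm
    by_cases h : b i = b k
    · rw [if_neg (fun h' => hij (h.trans h')), mul_zero]
    · rw [if_neg h, zero_mul]

variable [Fintype F]

open scoped Classical in
/-- The character `∏ ψ(det)` of a block triangular group, where `ψ` runs over the characters and
the determinant is that of the part of the matrix where the labels `θ` are equal to `ψ`. -/
def detChar (θ : Fin n → MulChar F ℂ) (g : GL (Fin n) F) : ℂ :=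
  ∏ ψ : MulChar F ℂ, ψ (g.1.toSquareBlock θ ψ).det

lemma isCharOn_detChar {α : Type*} [LinearOrder α] {b : Fin n → α} {θ : Fin n → MulChar F ℂ}
    (hθ : ∀ i j, b i = b j → θ i = θ j) : IsCharOn (blockGroup F b) (detChar θ) where
  one := by
    refine Finset.prod_eq_one fun ψ _ => ?_
    have : ((1 : GL (Fin n) F).1.toSquareBlock θ ψ) = 1 := by
      rw [Matrix.toSquareBlock, Matrix.toSquareBlockProp]
      exact Matrix.submatrix_one _ Subtype.val_injective
    rw [this, Matrix.det_one, map_one]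
  mul p hp p' hp' := by
    rw [detChar, detChar, detChar, ← Finset.prod_mul_distrib]
    refine Finset.prod_congr rfl fun ψ _ => ?_
    rw [Units.val_mul, det_toSquareBlock_mul hθ ψ hp hp', map_mul]

lemma detChar_permGL_conj (θ : Fin n → MulChar F ℂ) (w : Equiv.Perm (Fin n)) (g : GL (Fin n) F) :
    detChar θ ((permGL F n w)⁻¹ * g * permGL F n w) = detChar (θ ∘ w.symm) g := by
  classical
  refine Finset.prod_congr rfl fun ψ _ => ?_
  congr 1
  let e : {i // θ i = ψ} ≃ {i // (θ ∘ w.symm) i = ψ} :=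
    w.subtypeEquiv fun i => by simp
  rw [← Matrix.det_submatrix_equiv_self e]
  congr 1
  ext i j
  exact permGL_conj_apply g w i j

lemma detChar_torusGL (θ : Fin n → MulChar F ℂ) (t : Fin n → Fˣ) :
    detChar θ (torusGL F n t) = ∏ i, θ i (t i : F) := by
  classical
  have h1 : ∀ ψ : MulChar F ℂ, ψ ((torusGL F n t).1.toSquareBlock θ ψ).det =
      ∏ i ∈ Finset.univ.filter (fun i => θ i = ψ), θ i (t i : F) := by
    intro ψ
    have : (torusGL F n t).1.toSquareBlock θ ψ =
        Matrix.diagonal fun i : {i // θ i = ψ} => (t i : F) := by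
      ext i j
      rw [Matrix.toSquareBlock_def, Matrix.of_apply, torusGL_apply, Matrix.diagonal_apply]
      simp only [Subtype.ext_iff]
    rw [this, Matrix.det_diagonal, map_prod]
    rw [Finset.prod_subtype (p := fun i => θ i = ψ) _ (by simp)]
    exact Finset.prod_congr rfl fun i _ => by rw [i.2]
  rw [detChar, Finset.prod_congr rfl fun ψ _ => h1 ψ]
  exact Finset.prod_fiberwise _ _ _

/-- The induced class function `Ind_{P_b}^G ∏ ψ(det)`. -/
abbrev tauFun [DecidableEq F] {α : Type*} [LinearOrder α] (b : Fin n → α)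
    (θ : Fin n → MulChar F ℂ) : GL (Fin n) F → ℂ :=
  indFun (blockGroup F b) (detChar θ)

/-- Diagonal matrices with one entry different from 1 recover each component of a tuple of
characters, which gives one direction. For the other, conjugation by the permutation matrix carries
`detChar θ'` to `detChar (θ' ∘ w.symm)`. -/
lemma compat_perm {α β : Type*} [LinearOrder α] [LinearOrder β] {b : Fin n → α} {b' : Fin n → β}
    {θ θ' : Fin n → MulChar F ℂ} (hθ : ∀ i j, b i = b j → θ i = θ j) (w : Equiv.Perm (Fin n)) :
    Compat (blockGroup F b) (blockGroup F b') (detChar θ) (detChar θ') (permGL F n w) ↔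
      θ = θ' ∘ w.symm := by
  constructor
  · intro h
    by_contra hne
    obtain ⟨i, hi⟩ := Function.ne_iff.1 hne
    obtain ⟨x, hx⟩ : ∃ x : Fˣ, θ i x ≠ (θ' ∘ w.symm) i x := by
      by_contra hcon
      push Not at hcon
      exact hi (MulChar.ext fun x => hcon x)
    let t : Fin n → Fˣ := Pi.mulSingle i x
    have hmem : (permGL F n w)⁻¹ * torusGL F n t * permGL F n w ∈ blockGroup F b' := by
      have : (permGL F n w)⁻¹ * torusGL F n t * permGL F n w = torusGL F n (t ∘ w) := by
        refine gl_ext fun i j => ?_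
        rw [permGL_conj_apply, torusGL_apply, torusGL_apply]
        simp [w.injective.eq_iff]
      rw [this]
      exact torusGL_mem_blockGroup _
    have h1 := h (torusGL F n t) (torusGL_mem_blockGroup t) hmem
    rw [detChar_permGL_conj, ← map_inv, detChar_torusGL, detChar_torusGL] at h1
    have key : ∀ (η : Fin n → MulChar F ℂ) (y : Fˣ),
        ∏ k, η k ((Pi.mulSingle i y : Fin n → Fˣ) k : F) = η i y := by
      intro η y
      rw [Finset.prod_eq_single i]
      · simp
      · intro k _ hk
        simp [Pi.mulSingle_eq_of_ne hk]
      · simp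
    have hinv : t⁻¹ = Pi.mulSingle i x⁻¹ := by rw [Pi.mulSingle_inv]
    rw [key, hinv, key] at h1
    apply hx
    have h2 : (θ' ∘ w.symm) i (x⁻¹ : Fˣ) * (θ' ∘ w.symm) i x = 1 := by
      rw [← map_mul, ← Units.val_mul, inv_mul_cancel, Units.val_one, map_one]
    calc θ i x = θ i x * ((θ' ∘ w.symm) i (x⁻¹ : Fˣ) * (θ' ∘ w.symm) i x) := by rw [h2, mul_one]
      _ = (θ' ∘ w.symm) i x := by rw [← mul_assoc, h1, one_mul]
  · rintro h p hp -
    rw [detChar_permGL_conj, ← h, ← (isCharOn_detChar hθ).mul p hp _ (inv_mem hp),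
      mul_inv_cancel, (isCharOn_detChar hθ).one]

open scoped Classical in
/-- The intertwining numbers of the induced characters of block triangular groups are those of
the corresponding permutation groups. -/
lemma charPair_tauFun [DecidableEq F] {α β : Type*} [LinearOrder α] [LinearOrder β]
    {b : Fin n → α} {b' : Fin n → β} (hb : Monotone b) (hb' : Monotone b')
    {θ θ' : Fin n → MulChar F ℂ} (hθ : ∀ i j, b i = b j → θ i = θ j)
    (hθ' : ∀ i j, b' i = b' j → θ' i = θ' j) :
    charPair (tauFun b θ) (tauFun b' θ') =
      ((Nat.card (permBlock b) : ℂ) * Nat.card (permBlock b'))⁻¹ *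
        ∑ w : Equiv.Perm (Fin n), (stabCard (permBlock b) (permBlock b') w : ℂ) *
          (if θ = θ' ∘ w.symm then (1 : ℂ) else 0) := by
  rw [tauFun, tauFun, charPair_indFun_indFun _ _ _ _ (isCharOn_detChar hθ) (isCharOn_detChar hθ'),
    sum_stabCard_eq (blockGroup F b) (blockGroup F b') (permBlock b) (permBlock b')
      (permGL F n) (exists_sameCoset_perm hb hb') (fun w w' => sameCoset_perm)]
  · simp only [compat_perm hθ]
  · intro z z' h
    have : Compat (blockGroup F b) (blockGroup F b') (detChar θ) (detChar θ') z ↔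
        Compat (blockGroup F b) (blockGroup F b') (detChar θ) (detChar θ') z' :=
      ⟨compat_of_sameCoset (isCharOn_detChar hθ) (isCharOn_detChar hθ') h,
        compat_of_sameCoset (isCharOn_detChar hθ) (isCharOn_detChar hθ') h.symm⟩
    simp only [this]

end DetChar

end WildCount

end

noncomputable section

namespace WildCount

/-! ### Combinatorics of tableaux -/

section Tableaux

variable {n : ℕ}

/-- Rows and columns of the cells of a diagram, labelled by `Fin n`. -/
structure IsDiagram (r c : Fin n → ℕ) : Prop where
  inj : ∀ a a', r a = r a' → c a = c a' → a = a'
  closed : ∀ a, ∀ i ≤ r a, ∃ a', r a' = i ∧ c a' = c a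

variable {r c : Fin n → ℕ}

/-- In each column, a set of cells with distinct labels below `k` is not larger than the set of
cells in the first `k` rows. -/
lemma IsDiagram.card_le (h : IsDiagram r c) (r' : Fin n → ℕ) (y : Equiv.Perm (Fin n))
    (hy : ∀ a a', r' a = r' a' → c (y a) = c (y a') → a = a') (k j : ℕ) :
    (Finset.univ.filter fun a => r' a < k ∧ c (y a) = j).card ≤
      (Finset.univ.filter fun a => r a < k ∧ c a = j).card := by
  classical
  -- If column `j` has a cell in row `k` or below, it has a cell in each of the first `k` rows, and
  -- there are at most `k` distinct labels below `k`. Otherwise the whole column lies in the first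
  -- `k` rows.
  by_cases hc : ∃ a₀, c a₀ = j ∧ k ≤ r a₀
  · obtain ⟨a₀, ha₀, hk⟩ := hc
    calc _ ≤ (Finset.range k).card := by
          refine Finset.card_le_card_of_injOn r' ?_ ?_
          · intro a ha
            simp only [Finset.coe_filter, Finset.mem_univ, true_and, Set.mem_ofPred_eq] at ha
            simp [ha.1]
          · intro a ha a' ha' e
            simp only [Finset.coe_filter, Finset.mem_univ, true_and, Set.mem_ofPred_eq] at ha ha'
            exact hy a a' e (ha.2.trans ha'.2.symm)
      _ ≤ ((Finset.univ.filter fun a => r a < k ∧ c a = j).image r).card := by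
          refine Finset.card_le_card fun i hi => ?_
          rw [Finset.mem_range] at hi
          obtain ⟨a, ha, ha'⟩ := h.closed a₀ i (hi.le.trans hk)
          exact Finset.mem_image.2 ⟨a, by simp [ha, ha', ha₀, hi], ha⟩
      _ ≤ _ := Finset.card_image_le
  · push Not at hc
    refine Finset.card_le_card_of_injOn y ?_ y.injective.injOn
    intro a ha
    simp only [Finset.coe_filter, Finset.mem_univ, true_and, Set.mem_ofPred_eq] at ha ⊢
    exact ⟨hc _ ha.2, ha.2⟩

lemma card_filter_eq_sum (r c : Fin n → ℕ) (k : ℕ) :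
    (Finset.univ.filter fun a => r a < k).card =
      ∑ j ∈ Finset.univ.image c, (Finset.univ.filter fun a => r a < k ∧ c a = j).card := by
  classical
  rw [Finset.card_eq_sum_card_fiberwise (f := c) (t := Finset.univ.image c)
    (fun a _ => by simp)]
  refine Finset.sum_congr rfl fun j _ => ?_
  rw [Finset.filter_filter]

lemma image_comp_perm (c : Fin n → ℕ) (y : Equiv.Perm (Fin n)) :
    Finset.univ.image (fun a => c (y a)) = Finset.univ.image c := by
  ext j
  simp only [Finset.mem_image, Finset.mem_univ, true_and]
  exact ⟨fun ⟨a, ha⟩ => ⟨y a, ha⟩, fun ⟨a, ha⟩ => ⟨y.symm a, by simpa using ha⟩⟩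

/-- The column-wise estimate is summed over all columns; permuting the cells does not change the set
of columns. -/
lemma IsDiagram.dominates (h : IsDiagram r c) (r' : Fin n → ℕ) (y : Equiv.Perm (Fin n))
    (hy : ∀ a a', r' a = r' a' → c (y a) = c (y a') → a = a') (k : ℕ) :
    (Finset.univ.filter fun a => r' a < k).card ≤ (Finset.univ.filter fun a => r a < k).card := by
  rw [card_filter_eq_sum r' (fun a => c (y a)), card_filter_eq_sum r c, image_comp_perm]
  exact Finset.sum_le_sum fun j _ => h.card_le r' y hy k j

/-- A permutation for which rows and columns meet in at most one cell is a product of a row and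
a column permutation. -/
lemma IsDiagram.exists_factor (h : IsDiagram r c) (y : Equiv.Perm (Fin n))
    (hy : ∀ a a', r a = r a' → c (y a) = c (y a') → a = a') :
    ∃ z ∈ permBlock r, ∃ x ∈ permBlock c, y = x * z := by
  classical
  -- Summed over the columns both sides count the cells in the first `k` rows, so the column-wise
  -- inequality is an equality in every column.
  have heq : ∀ k, ∀ j ∈ Finset.univ.image c,
      (Finset.univ.filter fun a => r a < k ∧ c (y a) = j).card =
        (Finset.univ.filter fun a => r a < k ∧ c a = j).card := by
    intro k
    refine (Finset.sum_eq_sum_iff_of_le fun j _ => h.card_le r y hy k j).1 ?_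
    rw [← card_filter_eq_sum r c, ← image_comp_perm c y, ← card_filter_eq_sum r (fun a => c (y a))]
  -- If the column of `y a` ended above row `r a`, the equalities for `r a` and `r a + 1` would have
  -- the same right-hand side, although `a` itself is counted only on the left of the second.
  have hcell : ∀ a, ∃ a', r a' = r a ∧ c a' = c (y a) := by
    intro a
    by_contra hcon
    push Not at hcon
    have hlt : ∀ a', c a' = c (y a) → r a' < r a := by
      intro a' ha'
      by_contra hge
      obtain ⟨a'', h1, h2⟩ := h.closed a' (r a) (not_lt.1 hge)
      exact hcon a'' h1 (h2.trans ha')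
    have hj : c (y a) ∈ Finset.univ.image c := by simp
    have e1 := heq (r a) _ hj
    have e2 := heq (r a + 1) _ hj
    have e3 : (Finset.univ.filter fun a' => r a' < r a + 1 ∧ c a' = c (y a)) =
        Finset.univ.filter fun a' => r a' < r a ∧ c a' = c (y a) := by
      ext a'
      simp only [Finset.mem_filter, Finset.mem_univ, true_and]
      exact ⟨fun ⟨_, h2⟩ => ⟨hlt a' h2, h2⟩, fun ⟨h1, h2⟩ => ⟨h1.trans (Nat.lt_succ_self _), h2⟩⟩
    rw [e3, ← e1] at e2
    have e4 : (Finset.univ.filter fun a' => r a' < r a ∧ c (y a') = c (y a)) ⊂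
        Finset.univ.filter fun a' => r a' < r a + 1 ∧ c (y a') = c (y a) := by
      rw [Finset.ssubset_iff_of_subset]
      · exact ⟨a, by simp, by simp⟩
      · intro a' ha'
        simp only [Finset.mem_filter, Finset.mem_univ, true_and] at ha' ⊢
        exact ⟨ha'.1.trans (Nat.lt_succ_self _), ha'.2⟩
    exact absurd e2 (Finset.card_lt_card e4).ne'
  choose z hz using hcell
  have hinj : Function.Injective z := by
    intro a a' e
    refine hy a a' ?_ ?_
    · rw [← (hz a).1, ← (hz a').1, e]
    · rw [← (hz a).2, ← (hz a').2, e]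
  let σ : Equiv.Perm (Fin n) := Equiv.ofBijective z (Finite.injective_iff_bijective.1 hinj)
  refine ⟨σ, fun a => (hz a).1, y * σ⁻¹, fun a => ?_, by group⟩
  have e : σ (σ⁻¹ a) = a := σ.apply_symm_apply a
  have := (hz (σ⁻¹ a)).2
  rw [Equiv.Perm.mul_apply, ← this]
  exact congrArg c e

variable (lam : n.Partition)

lemma rowOf_lt (a : Fin n) : rowOf lam a < (rows lam).length :=
  ((blockEquiv (rowLen lam) (sum_rowLen lam)).symm a).1.2

lemma colOf_lt (a : Fin n) : colOf lam a < (rows lam)[rowOf lam a]'(rowOf_lt lam a) :=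
  ((blockEquiv (rowLen lam) (sum_rowLen lam)).symm a).2.2

lemma exists_cell (i j : ℕ) (hi : i < (rows lam).length) (hj : j < (rows lam)[i]) :
    ∃ a, rowOf lam a = i ∧ colOf lam a = j :=
  ⟨blockEquiv (rowLen lam) (sum_rowLen lam) ⟨⟨i, hi⟩, ⟨j, hj⟩⟩,
    by rw [rowOf, Equiv.symm_apply_apply], by rw [colOf, Equiv.symm_apply_apply]⟩

lemma rows_sorted : (rows lam).Pairwise (· ≥ ·) := Multiset.pairwise_sort _ _

lemma isDiagram : IsDiagram (rowOf lam) (colOf lam) where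
  inj a a' h1 h2 := by
    apply (blockEquiv (rowLen lam) (sum_rowLen lam)).symm.injective
    have h1' : ((blockEquiv (rowLen lam) (sum_rowLen lam)).symm a).1 =
        ((blockEquiv (rowLen lam) (sum_rowLen lam)).symm a').1 := Fin.ext h1
    refine Sigma.ext h1' ?_
    rw [Fin.heq_ext_iff (congrArg (rowLen lam) h1')]
    exact h2
  closed a i hi := by
    have hil := lt_of_le_of_lt hi (rowOf_lt lam a)
    refine exists_cell lam i (colOf lam a) hil ((colOf_lt lam a).trans_le ?_)
    rcases hi.lt_or_eq with h | h
    · exact List.pairwise_iff_getElem.1 (rows_sorted lam) i (rowOf lam a) hil (rowOf_lt lam a) h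
    · simp [h]

lemma card_rowOf_eq (i : Fin (rows lam).length) :
    (Finset.univ.filter fun a => rowOf lam a = i).card = rowLen lam i := by
  classical
  have : (Finset.univ.filter fun a => rowOf lam a = i) =
      Finset.univ.map ⟨fun j : Fin (rowLen lam i) => blockEquiv (rowLen lam) (sum_rowLen lam) ⟨i, j⟩,
        fun j j' e => by simpa using e⟩ := by
    ext a
    simp only [Finset.mem_filter, Finset.mem_univ, true_and, Finset.mem_map]
    constructor
    · intro h
      obtain ⟨⟨i', j⟩, rfl⟩ := (blockEquiv (rowLen lam) (sum_rowLen lam)).surjective a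
      have : i' = i := Fin.ext (by simpa [rowOf] using h)
      subst this
      exact ⟨j, rfl⟩
    · rintro ⟨j, rfl⟩
      change ((blockEquiv (rowLen lam) (sum_rowLen lam)).symm
        (blockEquiv (rowLen lam) (sum_rowLen lam) ⟨i, j⟩)).1.val = i
      rw [Equiv.symm_apply_apply]
  rw [this, Finset.card_map, Finset.card_univ, Fintype.card_fin]

/-- This translates between the partial sums in `Dominates` and the counts of cells produced by the
tableau argument. -/
lemma card_rowOf_lt (k : ℕ) :
    (Finset.univ.filter fun a => rowOf lam a < k).card = ((rows lam).take k).sum := by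
  classical
  have h1 : (Finset.univ.filter fun a => rowOf lam a < k).card =
      ∑ i : Fin (rows lam).length, if (i : ℕ) < k then rowLen lam i else 0 := by
    rw [Finset.card_eq_sum_card_fiberwise
      (f := fun a => (⟨rowOf lam a, rowOf_lt lam a⟩ : Fin (rows lam).length)) (t := Finset.univ)
      (fun a _ => by simp)]
    refine Finset.sum_congr rfl fun i _ => ?_
    rw [Finset.filter_filter]
    split_ifs with h
    · rw [← card_rowOf_eq]
      congr 1
      ext a
      simp only [Finset.mem_filter, Finset.mem_univ, true_and, Fin.ext_iff]
      exact ⟨fun h' => h'.2, fun h' => ⟨h' ▸ h, h'⟩⟩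
    · rw [Finset.card_eq_zero, Finset.filter_eq_empty_iff]
      rintro a - ⟨h1, h2⟩
      exact h (by rw [← h2]; exact h1)
  rw [h1]
  have h2 : ∀ (l : List ℕ) (k : ℕ),
      (∑ i : Fin l.length, if (i : ℕ) < k then l.get i else 0) = (l.take k).sum := by
    intro l
    induction l with
    | nil => intro k; simp
    | cons x l ih =>
      intro k
      cases k with
      | zero => simp
      | succ k =>
        rw [List.take_succ_cons, List.sum_cons, ← ih k]
        refine (Fin.sum_univ_succ (n := l.length) _).trans ?_
        simp
  exact h2 (rows lam) k

lemma rows_pos {x : ℕ} (hx : x ∈ rows lam) : 0 < x :=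
  lam.parts_pos (by rwa [rows, Multiset.mem_sort] at hx)

/-- Positivity of the entries is essential: appending zeros would not change the partial sums. -/
lemma list_eq_of_take_sum_eq : ∀ (l l' : List ℕ), (∀ x ∈ l, 0 < x) → (∀ x ∈ l', 0 < x) →
    (∀ k, (l.take k).sum = (l'.take k).sum) → l = l'
  | [], [], _, _, _ => rfl
  | [], x :: l', _, h', h => by
    have := h 1
    simp only [List.take_nil, List.sum_nil, List.take_succ_cons, List.take_zero, List.sum_cons,
      add_zero] at this
    exact absurd this (h' x (by simp)).ne
  | x :: l, [], h', _, h => by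
    have := h 1
    simp only [List.take_nil, List.sum_nil, List.take_succ_cons, List.take_zero, List.sum_cons,
      add_zero] at this
    exact absurd this (h' x (by simp)).ne'
  | x :: l, x' :: l', hl, hl', h => by
    have h1 := h 1
    simp only [List.take_succ_cons, List.take_zero, List.sum_cons, List.sum_nil, add_zero] at h1
    subst h1
    congr 1
    refine list_eq_of_take_sum_eq l l' (fun y hy => hl y (by simp [hy]))
      (fun y hy => hl' y (by simp [hy])) fun k => ?_
    have := h (k + 1)
    simpa using this

variable {lam}

lemma Dominates.antisymm {mu : n.Partition} (h : Dominates mu lam) (h' : Dominates lam mu) :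
    mu = lam := by
  have : rows mu = rows lam := list_eq_of_take_sum_eq _ _ (fun x => rows_pos mu)
    (fun x => rows_pos lam) fun k => le_antisymm (h' k) (h k)
  apply Nat.Partition.ext
  rw [← Multiset.sort_eq mu.parts (· ≥ ·), ← Multiset.sort_eq lam.parts (· ≥ ·)]
  exact congrArg _ this

lemma Dominates.trans {mu nu : n.Partition} (h : Dominates mu lam) (h' : Dominates lam nu) :
    Dominates mu nu := fun k => (h' k).trans (h k)

end Tableaux

/-! ### Young symmetrizers -/

section Young

variable {n : ℕ}

/-- The group algebra of the symmetric group. -/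
abbrev PermAlg (n : ℕ) : Type := MonoidAlgebra ℂ (Equiv.Perm (Fin n))

/-- A permutation as an element of the group algebra. -/
def permEl (s : Equiv.Perm (Fin n)) : PermAlg n := MonoidAlgebra.single s 1

lemma permEl_mul (s t : Equiv.Perm (Fin n)) : permEl (s * t) = permEl s * permEl t := by
  simp [permEl, MonoidAlgebra.single_mul_single]

/-- The row symmetrizer. -/
def rowSum (lam : n.Partition) : PermAlg n :=
  ∑ s : Equiv.Perm (Fin n) with ∀ a, rowOf lam (s a) = rowOf lam a, MonoidAlgebra.single s 1

/-- The signed column symmetrizer. -/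
def colSum (lam : n.Partition) : PermAlg n :=
  ∑ s : Equiv.Perm (Fin n) with ∀ a, colOf lam (s a) = colOf lam a,
    MonoidAlgebra.single s ((Equiv.Perm.sign s : ℤ) : ℂ)

lemma youngSymmetrizer_eq (lam : n.Partition) :
    youngSymmetrizer lam = rowSum lam * colSum lam := rfl

variable (lam : n.Partition)

lemma rowSum_mul_permEl {s : Equiv.Perm (Fin n)} (hs : s ∈ permBlock (rowOf lam)) :
    rowSum lam * permEl s = rowSum lam := by
  rw [rowSum, Finset.sum_mul]
  refine Finset.sum_equiv (Equiv.mulRight s) ?_ ?_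
  · intro t
    simp only [Finset.mem_filter, Finset.mem_univ, true_and, Equiv.coe_mulRight]
    exact ((permBlock (rowOf lam)).mul_mem_cancel_right hs).symm
  · intro t _
    simp [permEl, MonoidAlgebra.single_mul_single]

lemma permEl_mul_rowSum {s : Equiv.Perm (Fin n)} (hs : s ∈ permBlock (rowOf lam)) :
    permEl s * rowSum lam = rowSum lam := by
  rw [rowSum, Finset.mul_sum]
  refine Finset.sum_equiv (Equiv.mulLeft s) ?_ ?_
  · intro t
    simp only [Finset.mem_filter, Finset.mem_univ, true_and, Equiv.coe_mulLeft]
    exact ((permBlock (rowOf lam)).mul_mem_cancel_left hs).symm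
  · intro t _
    simp [permEl, MonoidAlgebra.single_mul_single]

lemma permEl_mul_colSum {s : Equiv.Perm (Fin n)} (hs : s ∈ permBlock (colOf lam)) :
    permEl s * colSum lam = ((Equiv.Perm.sign s : ℤ) : ℂ) • colSum lam := by
  rw [colSum, Finset.mul_sum, Finset.smul_sum]
  refine Finset.sum_equiv (Equiv.mulLeft s) ?_ ?_
  · intro t
    simp only [Finset.mem_filter, Finset.mem_univ, true_and, Equiv.coe_mulLeft]
    exact ((permBlock (colOf lam)).mul_mem_cancel_left hs).symm
  · intro t _
    have h1 : ((Equiv.Perm.sign s : ℤ) : ℂ) * ((Equiv.Perm.sign s : ℤ) : ℂ) = 1 := by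
      rw [← Int.cast_mul, ← Units.val_mul, Int.units_mul_self]
      simp
    simp only [permEl, MonoidAlgebra.single_mul_single, Equiv.coe_mulLeft, one_mul,
      MonoidAlgebra.smul_single, smul_eq_mul, Equiv.Perm.sign_mul, Units.val_mul, Int.cast_mul]
    rw [← mul_assoc, h1, one_mul]

/-- If two entries of one row of `mu` are carried by `x⁻¹` into one column of `lam`, their
transposition is absorbed by the row sum and, moved across `x`, changes the sign of the column sum,
so the product is its own negative. If no such pair exists, counting cells gives dominance, and for
equal shapes `x⁻¹` factors through a column and a row permutation. -/
lemma rowSum_mul_permEl_mul_colSum (mu : n.Partition) (x : Equiv.Perm (Fin n)) :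
    rowSum mu * permEl x * colSum lam = 0 ∨ Dominates lam mu ∧
      (mu = lam → ∃ t : ℂ, rowSum mu * permEl x * colSum lam = t • youngSymmetrizer lam) := by
  by_cases hx : ∀ a a', rowOf mu a = rowOf mu a' → colOf lam (x⁻¹ a) = colOf lam (x⁻¹ a') → a = a'
  · right
    refine ⟨fun k => ?_, ?_⟩
    · rw [← card_rowOf_lt, ← card_rowOf_lt]
      exact (isDiagram lam).dominates (rowOf mu) x⁻¹ hx k
    · rintro rfl
      obtain ⟨z, hz, c, hc, e⟩ := (isDiagram mu).exists_factor x⁻¹ hx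
      have e' : x = z⁻¹ * c⁻¹ := by rw [← mul_inv_rev, ← e, inv_inv]
      refine ⟨((Equiv.Perm.sign c⁻¹ : ℤ) : ℂ), ?_⟩
      rw [e', permEl_mul, ← mul_assoc, rowSum_mul_permEl mu (inv_mem hz), mul_assoc,
        permEl_mul_colSum mu (inv_mem hc), mul_smul_comm, youngSymmetrizer_eq]
  · left
    push Not at hx
    obtain ⟨a, a', h1, h2, hne⟩ := hx
    have ht : Equiv.swap a a' ∈ permBlock (rowOf mu) := by
      intro i
      by_cases hi : i = a
      · rw [hi, Equiv.swap_apply_left, h1]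
      by_cases hi' : i = a'
      · rw [hi', Equiv.swap_apply_right, h1]
      · rw [Equiv.swap_apply_of_ne_of_ne hi hi']
    have ht' : Equiv.swap (x⁻¹ a) (x⁻¹ a') ∈ permBlock (colOf lam) := by
      intro i
      by_cases hi : i = x⁻¹ a
      · rw [hi, Equiv.swap_apply_left, h2]
      by_cases hi' : i = x⁻¹ a'
      · rw [hi', Equiv.swap_apply_right, h2]
      · rw [Equiv.swap_apply_of_ne_of_ne hi hi']
    have hconj : Equiv.swap a a' * x = x * Equiv.swap (x⁻¹ a) (x⁻¹ a') := by
      rw [Equiv.mul_swap_eq_swap_mul]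
      have e1 : x (x⁻¹ a) = a := x.apply_symm_apply a
      have e2 : x (x⁻¹ a') = a' := x.apply_symm_apply a'
      rw [e1, e2]
    have hsign : ((Equiv.Perm.sign (Equiv.swap (x⁻¹ a) (x⁻¹ a')) : ℤ) : ℂ) = -1 := by
      rw [Equiv.Perm.sign_swap (fun h => hne (x⁻¹.injective h))]
      simp
    have key : rowSum mu * permEl x * colSum lam = -(rowSum mu * permEl x * colSum lam) := by
      conv_lhs => rw [← rowSum_mul_permEl mu ht, mul_assoc (rowSum mu), ← permEl_mul, hconj,
        permEl_mul, ← mul_assoc, mul_assoc _ _ (colSum lam), permEl_mul_colSum lam ht', hsign]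
      rw [neg_one_smul, mul_neg]
    have h2 : (2 : ℂ) • (rowSum mu * permEl x * colSum lam) = 0 := by
      rw [two_smul]
      nth_rewrite 1 [key]
      exact neg_add_cancel _
    exact (smul_eq_zero.1 h2).resolve_left two_ne_zero

lemma permAlg_eq_sum (z : PermAlg n) : z = ∑ s, z.coeff s • permEl s := by
  classical
  apply MonoidAlgebra.coeff_injective
  ext t
  simp [permEl, MonoidAlgebra.coeff_sum]

lemma rowSum_mul_mul_colSum (mu : n.Partition) (z : PermAlg n) :
    rowSum mu * z * colSum lam = 0 ∨ Dominates lam mu ∧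
      (mu = lam → ∃ t : ℂ, rowSum mu * z * colSum lam = t • youngSymmetrizer lam) := by
  have hz : rowSum mu * z * colSum lam = ∑ s, z.coeff s • (rowSum mu * permEl s * colSum lam) := by
    conv_lhs => rw [permAlg_eq_sum z]
    simp only [Finset.mul_sum, Finset.sum_mul, mul_smul_comm, smul_mul_assoc]
  by_cases hd : Dominates lam mu
  · right
    refine ⟨hd, fun e => ?_⟩
    have : ∀ s, ∃ t : ℂ, rowSum mu * permEl s * colSum lam = t • youngSymmetrizer lam := by
      intro s
      rcases rowSum_mul_permEl_mul_colSum lam mu s with h | h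
      · exact ⟨0, by rw [h, zero_smul]⟩
      · exact h.2 e
    choose t ht using this
    refine ⟨∑ s, z.coeff s * t s, ?_⟩
    rw [hz, Finset.sum_smul]
    exact Finset.sum_congr rfl fun s _ => by rw [ht, smul_smul]
  · left
    rw [hz]
    refine Finset.sum_eq_zero fun s _ => ?_
    rcases rowSum_mul_permEl_mul_colSum lam mu s with h | h
    · rw [h, smul_zero]
    · exact absurd h.1 hd

/-- The coefficient at the identity is 1, since only the identity preserves both rows and columns.
-/
lemma youngSymmetrizer_ne_zero : youngSymmetrizer lam ≠ 0 := by
  classical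
  intro h
  have h1 : (youngSymmetrizer lam).coeff 1 = 1 := by
    rw [youngSymmetrizer_eq, rowSum, colSum, Finset.sum_mul_sum]
    simp only [MonoidAlgebra.coeff_sum, Finsupp.finsetSum_apply, MonoidAlgebra.single_mul_single,
      one_mul, MonoidAlgebra.coeff_single, Finsupp.single_apply]
    rw [Finset.sum_eq_single 1]
    · rw [Finset.sum_eq_single 1]
      · simp
      · intro s _ hs
        rw [if_neg (by simpa using hs)]
      · simp
    · intro s hs hs1
      refine Finset.sum_eq_zero fun t ht => ?_
      rw [if_neg]
      intro e
      apply hs1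
      simp only [Finset.mem_filter, Finset.mem_univ, true_and] at hs ht
      have hst : s = t⁻¹ := eq_inv_of_mul_eq_one_left e
      ext a
      have hc : colOf lam (s a) = colOf lam a := by
        rw [hst]
        exact (permBlock (colOf lam)).inv_mem (x := t) ht a
      exact congrArg Fin.val ((isDiagram lam).inj _ _ (hs a) hc)
    · simp
  rw [h] at h1
  simp at h1

end Young

end WildCount

end

noncomputable section

namespace WildCount

/-! ### Characters of the symmetric group -/

section SymmetricGroup

variable {n : ℕ}

/-- The inclusion of the left ideal in the group algebra. -/
def spechtIncl (lam : n.Partition) : SpechtIdeal lam →ₗ[ℂ] PermAlg n where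
  toFun x := (RestrictScalars.addEquiv ℂ (PermAlg n) (Ideal.span {youngSymmetrizer lam}) x).1
  map_add' _ _ := rfl
  map_smul' c x := by
    rw [RestrictScalars.addEquiv_map_smul, Submodule.coe_smul, smul_eq_mul, RingHom.id_apply,
      Algebra.smul_def]

lemma spechtIncl_injective (lam : n.Partition) : Function.Injective (spechtIncl lam) :=
  fun _ _ h => (RestrictScalars.addEquiv ℂ (PermAlg n)
    (Ideal.span {youngSymmetrizer lam})).injective (Subtype.ext h)

lemma spechtIncl_specht (lam : n.Partition) (s : Equiv.Perm (Fin n)) (x : SpechtIdeal lam) :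
    spechtIncl lam (specht lam s x) = permEl s * spechtIncl lam x := rfl

instance instFinitePermAlg : FiniteDimensional ℂ (PermAlg n) :=
  Module.Finite.of_basis (MonoidAlgebra.basis (Equiv.Perm (Fin n)) ℂ)

/-- The left ideal as a subspace of the group algebra. -/
abbrev spechtSpace (lam : n.Partition) : Submodule ℂ (PermAlg n) := LinearMap.range (spechtIncl lam)

/-- The left ideal as a subspace of the group algebra. -/
def spechtEquiv (lam : n.Partition) : SpechtIdeal lam ≃ₗ[ℂ] spechtSpace lam :=
  LinearEquiv.ofInjective (spechtIncl lam) (spechtIncl_injective lam)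

/-- The representation of `𝔖_n` on the left ideal. -/
def spechtRep (lam : n.Partition) : Representation ℂ (Equiv.Perm (Fin n)) (spechtSpace lam) where
  toFun s := (LinearMap.mulLeft ℂ (permEl s)).restrict (by
    rintro _ ⟨x, rfl⟩
    exact ⟨specht lam s x, spechtIncl_specht lam s x⟩)
  map_one' := by
    ext x
    simp [permEl, LinearMap.restrict_apply, ← MonoidAlgebra.one_def]
  map_mul' s t := by
    ext x
    simp [LinearMap.restrict_apply, permEl_mul]

lemma spechtEquiv_specht (lam : n.Partition) (s : Equiv.Perm (Fin n)) (x : SpechtIdeal lam) :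
    spechtEquiv lam (specht lam s x) = spechtRep lam s (spechtEquiv lam x) :=
  Subtype.ext (spechtIncl_specht lam s x)

lemma trace_specht (lam : n.Partition) (s : Equiv.Perm (Fin n)) :
    LinearMap.trace ℂ _ (specht lam s) = (spechtRep lam).character s := by
  let m : Module ℂ (SpechtIdeal lam) := inferInstance
  -- Subtraction is rebuilt from the module structure so that the underlying additive monoid is the
  -- one over which the trace is formed.
  let g : AddCommGroup (SpechtIdeal lam) := Module.addCommMonoidToAddCommGroup ℂ
  refine (@LinearMap.trace_conj' ℂ _ (SpechtIdeal lam) g m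
    (spechtSpace lam) _ _ (specht lam s) (spechtEquiv lam)).symm.trans ?_
  refine congrArg (LinearMap.trace ℂ (spechtSpace lam)) ?_
  apply LinearMap.ext
  intro x
  obtain ⟨y, rfl⟩ := (spechtEquiv lam).surjective x
  change spechtEquiv lam (specht lam s ((spechtEquiv lam).symm (spechtEquiv lam y))) = _
  rw [LinearEquiv.symm_apply_apply, spechtEquiv_specht]

lemma coe_spechtRep (lam : n.Partition) (s : Equiv.Perm (Fin n)) (x : spechtSpace lam) :
    (spechtRep lam s x : PermAlg n) = permEl s * x := rfl

lemma exists_eq_mul_youngSymmetrizer (lam : n.Partition) (x : spechtSpace lam) :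
    ∃ y : PermAlg n, (x : PermAlg n) = y * youngSymmetrizer lam := by
  obtain ⟨_, ⟨x, rfl⟩⟩ := x
  have h := (RestrictScalars.addEquiv ℂ (PermAlg n) (Ideal.span {youngSymmetrizer lam}) x).2
  obtain ⟨y, hy⟩ := Ideal.mem_span_singleton'.1 h
  exact ⟨y, hy.symm⟩

/-- The Young symmetrizer as an element of the ideal it generates. -/
def spechtGen (lam : n.Partition) : spechtSpace lam :=
  ⟨youngSymmetrizer lam, (RestrictScalars.addEquiv ℂ (PermAlg n)
    (Ideal.span {youngSymmetrizer lam})).symm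
      ⟨youngSymmetrizer lam, Ideal.mem_span_singleton_self _⟩, rfl⟩

lemma coe_spechtGen (lam : n.Partition) :
    (spechtGen lam : PermAlg n) = youngSymmetrizer lam := rfl

lemma spechtGen_ne_zero (lam : n.Partition) : spechtGen lam ≠ 0 := by
  intro h
  apply youngSymmetrizer_ne_zero lam
  rw [← coe_spechtGen, h, Submodule.coe_zero]

lemma eq_sum_specht_gen (lam : n.Partition) (x : spechtSpace lam) :
    ∃ y : Equiv.Perm (Fin n) → ℂ, x = ∑ s, y s • spechtRep lam s (spechtGen lam) := by
  obtain ⟨y, hy⟩ := exists_eq_mul_youngSymmetrizer lam x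
  refine ⟨y.coeff, Subtype.ext ?_⟩
  rw [hy, Submodule.coe_sum]
  conv_lhs => rw [permAlg_eq_sum y, Finset.sum_mul]
  refine Finset.sum_congr rfl fun s _ => ?_
  rw [Submodule.coe_smul, coe_spechtRep, coe_spechtGen, smul_mul_assoc]

lemma rowSum_eq_sum (mu : n.Partition) : rowSum mu =
    ∑ s : Equiv.Perm (Fin n), open scoped Classical in
      if s ∈ permBlock (rowOf mu) then permEl s else 0 := by
  classical
  rw [rowSum, Finset.sum_filter]
  refine Finset.sum_congr rfl fun s _ => ?_
  have : s ∈ permBlock (rowOf mu) ↔ ∀ a, rowOf mu (s a) = rowOf mu a := Iff.rfl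
  by_cases h : s ∈ permBlock (rowOf mu)
  · rw [if_pos h, if_pos (this.1 h)]; rfl
  · rw [if_neg h, if_neg (fun h' => h (this.2 h'))]

lemma coe_avgOp_spechtRep (lam mu : n.Partition) (x : spechtSpace lam) :
    (avgOp (spechtRep lam) (permBlock (rowOf mu)) x : PermAlg n) =
      (Nat.card (permBlock (rowOf mu)) : ℂ)⁻¹ • (rowSum mu * x) := by
  classical
  rw [avgOp, rowSum_eq_sum, LinearMap.smul_apply, Submodule.coe_smul, LinearMap.sum_apply,
    Submodule.coe_sum, Finset.sum_mul]
  congr 1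
  refine Finset.sum_congr rfl fun s _ => ?_
  split_ifs with h
  · rw [coe_spechtRep]
  · simp

/-- The average is left multiplication by a multiple of the row sum of `mu`, and every element of
the ideal ends in the column sum of `lam`; the dichotomy for row and column sums applies. -/
lemma avgOp_specht_eq_zero (lam mu : n.Partition) (h : ¬ Dominates lam mu) :
    avgOp (spechtRep lam) (permBlock (rowOf mu)) = 0 := by
  refine LinearMap.ext fun x => ?_
  apply Subtype.ext
  obtain ⟨y, hy⟩ := exists_eq_mul_youngSymmetrizer lam x
  rw [coe_avgOp_spechtRep, hy, youngSymmetrizer_eq, ← mul_assoc y, ← mul_assoc]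
  rcases rowSum_mul_mul_colSum lam mu (y * rowSum lam) with h' | h'
  · rw [h', smul_zero, LinearMap.zero_apply, Submodule.coe_zero]
  · exact absurd h'.1 h

/-- The invariants of the row group of the same shape form the line of the Young symmetrizer. Both
the diagonal Kostka numbers and the irreducibility of the ideal rest on this. -/
lemma avgOp_specht_self (lam : n.Partition) (x : spechtSpace lam) :
    ∃ t : ℂ, avgOp (spechtRep lam) (permBlock (rowOf lam)) x = t • spechtGen lam := by
  obtain ⟨y, hy⟩ := exists_eq_mul_youngSymmetrizer lam x
  have hc := coe_avgOp_spechtRep lam lam x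
  rw [hy, youngSymmetrizer_eq, ← mul_assoc y, ← mul_assoc] at hc
  rcases rowSum_mul_mul_colSum lam lam (y * rowSum lam) with h' | h'
  · refine ⟨0, Subtype.ext ?_⟩
    rw [hc, h', smul_zero, zero_smul, Submodule.coe_zero]
  · obtain ⟨t, ht⟩ := h'.2 rfl
    refine ⟨(Nat.card (permBlock (rowOf lam)) : ℂ)⁻¹ * t, Subtype.ext ?_⟩
    rw [hc, ht, smul_smul, Submodule.coe_smul, coe_spechtGen]

lemma specht_gen (lam : n.Partition) {s : Equiv.Perm (Fin n)} (hs : s ∈ permBlock (rowOf lam)) :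
    spechtRep lam s (spechtGen lam) = spechtGen lam := by
  apply Subtype.ext
  rw [coe_spechtRep, coe_spechtGen, youngSymmetrizer_eq, ← mul_assoc, permEl_mul_rowSum lam hs]

/-- The character of `𝔖_n` attached to a partition. -/
def symChar (lam : n.Partition) : Equiv.Perm (Fin n) → ℂ := (spechtRep lam).character

lemma symChar_conj (lam : n.Partition) (x s : Equiv.Perm (Fin n)) :
    symChar lam (x * s * x⁻¹) = symChar lam s := (spechtRep lam).char_conj s x

/-- The multiplicity of the trivial representation of a Young subgroup. -/
def kostka (lam mu : n.Partition) : ℂ :=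
  LinearMap.trace ℂ _ (avgOp (spechtRep lam) (permBlock (rowOf mu)))

lemma kostka_eq_zero (lam mu : n.Partition) (h : ¬ Dominates lam mu) : kostka lam mu = 0 := by
  rw [kostka, avgOp_specht_eq_zero lam mu h, map_zero]

lemma apply_of_fixed {G V : Type*} [Group G] [Fintype G] [AddCommGroup V] [Module ℂ V]
    (ρ : Representation ℂ G V) (K : Subgroup G) (x : V) (h : ∀ g ∈ K, ρ g x = x) :
    avgOp ρ K x = x := by
  classical
  rw [avgOp, LinearMap.smul_apply, LinearMap.sum_apply]
  refine Eq.trans ?_ (avg_const K (fun g => ρ g x) x h)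
  congr 1
  refine Finset.sum_congr rfl fun g _ => ?_
  split_ifs <;> rfl

lemma trace_eq_one_of_range_span {V : Type*} [AddCommGroup V] [Module ℂ V] [FiniteDimensional ℂ V]
    (f : V →ₗ[ℂ] V) {v : V} (hv : v ≠ 0) (hfv : f v = v) (hf : ∀ x, ∃ t : ℂ, f x = t • v) :
    LinearMap.trace ℂ V f = 1 := by
  have hproj : LinearMap.IsProj (ℂ ∙ v) f := by
    refine ⟨fun x => ?_, fun x hx => ?_⟩
    · obtain ⟨t, ht⟩ := hf x
      rw [ht]
      exact Submodule.smul_mem _ _ (Submodule.mem_span_singleton_self _)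
    · obtain ⟨t, rfl⟩ := Submodule.mem_span_singleton.1 hx
      rw [map_smul, hfv]
  rw [hproj.trace, finrank_span_singleton hv, Nat.cast_one]

lemma kostka_self (lam : n.Partition) : kostka lam lam = 1 := by
  have hfix := apply_of_fixed (spechtRep lam) (permBlock (rowOf lam)) (spechtGen lam)
    fun s hs => specht_gen lam hs
  exact trace_eq_one_of_range_span _ (spechtGen_ne_zero lam) hfix (avgOp_specht_self lam)

lemma intertwining_ext (lam kap : n.Partition) (A B : (spechtRep lam).IntertwiningMap (spechtRep kap))
    (h : A (spechtGen lam) = B (spechtGen lam)) : A = B := by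
  refine DFunLike.ext _ _ fun x => ?_
  obtain ⟨y, rfl⟩ := eq_sum_specht_gen lam x
  simp only [map_sum, map_smul]
  refine Finset.sum_congr rfl fun s _ => ?_
  rw [A.isIntertwining, B.isIntertwining, h]

lemma avgOp_intertwining (lam kap : n.Partition) (A : (spechtRep lam).IntertwiningMap (spechtRep kap)) :
    avgOp (spechtRep kap) (permBlock (rowOf lam)) (A (spechtGen lam)) = A (spechtGen lam) := by
  refine apply_of_fixed _ _ _ fun s hs => ?_
  rw [← A.isIntertwining, specht_gen lam hs]

/-- An intertwiner is determined by the image of the generator. That image is fixed by the row group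
of `lam`, whose average vanishes on the ideal of `kap`. -/
lemma charPair_symChar_of_not_dominates (kap lam : n.Partition) (h : ¬ Dominates kap lam) :
    charPair (symChar kap) (symChar lam) = 0 := by
  have := Representation.card_inv_mul_sum_char_mul_char_eq_finrank (spechtRep lam) (spechtRep kap)
  refine this.trans ?_
  have hsub : Subsingleton ((spechtRep lam).IntertwiningMap (spechtRep kap)) := by
    refine ⟨fun A B => intertwining_ext lam kap A B ?_⟩
    rw [← avgOp_intertwining, ← avgOp_intertwining lam kap B, avgOp_specht_eq_zero kap lam h]
    rfl
  rw [Module.finrank_zero_of_subsingleton, Nat.cast_zero]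

lemma charPair_symChar_of_ne (kap lam : n.Partition) (h : kap ≠ lam) :
    charPair (symChar kap) (symChar lam) = 0 := by
  by_cases h1 : Dominates kap lam
  · rw [charPair_comm]
    exact charPair_symChar_of_not_dominates _ _ fun h2 => h (h1.antisymm h2)
  · exact charPair_symChar_of_not_dominates _ _ h1

lemma charPair_symChar_self (lam : n.Partition) :
    charPair (symChar lam) (symChar lam) = 1 := by
  have := Representation.card_inv_mul_sum_char_mul_char_eq_finrank (spechtRep lam) (spechtRep lam)
  refine this.trans ?_
  have h1 : Module.finrank ℂ ((spechtRep lam).IntertwiningMap (spechtRep lam)) = 1 := by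
    refine finrank_eq_one (Representation.IntertwiningMap.id (spechtRep lam)) ?_ ?_
    · intro h
      exact spechtGen_ne_zero lam (congrArg (fun A => A (spechtGen lam)) h)
    · intro A
      obtain ⟨t, ht⟩ := avgOp_specht_self lam (A (spechtGen lam))
      refine ⟨t, intertwining_ext lam lam _ _ ?_⟩
      rw [← avgOp_intertwining lam lam A, ht]
      rfl
  rw [h1, Nat.cast_one]

/-- The cycle type of a permutation, as a partition of `n`. -/
def cycleShape (s : Equiv.Perm (Fin n)) : n.Partition :=
  ⟨s.partition.parts, fun h => s.partition.parts_pos h, by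
    rw [s.partition.parts_sum, Fintype.card_fin]⟩

lemma isConj_of_cycleShape {s t : Equiv.Perm (Fin n)} (h : cycleShape s = cycleShape t) :
    IsConj s t := by
  rw [Equiv.Perm.partition_eq_of_isConj]
  have h1 : (cycleShape s).parts = (cycleShape t).parts := by rw [h]
  exact Nat.Partition.ext h1

lemma extend_cycleShape {f : Equiv.Perm (Fin n) → ℂ} (hf : ∀ x s, f (x * s * x⁻¹) = f s)
    (s : Equiv.Perm (Fin n)) : Function.extend cycleShape f 0 (cycleShape s) = f s := by
  classical
  have h : ∃ t, cycleShape t = cycleShape s := ⟨s, rfl⟩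
  rw [Function.extend_def, dif_pos h]
  obtain ⟨c, hc⟩ := isConj_iff.1 (isConj_of_cycleShape (Classical.choose_spec h))
  exact (hf c _).symm.trans (congrArg f hc)

/-- The irreducible characters span the class functions on `𝔖_n`. -/
lemma classFun_eq_sum_symChar {f : Equiv.Perm (Fin n) → ℂ} (hf : ∀ x s, f (x * s * x⁻¹) = f s)
    (s : Equiv.Perm (Fin n)) : f s = ∑ lam, charPair f (symChar lam) * symChar lam s := by
  -- Partitions index both the characters and the conjugacy classes. Read through cycle types,
  -- forming linear combinations of the characters is an endomorphism of one finite-dimensional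
  -- space; orthonormality makes it injective, hence surjective.
  let M : (n.Partition → ℂ) →ₗ[ℂ] (n.Partition → ℂ) :=
    ∑ lam, (LinearMap.proj lam).smulRight (Function.extend cycleShape (symChar lam) 0)
  have hM : ∀ a s, M a (cycleShape s) = ∑ lam, a lam * symChar lam s := by
    intro a s
    simp only [M, LinearMap.sum_apply, LinearMap.smulRight_apply, LinearMap.proj_apply,
      Finset.sum_apply, Pi.smul_apply, smul_eq_mul]
    exact Finset.sum_congr rfl fun lam _ => by rw [extend_cycleShape (symChar_conj lam)]
  have hcoef : ∀ (a : n.Partition → ℂ) mu,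
      charPair (fun s => ∑ lam, a lam * symChar lam s) (symChar mu) = a mu := by
    intro a mu
    rw [charPair_sum_left, Finset.sum_eq_single mu]
    · rw [charPair_symChar_self, mul_one]
    · intro lam _ h
      rw [charPair_symChar_of_ne _ _ h, mul_zero]
    · simp
  have hinj : Function.Injective M := by
    rw [injective_iff_map_eq_zero]
    intro a ha
    funext mu
    rw [← hcoef a mu]
    have : (fun s => ∑ lam, a lam * symChar lam s) = fun _ => 0 := by
      funext s
      rw [← hM, ha]
      rfl
    rw [this]
    simp [charPair]
  obtain ⟨a, ha⟩ := LinearMap.injective_iff_surjective.1 hinj (Function.extend cycleShape f 0)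
  have hfa : f = fun s => ∑ lam, a lam * symChar lam s := by
    funext s
    rw [← hM, ha, extend_cycleShape hf]
  have : ∀ lam, charPair f (symChar lam) = a lam := fun lam => by rw [hfa, hcoef]
  simp only [this]
  exact congrFun hfa s

/-- The character of the permutation representation on the cosets of a Young subgroup. -/
def permChar (mu : n.Partition) : Equiv.Perm (Fin n) → ℂ :=
  indFun (permBlock (rowOf mu)) fun _ => 1

lemma charPair_permChar (mu lam : n.Partition) :
    charPair (permChar mu) (symChar lam) = kostka lam mu := by
  classical
  rw [permChar, charPair_indFun _ _ _ (symChar_conj lam), kostka, trace_avgOp]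
  congr 1
  refine Fintype.sum_equiv (Equiv.inv _) _ _ fun s => ?_
  simp [symChar]

lemma permChar_eq_sum (mu : n.Partition) (s : Equiv.Perm (Fin n)) :
    permChar mu s = ∑ lam, kostka lam mu * symChar lam s := by
  rw [classFun_eq_sum_symChar (f := permChar mu) (indFun_conj _ _) s]
  exact Finset.sum_congr rfl fun lam _ => by rw [← charPair_permChar]

/-- The matrix of Kostka numbers. -/
def kostkaMatrix (n : ℕ) : Matrix n.Partition n.Partition ℂ := kostka

/-- The matrix is unitriangular for dominance. The entries of a kernel vector vanish by induction
from the least dominant partitions upwards. -/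
lemma isUnit_kostkaMatrix : IsUnit (kostkaMatrix n) := by
  rw [← Matrix.mulVec_injective_iff_isUnit, ← Matrix.coe_mulVecLin, injective_iff_map_eq_zero]
  intro v hv
  have hwf : WellFounded fun mu lam : n.Partition => Dominates lam mu ∧ mu ≠ lam := by
    have h1 : IsTrans n.Partition fun mu lam => Dominates lam mu ∧ mu ≠ lam :=
      ⟨fun a b c h h' => ⟨h'.1.trans h.1, fun e => h.2 (by subst e; exact h'.1.antisymm h.1)⟩⟩
    have h2 : Std.Irrefl fun mu lam : n.Partition => Dominates lam mu ∧ mu ≠ lam :=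
      ⟨fun a h => h.2 rfl⟩
    exact Finite.wellFounded_of_trans_of_irrefl _
  funext lam
  induction lam using hwf.induction with
  | _ lam ih =>
    have h1 := congrFun hv lam
    rw [Matrix.coe_mulVecLin, Matrix.mulVec, dotProduct, Finset.sum_eq_single lam] at h1
    · simpa [kostkaMatrix, kostka_self] using h1
    · intro mu _ hne
      by_cases hd : Dominates lam mu
      · rw [ih mu ⟨hd, hne⟩, Pi.zero_apply, mul_zero]
      · rw [kostkaMatrix, kostka_eq_zero lam mu hd, zero_mul]
    · simp

/-- The inverse Kostka numbers. -/
def invKostka (lam nu : n.Partition) : ℂ := (kostkaMatrix n)⁻¹ nu lam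

lemma sum_invKostka_mul_kostka (lam kap : n.Partition) :
    ∑ nu, invKostka lam nu * kostka kap nu = if kap = lam then 1 else 0 := by
  have h := Matrix.mul_nonsing_inv (kostkaMatrix n)
    ((Matrix.isUnit_iff_isUnit_det _).1 isUnit_kostkaMatrix)
  have := congrFun (congrFun h kap) lam
  rw [Matrix.mul_apply, Matrix.one_apply] at this
  rw [← this]
  exact Finset.sum_congr rfl fun nu _ => mul_comm _ _

lemma sum_kostka_mul_invKostka (mu nu : n.Partition) :
    ∑ kap, kostka kap mu * invKostka kap nu = if nu = mu then 1 else 0 := by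
  have h := Matrix.nonsing_inv_mul (kostkaMatrix n)
    ((Matrix.isUnit_iff_isUnit_det _).1 isUnit_kostkaMatrix)
  have := congrFun (congrFun h nu) mu
  rw [Matrix.mul_apply, Matrix.one_apply] at this
  rw [← this]
  exact Finset.sum_congr rfl fun nu _ => mul_comm _ _

lemma symChar_eq_sum (lam : n.Partition) (s : Equiv.Perm (Fin n)) :
    symChar lam s = ∑ nu, invKostka lam nu * permChar nu s := by
  simp only [permChar_eq_sum, Finset.mul_sum]
  rw [Finset.sum_comm]
  simp only [← mul_assoc, ← Finset.sum_mul, sum_invKostka_mul_kostka]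
  simp

/-- The Gram matrix of the permutation characters. -/
lemma charPair_permChar_permChar (mu nu : n.Partition) :
    charPair (permChar mu) (permChar nu) = ∑ kap, kostka kap mu * kostka kap nu := by
  have : permChar nu = fun s => ∑ lam, kostka lam nu * symChar lam s := by
    funext s; exact permChar_eq_sum nu s
  conv_lhs => rw [this]
  rw [charPair_sum_right]
  exact Finset.sum_congr rfl fun kap _ => by rw [charPair_permChar, mul_comm]

/-- Orthonormality, in terms of the Gram matrix. -/
lemma sum_invKostka_gram (lam lam' : n.Partition) :
    ∑ nu, ∑ nu', invKostka lam nu * invKostka lam' nu' * charPair (permChar nu) (permChar nu') =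
      if lam = lam' then 1 else 0 := by
  have h1 : ∀ nu nu', invKostka lam nu * invKostka lam' nu' *
      charPair (permChar nu) (permChar nu') =
      ∑ kap, (invKostka lam nu * kostka kap nu) * (invKostka lam' nu' * kostka kap nu') := by
    intro nu nu'
    rw [charPair_permChar_permChar, Finset.mul_sum]
    exact Finset.sum_congr rfl fun kap _ => by ring
  simp only [h1]
  have h2 : ∀ nu, ∑ nu', ∑ kap, (invKostka lam nu * kostka kap nu) *
      (invKostka lam' nu' * kostka kap nu') =
      ∑ kap, (invKostka lam nu * kostka kap nu) * (if kap = lam' then 1 else 0) := by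
    intro nu
    rw [Finset.sum_comm]
    refine Finset.sum_congr rfl fun kap _ => ?_
    rw [← Finset.mul_sum, sum_invKostka_mul_kostka]
  simp only [h2]
  rw [Finset.sum_comm]
  simp only [← Finset.sum_mul, sum_invKostka_mul_kostka]
  simp [eq_comm]

/-- The partition with all parts equal to one. -/
def onesPartition (n : ℕ) : n.Partition :=
  ⟨Multiset.replicate n 1, fun h => by rw [Multiset.eq_of_mem_replicate h]; exact one_pos, by simp⟩

lemma rowOf_ones_injective : Function.Injective (rowOf (onesPartition n)) := by
  have h0 : ∀ a, colOf (onesPartition n) a = 0 := by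
    intro a
    have h1 := colOf_lt (onesPartition n) a
    have h2 : (rows (onesPartition n))[rowOf (onesPartition n) a]'(rowOf_lt _ a) ∈
        (onesPartition n).parts := by
      rw [← Multiset.mem_sort (r := (· ≥ ·))]
      exact List.getElem_mem _
    rw [Multiset.eq_of_mem_replicate h2] at h1
    omega
  intro a a' h
  exact (isDiagram (onesPartition n)).inj a a' h (by rw [h0, h0])

lemma permBlock_eq_bot {α : Type*} {b : Fin n → α} (hb : Function.Injective b) :
    permBlock b = ⊥ := by
  rw [eq_bot_iff]
  intro s hs
  rw [Subgroup.mem_bot]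
  ext a
  rw [hb (hs a)]
  rfl

lemma kostka_ones (lam : n.Partition) : kostka lam (onesPartition n) = symChar lam 1 := by
  classical
  rw [kostka, trace_avgOp, permBlock_eq_bot rowOf_ones_injective]
  simp [symChar]

lemma permChar_one (mu : n.Partition) :
    permChar mu 1 = (n.factorial : ℂ) / Nat.card (permBlock (rowOf mu)) := by
  rw [permChar, indFun_one _ _ rfl]
  simp [Fintype.card_perm]

end SymmetricGroup

end WildCount

end

noncomputable section

namespace WildCount

/-! ### Peeling off constituents along a partial order -/

section Peeling

variable {G : Type*} [Group G] [Fintype G] {ι : Type*} [Fintype ι] {V : ι → Type*}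
  [∀ i, AddCommGroup (V i)] [∀ i, Module ℂ (V i)] [∀ i, FiniteDimensional ℂ (V i)]

lemma isoProj_idem {W : Type*} [AddCommGroup W] [Module ℂ W] (ρ : Representation ℂ G W)
    {χ : G → ℂ} (hχ : IsIrrChar χ) (h1 : charPair χ χ = 1) :
    isoProj ρ χ * isoProj ρ χ = isoProj ρ χ := by
  rw [isoProj_mul ρ hχ hχ.conj, h1, mul_one, mul_inv_cancel₀ hχ.one_ne_zero, one_smul]

lemma isoProj_mul_eq_zero {W : Type*} [AddCommGroup W] [Module ℂ W] (ρ : Representation ℂ G W)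
    {χ χ' : G → ℂ} (hχ : IsIrrChar χ) (hχ' : IsIrrChar χ') (h : charPair χ' χ = 0) :
    isoProj ρ χ * isoProj ρ χ' = 0 := by
  rw [isoProj_mul ρ hχ hχ'.conj, h, mul_zero, zero_smul]

omit [Fintype ι] in
/-- A sum of orthogonal isotypic projections is a projection. -/
lemma sum_isoProj_idem {W : Type*} [AddCommGroup W] [Module ℂ W] (ρ : Representation ℂ G W)
    (s : Finset ι) (c : ι → G → ℂ) (hc : ∀ i ∈ s, IsIrrChar (c i))
    (h1 : ∀ i, charPair (c i) (c i) = 1) (h0 : ∀ i j, i ≠ j → charPair (c i) (c j) = 0) :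
    (∑ i ∈ s, isoProj ρ (c i)) * ∑ i ∈ s, isoProj ρ (c i) = ∑ i ∈ s, isoProj ρ (c i) := by
  rw [Finset.sum_mul_sum]
  refine Finset.sum_congr rfl fun i hi => ?_
  rw [Finset.sum_eq_single_of_mem i hi, isoProj_idem ρ (hc i hi) (h1 i)]
  intro j hj hji
  exact isoProj_mul_eq_zero ρ (hc i hi) (hc j hj) (h0 j i hji)

omit [∀ i, FiniteDimensional ℂ (V i)] in
lemma charPair_character_eq (τ : ∀ i, Representation ℂ G (V i)) (K : ι → ι → ℂ) (c : ι → G → ℂ)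
    (hτ : ∀ j g, (τ j).character g = ∑ i, K i j * c i g)
    (h1 : ∀ i, charPair (c i) (c i) = 1) (h0 : ∀ i j, i ≠ j → charPair (c i) (c j) = 0)
    (i j : ι) : charPair (τ j).character (c i) = K i j := by
  rw [show (τ j).character = fun g => ∑ i, K i j * c i g from funext (hτ j), charPair_sum_left,
    Finset.sum_eq_single i, h1, mul_one]
  · intro k _ hk
    rw [h0 k i hk, mul_zero]
  · simp

/-- A vector that is killed by all homomorphisms to a representation that contains `χ` has
no component of type `χ`. -/
lemma isoProj_apply_eq_zero {V W : Type*} [AddCommGroup V] [Module ℂ V]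
    [AddCommGroup W] [Module ℂ W] [FiniteDimensional ℂ W]
    (ρ : Representation ℂ G V) (σ : Representation ℂ G W) {χ : G → ℂ} (hχ : IsIrrChar χ)
    (hσ : charPair σ.character χ ≠ 0) (f : V) (hf : ∀ A : ρ.IntertwiningMap σ, A f = 0) :
    isoProj ρ χ f = 0 := by
  have key : ∀ ℓ : V →ₗ[ℂ] ℂ, ℓ (isoProj ρ χ f) = 0 := by
    intro ℓ
    have hop : ∑ g, ℓ (ρ g⁻¹ f) • σ g = 0 := by
      ext x
      -- `B` is the group average of the rank one map v ↦ ℓ(v) x, hence an intertwiner, and so it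
      -- kills `f`.
      let B : V →ₗ[ℂ] W := ∑ g, (ℓ ∘ₗ ρ g⁻¹).smulRight (σ g x)
      have hB : ∀ v, B v = ∑ g, ℓ (ρ g⁻¹ v) • σ g x := by
        intro v
        simp [B]
      let A : ρ.IntertwiningMap σ := ⟨B, fun h => by
        ext v
        rw [LinearMap.comp_apply, LinearMap.comp_apply, hB, hB, map_sum]
        refine Fintype.sum_equiv (Equiv.mulLeft h⁻¹) _ _ fun g => ?_
        rw [map_smul, Equiv.coe_mulLeft, ← Module.End.mul_apply, ← Module.End.mul_apply, ← map_mul,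
          ← map_mul]
        congr 4
        · group
        · group⟩
      have := hf A
      change B f = 0 at this
      rw [hB] at this
      simpa using this
    -- Taking the trace against the isotypic projection of `σ` replaces each `σ g` by the
    -- multiplicity times χ(g). The multiplicity is not zero, and what remains is ℓ of the isotypic
    -- component of `f`, up to a scalar.
    have htr : LinearMap.trace ℂ W (isoProj σ χ * ∑ g, ℓ (ρ g⁻¹ f) • σ g) = 0 := by
      rw [hop, mul_zero, map_zero]
    simp only [Finset.mul_sum, mul_smul_comm, map_sum, map_smul, trace_isoProj_mul σ hχ,
      smul_eq_mul] at htr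
    have h2 : charPair σ.character χ * ∑ g, χ g⁻¹ * ℓ (ρ g f) = 0 := by
      rw [← htr, Finset.mul_sum]
      refine Fintype.sum_equiv (Equiv.inv G) _ _ fun g => ?_
      simp only [Equiv.inv_apply, inv_inv]
      ring
    have h3 := (mul_eq_zero.1 h2).resolve_left hσ
    rw [isoProj, LinearMap.smul_apply, LinearMap.sum_apply, map_smul, map_sum]
    simp only [LinearMap.smul_apply, map_smul, smul_eq_mul, h3, mul_zero]
  exact (Module.forall_dual_apply_eq_zero_iff ℂ _).1 key

variable (τ : ∀ i, Representation ℂ G (V i)) (K : ι → ι → ℂ) (c : ι → G → ℂ)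
  (D : ι → ι → Prop)

/-- If `τ_j = ∑ K_{ij} c_i` with `K` unitriangular, the vectors of `τ_j` killed by all
homomorphisms to the `τ_k` with `k` above `j` form a representation with character `c_j`. -/
lemma trace_restrict_eq_of_unitriangular
    (hτ : ∀ j g, (τ j).character g = ∑ i, K i j * c i g)
    (h1 : ∀ i, charPair (c i) (c i) = 1) (h0 : ∀ i j, i ≠ j → charPair (c i) (c j) = 0)
    (hK0 : ∀ i j, ¬ D i j → K i j = 0) (hK1 : ∀ i, K i i = 1)
    (htrans : ∀ i j k, D i j → D j k → D i k) (hanti : ∀ i j, D i j → D j i → i = j)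
    (j : ι) (hirr : ∀ i, D i j → i ≠ j → IsIrrChar (c i)) (X : Submodule ℂ (V j))
    (hX : ∀ f, f ∈ X ↔ ∀ i, D i j → i ≠ j → ∀ A : (τ j).IntertwiningMap (τ i), A f = 0)
    (hres : ∀ g, ∀ x ∈ X, τ j g x ∈ X) (g : G) :
    LinearMap.trace ℂ X ((τ j g).restrict (hres g)) = c j g := by
  classical
  let s : Finset ι := Finset.univ.filter fun i => D i j ∧ i ≠ j
  have hs : ∀ i, i ∈ s ↔ D i j ∧ i ≠ j := by simp [s]
  have hirr' : ∀ i ∈ s, IsIrrChar (c i) := fun i hi => hirr i ((hs i).1 hi).1 ((hs i).1 hi).2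
  let E : ∀ i, V i →ₗ[ℂ] V i := fun i => ∑ k ∈ s, isoProj (τ i) (c k)
  have hE : ∀ i, E i * E i = E i := fun i => sum_isoProj_idem (τ i) s c hirr' h1 h0
  have htrE : ∀ i g, LinearMap.trace ℂ (V i) (E i * τ i g) = ∑ k ∈ s, K k i * c k g := by
    intro i g
    rw [Finset.sum_mul, map_sum]
    refine Finset.sum_congr rfl fun k hk => ?_
    rw [trace_isoProj_mul _ (hirr' k hk), charPair_character_eq τ K c hτ h1 h0]
  -- For `i` strictly above `j` every constituent of `τ i` is indexed by an element above `i`, hence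
  -- by an element of `s`. The idempotent `1 - E i` therefore has trace zero.
  have hE1 : ∀ i ∈ s, E i = 1 := by
    intro i hi
    have hz : 1 - E i = 0 := by
      apply eq_zero_of_idempotent_of_trace_eq_zero
      · rw [mul_sub, sub_mul, sub_mul, hE]
        simp
      · have e1 := htrE i 1
        have e2 := hτ i 1
        rw [map_one, mul_one] at e1
        rw [Representation.character, map_one] at e2
        rw [map_sub, e1, e2, sub_eq_zero]
        symm
        refine Finset.sum_subset (Finset.subset_univ _) fun k _ hk => ?_
        rw [hK0, zero_mul]
        intro hd
        apply hk
        refine (hs k).2 ⟨htrans _ _ _ hd ((hs i).1 hi).1, ?_⟩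
        rintro rfl
        exact ((hs i).1 hi).2 (hanti _ _ ((hs i).1 hi).1 hd)
    exact (sub_eq_zero.1 hz).symm
  -- Vectors killed by all maps to `τ k` have no component of type `c k`, as `K k k = 1`.
  -- Conversely, a map to `τ i` commutes with the projections, and `E i` is the identity there.
  have hker : ∀ f, f ∈ X ↔ E j f = 0 := by
    intro f
    rw [hX]
    constructor
    · intro hf
      rw [LinearMap.sum_apply]
      refine Finset.sum_eq_zero fun k hk => ?_
      refine isoProj_apply_eq_zero (τ j) (τ k) (hirr' k hk) ?_ f
        (hf k ((hs k).1 hk).1 ((hs k).1 hk).2)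
      rw [charPair_character_eq τ K c hτ h1 h0, hK1]
      exact one_ne_zero
    · intro hf i hi hij A
      have hi' : i ∈ s := (hs i).2 ⟨hi, hij⟩
      have e1 : A (E j f) = E i (A f) := by
        simp only [E, LinearMap.sum_apply, map_sum, isoProj_intertwining]
      rw [hf, map_zero, hE1 i hi'] at e1
      exact e1.symm
  have hEg : ∀ g, E j * τ j g = τ j g * E j := by
    intro g
    rw [Finset.sum_mul, Finset.mul_sum]
    exact Finset.sum_congr rfl fun k hk => isoProj_comm (τ j) (hirr' k hk).conj g
  -- `1 - E j` is the equivariant projection onto `X`. Its trace against `g` removes from the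
  -- character of `τ j` all terms strictly above `j`, and unitriangularity leaves `c j`.
  have hproj : ∀ x, (τ j g * (1 - E j)) x ∈ X := by
    intro x
    rw [hker, ← Module.End.mul_apply, ← mul_assoc, hEg, mul_assoc, mul_sub, hE, mul_one, sub_self,
      mul_zero, LinearMap.zero_apply]
  have hfix : ∀ x ∈ X, (τ j g * (1 - E j)) x = τ j g x := by
    intro x hx
    rw [Module.End.mul_apply, LinearMap.sub_apply, (hker x).1 hx, sub_zero, Module.End.one_apply]
  have e1 := LinearMap.trace_restrict_eq_of_forall_mem X (τ j g * (1 - E j)) hproj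
  have e2 : LinearMap.restrict (τ j g * (1 - E j)) (fun x _ => hproj x) =
      (τ j g).restrict (hres g) := by
    ext x
    exact hfix x x.2
  rw [← e2, e1, mul_sub, mul_one, map_sub, ← hEg, htrE]
  have e3 := hτ j g
  rw [Representation.character] at e3
  rw [e3, ← Finset.sum_filter_add_sum_filter_not Finset.univ (fun i => D i j ∧ i ≠ j)]
  rw [add_sub_cancel_left, Finset.sum_eq_single j]
  · rw [hK1, one_mul]
  · intro i hi hij
    rw [hK0, zero_mul]
    intro hd
    exact (Finset.mem_filter.1 hi).2 ⟨hd, hij⟩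
  · intro h
    exact absurd (Finset.mem_filter.2 ⟨Finset.mem_univ j, fun h => h.2 rfl⟩) h

end Peeling

/-! ### Unipotent characters -/

section Unipotent

variable {F : Type*} [Field F] [Fintype F] [DecidableEq F] {n : ℕ}

/-- The character of the functions on the flags of the type given by the labelling `b`. -/
def flagChar (F : Type*) [Field F] [Fintype F] [DecidableEq F] {n : ℕ} {α : Type*}
    [LinearOrder α] (b : Fin n → α) : GL (Fin n) F → ℂ :=
  indFun (blockGroup F b) fun _ => 1

lemma compat_one {G : Type*} [Group G] (P Q : Subgroup G) (z : G) :
    Compat P Q (fun _ => 1) (fun _ => 1) z := fun _ _ _ => by simp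

lemma isCharOn_one {G : Type*} [Group G] (P : Subgroup G) : IsCharOn P fun _ => 1 :=
  ⟨rfl, fun _ _ _ _ => by simp⟩

/-- Trivial characters are compatible at every double coset, so both sides count double cosets, and
these correspond by the Bruhat decomposition. -/
lemma charPair_flagChar {α β : Type*} [LinearOrder α] [LinearOrder β] {b : Fin n → α}
    {b' : Fin n → β} (hb : Monotone b) (hb' : Monotone b') :
    charPair (flagChar F b) (flagChar F b') =
      charPair (indFun (permBlock b) fun _ => 1) (indFun (permBlock b') fun _ => 1) := by
  rw [flagChar, flagChar, charPair_indFun_indFun _ _ _ _ (isCharOn_one _) (isCharOn_one _),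
    charPair_indFun_indFun _ _ _ _ (isCharOn_one _) (isCharOn_one _)]
  simp only [if_pos (compat_one _ _ _)]
  exact sum_stabCard_eq (blockGroup F b) (blockGroup F b') (permBlock b) (permBlock b')
    (permGL F n) (exists_sameCoset_perm hb hb') (fun w w' => sameCoset_perm) (fun _ => 1)
    (fun _ _ _ => rfl)

lemma blockEquiv_val {k n : ℕ} (d : Fin k → ℕ) (h : ∑ i, d i = n) (y : Σ i, Fin (d i)) :
    ((blockEquiv d h y : Fin n) : ℕ) = ∑ j ∈ Finset.univ.filter (fun j => j < y.1), d j + y.2 := by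
  change ((finSigmaFinEquiv y : Fin _) : ℕ) = _
  rw [finSigmaFinEquiv_apply]
  congr 1
  refine Finset.sum_nbij (fun j => Fin.castLE y.1.2.le j) ?_ ?_ ?_ ?_
  · intro j _
    simp only [Finset.mem_filter, Finset.mem_univ, true_and, Fin.lt_def, Fin.val_castLE]
    exact j.2
  · intro j _ j' _ e
    exact Fin.castLE_injective _ e
  · intro j hj
    simp only [Finset.coe_filter, Finset.mem_univ, true_and, Set.mem_ofPred_eq] at hj
    exact ⟨⟨j, hj⟩, by simp, rfl⟩
  · intro j _
    rfl

lemma blockOf_monotone {k n : ℕ} (d : Fin k → ℕ) (h : ∑ i, d i = n) : Monotone (blockOf d h) := by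
  intro a a' haa
  obtain ⟨⟨i, x⟩, rfl⟩ := (blockEquiv d h).surjective a
  obtain ⟨⟨i', x'⟩, rfl⟩ := (blockEquiv d h).surjective a'
  rw [blockOf, blockOf, Equiv.symm_apply_apply, Equiv.symm_apply_apply]
  by_contra hlt
  rw [not_le] at hlt
  have h1 := Fin.le_def.1 haa
  rw [blockEquiv_val, blockEquiv_val] at h1
  have h2 : ∑ j ∈ Finset.univ.filter (fun j => j < i'), d j + d i' ≤
      ∑ j ∈ Finset.univ.filter (fun j => j < i), d j := by
    rw [add_comm, ← Finset.sum_insert (by simp)]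
    refine Finset.sum_le_sum_of_subset fun j hj => ?_
    simp only [Finset.mem_insert, Finset.mem_filter, Finset.mem_univ, true_and] at hj ⊢
    rcases hj with rfl | hj
    · exact hlt
    · exact hj.trans hlt
  have h3 := x'.2
  dsimp only at h1
  omega

lemma rowOf_monotone (lam : n.Partition) : Monotone (rowOf lam) :=
  fun _ _ h => blockOf_monotone (rowLen lam) (sum_rowLen lam) h

/-- The unipotent character attached to a partition. -/
def uniChar (F : Type*) [Field F] [Fintype F] [DecidableEq F] {n : ℕ} (lam : n.Partition)
    (g : GL (Fin n) F) : ℂ :=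
  ∑ nu, invKostka lam nu * flagChar F (rowOf nu) g

/-- Flag characters have the same Gram matrix as the permutation characters of the symmetric group,
so the same inverse Kostka combinations are orthonormal. -/
lemma charPair_uniChar (lam lam' : n.Partition) :
    charPair (uniChar F lam) (uniChar F lam') = if lam = lam' then 1 else 0 := by
  unfold uniChar
  rw [charPair_sum_left]
  simp only [charPair_sum_right, charPair_flagChar (rowOf_monotone _) (rowOf_monotone _)]
  rw [← sum_invKostka_gram lam lam']
  refine Finset.sum_congr rfl fun nu _ => ?_
  rw [Finset.mul_sum]
  exact Finset.sum_congr rfl fun nu' _ => by rw [mul_assoc]; rfl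

lemma flagChar_eq_sum (mu : n.Partition) (g : GL (Fin n) F) :
    flagChar F (rowOf mu) g = ∑ lam, kostka lam mu * uniChar F lam g := by
  simp only [uniChar, Finset.mul_sum]
  rw [Finset.sum_comm]
  simp only [← mul_assoc, ← Finset.sum_mul, sum_kostka_mul_invKostka]
  simp

lemma character_coind_subtype {G A : Type*} [Group G] [Fintype G] [AddCommGroup A] [Module ℂ A]
    [FiniteDimensional ℂ A] (P : Subgroup G) (σ : Representation ℂ P A) (φ : G → ℂ)
    (hφ : ∀ p : P, σ.character p = φ p) (g : G) :
    (Representation.coind P.subtype σ).character g = indFun P φ g := by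
  classical
  rw [character_coind, indFun, Nat.card_eq_fintype_card]
  congr 1
  refine Finset.sum_congr rfl fun x _ => ?_
  split_ifs with h
  · rw [Finset.sum_eq_single ⟨_, h⟩]
    · exact (if_pos rfl).trans (hφ _)
    · intro p _ hp
      rw [if_neg]
      intro e
      exact hp (Subtype.ext e)
    · simp
  · refine Finset.sum_eq_zero fun p _ => ?_
    rw [if_neg]
    intro e
    rw [← e] at h
    exact h p.2

lemma character_tau (nu : n.Partition) (g : GL (Fin n) F) :
    (tau F nu).character g = flagChar F (rowOf nu) g := by
  refine character_coind_subtype _ _ _ (fun p => ?_) g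
  simp [Representation.character]

lemma isIrrChar_subrepresentation {G V : Type*} [Group G] [Fintype G] [AddCommGroup V]
    [Module ℂ V] [FiniteDimensional ℂ V] (ρ : Representation ℂ G V) (X : Subrepresentation ρ)
    (χ : G → ℂ) (hχ : ∀ g, LinearMap.trace ℂ X.toSubmodule (X.toRepresentation g) = χ g)
    (h1 : charPair χ χ = 1) : IsIrrChar χ := by
  have hc : X.toRepresentation.character = χ := funext hχ
  rw [← hc]
  apply isIrrChar_character
  rw [hc, h1]

/-- Induction from the most dominant partitions downwards. For partitions strictly above `lam`,
`uniChar` is already known to be the character of a representation; having norm one, it is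
irreducible, as the peeling argument requires. -/
lemma character_unipotentRep (lam : n.Partition) (g : GL (Fin n) F) :
    LinearMap.trace ℂ _ (unipotentRep F lam g) = uniChar F lam g := by
  have hwf : WellFounded fun mu lam : n.Partition => Dominates mu lam ∧ mu ≠ lam := by
    have h1 : IsTrans n.Partition fun mu lam => Dominates mu lam ∧ mu ≠ lam :=
      ⟨fun a b c h h' => ⟨h.1.trans h'.1, fun e => h.2 (by subst e; exact h.1.antisymm h'.1)⟩⟩
    have h2 : Std.Irrefl fun mu lam : n.Partition => Dominates mu lam ∧ mu ≠ lam :=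
      ⟨fun a h => h.2 rfl⟩
    exact Finite.wellFounded_of_trans_of_irrefl _
  induction lam using hwf.induction generalizing g with
  | _ lam ih =>
    refine trace_restrict_eq_of_unitriangular (tau F) kostka (uniChar F) Dominates
      (fun mu g => by rw [character_tau, flagChar_eq_sum])
      (fun mu => by rw [charPair_uniChar, if_pos rfl])
      (fun mu mu' h => by rw [charPair_uniChar, if_neg h])
      kostka_eq_zero kostka_self (fun _ _ _ h h' => h.trans h') (fun _ _ h h' => h.antisymm h')
      lam ?_ (unipotent F lam).toSubmodule (fun f => Iff.rfl)
      (fun g x hx => (unipotent F lam).apply_mem_toSubmodule g hx) g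
    intro mu hd hne
    exact isIrrChar_subrepresentation (tau F mu) (unipotent F mu) (uniChar F mu)
      (fun g => ih mu ⟨hd, hne⟩ g) (by rw [charPair_uniChar, if_pos rfl])

end Unipotent

end WildCount

end

noncomputable section

namespace WildCount

/-! ### Induction in stages through a product of groups -/

section Stages

lemma prod_sum_pi {ι : Type*} [Fintype ι] [DecidableEq ι] {X : ι → Type*} [∀ i, Fintype (X i)]
    (f : ∀ i, X i → ℂ) : ∏ i, ∑ x, f i x = ∑ p : ∀ i, X i, ∏ i, f i (p i) := by
  rw [Finset.prod_univ_sum, Fintype.piFinset_univ]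

/-- Sums over a group of functions that factor through a quotient. -/
lemma sum_comp_surjective {Y Z : Type*} [Group Y] [Fintype Y] [Group Z] [Fintype Z] (π : Y →* Z)
    (hπ : Function.Surjective π) (f : Z → ℂ) :
    ∑ y, f (π y) = (Nat.card π.ker : ℂ) * ∑ z, f z := by
  classical
  rw [← Finset.sum_fiberwise Finset.univ π, Finset.mul_sum]
  refine Finset.sum_congr rfl fun z _ => ?_
  have h1 : ∀ y ∈ Finset.univ.filter (fun y => π y = z), f (π y) = f z := by
    intro y hy
    rw [(Finset.mem_filter.1 hy).2]
  rw [Finset.sum_congr rfl h1, Finset.sum_const, nsmul_eq_mul]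
  congr 1
  have h2 := MonoidHom.card_fiber_eq_of_mem_range π (x := z) (y := 1) (hπ z) ⟨1, map_one π⟩
  rw [h2, Nat.card_eq_fintype_card, Fintype.card_subtype]
  simp only [MonoidHom.mem_ker]

variable {G : Type*} [Group G] [Fintype G] {ι : Type*} [Fintype ι] {M : ι → Type*}
  [∀ i, Group (M i)] [∀ i, Fintype (M i)]

/-- Induction in stages from a subgroup that is defined by conditions on the factors of a
product that is a quotient of `P`. -/
lemma indFun_stages_pi {H P : Subgroup G} (hHP : H ≤ P) (π : P →* ∀ i, M i)
    (hπ : Function.Surjective π) (K : ∀ i, Subgroup (M i))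
    (hK : ∀ p : P, (p : G) ∈ H ↔ ∀ i, π p i ∈ K i) (φ ξ : G → ℂ)
    (hφ : ∀ p ∈ P, ∀ y ∈ P, φ (y * p * y⁻¹) = φ p)
    (hξ : ∀ p : P, ξ p = φ p * ∏ i, indFun (K i) (fun _ => 1) (π p i)) (g : G) :
    indFun P ξ g = indFun H φ g := by
  classical
  -- `H` is the preimage under `π` of the product of the `K i`.
  have hcard : (Nat.card H : ℂ) = Nat.card π.ker * ∏ i, (Nat.card (K i) : ℂ) := by
    have h1 := sum_comp_surjective π hπ fun z => if ∀ i, z i ∈ K i then 1 else 0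
    have h2 : (∑ y : P, if ∀ i, π y i ∈ K i then (1 : ℂ) else 0) = Nat.card H := by
      simp only [← hK]
      rw [Finset.sum_boole, Nat.card_eq_fintype_card]
      congr 1
      rw [← Fintype.card_subtype]
      exact Fintype.card_congr ⟨fun x => ⟨x.1, x.2⟩, fun x => ⟨⟨x, hHP x.2⟩, x.2⟩,
        fun _ => rfl, fun _ => rfl⟩
    have h3 : (∑ z : ∀ i, M i, if ∀ i, z i ∈ K i then (1 : ℂ) else 0) =
        ∏ i, (Nat.card (K i) : ℂ) := by
      have : ∀ i, (Nat.card (K i) : ℂ) = ∑ x : M i, if x ∈ K i then 1 else 0 := by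
        intro i
        rw [sum_ite_mem_const, smul_eq_mul, mul_one]
      simp only [this]
      rw [prod_sum_pi]
      refine Finset.sum_congr rfl fun z _ => ?_
      split_ifs with h
      · exact (Finset.prod_eq_one fun i _ => if_pos (h i)).symm
      · obtain ⟨i, hi⟩ := not_forall.1 h
        exact (Finset.prod_eq_zero (Finset.mem_univ i) (if_neg hi)).symm
    rw [← h2, h1, h3]
  -- `ξ` is the class function induced from `H` to `P`: conjugation by elements of `P` fixes `φ`,
  -- and membership in `H` is tested factor by factor, so the sum over `P` passes to the quotient
  -- and splits.
  have key : ∀ p : P, ξ p = (Nat.card H : ℂ)⁻¹ * ∑ y : G, if y ∈ P then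
      (if y * p * y⁻¹ ∈ H then φ (y * p * y⁻¹) else 0) else 0 := by
    intro p
    rw [hξ]
    have h1 : (∑ y : G, if y ∈ P then (if y * p * y⁻¹ ∈ H then φ (y * p * y⁻¹) else 0) else 0) =
        ∑ y : P, φ p * (if ∀ i, π y i * π p i * (π y i)⁻¹ ∈ K i then 1 else 0) := by
      rw [← Finset.sum_filter]
      rw [Finset.sum_subtype (F := inferInstance) _ (p := fun y => y ∈ P) (by simp)]
      refine Finset.sum_congr rfl fun y _ => ?_
      have h2 := hK (y * p * y⁻¹)
      simp only [map_mul, map_inv, Pi.mul_apply, Pi.inv_apply, Subgroup.coe_mul,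
        Subgroup.coe_inv] at h2
      simp only [h2]
      split_ifs
      · rw [hφ p p.2 y y.2, mul_one]
      · rw [mul_zero]
    rw [h1, ← Finset.mul_sum, sum_comp_surjective π hπ fun z =>
      if ∀ i, z i * π p i * (z i)⁻¹ ∈ K i then 1 else 0, hcard]
    have h3 : (∑ z : ∀ i, M i, if ∀ i, z i * π p i * (z i)⁻¹ ∈ K i then (1 : ℂ) else 0) =
        ∏ i, ∑ x : M i, if x * π p i * x⁻¹ ∈ K i then 1 else 0 := by
      rw [prod_sum_pi]
      refine Finset.sum_congr rfl fun z _ => ?_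
      split_ifs with h
      · exact (Finset.prod_eq_one fun i _ => if_pos (h i)).symm
      · obtain ⟨i, hi⟩ := not_forall.1 h
        exact (Finset.prod_eq_zero (Finset.mem_univ i) (if_neg hi)).symm
    rw [h3]
    simp only [indFun, Finset.prod_mul_distrib, Finset.prod_inv_distrib]
    have hk : (Nat.card π.ker : ℂ) ≠ 0 := card_subgroup_ne_zero _
    rw [mul_inv]
    field_simp
  rw [← indFun_stages hHP φ g]
  unfold indFun
  congr 1
  refine Finset.sum_congr rfl fun x _ => ?_
  split_ifs with h
  · exact key ⟨_, h⟩
  · rfl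

end Stages

/-! ### Refinements of block structures -/

section Refinement

variable {k n : ℕ} (d : Fin k → ℕ) (h : ∑ i, d i = n) (nu : ∀ i, (d i).Partition)

lemma blockOf_blockEquiv (y : Σ i, Fin (d i)) : blockOf d h (blockEquiv d h y) = y.1 := by
  rw [blockOf, Equiv.symm_apply_apply]

/-- The rows of the tableaux in the blocks, numbered lexicographically. -/
def lexLabel (a : Fin n) : Fin k ×ₗ ℕ :=
  toLex (((blockEquiv d h).symm a).1,
    rowOf (nu ((blockEquiv d h).symm a).1) ((blockEquiv d h).symm a).2)

lemma lexLabel_blockEquiv (y : Σ i, Fin (d i)) :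
    lexLabel d h nu (blockEquiv d h y) = toLex (y.1, rowOf (nu y.1) y.2) := by
  rw [lexLabel, Equiv.symm_apply_apply]

lemma lexLabel_monotone : Monotone (lexLabel d h nu) := by
  intro a a' haa
  have hb := blockOf_monotone d h haa
  obtain ⟨⟨i, x⟩, rfl⟩ := (blockEquiv d h).surjective a
  obtain ⟨⟨i', x'⟩, rfl⟩ := (blockEquiv d h).surjective a'
  rw [blockOf_blockEquiv, blockOf_blockEquiv] at hb
  rw [lexLabel_blockEquiv, lexLabel_blockEquiv, Prod.Lex.toLex_le_toLex]
  rcases hb.lt_or_eq with hlt | heq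
  · exact Or.inl hlt
  · right
    dsimp only at heq
    subst heq
    refine ⟨rfl, rowOf_monotone _ ?_⟩
    have h1 := Fin.le_def.1 haa
    rw [blockEquiv_val, blockEquiv_val] at h1
    exact Fin.le_def.2 (by simpa using h1)

lemma blockOf_eq_of_lexLabel_eq {a a' : Fin n} (e : lexLabel d h nu a = lexLabel d h nu a') :
    blockOf d h a = blockOf d h a' := congrArg (fun x => (ofLex x).1) e

variable {d h nu}

lemma permBlock_lexLabel_le : permBlock (lexLabel d h nu) ≤ permBlock (blockOf d h) :=
  fun _ hs a => blockOf_eq_of_lexLabel_eq d h nu (hs a)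

variable (d h)

/-- The embedding of a product of symmetric groups along consecutive blocks. -/
def blockHom : (∀ i, Equiv.Perm (Fin (d i))) →* Equiv.Perm (Fin n) :=
  (blockEquiv d h).permCongrHom.toMonoidHom.comp
    (Equiv.Perm.sigmaCongrRightHom fun i => Fin (d i))

lemma blockHom_apply (s : ∀ i, Equiv.Perm (Fin (d i))) (y : Σ i, Fin (d i)) :
    blockHom d h s (blockEquiv d h y) = blockEquiv d h ⟨y.1, s y.1 y.2⟩ := by
  simp [blockHom, Equiv.permCongrHom, Equiv.Perm.sigmaCongrRightHom]

lemma blockHom_injective : Function.Injective (blockHom d h) := by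
  intro s t e
  funext i
  ext x
  have h1 := congrArg (fun w : Equiv.Perm (Fin n) => w (blockEquiv d h ⟨i, x⟩)) e
  simp only [blockHom_apply] at h1
  have h2 := (blockEquiv d h).injective h1
  simp only [Sigma.mk.injEq, heq_eq_eq, true_and] at h2
  rw [h2]

lemma range_blockHom : (blockHom d h).range = permBlock (blockOf d h) := by
  ext w
  constructor
  · rintro ⟨s, rfl⟩ a
    obtain ⟨y, rfl⟩ := (blockEquiv d h).surjective a
    rw [blockHom_apply, blockOf_blockEquiv, blockOf_blockEquiv]
  · intro hw
    have h1 : ∀ i (x : Fin (d i)), ∃ x' : Fin (d i),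
        w (blockEquiv d h ⟨i, x⟩) = blockEquiv d h ⟨i, x'⟩ := by
      intro i x
      have h2 := hw (blockEquiv d h ⟨i, x⟩)
      obtain ⟨⟨i', x'⟩, e⟩ := (blockEquiv d h).surjective (w (blockEquiv d h ⟨i, x⟩))
      rw [← e, blockOf_blockEquiv, blockOf_blockEquiv] at h2
      dsimp only at h2
      subst h2
      exact ⟨x', e.symm⟩
    choose f hf using h1
    have hinj : ∀ i, Function.Injective (f i) := by
      intro i x x' e
      have h3 := hf i x
      rw [e, ← hf i x'] at h3
      have h4 := (blockEquiv d h).injective (w.injective h3)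
      simpa using h4
    refine ⟨fun i => Equiv.ofBijective (f i) (Finite.injective_iff_bijective.1 (hinj i)), ?_⟩
    ext a
    obtain ⟨y, rfl⟩ := (blockEquiv d h).surjective a
    rw [blockHom_apply, Equiv.ofBijective_apply, ← hf]

variable (nu) in
lemma blockHom_mem_lexLabel (s : ∀ i, Equiv.Perm (Fin (d i))) :
    blockHom d h s ∈ permBlock (lexLabel d h nu) ↔ ∀ i, s i ∈ permBlock (rowOf (nu i)) := by
  constructor
  · intro hs i x
    have h1 := hs (blockEquiv d h ⟨i, x⟩)
    rw [blockHom_apply, lexLabel_blockEquiv, lexLabel_blockEquiv] at h1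
    exact congrArg (fun x => (ofLex x).2) h1
  · intro hs a
    obtain ⟨y, rfl⟩ := (blockEquiv d h).surjective a
    rw [blockHom_apply, lexLabel_blockEquiv, lexLabel_blockEquiv, hs]

lemma card_permBlock_lexLabel : Nat.card (permBlock (lexLabel d h nu)) =
    ∏ i, Nat.card (permBlock (rowOf (nu i))) := by
  rw [← Nat.card_pi]
  symm
  refine Nat.card_congr (Equiv.ofBijective (fun s : ∀ i, permBlock (rowOf (nu i)) =>
    (⟨blockHom d h fun i => (s i).1, (blockHom_mem_lexLabel d h nu _).2 fun i => (s i).2⟩ :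
      permBlock (lexLabel d h nu))) ⟨?_, ?_⟩)
  · intro s t e
    have h1 := blockHom_injective d h (congrArg Subtype.val e)
    funext i
    exact Subtype.ext (congrFun h1 i)
  · rintro ⟨w, hw⟩
    have h1 : w ∈ (blockHom d h).range := by
      rw [range_blockHom]
      exact permBlock_lexLabel_le hw
    obtain ⟨s, rfl⟩ := h1
    exact ⟨fun i => ⟨s i, (blockHom_mem_lexLabel d h nu s).1 hw i⟩, rfl⟩

/-- Elements of the refined Young subgroups preserve the blocks, so both defining conditions can be
tested in each block separately. -/
lemma stabCard_blockHom (nu' : ∀ i, (d i).Partition) (w : ∀ i, Equiv.Perm (Fin (d i))) :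
    stabCard (permBlock (lexLabel d h nu)) (permBlock (lexLabel d h nu')) (blockHom d h w) =
      ∏ i, stabCard (permBlock (rowOf (nu i))) (permBlock (rowOf (nu' i))) (w i) := by
  unfold stabCard
  rw [← Nat.card_pi]
  have hconj : ∀ s, (blockHom d h w)⁻¹ * blockHom d h s * blockHom d h w =
      blockHom d h (fun i => (w i)⁻¹ * s i * w i) := by
    intro s
    rw [← map_inv, ← map_mul, ← map_mul]
    rfl
  symm
  refine Nat.card_congr (Equiv.ofBijective (fun s : ∀ i, {r : Equiv.Perm (Fin (d i)) //
      r ∈ permBlock (rowOf (nu i)) ∧ (w i)⁻¹ * r * w i ∈ permBlock (rowOf (nu' i))} =>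
    (⟨blockHom d h fun i => (s i).1, (blockHom_mem_lexLabel d h nu _).2 fun i => (s i).2.1, by
      rw [hconj]
      exact (blockHom_mem_lexLabel d h nu' _).2 fun i => (s i).2.2⟩ :
      {r // r ∈ permBlock (lexLabel d h nu) ∧
        (blockHom d h w)⁻¹ * r * blockHom d h w ∈ permBlock (lexLabel d h nu')})) ⟨?_, ?_⟩)
  · intro s t e
    have h1 := blockHom_injective d h (congrArg Subtype.val e)
    funext i
    exact Subtype.ext (congrFun h1 i)
  · rintro ⟨r, hr, hr'⟩
    have h1 : r ∈ (blockHom d h).range := by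
      rw [range_blockHom]
      exact permBlock_lexLabel_le hr
    obtain ⟨s, rfl⟩ := h1
    rw [hconj] at hr'
    exact ⟨fun i => ⟨s i, (blockHom_mem_lexLabel d h nu s).1 hr i,
      (blockHom_mem_lexLabel d h nu' _).1 hr' i⟩, rfl⟩

lemma charPair_permChar_eq {m : ℕ} (mu nu : m.Partition) : charPair (permChar mu) (permChar nu) =
    ((Nat.card (permBlock (rowOf mu)) : ℂ) * Nat.card (permBlock (rowOf nu)))⁻¹ *
      ∑ w, (stabCard (permBlock (rowOf mu)) (permBlock (rowOf nu)) w : ℂ) := by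
  rw [permChar, permChar, charPair_indFun_indFun _ _ _ _ (isCharOn_one _) (isCharOn_one _)]
  simp only [if_pos (compat_one _ _ _), mul_one]

/-- The Gram matrix of the refinements of one block structure is a product. -/
lemma gram_lexLabel (nu' : ∀ i, (d i).Partition) :
    ((Nat.card (permBlock (lexLabel d h nu)) : ℂ) *
        Nat.card (permBlock (lexLabel d h nu')))⁻¹ *
      (∑ w : Equiv.Perm (Fin n), open scoped Classical in
        if w ∈ permBlock (blockOf d h) then
          (stabCard (permBlock (lexLabel d h nu)) (permBlock (lexLabel d h nu')) w : ℂ) else 0) =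
      ∏ i, charPair (permChar (nu i)) (permChar (nu' i)) := by
  classical
  have h1 : (∑ w : Equiv.Perm (Fin n), if w ∈ permBlock (blockOf d h) then
      (stabCard (permBlock (lexLabel d h nu)) (permBlock (lexLabel d h nu')) w : ℂ) else 0) =
      ∑ w : ∀ i, Equiv.Perm (Fin (d i)),
        ∏ i, (stabCard (permBlock (rowOf (nu i))) (permBlock (rowOf (nu' i))) (w i) : ℂ) := by
    rw [← Finset.sum_filter]
    symm
    refine Finset.sum_bij (fun w _ => blockHom d h w) ?_ ?_ ?_ ?_
    · intro w _
      rw [Finset.mem_filter, ← range_blockHom]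
      exact ⟨Finset.mem_univ _, w, rfl⟩
    · intro w _ w' _ e
      exact blockHom_injective d h e
    · intro w hw
      rw [Finset.mem_filter, ← range_blockHom] at hw
      obtain ⟨s, rfl⟩ := hw.2
      exact ⟨s, Finset.mem_univ _, rfl⟩
    · intro w _
      rw [stabCard_blockHom, Nat.cast_prod]
  rw [h1, ← prod_sum_pi (fun i w =>
    (stabCard (permBlock (rowOf (nu i))) (permBlock (rowOf (nu' i))) w : ℂ)), card_permBlock_lexLabel, card_permBlock_lexLabel, Nat.cast_prod,
    Nat.cast_prod, ← Finset.prod_mul_distrib, ← Finset.prod_inv_distrib, ← Finset.prod_mul_distrib]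
  exact Finset.prod_congr rfl fun i _ => (charPair_permChar_eq _ _).symm

end Refinement

end WildCount

end

noncomputable section

namespace WildCount

/-! ### The characters `χ_Λ^G` -/

section LeviCharacters

variable {F : Type*} [Field F] [Fintype F] {n : ℕ}

lemma charAt_injective : Function.Injective (charAt F) :=
  (Fintype.equivFin (MulChar F ℂ)).symm.injective

variable (d : Fin (Fintype.card (MulChar F ℂ)) → ℕ) (h : ∑ i, d i = n)

/-- The character `ψ_i` on the `i`-th block. -/
def blockTheta (a : Fin n) : MulChar F ℂ := charAt F (blockOf d h a)

/-- Distinct blocks carry distinct characters, so the part labelled `ψ_i` is exactly the `i`-th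
block. Blocks of size zero contribute the determinant 1 of the empty matrix. -/
lemma detChar_parabolic (p : parabolic F d h) :
    detChar (blockTheta d h) p = ∏ i, charAt F i (leviBlock d h i p).det.val := by
  classical
  rw [detChar, ← Equiv.prod_comp (Fintype.equivFin (MulChar F ℂ)).symm]
  refine Finset.prod_congr rfl fun i _ => ?_
  change charAt F i _ = _
  congr 1
  let e : Fin (d i) ≃ {a // blockTheta d h a = charAt F i} :=
    Equiv.ofBijective (fun x => ⟨blockEquiv d h ⟨i, x⟩, by rw [blockTheta, blockOf_blockEquiv]⟩)
      ⟨fun x x' e => by simpa using congrArg Subtype.val e, by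
        rintro ⟨a, ha⟩
        obtain ⟨⟨i', x⟩, rfl⟩ := (blockEquiv d h).surjective a
        rw [blockTheta, blockOf_blockEquiv] at ha
        have := charAt_injective ha
        dsimp only at this
        subst this
        exact ⟨x, rfl⟩⟩
  rw [Matrix.GeneralLinearGroup.val_det_apply]
  exact (Matrix.det_submatrix_equiv_self e _).symm

omit [Fintype F] in
lemma leviBlock_surjective {k : ℕ} (d : Fin k → ℕ) (h : ∑ i, d i = n) :
    Function.Surjective (MonoidHom.pi fun i => leviBlock (F := F) d h i) := by
  classical
  intro z
  let B : (∀ i, GL (Fin (d i)) F) → Matrix (Fin n) (Fin n) F := fun z =>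
    (Matrix.blockDiagonal' fun i => (z i).1).submatrix (blockEquiv d h).symm (blockEquiv d h).symm
  have hmul : ∀ z z', B z * B z' = B (z * z') := by
    intro z z'
    rw [Matrix.submatrix_mul_equiv, ← Matrix.blockDiagonal'_mul]
    rfl
  have hone : B 1 = 1 := by
    change (Matrix.blockDiagonal' fun i => (1 : Matrix (Fin (d i)) (Fin (d i)) F)).submatrix _ _ = 1
    have : (Matrix.blockDiagonal' fun i => (1 : Matrix (Fin (d i)) (Fin (d i)) F)) = 1 :=
      Matrix.blockDiagonal'_one
    rw [this, Matrix.submatrix_one_equiv]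
  let u : GL (Fin n) F := ⟨B z, B z⁻¹, by rw [hmul, mul_inv_cancel, hone],
    by rw [hmul, inv_mul_cancel, hone]⟩
  have hu : u ∈ parabolic F d h := by
    intro a a' haa
    obtain ⟨y, rfl⟩ := (blockEquiv d h).surjective a
    obtain ⟨y', rfl⟩ := (blockEquiv d h).surjective a'
    rw [blockOf_blockEquiv, blockOf_blockEquiv] at haa
    change (Matrix.blockDiagonal' fun i => (z i).1) ((blockEquiv d h).symm _)
      ((blockEquiv d h).symm _) = 0
    rw [Equiv.symm_apply_apply, Equiv.symm_apply_apply]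
    exact Matrix.blockDiagonal'_apply_ne _ _ _ haa.ne'
  refine ⟨⟨u, hu⟩, funext fun i => gl_ext fun x y => ?_⟩
  change (Matrix.blockDiagonal' fun i => (z i).1) ((blockEquiv d h).symm (blockEquiv d h ⟨i, x⟩))
    ((blockEquiv d h).symm (blockEquiv d h ⟨i, y⟩)) = _
  rw [Equiv.symm_apply_apply, Equiv.symm_apply_apply, Matrix.blockDiagonal'_apply_eq]

omit [Fintype F] in
lemma mem_blockGroup_lexLabel {k : ℕ} (d : Fin k → ℕ) (h : ∑ i, d i = n)
    (nu : ∀ i, (d i).Partition) (p : parabolic F d h) :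
    (p : GL (Fin n) F) ∈ blockGroup F (lexLabel d h nu) ↔
      ∀ i, leviBlock d h i p ∈ blockGroup F (rowOf (nu i)) := by
  constructor
  · intro hp i x y hxy
    refine hp ?_
    rw [lexLabel_blockEquiv, lexLabel_blockEquiv, Prod.Lex.toLex_lt_toLex]
    exact Or.inr ⟨rfl, hxy⟩
  · intro hp a a' haa
    obtain ⟨⟨i, x⟩, rfl⟩ := (blockEquiv d h).surjective a
    obtain ⟨⟨i', y⟩, rfl⟩ := (blockEquiv d h).surjective a'
    rw [lexLabel_blockEquiv, lexLabel_blockEquiv, Prod.Lex.toLex_lt_toLex] at haa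
    rcases haa with hlt | ⟨heq, hlt⟩
    · refine p.2 ?_
      rw [blockOf_blockEquiv, blockOf_blockEquiv]
      exact hlt
    · dsimp only at heq
      subst heq
      exact hp i' hlt

omit [Fintype F] in
lemma blockGroup_lexLabel_le {k : ℕ} (d : Fin k → ℕ) (h : ∑ i, d i = n)
    (nu : ∀ i, (d i).Partition) : blockGroup F (lexLabel d h nu) ≤ parabolic F d h := by
  intro p hp a a' haa
  refine hp ?_
  obtain ⟨⟨i, x⟩, rfl⟩ := (blockEquiv d h).surjective a
  obtain ⟨⟨i', y⟩, rfl⟩ := (blockEquiv d h).surjective a'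
  rw [blockOf_blockEquiv, blockOf_blockEquiv] at haa
  rw [lexLabel_blockEquiv, lexLabel_blockEquiv, Prod.Lex.toLex_lt_toLex]
  exact Or.inl haa

lemma indFun_sum {G : Type*} [Group G] [Fintype G] {ι : Type*} (s : Finset ι) (H : Subgroup G)
    (c : ι → ℂ) (ξ : ι → G → ℂ) (φ : G → ℂ) (hφ : ∀ p ∈ H, φ p = ∑ i ∈ s, c i * ξ i p) (g : G) :
    indFun H φ g = ∑ i ∈ s, c i * indFun H (ξ i) g := by
  classical
  simp only [indFun, Finset.mul_sum]
  rw [Finset.sum_comm]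
  refine Finset.sum_congr rfl fun x _ => ?_
  split_ifs with hx
  · rw [hφ _ hx, Finset.mul_sum]
    exact Finset.sum_congr rfl fun i _ => by ring
  · simp

variable [DecidableEq F]

/-- The character `χ_Λ^G`, as a combination of characters induced from parabolic subgroups. -/
def levChar (lam : ∀ i, (d i).Partition) (g : GL (Fin n) F) : ℂ :=
  ∑ nu : ∀ i, (d i).Partition,
    (∏ i, invKostka (lam i) (nu i)) * tauFun (lexLabel d h nu) (blockTheta d h) g

-- Each unipotent character is expanded in flag characters, the product is expanded over tuples of
-- partitions, and each term is induced in stages from the block triangular group that refines the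
-- parabolic.
open scoped Classical in
lemma indFun_parabolic (lam : ∀ i, (d i).Partition) (φ : GL (Fin n) F → ℂ)
    (hφ : ∀ p : parabolic F d h, φ p =
      ∏ i, charAt F i (leviBlock d h i p).det.val * uniChar F (lam i) (leviBlock d h i p))
    (g : GL (Fin n) F) : indFun (parabolic F d h) φ g = levChar d h lam g := by
  let ξ : (∀ i, (d i).Partition) → GL (Fin n) F → ℂ := fun nu g =>
    if hg : g ∈ parabolic F d h then detChar (blockTheta d h) g *
      ∏ i, flagChar F (rowOf (nu i)) (leviBlock d h i ⟨g, hg⟩) else 0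
  have hξ : ∀ nu (p : parabolic F d h), ξ nu p = detChar (blockTheta d h) p *
      ∏ i, flagChar F (rowOf (nu i)) (leviBlock d h i p) := by
    intro nu p
    exact dif_pos p.2
  have hch : IsCharOn (parabolic F d h) (detChar (blockTheta d h)) :=
    isCharOn_detChar (b := blockOf d h) fun i j e => congrArg (charAt F) e
  rw [indFun_sum Finset.univ (parabolic F d h)
    (fun nu : ∀ i, (d i).Partition => ∏ i, invKostka (lam i) (nu i)) ξ φ, levChar]
  · refine Finset.sum_congr rfl fun nu _ => ?_
    congr 1
    refine indFun_stages_pi (blockGroup_lexLabel_le d h nu)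
      (MonoidHom.pi fun i => leviBlock (F := F) d h i) (leviBlock_surjective d h)
      (fun i => blockGroup F (rowOf (nu i))) (mem_blockGroup_lexLabel d h nu) _ _ ?_ (hξ nu) g
    intro p hp y hy
    have := hch.conj (inv_mem hy) hp
    rwa [inv_inv] at this
  · intro p hp
    rw [hφ ⟨p, hp⟩, Finset.prod_mul_distrib, ← detChar_parabolic]
    simp only [uniChar]
    rw [prod_sum_pi, Finset.mul_sum]
    refine Finset.sum_congr rfl fun nu _ => ?_
    rw [hξ nu ⟨p, hp⟩, Finset.prod_mul_distrib]
    ring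

lemma finite_piTensorProduct {ι : Type*} [Fintype ι] {M : ι → Type*} [∀ i, AddCommGroup (M i)]
    [∀ i, Module ℂ (M i)] [∀ i, FiniteDimensional ℂ (M i)] :
    Module.Finite ℂ (PiTensorProduct ℂ M) := inferInstance

instance QSet.instFiniteLeviSpace (L : QSet F n) : FiniteDimensional ℂ L.LeviSpace :=
  @finite_piTensorProduct _ _ (fun i => (unipotent F (L.part i)).toSubmodule)
    (fun _ => Submodule.addCommGroup _) (fun _ => Submodule.module _)
    (fun _ => FiniteDimensional.finiteDimensional_submodule _)

lemma QSet.character_leviRep (L : QSet F n) (p : L.parabolic) :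
    L.leviRep.character p = ∏ i, charAt F i (leviBlock L.size L.sum_size i p).det.val *
      uniChar F (L.part i) (leviBlock L.size L.sum_size i p) := by
  refine (@trace_piTensorProduct_map _ _ (fun i => (unipotent F (L.part i)).toSubmodule)
    (fun i => Submodule.addCommGroup _) (fun i => Submodule.module _) _ _).trans ?_
  refine Finset.prod_congr rfl fun i _ => ?_
  rw [map_smul, smul_eq_mul]
  congr 1
  exact character_unipotentRep _ _

lemma QSet.chiG_eq (L : QSet F n) (g : GL (Fin n) F) :
    L.chiG g = levChar L.size L.sum_size L.part g := by
  classical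
  let φ : GL (Fin n) F → ℂ := fun g => if hg : g ∈ L.parabolic then L.leviRep.character ⟨g, hg⟩ else 0
  have hφ : ∀ p : L.parabolic, L.leviRep.character p = φ p := fun p => by
    simp only [φ, dif_pos p.2]
  rw [QSet.chiG, QSet.repG, character_coind_subtype _ _ φ hφ]
  exact indFun_parabolic _ _ _ φ (fun p => by rw [← hφ, L.character_leviRep]) g

/-! ### Orthonormality -/

omit [DecidableEq F] in
lemma card_blockTheta (i : Fin (Fintype.card (MulChar F ℂ))) :
    Nat.card {a // blockTheta d h a = charAt F i} = d i := by
  have e : Fin (d i) ≃ {a // blockTheta d h a = charAt F i} :=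
    Equiv.ofBijective (fun x => ⟨blockEquiv d h ⟨i, x⟩, by rw [blockTheta, blockOf_blockEquiv]⟩)
      ⟨fun x x' e => by simpa using congrArg Subtype.val e, by
        rintro ⟨a, ha⟩
        obtain ⟨⟨i', x⟩, rfl⟩ := (blockEquiv d h).surjective a
        rw [blockTheta, blockOf_blockEquiv] at ha
        have := charAt_injective ha
        dsimp only at this
        subst this
        exact ⟨x, rfl⟩⟩
  rw [← Nat.card_congr e, Nat.card_eq_fintype_card, Fintype.card_fin]

-- A permutation preserves the number of indices carrying a given character, and these numbers are
-- the block sizes.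
omit [DecidableEq F] in
lemma eq_of_blockTheta_eq {d d' : Fin (Fintype.card (MulChar F ℂ)) → ℕ} {h : ∑ i, d i = n}
    {h' : ∑ i, d' i = n} (w : Equiv.Perm (Fin n))
    (e : blockTheta (F := F) d h = blockTheta d' h' ∘ w.symm) : d = d' := by
  funext i
  rw [← card_blockTheta d h, ← card_blockTheta d' h']
  refine Nat.card_congr (w.symm.subtypeEquiv fun a => ?_)
  rw [e]
  rfl

omit [DecidableEq F] in
lemma blockTheta_of_lexLabel (nu : ∀ i, (d i).Partition) (a a' : Fin n)
    (e : lexLabel d h nu a = lexLabel d h nu a') :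
    blockTheta (F := F) d h a = blockTheta d h a' :=
  congrArg (charAt F) (blockOf_eq_of_lexLabel_eq d h nu e)

/-- No permutation carries one tuple of characters to the other, so every term of the intertwining
number vanishes. -/
lemma charPair_levChar_of_ne {d d' : Fin (Fintype.card (MulChar F ℂ)) → ℕ} {h : ∑ i, d i = n}
    {h' : ∑ i, d' i = n} (hne : d ≠ d') (lam : ∀ i, (d i).Partition)
    (lam' : ∀ i, (d' i).Partition) :
    charPair (levChar (F := F) d h lam) (levChar d' h' lam') = 0 := by
  unfold levChar
  rw [charPair_sum_left]
  refine Finset.sum_eq_zero fun nu _ => ?_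
  rw [charPair_sum_right, Finset.sum_eq_zero, mul_zero]
  intro nu' _
  rw [charPair_tauFun (lexLabel_monotone d h nu) (lexLabel_monotone d' h' nu')
    (blockTheta_of_lexLabel d h nu) (blockTheta_of_lexLabel d' h' nu'), Finset.sum_eq_zero,
    mul_zero, mul_zero]
  intro w _
  rw [if_neg (fun e => hne (eq_of_blockTheta_eq w e)), mul_zero]

omit [DecidableEq F] in
lemma blockTheta_eq_comp_iff (w : Equiv.Perm (Fin n)) :
    blockTheta (F := F) d h = blockTheta d h ∘ w.symm ↔ w ∈ permBlock (blockOf d h) := by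
  constructor
  · intro e a
    have := congrFun e (w a)
    rw [Function.comp_apply, Equiv.symm_apply_apply] at this
    exact charAt_injective this
  · intro hw
    funext a
    have := hw (w.symm a)
    rw [Equiv.apply_symm_apply] at this
    exact congrArg (charAt F) this

/-- For equal block sizes only permutations preserving the blocks contribute. The Gram matrix is
then a product of Gram matrices of permutation characters, and orthonormality follows factor by
factor. -/
lemma charPair_levChar (lam lam' : ∀ i, (d i).Partition) :
    charPair (levChar (F := F) d h lam) (levChar d h lam') = if lam = lam' then 1 else 0 := by
  classical
  unfold levChar
  rw [charPair_sum_left]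
  have h1 : ∀ nu nu' : ∀ i, (d i).Partition,
      charPair (tauFun (lexLabel d h nu) (blockTheta (F := F) d h))
        (tauFun (lexLabel d h nu') (blockTheta d h)) =
      ∏ i, charPair (permChar (nu i)) (permChar (nu' i)) := by
    intro nu nu'
    rw [charPair_tauFun (lexLabel_monotone d h nu) (lexLabel_monotone d h nu')
      (blockTheta_of_lexLabel d h nu) (blockTheta_of_lexLabel d h nu'), ← gram_lexLabel d h nu']
    congr 1
    refine Finset.sum_congr rfl fun w _ => ?_
    simp only [blockTheta_eq_comp_iff, mul_ite, mul_one, mul_zero]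
  have h2 : ∀ nu : ∀ i, (d i).Partition, (∏ i, invKostka (lam i) (nu i)) *
      charPair (tauFun (lexLabel d h nu) (blockTheta (F := F) d h)) (fun g =>
        ∑ nu' : ∀ i, (d i).Partition, (∏ i, invKostka (lam' i) (nu' i)) *
          tauFun (lexLabel d h nu') (blockTheta d h) g) =
      ∏ i, ∑ x', invKostka (lam i) (nu i) * invKostka (lam' i) x' *
        charPair (permChar (nu i)) (permChar x') := by
    intro nu
    rw [charPair_sum_right, prod_sum_pi, Finset.mul_sum]
    refine Finset.sum_congr rfl fun nu' _ => ?_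
    rw [h1, Finset.prod_mul_distrib, Finset.prod_mul_distrib, mul_assoc]
  rw [Finset.sum_congr rfl fun nu _ => h2 nu, ← prod_sum_pi (fun i x =>
    ∑ x', invKostka (lam i) x * invKostka (lam' i) x' * charPair (permChar x) (permChar x'))]
  simp only [sum_invKostka_gram]
  split_ifs with hl
  · exact Finset.prod_eq_one fun i _ => if_pos (congrFun hl i)
  · obtain ⟨i, hi⟩ := Function.ne_iff.1 hl
    exact Finset.prod_eq_zero (Finset.mem_univ i) (if_neg hi)

/-- The parameters `Λ`, sorted by the sizes of the partitions. -/
def QSet.equivSigma (F : Type*) [Field F] [Fintype F] (n : ℕ) : QSet F n ≃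
    Σ d : {d : Fin (Fintype.card (MulChar F ℂ)) → ℕ // ∑ i, d i = n}, ∀ i, (d.1 i).Partition where
  toFun L := ⟨⟨L.size, L.sum_size⟩, L.part⟩
  invFun x := ⟨fun psi => ⟨x.1.1 (Fintype.equivFin _ psi), x.2 (Fintype.equivFin _ psi)⟩,
    (Equiv.sum_comp (Fintype.equivFin (MulChar F ℂ)) x.1.1).trans x.1.2⟩
  left_inv L := by
    apply Subtype.ext
    funext psi
    change L.1 ((Fintype.equivFin _).symm (Fintype.equivFin _ psi)) = L.1 psi
    rw [Equiv.symm_apply_apply]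
  right_inv x := by
    obtain ⟨⟨d, hd⟩, lam⟩ := x
    -- The composite of the numbering and its inverse is generalized to a function equal to the
    -- identity, which can be substituted without transporting the dependent partitions.
    have key : ∀ f : Fin (Fintype.card (MulChar F ℂ)) → Fin (Fintype.card (MulChar F ℂ)),
        f = id → ∀ hf : ∑ i, d (f i) = n,
        (⟨⟨fun i => d (f i), hf⟩, fun i => lam (f i)⟩ :
          Σ d : {d : Fin (Fintype.card (MulChar F ℂ)) → ℕ // ∑ i, d i = n},
            ∀ i, (d.1 i).Partition) = ⟨⟨d, hd⟩, lam⟩ := by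
      rintro f rfl hf
      rfl
    exact key (fun i => Fintype.equivFin _ ((Fintype.equivFin _).symm i))
      (funext fun i => Equiv.apply_symm_apply _ i) _

lemma QSet.charPair_chiG (L L' : QSet F n) :
    charPair L.chiG L'.chiG = open scoped Classical in if L = L' then 1 else 0 := by
  classical
  have key : ∀ x x' : Σ d : {d : Fin (Fintype.card (MulChar F ℂ)) → ℕ // ∑ i, d i = n},
      ∀ i, (d.1 i).Partition, charPair (levChar (F := F) x.1.1 x.1.2 x.2)
        (levChar x'.1.1 x'.1.2 x'.2) = if x = x' then 1 else 0 := by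
    rintro ⟨⟨d, hd⟩, lam⟩ ⟨⟨d', hd'⟩, lam'⟩
    by_cases e : d = d'
    · subst e
      rw [charPair_levChar]
      simp
    · rw [charPair_levChar_of_ne e, if_neg]
      intro e'
      exact e (congrArg (fun x => x.1.1) e')
  have h1 := key (QSet.equivSigma F n L) (QSet.equivSigma F n L')
  rw [show L.chiG = levChar L.size L.sum_size L.part from funext L.chiG_eq,
    show L'.chiG = levChar L'.size L'.sum_size L'.part from funext L'.chiG_eq]
  refine h1.trans ?_
  simp only [EmbeddingLike.apply_eq_iff_eq]

end LeviCharacters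

end WildCount

end

noncomputable section

namespace WildCount

/-! ### Averages over the kernels of the block determinants -/

section DetGroup

variable {F : Type*} [Field F] {n : ℕ} {α : Type*} [LinearOrder α]

/-- The determinant of one diagonal block. -/
def blockDet (b : Fin n → α) (v : α) (g : GL (Fin n) F) : F := (g.1.toSquareBlock b v).det

lemma prod_blockDet {b : Fin n → α} {g : GL (Fin n) F} (hg : g ∈ blockGroup F b) :
    ∏ v ∈ Finset.univ.image b, blockDet b v g = g.1.det :=
  (Matrix.BlockTriangular.det hg).symm

lemma blockDet_ne_zero {b : Fin n → α} {g : GL (Fin n) F} (hg : g ∈ blockGroup F b) {v : α}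
    (hv : v ∈ Finset.univ.image b) : blockDet b v g ≠ 0 := by
  intro h0
  have h1 := prod_blockDet hg
  rw [Finset.prod_eq_zero hv h0] at h1
  have h2 : IsUnit g.1.det := (Matrix.isUnit_iff_isUnit_det _).1 g.isUnit
  exact h2.ne_zero h1.symm

lemma blockDet_mul {b : Fin n → α} (v : α) {g g' : GL (Fin n) F} (hg : g ∈ blockGroup F b)
    (hg' : g' ∈ blockGroup F b) : blockDet b v (g * g') = blockDet b v g * blockDet b v g' :=
  det_toSquareBlock_mul (b := b) (θ := b) (fun _ _ e => e) v hg hg'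

lemma blockDet_one (b : Fin n → α) (v : α) : blockDet b v (1 : GL (Fin n) F) = 1 := by
  have : ((1 : GL (Fin n) F).1.toSquareBlock b v) = 1 := by
    rw [Matrix.toSquareBlock, Matrix.toSquareBlockProp]
    exact Matrix.submatrix_one _ Subtype.val_injective
  rw [blockDet, this, Matrix.det_one]

/-- Block triangular matrices all of whose diagonal blocks have determinant one. -/
def detGroup (F : Type*) [Field F] {n : ℕ} {α : Type*} [LinearOrder α] (b : Fin n → α) :
    Subgroup (GL (Fin n) F) where
  carrier := {g | g ∈ blockGroup F b ∧ ∀ v ∈ Finset.univ.image b, blockDet b v g = 1}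
  mul_mem' {g g'} hg hg' := ⟨mul_mem hg.1 hg'.1, fun v hv => by
    rw [blockDet_mul v hg.1 hg'.1, hg.2 v hv, hg'.2 v hv, one_mul]⟩
  one_mem' := ⟨one_mem _, fun v _ => blockDet_one b v⟩
  inv_mem' {g} hg := ⟨inv_mem hg.1, fun v hv => by
    have h1 := blockDet_mul v hg.1 (inv_mem hg.1)
    rw [mul_inv_cancel, blockDet_one, hg.2 v hv, one_mul] at h1
    exact h1.symm⟩

variable [Fintype F]

/-- On block triangular matrices, `detChar` is a product over the blocks. -/
lemma detChar_eq_prod {b : Fin n → α} (η : α → MulChar F ℂ) {g : GL (Fin n) F}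
    (hg : g ∈ blockGroup F b) :
    detChar (η ∘ b) g = ∏ v ∈ Finset.univ.image b, η v (blockDet b v g) := by
  classical
  have h1 : ∀ ψ : MulChar F ℂ, (g.1.toSquareBlock (η ∘ b) ψ).det =
      ∏ v ∈ (Finset.univ.image b).filter (fun v => η v = ψ), blockDet b v g := by
    intro ψ
    let c : {a // (η ∘ b) a = ψ} → α := fun a => b a
    have hc : (g.1.toSquareBlock (η ∘ b) ψ).BlockTriangular c := fun i j hij => hg hij
    rw [hc.det]
    have h2 : Finset.univ.image c = (Finset.univ.image b).filter (fun v => η v = ψ) := by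
      ext v
      simp only [Finset.mem_image, Finset.mem_univ, true_and, Finset.mem_filter, Subtype.exists, c]
      constructor
      · rintro ⟨a, ha, rfl⟩
        exact ⟨⟨a, rfl⟩, ha⟩
      · rintro ⟨⟨a, rfl⟩, ha⟩
        exact ⟨a, ha, rfl⟩
    rw [h2]
    refine Finset.prod_congr rfl fun v hv => ?_
    have hv' := (Finset.mem_filter.1 hv).2
    let e : {a // b a = v} ≃ {x // c x = v} :=
      ⟨fun a => ⟨⟨a.1, by rw [Function.comp_apply, a.2, hv']⟩, a.2⟩, fun x => ⟨x.1.1, x.2⟩,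
        fun _ => rfl, fun _ => rfl⟩
    exact (Matrix.det_submatrix_equiv_self e _).symm
  rw [detChar]
  simp only [h1, map_prod]
  rw [← Finset.prod_fiberwise (Finset.univ.image b) η]
  refine Finset.prod_congr rfl fun ψ _ => Finset.prod_congr rfl fun v hv => ?_
  rw [(Finset.mem_filter.1 hv).2]

open scoped Classical in
/-- The tuples of characters that are constant on the blocks. -/
def constLabels (F : Type*) [Field F] [Fintype F] {n : ℕ} {α : Type*} (b : Fin n → α) :
    Finset (Fin n → MulChar F ℂ) :=
  Finset.univ.filter fun θ => ∀ a a', b a = b a' → θ a = θ a'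

omit [LinearOrder α] in
lemma mem_constLabels {b : Fin n → α} {θ : Fin n → MulChar F ℂ} :
    θ ∈ constLabels F b ↔ ∀ a a', b a = b a' → θ a = θ a' := by
  simp [constLabels]

omit [LinearOrder α] in
lemma exists_eq_comp {b : Fin n → α} {θ : Fin n → MulChar F ℂ} (hθ : θ ∈ constLabels F b) :
    ∃ η : α → MulChar F ℂ, θ = η ∘ b := by
  refine ⟨Function.extend b θ 1, funext fun a => ?_⟩
  exact (Function.FactorsThrough.extend_apply (fun a a' e => mem_constLabels.1 hθ a a' e) _ a).symm

-- Orthogonality of characters: if some block determinant is not 1, a character nontrivial at that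
-- value exists, and multiplying all tuples by it in that block permutes them while scaling the sum.
open scoped Classical in
lemma sum_detChar {b : Fin n → α} {g : GL (Fin n) F} (hg : g ∈ blockGroup F b) :
    ∑ θ ∈ constLabels F b, detChar θ g =
      if g ∈ detGroup F b then ((constLabels F b).card : ℂ) else 0 := by
  split_ifs with h
  · rw [Finset.sum_congr rfl (g := fun _ => (1 : ℂ))]
    · simp
    · intro θ hθ
      obtain ⟨η, rfl⟩ := exists_eq_comp hθ
      rw [detChar_eq_prod η hg]
      exact Finset.prod_eq_one fun v hv => by rw [h.2 v hv, map_one]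
  · have h1 : ∃ v ∈ Finset.univ.image b, blockDet b v g ≠ 1 := by
      by_contra hcon
      push Not at hcon
      exact h ⟨hg, hcon⟩
    obtain ⟨v, hv, hne⟩ := h1
    obtain ⟨ψ, hψ⟩ := MulChar.exists_apply_ne_one_of_hasEnoughRootsOfUnity F ℂ hne
    let η₀ : α → MulChar F ℂ := fun v' => if v' = v then ψ else 1
    have hη₀ : detChar (η₀ ∘ b) g = ψ (blockDet b v g) := by
      rw [detChar_eq_prod η₀ hg, Finset.prod_eq_single_of_mem v hv]
      · simp [η₀]
      · intro v' hv' hne'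
        simp only [η₀, if_neg hne']
        exact MulChar.one_apply (blockDet_ne_zero hg hv').isUnit
    have hmul : ∀ θ ∈ constLabels F b,
        detChar ((η₀ ∘ b) * θ) g = ψ (blockDet b v g) * detChar θ g := by
      intro θ hθ
      obtain ⟨η, rfl⟩ := exists_eq_comp hθ
      have : (η₀ ∘ b) * (η ∘ b) = (η₀ * η) ∘ b := rfl
      rw [this, detChar_eq_prod _ hg, detChar_eq_prod _ hg, ← hη₀, detChar_eq_prod _ hg,
        ← Finset.prod_mul_distrib]
      rfl
    have hshift : ∑ θ ∈ constLabels F b, detChar θ g =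
        ψ (blockDet b v g) * ∑ θ ∈ constLabels F b, detChar θ g := by
      rw [Finset.mul_sum]
      symm
      refine Finset.sum_equiv (Equiv.mulLeft (η₀ ∘ b)) ?_ ?_
      · intro θ
        rw [mem_constLabels, mem_constLabels]
        constructor
        · intro hθ a a' e
          simp [hθ a a' e, e]
        · intro hθ a a' e
          have := hθ a a' e
          simpa [e] using this
      · intro θ hθ
        exact (hmul θ hθ).symm
    have h2 : (1 - ψ (blockDet b v g)) * ∑ θ ∈ constLabels F b, detChar θ g = 0 := by
      rw [sub_mul, one_mul, ← hshift, sub_self]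
    exact (mul_eq_zero.1 h2).resolve_left (sub_ne_zero.2 (Ne.symm hψ))

variable [DecidableEq F]

open scoped Classical in
lemma sum_detChar_eq_zero {b : Fin n → α} {θ : Fin n → MulChar F ℂ}
    (hθ : ∀ a a', b a = b a' → θ a = θ a') (hne : θ ≠ 1) :
    (∑ g : GL (Fin n) F, if g ∈ blockGroup F b then detChar θ g else 0) = 0 := by
  obtain ⟨a, ha⟩ := Function.ne_iff.1 hne
  obtain ⟨x, hx⟩ : ∃ x : Fˣ, θ a x ≠ 1 := by
    by_contra hcon
    push Not at hcon
    exact ha (MulChar.ext fun x => by rw [hcon x, Pi.one_apply, MulChar.one_apply_coe])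
  have hch := isCharOn_detChar (F := F) hθ
  let t := torusGL F n (Pi.mulSingle a x)
  have ht : t ∈ blockGroup F b := torusGL_mem_blockGroup _
  have hdt : detChar θ t = θ a x := by
    rw [detChar_torusGL, Finset.prod_eq_single a]
    · simp
    · intro i _ hi
      simp [Pi.mulSingle_eq_of_ne hi]
    · simp
  have hshift : (∑ g : GL (Fin n) F, if g ∈ blockGroup F b then detChar θ g else 0) =
      θ a x * ∑ g : GL (Fin n) F, if g ∈ blockGroup F b then detChar θ g else 0 := by
    rw [Finset.mul_sum]
    symm
    refine Fintype.sum_equiv (Equiv.mulLeft t) _ _ fun g => ?_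
    simp only [Equiv.coe_mulLeft, (blockGroup F b).mul_mem_cancel_left ht, mul_ite, mul_zero]
    split_ifs with hg
    · rw [hch.mul _ ht _ hg, hdt]
    · rfl
  have h2 : (1 - θ a x) *
      (∑ g : GL (Fin n) F, if g ∈ blockGroup F b then detChar θ g else 0) = 0 := by
    rw [sub_mul, one_mul, ← hshift, sub_self]
  exact (mul_eq_zero.1 h2).resolve_left (sub_ne_zero.2 (Ne.symm hx))

omit [DecidableEq F] in
lemma detChar_one {b : Fin n → α} {g : GL (Fin n) F} (hg : g ∈ blockGroup F b) :
    detChar 1 g = 1 := by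
  have : (1 : Fin n → MulChar F ℂ) = (fun _ : α => (1 : MulChar F ℂ)) ∘ b := rfl
  rw [this, detChar_eq_prod _ hg]
  exact Finset.prod_eq_one fun v hv => MulChar.one_apply (blockDet_ne_zero hg hv).isUnit

variable {β : Type*} [LinearOrder β]

/-- Sum all `detChar θ` over the finer group in two orders: orthogonality in `θ` gives the left
side, while orthogonality over the group leaves only the trivial `θ`. -/
lemma card_constLabels_mul {b : Fin n → α} {b₁ : Fin n → β}
    (hle : blockGroup F b₁ ≤ blockGroup F b) (href : ∀ a a', b₁ a = b₁ a' → b a = b a') :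
    ((constLabels F b).card : ℂ) * Nat.card (blockGroup F b₁ ⊓ detGroup F b : Subgroup _) =
      Nat.card (blockGroup F b₁) := by
  classical
  have h1 : (∑ g : GL (Fin n) F, if g ∈ blockGroup F b₁ then
      ∑ θ ∈ constLabels F b, detChar θ g else 0) =
      ((constLabels F b).card : ℂ) * Nat.card (blockGroup F b₁ ⊓ detGroup F b : Subgroup _) := by
    have h2 := sum_ite_mem_const (blockGroup F b₁ ⊓ detGroup F b) ((constLabels F b).card : ℂ)
    rw [smul_eq_mul, mul_comm] at h2
    rw [← h2]
    refine Finset.sum_congr rfl fun g _ => ?_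
    by_cases hg : g ∈ blockGroup F b₁
    · rw [if_pos hg, sum_detChar (hle hg)]
      simp only [Subgroup.mem_inf, hg, true_and]
    · rw [if_neg hg, if_neg (fun h' => hg h'.1)]
  rw [← h1]
  have h3 : (∑ g : GL (Fin n) F, if g ∈ blockGroup F b₁ then
      ∑ θ ∈ constLabels F b, detChar θ g else 0) = ∑ θ ∈ constLabels F b,
      ∑ g : GL (Fin n) F, if g ∈ blockGroup F b₁ then detChar θ g else 0 := by
    rw [Finset.sum_comm]
    refine Finset.sum_congr rfl fun g _ => ?_
    split_ifs
    · rfl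
    · simp
  rw [h3, Finset.sum_eq_single_of_mem 1 (mem_constLabels.2 fun _ _ _ => rfl)]
  · have h4 := sum_ite_mem_const (blockGroup F b₁) (1 : ℂ)
    rw [smul_eq_mul, mul_one] at h4
    rw [← h4]
    refine Finset.sum_congr rfl fun g _ => ?_
    split_ifs with hg
    · exact detChar_one hg
    · rfl
  · intro θ hθ hne
    exact sum_detChar_eq_zero (fun a a' e => mem_constLabels.1 hθ a a' (href a a' e)) hne

open scoped Classical in
/-- Averages of class functions over a determinant group are sums of multiplicities in
principal series. -/
lemma avg_detGroup {b : Fin n → α} {b₁ : Fin n → β}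
    (hle : blockGroup F b₁ ≤ blockGroup F b) (href : ∀ a a', b₁ a = b₁ a' → b a = b a')
    {χ : GL (Fin n) F → ℂ} (hχ : ∀ x g, χ (x * g * x⁻¹) = χ g) :
    (Nat.card (blockGroup F b₁ ⊓ detGroup F b : Subgroup _) : ℂ)⁻¹ *
      (∑ g : GL (Fin n) F, if g ∈ blockGroup F b₁ ⊓ detGroup F b then χ g else 0) =
      ∑ θ ∈ constLabels F b, charPair (tauFun b₁ θ) χ := by
  simp only [charPair_indFun _ _ _ hχ]
  rw [← Finset.mul_sum, Finset.sum_comm]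
  have h1 : ∀ g : GL (Fin n) F, (∑ θ ∈ constLabels F b,
      if g ∈ blockGroup F b₁ then detChar θ g * χ g⁻¹ else 0) =
      (constLabels F b).card * (if g ∈ blockGroup F b₁ ⊓ detGroup F b then χ g⁻¹ else 0) := by
    intro g
    by_cases hg : g ∈ blockGroup F b₁
    · simp only [if_pos hg]
      rw [← Finset.sum_mul, sum_detChar (hle hg)]
      simp only [Subgroup.mem_inf, hg, true_and]
      split_ifs <;> simp
    · simp only [Subgroup.mem_inf, hg, false_and, if_false]
      simp
  simp only [h1]
  rw [← Finset.mul_sum, ← card_constLabels_mul hle href]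
  have h2 : (∑ g : GL (Fin n) F, if g ∈ blockGroup F b₁ ⊓ detGroup F b then χ g⁻¹ else 0) =
      ∑ g : GL (Fin n) F, if g ∈ blockGroup F b₁ ⊓ detGroup F b then χ g else 0 := by
    refine Fintype.sum_equiv (Equiv.inv _) _ _ fun g => ?_
    simp only [Equiv.inv_apply, inv_mem_iff]
  rw [h2]
  have hX : ((constLabels F b).card : ℂ) ≠ 0 := by
    rw [Nat.cast_ne_zero, ← Nat.pos_iff_ne_zero, Finset.card_pos]
    exact ⟨1, mem_constLabels.2 fun _ _ _ => rfl⟩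
  rw [mul_inv]
  field_simp

end DetGroup

end WildCount

end

noncomputable section

namespace WildCount

/-! ### Adjacent transpositions -/

section AdjacentSwap

variable {n : ℕ}

/-- The labelling that identifies `k` and `k + 1`. -/
def mergeIdx (k : ℕ) (a : Fin n) : ℕ := if (a : ℕ) ≤ k then a else a - 1

lemma mergeIdx_monotone (k : ℕ) : Monotone (mergeIdx (n := n) k) := by
  intro a a' haa
  have := Fin.le_def.1 haa
  unfold mergeIdx
  split_ifs <;> omega

lemma mergeIdx_eq_iff {k : ℕ} {a a' : Fin n} : mergeIdx k a = mergeIdx k a' ↔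
    a = a' ∨ ((a : ℕ) = k ∧ (a' : ℕ) = k + 1) ∨ ((a' : ℕ) = k ∧ (a : ℕ) = k + 1) := by
  rw [Fin.ext_iff]
  unfold mergeIdx
  split_ifs <;> omega

variable {k : ℕ} (hk : k + 1 < n)

/-- The transposition of `k` and `k + 1`. -/
def adjSwap : Equiv.Perm (Fin n) := Equiv.swap ⟨k, k.lt_succ_self.trans hk⟩ ⟨k + 1, hk⟩

lemma adjSwap_ne_one : adjSwap hk ≠ 1 := by
  intro e
  rw [adjSwap, Equiv.swap_eq_one_iff, Fin.mk.injEq] at e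
  omega

lemma adjSwap_mul_self : adjSwap hk * adjSwap hk = 1 := Equiv.swap_mul_self _ _

lemma mem_permBlock_mergeIdx (s : Equiv.Perm (Fin n)) :
    s ∈ permBlock (mergeIdx k) ↔ s = 1 ∨ s = adjSwap hk := by
  constructor
  · intro hs
    have h1 : ∀ a : Fin n, (a : ℕ) ≠ k → (a : ℕ) ≠ k + 1 → s a = a := by
      intro a h1 h2
      have := mergeIdx_eq_iff.1 (hs a)
      tauto
    have h2 := mergeIdx_eq_iff.1 (hs ⟨k, k.lt_succ_self.trans hk⟩)
    have h3 := mergeIdx_eq_iff.1 (hs ⟨k + 1, hk⟩)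
    by_cases h4 : s ⟨k, k.lt_succ_self.trans hk⟩ = ⟨k, k.lt_succ_self.trans hk⟩
    · left
      ext a
      by_cases ha : (a : ℕ) = k
      · have : a = ⟨k, k.lt_succ_self.trans hk⟩ := Fin.ext ha
        rw [this, h4]
        rfl
      by_cases ha' : (a : ℕ) = k + 1
      · have : a = ⟨k + 1, hk⟩ := Fin.ext ha'
        rw [this, Equiv.Perm.one_apply]
        rcases h3 with h3 | h3 | h3
        · rw [h3]
        · have : s ⟨k + 1, hk⟩ = ⟨k, k.lt_succ_self.trans hk⟩ := Fin.ext h3.1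
          rw [← h4] at this
          have := congrArg Fin.val (s.injective this)
          simp at this
        · simp at h3
      · rw [h1 a ha ha']
        rfl
    · right
      have e1 : s ⟨k, k.lt_succ_self.trans hk⟩ = ⟨k + 1, hk⟩ := by
        rcases h2 with h2 | h2 | h2
        · exact absurd h2 h4
        · simp at h2
        · exact Fin.ext h2.2
      have e2 : s ⟨k + 1, hk⟩ = ⟨k, k.lt_succ_self.trans hk⟩ := by
        rcases h3 with h3 | h3 | h3
        · rw [← e1] at h3
          have := congrArg Fin.val (s.injective h3)
          rw [e1] at this
          simp at this
        · exact Fin.ext h3.1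
        · simp at h3
      ext a
      by_cases ha : (a : ℕ) = k
      · have : a = ⟨k, k.lt_succ_self.trans hk⟩ := Fin.ext ha
        rw [this, e1, adjSwap, Equiv.swap_apply_left]
      by_cases ha' : (a : ℕ) = k + 1
      · have : a = ⟨k + 1, hk⟩ := Fin.ext ha'
        rw [this, e2, adjSwap, Equiv.swap_apply_right]
      · rw [h1 a ha ha', adjSwap, Equiv.swap_apply_of_ne_of_ne]
        · exact fun e => ha (congrArg Fin.val e)
        · exact fun e => ha' (congrArg Fin.val e)
  · rintro (rfl | rfl)
    · exact one_mem _
    · intro a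
      rw [mergeIdx_eq_iff]
      by_cases ha : (a : ℕ) = k
      · have : a = ⟨k, k.lt_succ_self.trans hk⟩ := Fin.ext ha
        subst this
        rw [adjSwap, Equiv.swap_apply_left]
        simp
      by_cases ha' : (a : ℕ) = k + 1
      · have : a = ⟨k + 1, hk⟩ := Fin.ext ha'
        subst this
        rw [adjSwap, Equiv.swap_apply_right]
        simp
      · left
        rw [adjSwap, Equiv.swap_apply_of_ne_of_ne]
        · exact fun e => ha (congrArg Fin.val e)
        · exact fun e => ha' (congrArg Fin.val e)

include hk in
lemma card_permBlock_mergeIdx : Nat.card (permBlock (n := n) (mergeIdx k)) = 2 := by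
  classical
  rw [Nat.card_eq_fintype_card, Fintype.card_subtype]
  have : (Finset.univ.filter fun s : Equiv.Perm (Fin n) => s ∈ permBlock (mergeIdx k)) =
      {1, adjSwap hk} := by
    ext s
    simp [mem_permBlock_mergeIdx hk]
  rw [this, Finset.card_pair (adjSwap_ne_one hk).symm]

-- The conjugated group w ⟨s⟩ w⁻¹ has two elements and meets `W` in one or both. The second summand
-- is the one that later produces the value of an induced character at `s`.
open scoped Classical in
lemma stabCard_mergeIdx (W : Subgroup (Equiv.Perm (Fin n))) (w : Equiv.Perm (Fin n)) :
    stabCard W (permBlock (mergeIdx k)) w =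
      1 + if w * adjSwap hk * w⁻¹ ∈ W then 1 else 0 := by
  rw [stabCard, Nat.card_eq_fintype_card, Fintype.card_subtype]
  have h0 : w * adjSwap hk * w⁻¹ ≠ 1 := by
    intro e
    apply adjSwap_ne_one hk
    have : adjSwap hk = w⁻¹ * (w * adjSwap hk * w⁻¹) * w := by group
    rw [this, e]
    group
  have h1 : ∀ r, w⁻¹ * r * w ∈ permBlock (mergeIdx k) ↔ r = 1 ∨ r = w * adjSwap hk * w⁻¹ := by
    intro r
    rw [mem_permBlock_mergeIdx hk]
    constructor
    · rintro (e | e)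
      · left
        have : r = w * (w⁻¹ * r * w) * w⁻¹ := by group
        rw [this, e]
        group
      · right
        rw [← e]
        group
    · rintro (rfl | rfl)
      · left; group
      · right; group
  simp only [h1]
  split_ifs with hW
  · have : (Finset.univ.filter fun r => r ∈ W ∧ (r = 1 ∨ r = w * adjSwap hk * w⁻¹)) =
        {1, w * adjSwap hk * w⁻¹} := by
      ext r
      simp only [Finset.mem_filter, Finset.mem_univ, true_and, Finset.mem_insert,
        Finset.mem_singleton]
      constructor
      · exact fun hr => hr.2
      · rintro (rfl | rfl)
        · exact ⟨one_mem _, Or.inl rfl⟩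
        · exact ⟨hW, Or.inr rfl⟩
    rw [this, Finset.card_pair h0.symm]
  · have : (Finset.univ.filter fun r => r ∈ W ∧ (r = 1 ∨ r = w * adjSwap hk * w⁻¹)) = {1} := by
      ext r
      simp only [Finset.mem_filter, Finset.mem_univ, true_and, Finset.mem_singleton]
      constructor
      · rintro ⟨hr, rfl | rfl⟩
        · rfl
        · exact absurd hr hW
      · rintro rfl
        exact ⟨one_mem _, Or.inl rfl⟩
    rw [this, Finset.card_singleton]

end AdjacentSwap

/-! ### Multiplicities of `χ_Λ^G` in principal series -/

section Multiplicities

variable {n : ℕ}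

/-- The character of `𝔖_n` induced from the product of the characters `χ_{λ_i}^𝔖`. -/
def symInd {k : ℕ} (d : Fin k → ℕ) (h : ∑ i, d i = n) (lam : ∀ i, (d i).Partition)
    (s : Equiv.Perm (Fin n)) : ℂ :=
  ∑ nu : ∀ i, (d i).Partition,
    (∏ i, invKostka (lam i) (nu i)) * indFun (permBlock (lexLabel d h nu)) (fun _ => 1) s

lemma symInd_conj {k : ℕ} (d : Fin k → ℕ) (h : ∑ i, d i = n) (lam : ∀ i, (d i).Partition)
    (x s : Equiv.Perm (Fin n)) : symInd d h lam (x * s * x⁻¹) = symInd d h lam s := by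
  simp only [symInd, indFun_conj]

lemma symInd_one {k : ℕ} (d : Fin k → ℕ) (h : ∑ i, d i = n) (lam : ∀ i, (d i).Partition) :
    symInd d h lam 1 = (n.factorial : ℂ) / (∏ i, (d i).factorial : ℕ) *
      ∏ i, symChar (lam i) 1 := by
  simp only [symChar_eq_sum]
  rw [prod_sum_pi, Finset.mul_sum, symInd]
  refine Finset.sum_congr rfl fun nu _ => ?_
  rw [indFun_one _ _ rfl, card_permBlock_lexLabel, Finset.prod_mul_distrib]
  simp only [permChar_one, Finset.prod_div_distrib]
  rw [Nat.card_eq_fintype_card, Fintype.card_perm, Fintype.card_fin, Nat.cast_prod, Nat.cast_prod]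
  have h1 : (∏ i, ((d i).factorial : ℂ)) ≠ 0 :=
    Finset.prod_ne_zero_iff.2 fun i _ => by exact_mod_cast (d i).factorial_ne_zero
  have h2 : (∏ i, (Nat.card (permBlock (rowOf (nu i))) : ℂ)) ≠ 0 :=
    Finset.prod_ne_zero_iff.2 fun i _ => card_subgroup_ne_zero _
  field_simp

/-- Expand the characters of the factors in permutation characters and induce in stages. Only the
values of `φ` on the product of symmetric groups matter. -/
lemma symInd_eq_indFun {k : ℕ} (d : Fin k → ℕ) (h : ∑ i, d i = n) (lam : ∀ i, (d i).Partition)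
    (φ : Equiv.Perm (Fin n) → ℂ)
    (hφ : ∀ w, φ (blockHom d h w) = ∏ i, symChar (lam i) (w i)) (s : Equiv.Perm (Fin n)) :
    symInd d h lam s = indFun (blockHom d h).range φ s := by
  classical
  let E := (MonoidHom.ofInjective (blockHom_injective d h)).symm
  have hE : ∀ w (hw : blockHom d h w ∈ (blockHom d h).range), E ⟨blockHom d h w, hw⟩ = w := by
    intro w hw
    exact (MonoidHom.ofInjective (blockHom_injective d h)).symm_apply_apply w
  let ξ : (∀ i, (d i).Partition) → Equiv.Perm (Fin n) → ℂ := fun nu g =>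
    if hg : g ∈ (blockHom d h).range then ∏ i, permChar (nu i) (E ⟨g, hg⟩ i) else 0
  have hξ : ∀ nu (p : (blockHom d h).range), ξ nu p = 1 * ∏ i, permChar (nu i) (E p i) := by
    intro nu p
    rw [one_mul]
    exact dif_pos p.2
  rw [indFun_sum Finset.univ (blockHom d h).range
    (fun nu : ∀ i, (d i).Partition => ∏ i, invKostka (lam i) (nu i)) ξ φ, symInd]
  · refine Finset.sum_congr rfl fun nu _ => ?_
    congr 1
    symm
    refine indFun_stages_pi ?_ E.toMonoidHom E.surjective
      (fun i => permBlock (rowOf (nu i))) ?_ _ _ (fun _ _ _ _ => rfl) (hξ nu) s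
    · rw [range_blockHom]
      exact permBlock_lexLabel_le
    · rintro ⟨_, w, rfl⟩
      refine (blockHom_mem_lexLabel d h nu w).trans (forall_congr' fun i => ?_)
      exact iff_of_eq (congrArg (· ∈ permBlock (rowOf (nu i))) (congrFun (hE w ⟨w, rfl⟩) i).symm)
  · rintro _ ⟨w, rfl⟩
    rw [hφ]
    simp only [symChar_eq_sum]
    rw [prod_sum_pi]
    refine Finset.sum_congr rfl fun nu _ => ?_
    rw [hξ nu ⟨blockHom d h w, MonoidHom.mem_range.2 ⟨w, rfl⟩⟩, Finset.prod_mul_distrib, one_mul,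
      hE]

variable {F : Type*} [Field F] [Fintype F] [DecidableEq F]
variable (d : Fin (Fintype.card (MulChar F ℂ)) → ℕ) (h : ∑ i, d i = n)

lemma levChar_conj (lam : ∀ i, (d i).Partition) (x g : GL (Fin n) F) :
    levChar d h lam (x * g * x⁻¹) = levChar d h lam g := by
  simp only [levChar, tauFun, indFun_conj]

-- For each `w`, exactly one tuple `θ` satisfies the compatibility condition of the intertwining
-- formula. It is constant on the blocks of `b` exactly when `w` sends indices with equal `b`-labels
-- into one block.
open scoped Classical in
lemma sum_charPair_levChar {α β : Type*} [LinearOrder α] [LinearOrder β] {b : Fin n → α}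
    {b₁ : Fin n → β} (hb₁ : Monotone b₁) (href : ∀ a a', b₁ a = b₁ a' → b a = b a')
    (lam : ∀ i, (d i).Partition) :
    ∑ θ ∈ constLabels F b, charPair (tauFun b₁ θ) (levChar d h lam) =
      ∑ nu : ∀ i, (d i).Partition, (∏ i, invKostka (lam i) (nu i)) *
        (((Nat.card (permBlock (lexLabel d h nu)) : ℂ) * Nat.card (permBlock b₁))⁻¹ *
          ∑ w : Equiv.Perm (Fin n),
            if ∀ a a', b a = b a' → blockOf d h (w a) = blockOf d h (w a') then
              (stabCard (permBlock (lexLabel d h nu)) (permBlock b₁) w : ℂ) else 0) := by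
  unfold levChar
  simp only [charPair_sum_right]
  rw [Finset.sum_comm]
  refine Finset.sum_congr rfl fun nu _ => ?_
  rw [← Finset.mul_sum]
  congr 1
  have h1 : ∀ θ ∈ constLabels F b, charPair (tauFun b₁ θ) (tauFun (lexLabel d h nu)
      (blockTheta d h)) =
      ((Nat.card (permBlock (lexLabel d h nu)) : ℂ) * Nat.card (permBlock b₁))⁻¹ *
        ∑ w : Equiv.Perm (Fin n), (stabCard (permBlock (lexLabel d h nu)) (permBlock b₁) w : ℂ) *
          (if blockTheta d h = θ ∘ w.symm then 1 else 0) := by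
    intro θ hθ
    rw [charPair_comm, charPair_tauFun (lexLabel_monotone d h nu) hb₁
      (blockTheta_of_lexLabel d h nu) (fun a a' e => mem_constLabels.1 hθ a a' (href a a' e))]
  rw [Finset.sum_congr rfl h1, ← Finset.mul_sum, Finset.sum_comm]
  congr 1
  refine Finset.sum_congr rfl fun w _ => ?_
  rw [← Finset.mul_sum]
  have h2 : ∀ θ : Fin n → MulChar F ℂ, blockTheta d h = θ ∘ w.symm ↔ blockTheta d h ∘ w = θ := by
    intro θ
    rw [Equiv.eq_comp_symm]
  simp only [h2]
  rw [Finset.sum_ite_eq]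
  have h3 : (∀ a a', b a = b a' → (blockTheta (F := F) d h ∘ w) a = (blockTheta d h ∘ w) a') ↔
      ∀ a a', b a = b a' → blockOf d h (w a) = blockOf d h (w a') :=
    forall_congr' fun a => forall_congr' fun a' => imp_congr_right fun _ =>
      charAt_injective.eq_iff
  simp only [mem_constLabels, h3]
  split_ifs <;> simp

lemma stabCard_bot {G : Type*} [Group G] [Fintype G] (P : Subgroup G) (z : G) :
    stabCard P ⊥ z = 1 := by
  rw [stabCard, Nat.card_eq_one_iff_unique]
  refine ⟨⟨fun x y => Subtype.ext ?_⟩, ⟨1, P.one_mem, by simp⟩⟩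
  have hx : ∀ x : {r : G // r ∈ P ∧ z⁻¹ * r * z ∈ (⊥ : Subgroup G)}, x.1 = 1 := by
    intro x
    have h1 := Subgroup.mem_bot.1 x.2.2
    have : x.1 = z * (z⁻¹ * x.1 * z) * z⁻¹ := by group
    rw [this, h1]
    group
  rw [hx x, hx y]

omit [Fintype F] [DecidableEq F] in
lemma detGroup_id : detGroup F (id : Fin n → Fin n) = upperU F n := by
  ext g
  rw [mem_upperU]
  constructor
  · intro hg
    refine ⟨fun i j hij => hg.1 hij, fun i => ?_⟩
    have := hg.2 i (by simp)
    rwa [blockDet, Matrix.det_toSquareBlock_id] at this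
  · intro hg
    refine ⟨fun i j hij => hg.1 i j hij, fun i _ => ?_⟩
    rw [blockDet, Matrix.det_toSquareBlock_id, hg.2]

omit [Fintype F] [DecidableEq F] in
lemma detGroup_le {α : Type*} [LinearOrder α] (b : Fin n → α) :
    detGroup F b ≤ blockGroup F b := fun _ hg => hg.1

open scoped Classical in
/-- The dimension of the `U`-invariants. -/
lemma avg_upperU_levChar (lam : ∀ i, (d i).Partition) :
    (Nat.card (upperU F n) : ℂ)⁻¹ *
      (∑ g : GL (Fin n) F, if g ∈ upperU F n then levChar d h lam g else 0) = symInd d h lam 1 := by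
  have h1 := avg_detGroup (F := F) (b := (id : Fin n → Fin n)) (b₁ := (id : Fin n → Fin n)) le_rfl
    (fun _ _ e => e) (levChar_conj d h lam)
  rw [inf_eq_right.2 (detGroup_le _), detGroup_id] at h1
  rw [h1, sum_charPair_levChar d h monotone_id (fun _ _ e => e), symInd]
  refine Finset.sum_congr rfl fun nu _ => ?_
  congr 1
  rw [permBlock_eq_bot Function.injective_id, indFun_one _ _ rfl]
  simp only [stabCard_bot]
  rw [Finset.sum_congr rfl (g := fun _ => (1 : ℂ))]
  · simp [div_eq_inv_mul]
  · intro w _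
    rw [if_pos]
    · simp
    · rintro a a' e
      exact congrArg (fun a => blockOf d h (w a)) e

variable {k : ℕ} (hk : k + 1 < n)

open scoped Classical in
/-- The dimensions of the invariants of the groups attached to a simple reflection. -/
lemma avg_mergeIdx_levChar (lam : ∀ i, (d i).Partition) :
    2 * ((Nat.card (detGroup F (n := n) (mergeIdx k)) : ℂ)⁻¹ *
      (∑ g : GL (Fin n) F, if g ∈ detGroup F (mergeIdx k) then levChar d h lam g else 0)) -
    (Nat.card (blockGroup F (id : Fin n → Fin n) ⊓ detGroup F (mergeIdx k) : Subgroup _) : ℂ)⁻¹ *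
      (∑ g : GL (Fin n) F, if g ∈ blockGroup F (id : Fin n → Fin n) ⊓ detGroup F (mergeIdx k)
        then levChar d h lam g else 0) = symInd d h lam (adjSwap hk) := by
  have h1 := avg_detGroup (F := F) (b := mergeIdx (n := n) k) (b₁ := mergeIdx (n := n) k) le_rfl
    (fun _ _ e => e) (levChar_conj d h lam)
  rw [inf_eq_right.2 (detGroup_le _)] at h1
  have hle : blockGroup F (id : Fin n → Fin n) ≤ blockGroup F (mergeIdx k) := by
    intro g hg i j hij
    refine hg (lt_of_not_ge fun hle => ?_)
    exact absurd (mergeIdx_monotone k hle) (not_le.2 hij)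
  have href : ∀ a a' : Fin n, id a = id a' → mergeIdx k a = mergeIdx k a' :=
    fun a a' e => congrArg _ e
  have h2 := avg_detGroup (F := F) (b := mergeIdx (n := n) k) (b₁ := (id : Fin n → Fin n)) hle
    href (levChar_conj d h lam)
  rw [h1, h2, sum_charPair_levChar d h (mergeIdx_monotone k) (fun _ _ e => e),
    sum_charPair_levChar d h monotone_id href, symInd, Finset.mul_sum, ← Finset.sum_sub_distrib]
  refine Finset.sum_congr rfl fun nu _ => ?_
  rw [mul_left_comm, ← mul_sub]
  congr 1
  rw [permBlock_eq_bot Function.injective_id, card_permBlock_mergeIdx hk]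
  have hc : (Nat.card (permBlock (lexLabel d h nu)) : ℂ) ≠ 0 := card_subgroup_ne_zero _
  simp only [stabCard_bot, stabCard_mergeIdx hk, indFun]
  -- If w s w⁻¹ preserves the refined labels, then `w` sends `k` and `k + 1` into the same block, so
  -- the condition on `w` in the sum holds automatically.
  have h3 : ∀ w : Equiv.Perm (Fin n), w * adjSwap hk * w⁻¹ ∈ permBlock (lexLabel d h nu) →
      ∀ a a', mergeIdx k a = mergeIdx k a' → blockOf d h (w a) = blockOf d h (w a') := by
    intro w hw a a' e
    have h4 : ∀ a, blockOf d h (w (adjSwap hk a)) = blockOf d h (w a) := by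
      intro a
      have := permBlock_lexLabel_le hw (w a)
      simpa using this
    rcases mergeIdx_eq_iff.1 e with rfl | ⟨e1, e2⟩ | ⟨e1, e2⟩
    · rfl
    · have e1' : a = ⟨k, k.lt_succ_self.trans hk⟩ := Fin.ext e1
      have e2' : a' = ⟨k + 1, hk⟩ := Fin.ext e2
      rw [e1', e2', ← h4 ⟨k, k.lt_succ_self.trans hk⟩, adjSwap, Equiv.swap_apply_left]
    · have e1' : a' = ⟨k, k.lt_succ_self.trans hk⟩ := Fin.ext e1
      have e2' : a = ⟨k + 1, hk⟩ := Fin.ext e2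
      rw [e1', e2', ← h4 ⟨k, k.lt_succ_self.trans hk⟩, adjSwap, Equiv.swap_apply_left]
  -- The stabilizer weight is 1 plus the indicator that w s w⁻¹ lies in the Young subgroup. The
  -- factor 2 cancels the order of ⟨s⟩, and subtracting the second average removes the part with
  -- weight 1, leaving the induction formula at `s`.
  have h5 : (∑ w : Equiv.Perm (Fin n),
      if ∀ a a', mergeIdx k a = mergeIdx k a' → blockOf d h (w a) = blockOf d h (w a') then
        (((1 + if w * adjSwap hk * w⁻¹ ∈ permBlock (lexLabel d h nu) then 1 else 0 : ℕ)) : ℂ)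
        else 0) =
      (∑ w : Equiv.Perm (Fin n),
      if ∀ a a', mergeIdx k a = mergeIdx k a' → blockOf d h (w a) = blockOf d h (w a') then
        ((1 : ℕ) : ℂ) else 0) + ∑ w : Equiv.Perm (Fin n),
        if w * adjSwap hk * w⁻¹ ∈ permBlock (lexLabel d h nu) then (1 : ℂ) else 0 := by
    rw [← Finset.sum_add_distrib]
    refine Finset.sum_congr rfl fun w _ => ?_
    by_cases hw : w * adjSwap hk * w⁻¹ ∈ permBlock (lexLabel d h nu)
    · rw [if_pos (h3 w hw), if_pos hw, if_pos (h3 w hw), if_pos hw]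
      push_cast
      ring
    · rw [if_neg hw, if_neg hw, add_zero, add_zero]
  rw [h5]
  simp only [Nat.card_eq_fintype_card (α := (⊥ : Subgroup (Equiv.Perm (Fin n)))),
    Nat.cast_ofNat, Fintype.card_unique, Nat.cast_one, mul_one]
  field_simp
  ring

end Multiplicities

end WildCount

end

noncomputable section

namespace WildCount

/-! ### The characters `χ_Λ^N` -/

section Monomial

variable {n : ℕ} {F : Type*} [Field F] [Fintype F]

instance finiteDimensional_spechtIdeal {m : ℕ} (lam : m.Partition) :
    Module.Finite ℂ (SpechtIdeal lam) :=
  Module.Finite.equiv (spechtEquiv lam).symm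

instance QSet.instFiniteMonomialLeviSpace (L : QSet F n) :
    FiniteDimensional ℂ L.MonomialLeviSpace :=
  let m : ∀ i, Module ℂ (SpechtIdeal (L.part i)) := fun _ => inferInstance
  @finite_piTensorProduct _ _ (fun i => SpechtIdeal (L.part i))
    (fun _ => Module.addCommMonoidToAddCommGroup ℂ) m
    (fun _ => finiteDimensional_spechtIdeal _)

lemma QSet.character_monomialLeviRep (L : QSet F n) (x : L.MonomialLevi) :
    L.monomialLeviRep.character x =
      L.torusChar x.left * ∏ i, symChar (L.part i) (x.right i) := by
  refine (map_smul (LinearMap.trace ℂ L.MonomialLeviSpace) _ _).trans ?_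
  rw [smul_eq_mul]
  congr 1
  let m : ∀ i, Module ℂ (SpechtIdeal (L.part i)) := fun _ => inferInstance
  refine (@trace_piTensorProduct_map _ _ (fun i => SpechtIdeal (L.part i))
    (fun _ => Module.addCommMonoidToAddCommGroup ℂ) m
    (fun _ => finiteDimensional_spechtIdeal _) _).trans ?_
  refine Finset.prod_congr rfl fun i _ => ?_
  exact trace_specht _ _

lemma QSet.torusChar_ne_zero (L : QSet F n) (t : Fin n → Fˣ) : L.torusChar t ≠ 0 := by
  intro h
  have h1 := L.torusChar.map_mul t t⁻¹
  rw [mul_inv_cancel, map_one, h, zero_mul] at h1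
  exact one_ne_zero h1

/-- In the induction formula the conjugate of `s` by `x` has torus part t / (π·t), where π is the
permutation part of that conjugate. The torus character is invariant under the block permutations,
so it takes the value 1 there, and the sum over the torus part of `x` cancels against the order of
the torus. -/
lemma QSet.chiN_inr [DecidableEq F] (L : QSet F n) (s : Equiv.Perm (Fin n)) :
    L.chiN (SemidirectProduct.inr s) = symInd L.size L.sum_size L.part s := by
  classical
  let _ : Fintype (Monomial F n) := Fintype.ofEquiv _ SemidirectProduct.equivProd.symm
  let _ : Fintype L.MonomialLevi := Fintype.ofEquiv _ SemidirectProduct.equivProd.symm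
  let φ : Equiv.Perm (Fin n) → ℂ := fun y => ∑ w : ∀ i, Equiv.Perm (Fin (L.size i)),
    if L.youngHom w = y then ∏ i, symChar (L.part i) (w i) else 0
  have hinj : Function.Injective L.youngHom := blockHom_injective L.size L.sum_size
  rw [symInd_eq_indFun L.size L.sum_size L.part φ, QSet.chiN, character_coind, indFun]
  · have hx : ∀ x : Monomial F n, (∑ h : L.MonomialLevi,
        if L.monomialHom h = x * SemidirectProduct.inr s * x⁻¹ then L.monomialLeviRep.character h
          else 0) = φ (x.right * s * x.right⁻¹) := by
      intro x
      rw [← Equiv.sum_comp SemidirectProduct.equivProd.symm, Fintype.sum_prod_type_right]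
      refine Finset.sum_congr rfl fun w _ => ?_
      have h1 : ∀ t : Fin n → Fˣ, L.monomialHom (SemidirectProduct.equivProd.symm (t, w)) =
          x * SemidirectProduct.inr s * x⁻¹ ↔
          t = x.left * (mulAutArrow (x.right * s * x.right⁻¹) x.left)⁻¹ ∧
            L.youngHom w = x.right * s * x.right⁻¹ := by
        intro t
        rw [SemidirectProduct.ext_iff]
        refine and_congr (iff_of_eq (congrArg₂ Eq rfl ?_)) (iff_of_eq (congrArg₂ Eq rfl ?_))
        · simp [SemidirectProduct.mul_left, MulAut.mul_apply]
        · simp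
      simp only [h1, ite_and]
      rw [Finset.sum_ite_eq', if_pos (Finset.mem_univ _)]
      split_ifs with hw
      · rw [L.character_monomialLeviRep, ← hw]
        change L.torusChar (x.left * _⁻¹) * _ = _
        have h2 := L.torusChar.map_mul (x.left *
          (mulAutArrow (L.youngHom w) x.left)⁻¹) (mulAutArrow (L.youngHom w) x.left)
        rw [inv_mul_cancel_right, L.torusChar_smul] at h2
        have h3 := mul_right_cancel₀ (L.torusChar_ne_zero x.left) ((one_mul _).trans h2)
        rw [← h3, one_mul]
        rfl
      · rfl
    have hx' := Finset.sum_congr (s₁ := Finset.univ) rfl fun x _ => hx x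
    refine (congrArg _ (Eq.trans (Finset.sum_congr rfl fun x _ => Finset.sum_congr rfl fun y _ =>
      ?_) hx')).trans ?_
    · congr
    rw [← Equiv.sum_comp SemidirectProduct.equivProd.symm, Fintype.sum_prod_type]
    have h4 : ∀ w, φ w = if w ∈ (blockHom L.size L.sum_size).range then φ w else 0 := by
      intro w
      split_ifs with hw
      · rfl
      · refine Finset.sum_eq_zero fun π _ => if_neg fun e => hw ⟨π, e⟩
    have h5 : ∀ t : Fin n → Fˣ, (∑ w : Equiv.Perm (Fin n),
        φ ((SemidirectProduct.equivProd.symm (t, w) : Monomial F n).right * s *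
          (SemidirectProduct.equivProd.symm (t, w) : Monomial F n).right⁻¹)) =
        ∑ w : Equiv.Perm (Fin n), if w * s * w⁻¹ ∈ (blockHom L.size L.sum_size).range then
          φ (w * s * w⁻¹) else 0 :=
      fun t => Finset.sum_congr rfl fun w _ => h4 _
    simp only [h5]
    rw [Finset.sum_const, nsmul_eq_mul, ← mul_assoc]
    refine congrArg₂ (· * ·) ?_ (Finset.sum_congr rfl fun w _ => by congr)
    have h6 : Nat.card (blockHom L.size L.sum_size).range =
        Fintype.card (∀ i, Equiv.Perm (Fin (L.size i))) := by
      rw [← Nat.card_eq_fintype_card (α := ∀ i, Equiv.Perm (Fin (L.size i)))]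
      exact (Nat.card_congr (MonoidHom.ofInjective hinj).toEquiv).symm
    have h7 : Fintype.card L.MonomialLevi =
        Fintype.card (Fin n → Fˣ) * Fintype.card (∀ i, Equiv.Perm (Fin (L.size i))) := by
      rw [← Fintype.card_prod]
      exact Fintype.card_congr SemidirectProduct.equivProd
    rw [h6, h7, Finset.card_univ]
    have h8 : (Fintype.card (Fin n → Fˣ) : ℂ) ≠ 0 := by exact_mod_cast Fintype.card_ne_zero
    push_cast
    field_simp
  · intro w
    refine (Finset.sum_eq_single w (fun w' _ hw' => if_neg fun e => hw' (hinj e)) ?_).trans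
      (if_pos rfl)
    intro hw
    exact absurd (Finset.mem_univ w) hw

lemma QSet.chiN_one [DecidableEq F] (L : QSet F n) :
    L.chiN 1 = symInd L.size L.sum_size L.part 1 := by
  rw [← L.chiN_inr, map_one]

end Monomial

/-! ### Completeness of the characters `χ_Λ^G` in `Ind_U^G 1` -/

section Completeness

variable {n : ℕ} {F : Type*} [Field F] [Fintype F] [DecidableEq F]

omit [DecidableEq F] in
lemma card_constLabels_id :
    ((constLabels F (id : Fin n → Fin n)).card : ℂ) = (Fintype.card (MulChar F ℂ) : ℂ) ^ n := by
  have : constLabels F (id : Fin n → Fin n) = Finset.univ := by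
    ext θ
    rw [mem_constLabels]
    refine iff_of_true (fun a a' e => congrArg θ e) (Finset.mem_univ _)
  rw [this]
  simp [Finset.card_univ]

lemma card_blockGroup_id : (Fintype.card (MulChar F ℂ) : ℂ) ^ n * Nat.card (upperU F n) =
    Nat.card (blockGroup F (id : Fin n → Fin n)) := by
  rw [← card_constLabels_id (F := F), ← card_constLabels_mul (F := F) (le_refl
    (blockGroup F (id : Fin n → Fin n))) (fun _ _ e => e), inf_eq_right.2 (detGroup_le _),
    detGroup_id]

omit [Fintype F] [DecidableEq F] in
lemma blockGroup_eq_of_injective {α : Type*} [LinearOrder α] {b : Fin n → α} (hb : Monotone b)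
    (hb' : Function.Injective b) : blockGroup F b = blockGroup F (id : Fin n → Fin n) := by
  have hs := hb.strictMono_of_injective hb'
  ext g
  exact ⟨fun hg i j hij => hg (hs hij), fun hg i j hij => hg (hs.lt_iff_lt.1 hij)⟩

variable (d : Fin (Fintype.card (MulChar F ℂ)) → ℕ) (h : ∑ i, d i = n)

omit [DecidableEq F] in
lemma lexLabel_ones_injective :
    Function.Injective (lexLabel d h fun i => onesPartition (d i)) := by
  intro a a' e
  obtain ⟨⟨i, x⟩, rfl⟩ := (blockEquiv d h).surjective a
  obtain ⟨⟨i', x'⟩, rfl⟩ := (blockEquiv d h).surjective a'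
  rw [lexLabel_blockEquiv, lexLabel_blockEquiv] at e
  have e1 : i = i' := congrArg (fun x => (ofLex x).1) e
  subst e1
  have e2 : rowOf (onesPartition (d i)) x = rowOf (onesPartition (d i)) x' :=
    congrArg (fun x => (ofLex x).2) e
  rw [rowOf_ones_injective e2]

/-- The degree of `symChar lam` is the Kostka number for the partition with all parts one, so
summation against inverse Kostka numbers leaves only the character induced from the upper triangular
group. -/
lemma sum_symChar_mul_levChar_one :
    ∑ lam : ∀ i, (d i).Partition, (∏ i, symChar (lam i) 1) * levChar d h lam (1 : GL (Fin n) F) =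
      (Nat.card (GL (Fin n) F) : ℂ) / Nat.card (blockGroup F (id : Fin n → Fin n)) := by
  classical
  simp only [levChar, Finset.mul_sum, ← mul_assoc]
  rw [Finset.sum_comm]
  simp only [← Finset.sum_mul, ← Finset.prod_mul_distrib]
  have h1 : ∀ nu : ∀ i, (d i).Partition,
      (∑ lam : ∀ i, (d i).Partition, ∏ i, symChar (lam i) 1 * invKostka (lam i) (nu i)) =
        if nu = fun i => onesPartition (d i) then 1 else 0 := by
    intro nu
    rw [← prod_sum_pi fun i (l : (d i).Partition) => symChar l 1 * invKostka l (nu i)]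
    simp only [← kostka_ones, sum_kostka_mul_invKostka]
    rw [Finset.prod_ite_zero]
    simp [funext_iff]
  simp only [h1, ite_mul, one_mul, zero_mul]
  rw [Finset.sum_ite_eq', if_pos (Finset.mem_univ _), tauFun, indFun_one,
    blockGroup_eq_of_injective (lexLabel_monotone d h _) (lexLabel_ones_injective d h)]
  · exact (isCharOn_detChar (b := lexLabel d h fun i => onesPartition (d i))
      (blockTheta_of_lexLabel d h _)).one

omit [DecidableEq F] in
lemma sum_multinomial {k : ℕ} :
    ∑ d ∈ Finset.piAntidiag (Finset.univ : Finset (Fin k)) n,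
      ((n.factorial : ℂ) / (∏ i, (d i).factorial : ℕ)) = (k : ℂ) ^ n := by
  have h1 := Finset.sum_pow_eq_sum_piAntidiag (Finset.univ : Finset (Fin k)) (fun _ => (1 : ℂ)) n
  simp only [Finset.sum_const, Finset.card_univ, Fintype.card_fin, nsmul_eq_mul, mul_one, one_pow,
    Finset.prod_const_one] at h1
  rw [h1]
  refine Finset.sum_congr rfl fun d hd => ?_
  have h2 : (∏ i, (d i).factorial) ≠ 0 :=
    Finset.prod_ne_zero_iff.2 fun i _ => (d i).factorial_ne_zero
  rw [← (Finset.mem_piAntidiag.1 hd).1, ← Nat.multinomial_spec, Nat.cast_mul,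
    mul_div_cancel_left₀ _ (Nat.cast_ne_zero.2 h2)]

-- The `U`-invariants of V_Λ have dimension n!/∏ n_i! times the product of the degrees of the `λ_i`.
-- For fixed sizes, summing over partitions gives this multinomial coefficient times [G : B]. The
-- coefficients add up to the n-th power of the number of characters, which is |B|/|U|.
open scoped Classical in
lemma QSet.sum_chiG_one_mul :
    ∑ L : QSet F n, L.chiG 1 * (∑ u, if u ∈ upperU F n then L.chiG u else 0) =
      (Nat.card (GL (Fin n) F) : ℂ) := by
  let _ : Fintype {d : Fin (Fintype.card (MulChar F ℂ)) → ℕ // ∑ i, d i = n} :=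
    Fintype.subtype (Finset.piAntidiag Finset.univ n) (by simp)
  have hU : (Nat.card (upperU F n) : ℂ) ≠ 0 := card_subgroup_ne_zero _
  have hB : (Nat.card (blockGroup F (id : Fin n → Fin n)) : ℂ) ≠ 0 := card_subgroup_ne_zero _
  have h1 : ∀ L : QSet F n, L.chiG 1 * (∑ u, if u ∈ upperU F n then L.chiG u else 0) =
      levChar L.size L.sum_size L.part 1 *
        (Nat.card (upperU F n) * symInd L.size L.sum_size L.part 1) := by
    intro L
    simp only [L.chiG_eq]
    rw [← avg_upperU_levChar (F := F), mul_inv_cancel_left₀ hU]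
  rw [Finset.sum_congr rfl fun L _ => h1 L]
  refine (Fintype.sum_equiv (QSet.equivSigma F n) _
    (fun x => levChar x.1.1 x.1.2 x.2 1 * (Nat.card (upperU F n) * symInd x.1.1 x.1.2 x.2 1))
    (fun _ => rfl)).trans ?_
  rw [Fintype.sum_sigma]
  have h2 : ∀ d : {d : Fin (Fintype.card (MulChar F ℂ)) → ℕ // ∑ i, d i = n},
      (∑ lam : ∀ i, (d.1 i).Partition,
        levChar d.1 d.2 lam 1 * (Nat.card (upperU F n) * symInd d.1 d.2 lam 1)) =
      ((n.factorial : ℂ) / (∏ i, (d.1 i).factorial : ℕ)) * (Nat.card (upperU F n) *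
        ((Nat.card (GL (Fin n) F) : ℂ) / Nat.card (blockGroup F (id : Fin n → Fin n)))) := by
    intro d
    rw [← sum_symChar_mul_levChar_one d.1 d.2, Finset.mul_sum, Finset.mul_sum]
    refine Finset.sum_congr rfl fun lam _ => ?_
    rw [symInd_one]
    ring
  rw [Finset.sum_congr rfl fun d _ => h2 d, ← Finset.sum_mul]
  have h3 := Finset.sum_subtype (F := inferInstance) (Finset.piAntidiag Finset.univ n)
    (p := fun d : Fin (Fintype.card (MulChar F ℂ)) → ℕ => ∑ i, d i = n) (by simp)
    (fun d => ((n.factorial : ℂ) / (∏ i, (d i).factorial : ℕ)))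
  rw [← h3, sum_multinomial, ← mul_assoc, card_blockGroup_id, mul_div_cancel₀ _ hB]

end Completeness

end WildCount

end

noncomputable section

namespace WildCount

/-! ### Idempotents, corners and transversals -/

section Corner

variable {V : Type*} [AddCommGroup V] [Module ℂ V] [FiniteDimensional ℂ V]

/-- The eigenvalues of `1 + (z - 1) p` for an idempotent `p`. -/
lemma exists_det_of_idempotent (p : V →ₗ[ℂ] V) (hp : p * p = p) :
    ∃ r : ℕ, LinearMap.trace ℂ V p = r ∧ ∀ z : ℂ, LinearMap.det (1 + (z - 1) • p) = z ^ r := by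
  have h := LinearMap.IsIdempotentElem.isProj_range p hp
  refine ⟨Module.finrank ℂ (LinearMap.range p), LinearMap.IsProj.trace h, fun z => ?_⟩
  have h1 : (1 + (z - 1) • p) = (Submodule.prodEquivOfIsCompl _ _ h.isCompl).conj
      (LinearMap.prodMap (z • 1) 1) := by
    have h2 := LinearMap.IsProj.eq_conj_prodMap h
    conv_lhs => rw [h2]
    rw [← map_smul]
    have h3 : (1 : V →ₗ[ℂ] V) = (Submodule.prodEquivOfIsCompl _ _ h.isCompl).conj 1 := by
      exact (LinearEquiv.conj_id _).symm
    rw [h3, ← map_add]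
    congr 1
    apply LinearMap.ext
    rintro ⟨x, y⟩
    simp [sub_smul]
  rw [h1, LinearEquiv.conj_apply, LinearMap.comp_assoc, LinearMap.det_conj, LinearMap.det_prodMap]
  simp

/-- The determinant on the corner `e A e`. -/
def cornerDet (e x : V →ₗ[ℂ] V) : ℂ := LinearMap.det (x + (1 - e))

-- Adding `1 - e` extends an operator of the corner by the identity on the kernel of `e`. The
-- one-sided absorption hypotheses already kill the mixed terms.
omit [FiniteDimensional ℂ V] in
lemma cornerDet_mul {e x y : V →ₗ[ℂ] V} (he : e * e = e) (hx : x * e = x) (hy : e * y = y) :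
    cornerDet e (x * y) = cornerDet e x * cornerDet e y := by
  rw [cornerDet, cornerDet, cornerDet, ← map_mul]
  congr 1
  have h1 : x * (1 - e) = 0 := by rw [mul_sub, mul_one, hx, sub_self]
  have h2 : (1 - e) * y = 0 := by rw [sub_mul, one_mul, hy, sub_self]
  have h3 : (1 - e) * (1 - e) = 1 - e := by
    rw [mul_sub, mul_one, sub_mul, one_mul, he, sub_self, sub_zero]
  rw [add_mul, mul_add, mul_add, h1, h2, h3, add_zero, zero_add]

omit [FiniteDimensional ℂ V] in
lemma cornerDet_self (e : V →ₗ[ℂ] V) : cornerDet e e = 1 := by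
  rw [cornerDet, add_sub_cancel, map_one]

omit [FiniteDimensional ℂ V] in
lemma cornerDet_smul (e x : V →ₗ[ℂ] V) (he : e * e = e) (hx : e * x = x) (z : ℂ) :
    cornerDet e (z • x) = cornerDet e (z • e) * cornerDet e x := by
  rw [← cornerDet_mul he (by rw [smul_mul_assoc, he]) hx, smul_mul_assoc, hx]

end Corner

/-! ### Coset representatives and averages. -/

section Transversal

variable {G : Type*} [Group G] [Fintype G]

-- The hypotheses say that `K` is the disjoint union of the cosets `U r_i`, in a form that can be
-- checked on matrix entries.
open scoped Classical in
lemma sum_transversal {E I : Type*} [AddCommGroup E] [Fintype I] {U K : Subgroup G} (r : I → G)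
    (h : ∀ g i, g * (r i)⁻¹ ∈ U → g ∈ K) (h' : ∀ g ∈ K, ∃! i, g * (r i)⁻¹ ∈ U) (f : G → E) :
    (∑ g : G, if g ∈ K then f g else 0) = ∑ i, ∑ g : G, if g ∈ U then f (g * r i) else 0 := by
  have h1 : ∀ i, (∑ g : G, if g ∈ U then f (g * r i) else 0) =
      ∑ g : G, if g * (r i)⁻¹ ∈ U then f g else 0 := fun i =>
    Fintype.sum_equiv (Equiv.mulRight (r i)) _ _ fun g => by simp
  rw [Finset.sum_congr rfl fun i _ => h1 i, Finset.sum_comm]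
  refine Finset.sum_congr rfl fun g _ => ?_
  split_ifs with hg
  · obtain ⟨i, hi, hu⟩ := h' g hg
    rw [Finset.sum_eq_single i]
    · rw [if_pos hi]
    · intro j _ hj
      rw [if_neg fun hj' => hj (hu j hj')]
    · intro hi
      exact absurd (Finset.mem_univ i) hi
  · symm
    exact Finset.sum_eq_zero fun i _ => if_neg fun hi => hg (h g i hi)

lemma card_transversal {I : Type*} [Fintype I] {U K : Subgroup G} (r : I → G)
    (h : ∀ g i, g * (r i)⁻¹ ∈ U → g ∈ K) (h' : ∀ g ∈ K, ∃! i, g * (r i)⁻¹ ∈ U) :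
    (Nat.card K : ℂ) = Nat.card U * Fintype.card I := by
  classical
  have h1 := sum_transversal r h h' (fun _ => (1 : ℂ))
  rw [sum_ite_mem_const, sum_ite_mem_const] at h1
  simpa [mul_comm] using h1

lemma card_smul_avgOp {V I : Type*} [AddCommGroup V] [Module ℂ V] [Fintype I]
    (ρ : Representation ℂ G V) {U K : Subgroup G} (r : I → G)
    (h : ∀ g i, g * (r i)⁻¹ ∈ U → g ∈ K) (h' : ∀ g ∈ K, ∃! i, g * (r i)⁻¹ ∈ U) :
    (Nat.card K : ℂ) • avgOp ρ K = (Nat.card U : ℂ) • ∑ i, avgOp ρ U * ρ (r i) := by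
  classical
  have hK : (Nat.card K : ℂ) ≠ 0 := card_subgroup_ne_zero _
  have hU : (Nat.card U : ℂ) ≠ 0 := card_subgroup_ne_zero _
  simp only [avgOp_mul]
  rw [avgOp, smul_inv_smul₀ hK, ← Finset.smul_sum, smul_inv_smul₀ hU,
    sum_transversal r h h' fun g => ρ g]
  refine Finset.sum_congr rfl fun i _ => ?_
  simp only [map_mul]

end Transversal

/-! ### Central elements of the Hecke algebra and positivity. -/

section Scalars

variable {G : Type*} [Group G] [Fintype G] {V : Type*} [AddCommGroup V] [Module ℂ V]

lemma sum_conj_comm (ρ : Representation ℂ G V) (A : V →ₗ[ℂ] V) (x : G) :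
    (∑ g, ρ g * A * ρ g⁻¹) * ρ x = ρ x * ∑ g, ρ g * A * ρ g⁻¹ := by
  rw [Finset.sum_mul, Finset.mul_sum]
  refine Fintype.sum_equiv (Equiv.mulLeft x⁻¹) _ _ fun g => ?_
  simp only [Equiv.coe_mulLeft, mul_inv_rev, inv_inv, map_mul, mul_assoc]
  rw [← mul_assoc (ρ x), ← map_mul ρ x, mul_inv_cancel, map_one, one_mul]

variable [FiniteDimensional ℂ V]

/-- In an irreducible representation, a central element of the Hecke algebra acts by a scalar. -/
lemma eq_smul_of_corner_central (ρ : Representation ℂ G V)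
    (hρ : charPair ρ.character ρ.character = 1) (U : Subgroup G)
    (hU : LinearMap.trace ℂ V (avgOp ρ U) ≠ 0) (A : V →ₗ[ℂ] V) (hA : avgOp ρ U * A = A)
    (hA' : A * avgOp ρ U = A)
    (hc : ∀ g, A * (avgOp ρ U * ρ g * avgOp ρ U) = avgOp ρ U * ρ g * avgOp ρ U * A) :
    ∃ c : ℂ, A = c • avgOp ρ U := by
  set e := avgOp ρ U with he
  have hee : e * e = e := avgOp_idem ρ
  obtain ⟨c₁, h₁⟩ := eq_smul_one_of_charPair_eq_one ρ hρ _ (sum_conj_comm ρ A)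
  obtain ⟨c₂, h₂⟩ := eq_smul_one_of_charPair_eq_one ρ hρ _ (sum_conj_comm ρ e)
  have hne : c₂ ≠ 0 := by
    rintro rfl
    rw [zero_smul] at h₂
    have h3 := congrArg (LinearMap.trace ℂ V) h₂
    rw [map_sum, map_zero] at h3
    have h4 : ∀ g, LinearMap.trace ℂ V (ρ g * e * ρ g⁻¹) = LinearMap.trace ℂ V e := by
      intro g
      rw [LinearMap.trace_mul_comm, ← mul_assoc, ← map_mul, inv_mul_cancel, map_one, one_mul]
    simp only [h4, Finset.sum_const, Finset.card_univ, nsmul_eq_mul] at h3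
    exact (mul_ne_zero (by exact_mod_cast Fintype.card_ne_zero) hU) h3
  -- By Schur's lemma the averages of `A` and `e` over conjugation are the scalars `c₁` and `c₂`.
  -- Centrality lets `A` be pulled out of the first one, so that `c₁ • e = c₂ • A`; the trace of `e`
  -- being nonzero gives `c₂ ≠ 0`.
  have h3 : e * (∑ g, ρ g * A * ρ g⁻¹) * e = A * (e * (∑ g, ρ g * e * ρ g⁻¹) * e) := by
    simp only [Finset.mul_sum, Finset.sum_mul]
    refine Finset.sum_congr rfl fun g _ => ?_
    calc e * (ρ g * A * ρ g⁻¹) * e = e * (ρ g * (e * A) * ρ g⁻¹) * e := by rw [hA]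
      _ = e * ρ g * (e * A) * ρ g⁻¹ * e := by simp only [mul_assoc]
      _ = e * ρ g * (e * (A * e)) * ρ g⁻¹ * e := by rw [hA']
      _ = (e * ρ g * e * A) * e * ρ g⁻¹ * e := by simp only [mul_assoc]
      _ = A * (e * ρ g * e) * e * ρ g⁻¹ * e := by rw [← hc g]
      _ = A * (e * ρ g * (e * e) * ρ g⁻¹ * e) := by simp only [mul_assoc]
      _ = A * (e * (ρ g * e * ρ g⁻¹) * e) := by rw [hee]; simp only [mul_assoc]
  rw [h₁, h₂] at h3
  simp only [mul_smul_comm, smul_mul_assoc, mul_one, hee, hA'] at h3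
  exact ⟨c₂⁻¹ * c₁, by rw [mul_smul, h3, inv_smul_smul₀ hne]⟩

/-- If the square of the self-adjoint Hecke operator of an involution is a scalar, the scalar is
nonnegative. -/
lemma nonneg_of_sq_eq_smul (ρ : Representation ℂ G V) (U : Subgroup G) (w : G) (hw : w⁻¹ = w)
    (hU : avgOp ρ U ≠ 0) (c : ℂ)
    (hc : avgOp ρ U * ρ w * avgOp ρ U * ρ w * avgOp ρ U = c • avgOp ρ U) :
    ∃ x : ℝ, 0 ≤ x ∧ c = x := by
  classical
  set e := avgOp ρ U with he
  have hee : e * e = e := avgOp_idem ρ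
  obtain ⟨v, hv⟩ : ∃ v, e v ≠ 0 := by
    by_contra hcon
    push Not at hcon
    exact hU (LinearMap.ext hcon)
  obtain ⟨l, hl⟩ : ∃ l : Module.Dual ℂ V, l (e v) ≠ 0 := by
    by_contra hcon
    push Not at hcon
    exact hv ((Module.forall_dual_apply_eq_zero_iff ℂ _).1 hcon)
  -- Averaging |ℓ|² over the group gives an invariant positive semidefinite Hermitian form.
  -- Definiteness is not needed, since `l (e v) ≠ 0` makes the form positive at `e v`.
  let B : V → V → ℂ := fun x y => ∑ g, starRingEnd ℂ (l (ρ g x)) * l (ρ g y)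
  have hB : ∀ h x y, B (ρ h x) y = B x (ρ h⁻¹ y) := by
    intro h x y
    refine Fintype.sum_equiv (Equiv.mulRight h) _ _ fun g => ?_
    simp only [Equiv.coe_mulRight]
    rw [← Module.End.mul_apply, ← map_mul, ← Module.End.mul_apply, ← map_mul, mul_inv_cancel_right]
  have hadd : ∀ x (s : Finset G) (f : G → V), B x (∑ g ∈ s, f g) = ∑ g ∈ s, B x (f g) := by
    intro x s f
    simp only [B, map_sum, Finset.mul_sum]
    exact Finset.sum_comm
  have hadd' : ∀ y (s : Finset G) (f : G → V), B (∑ g ∈ s, f g) y = ∑ g ∈ s, B (f g) y := by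
    intro x s f
    simp only [B, map_sum, Finset.sum_mul]
    exact Finset.sum_comm
  have hsm : ∀ z x y, B x (z • y) = z * B x y := by
    intro z x y
    simp only [B, map_smul, smul_eq_mul, Finset.mul_sum]
    exact Finset.sum_congr rfl fun g _ => by ring
  have hsm' : ∀ z x y, B (z • x) y = starRingEnd ℂ z * B x y := by
    intro z x y
    simp only [B, map_smul, smul_eq_mul, map_mul, Finset.mul_sum]
    exact Finset.sum_congr rfl fun g _ => by ring
  have hBe : ∀ x y, B (e x) y = B x (e y) := by
    intro x y
    have h1 : ∀ x, e x = (Nat.card U : ℂ)⁻¹ • ∑ g : G, if g ∈ U then ρ g x else 0 := by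
      intro x
      simp only [he, avgOp, LinearMap.smul_apply, LinearMap.sum_apply]
      congr 1
      refine Finset.sum_congr rfl fun g _ => ?_
      split_ifs <;> rfl
    rw [h1 x, h1 y, hsm, hsm', hadd, hadd']
    simp only [map_inv₀, Complex.conj_natCast]
    congr 1
    refine Fintype.sum_equiv (Equiv.inv G) _ _ fun g => ?_
    simp only [Equiv.inv_apply, inv_mem_iff]
    split_ifs
    · rw [hB]
    · simp [B]
  have hpos : ∀ x, B x x = ((∑ g, Complex.normSq (l (ρ g x)) : ℝ) : ℂ) := by
    intro x
    push_cast
    exact Finset.sum_congr rfl fun g _ => by rw [mul_comm, Complex.mul_conj]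
  -- Both `e` and `ρ w` are self-adjoint for `B`, because `w` is its own inverse.
  have h1 : B (e (ρ w (e v))) (e (ρ w (e v))) = c * B (e v) (e v) := by
    have h2 := LinearMap.congr_fun hc v
    simp only [Module.End.mul_apply, LinearMap.smul_apply] at h2
    rw [hBe, hB, hw, hBe, ← Module.End.mul_apply e e, hee, hBe v (e v), ← Module.End.mul_apply e e,
      hee, h2, hsm]
  rw [hpos, hpos] at h1
  have h3 : 0 < ∑ g, Complex.normSq (l (ρ g (e v))) := by
    refine Finset.sum_pos' (fun g _ => Complex.normSq_nonneg _) ⟨1, Finset.mem_univ _, ?_⟩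
    rw [map_one]
    exact Complex.normSq_pos.2 hl
  refine ⟨(∑ g, Complex.normSq (l (ρ g (e (ρ w (e v)))))) /
    ∑ g, Complex.normSq (l (ρ g (e v))), ?_, ?_⟩
  · exact div_nonneg (Finset.sum_nonneg fun g _ => Complex.normSq_nonneg _) h3.le
  · rw [Complex.ofReal_div, h1, mul_div_cancel_right₀ _ (Complex.ofReal_ne_zero.2 h3.ne')]

end Scalars

/-! ### Inversions of permutations -/

section Inversions

variable {n : ℕ}

/-- The inversions of a permutation. -/
def inversions (w : Equiv.Perm (Fin n)) : Finset (Fin n × Fin n) :=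
  Finset.univ.filter fun p => p.1 < p.2 ∧ w p.2 < w p.1

lemma mem_inversions {w : Equiv.Perm (Fin n)} {p : Fin n × Fin n} :
    p ∈ inversions w ↔ p.1 < p.2 ∧ w p.2 < w p.1 := by
  simp [inversions]

lemma inversions_one : inversions (1 : Equiv.Perm (Fin n)) = ∅ := by
  ext p
  simp only [mem_inversions, Equiv.Perm.coe_one, id_eq, Finset.notMem_empty, iff_false]
  exact fun h => lt_asymm h.1 h.2

lemma inversions_rev : inversions (Fin.revPerm : Equiv.Perm (Fin n)) =
    Finset.univ.filter fun p : Fin n × Fin n => p.1 < p.2 := by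
  ext p
  simp [mem_inversions]

lemma card_lt_pairs : (Finset.univ.filter fun p : Fin n × Fin n => p.1 < p.2).card = n.choose 2 := by
  rw [Finset.card_filter, Fintype.sum_prod_type_right]
  simp only [← Finset.card_filter]
  have : ∀ j : Fin n, (Finset.univ.filter fun i : Fin n => i < j).card = j := by
    intro j
    rw [← Fin.card_Iio j]
    congr 1
    ext i
    simp
  simp only [this]
  rw [Fin.sum_univ_eq_sum_range (fun i => i) n, Finset.sum_range_id, Nat.choose_two_right]

variable {k : ℕ} (hk : k + 1 < n)

lemma adjSwap_lt {i j : Fin n} (hij : i < j) (hne : ¬((i : ℕ) = k ∧ (j : ℕ) = k + 1)) :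
    adjSwap hk i < adjSwap hk j := by
  have hv : ∀ a : Fin n, (adjSwap hk a : ℕ) = if (a : ℕ) = k then k + 1 else
      if (a : ℕ) = k + 1 then k else a := by
    intro a
    rw [adjSwap, Equiv.swap_apply_def]
    simp only [Fin.ext_iff]
    split_ifs <;> simp
  rw [Fin.lt_def] at *
  rw [hv, hv]
  split_ifs <;> omega

lemma adjSwap_apply_left : adjSwap hk ⟨k, k.lt_succ_self.trans hk⟩ = ⟨k + 1, hk⟩ :=
  Equiv.swap_apply_left _ _

lemma adjSwap_apply_right : adjSwap hk ⟨k + 1, hk⟩ = ⟨k, k.lt_succ_self.trans hk⟩ :=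
  Equiv.swap_apply_right _ _

lemma adjSwap_apply_apply (a : Fin n) : adjSwap hk (adjSwap hk a) = a :=
  Equiv.swap_apply_self _ _ _

/-- The transposition permutes the increasing pairs other than (k, k + 1), and that pair becomes the
single new inversion. -/
lemma card_inversions_mul_adjSwap (x : Equiv.Perm (Fin n))
    (hx : x ⟨k, k.lt_succ_self.trans hk⟩ < x ⟨k + 1, hk⟩) :
    (inversions (x * adjSwap hk)).card = (inversions x).card + 1 := by
  have h1 : inversions (x * adjSwap hk) = insert (⟨k, k.lt_succ_self.trans hk⟩, ⟨k + 1, hk⟩)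
      ((inversions x).image (Prod.map (adjSwap hk) (adjSwap hk))) := by
    ext ⟨i, j⟩
    rw [Finset.mem_insert, Finset.mem_image, mem_inversions, Equiv.Perm.mul_apply,
      Equiv.Perm.mul_apply]
    by_cases hij : (i : ℕ) = k ∧ (j : ℕ) = k + 1
    · obtain ⟨hi, hj⟩ := hij
      have hi' : i = ⟨k, k.lt_succ_self.trans hk⟩ := Fin.ext hi
      have hj' : j = ⟨k + 1, hk⟩ := Fin.ext hj
      rw [hi', hj', adjSwap_apply_left, adjSwap_apply_right]
      refine iff_of_true ⟨Fin.lt_def.2 (Nat.lt_succ_self k), hx⟩ (Or.inl rfl)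
    · constructor
      · rintro ⟨h1, h2⟩
        refine Or.inr ⟨(adjSwap hk i, adjSwap hk j), mem_inversions.2
          ⟨adjSwap_lt hk h1 hij, h2⟩, ?_⟩
        rw [Prod.map_apply, adjSwap_apply_apply, adjSwap_apply_apply]
      · rintro (e | ⟨⟨a, b⟩, hab, e⟩)
        · rw [Prod.mk.injEq] at e
          exact absurd ⟨congrArg Fin.val e.1, congrArg Fin.val e.2⟩ hij
        · rw [Prod.map_apply, Prod.mk.injEq] at e
          obtain ⟨rfl, rfl⟩ := e
          have hab' := mem_inversions.1 hab
          rw [adjSwap_apply_apply, adjSwap_apply_apply]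
          refine ⟨adjSwap_lt hk hab'.1 ?_, hab'.2⟩
          rintro ⟨ha, hb⟩
          have ha' : a = ⟨k, k.lt_succ_self.trans hk⟩ := Fin.ext ha
          have hb' : b = ⟨k + 1, hk⟩ := Fin.ext hb
          have := hab'.2
          rw [ha', hb'] at this
          exact lt_asymm hx this
  rw [h1, Finset.card_insert_of_notMem, Finset.card_image_of_injective]
  · exact (adjSwap hk).injective.prodMap (adjSwap hk).injective
  · rw [Finset.mem_image]
    rintro ⟨⟨a, b⟩, hab, e⟩
    rw [Prod.map_apply, Prod.mk.injEq] at e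
    have h2 : a = ⟨k + 1, hk⟩ := by
      rw [← adjSwap_apply_apply hk a, e.1, adjSwap_apply_left]
    have h3 : b = ⟨k, k.lt_succ_self.trans hk⟩ := by
      rw [← adjSwap_apply_apply hk b, e.2, adjSwap_apply_right]
    have := (mem_inversions.1 hab).1
    rw [h2, h3, Fin.lt_def] at this
    simp at this

/-- Induction along reduced words. -/
lemma perm_induction {P : Equiv.Perm (Fin n) → Prop} (h1 : P 1)
    (hs : ∀ (k : ℕ) (hk : k + 1 < n) (x : Equiv.Perm (Fin n)),
      x ⟨k, k.lt_succ_self.trans hk⟩ < x ⟨k + 1, hk⟩ → P x → P (x * adjSwap hk))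
    (w : Equiv.Perm (Fin n)) : P w := by
  induction hm : (inversions w).card using Nat.strong_induction_on generalizing w with
  | _ m ih =>
    -- Removing an adjacent descent lowers the number of inversions; a permutation without one is
    -- increasing, hence the identity.
    by_cases hd : ∃ k, ∃ hk : k + 1 < n, w ⟨k + 1, hk⟩ < w ⟨k, k.lt_succ_self.trans hk⟩
    · obtain ⟨k, hk, hlt⟩ := hd
      have hx : (w * adjSwap hk) ⟨k, k.lt_succ_self.trans hk⟩ < (w * adjSwap hk) ⟨k + 1, hk⟩ := by
        rwa [Equiv.Perm.mul_apply, Equiv.Perm.mul_apply, adjSwap_apply_left, adjSwap_apply_right]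
      have hw : w = w * adjSwap hk * adjSwap hk := by rw [mul_assoc, adjSwap_mul_self, mul_one]
      have hc := card_inversions_mul_adjSwap hk _ hx
      rw [← hw] at hc
      rw [hw]
      exact hs k hk _ hx (ih _ (by omega) _ rfl)
    · push Not at hd
      have hmono : StrictMono w := by
        cases n with
        | zero => intro a; exact a.elim0
        | succ n =>
          refine Fin.strictMono_iff_lt_succ.2 fun i => lt_of_le_of_ne
            (hd i (Nat.succ_lt_succ i.2)) fun e => ?_
          exact (Fin.castSucc_lt_succ (i := i)).ne (w.injective e)
      have : w = 1 := by
        ext a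
        have := Subsingleton.elim (hmono.orderIsoOfSurjective w w.surjective) (OrderIso.refl _)
        have h2 := congrArg (fun f : Fin n ≃o Fin n => f a) this
        exact congrArg Fin.val h2
      rwa [this]

end Inversions

end WildCount

end

noncomputable section

namespace WildCount

/-! ### Root subgroups -/

section Roots

variable {F : Type*} [Field F] {n : ℕ}

/-- The elementary matrix `1 + c E_{ij}`. -/
def rootGL {i j : Fin n} (hij : i ≠ j) (c : F) : GL (Fin n) F :=
  ⟨Matrix.transvection i j c, Matrix.transvection i j (-c),
    by rw [Matrix.transvection_mul_transvection_same _ _ hij, add_neg_cancel,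
      Matrix.transvection_zero],
    by rw [Matrix.transvection_mul_transvection_same _ _ hij, neg_add_cancel,
      Matrix.transvection_zero]⟩

variable {i j : Fin n} (hij : i ≠ j)

lemma rootGL_zero : rootGL hij (0 : F) = 1 := Units.ext (Matrix.transvection_zero _ _)

lemma rootGL_inv (c : F) : (rootGL hij c)⁻¹ = rootGL hij (-c) := Units.ext rfl

lemma rootGL_apply (c : F) (a b : Fin n) : (rootGL hij c).1 a b =
    (if a = b then 1 else 0) + if a = i ∧ b = j then c else 0 := by
  simp only [rootGL, Matrix.transvection, Matrix.add_apply, Matrix.one_apply, Matrix.single_apply]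
  congr 1
  simp only [eq_comm]

lemma mul_rootGL_apply (g : GL (Fin n) F) (c : F) (a b : Fin n) :
    (g * rootGL hij c).1 a b = g.1 a b + if b = j then g.1 a i * c else 0 := by
  rw [Units.val_mul]
  by_cases hb : b = j
  · rw [if_pos hb, hb]
    exact (Matrix.mul_transvection_apply_same _ _ _ _ _).trans (by rw [mul_comm])
  · rw [if_neg hb, add_zero]
    exact Matrix.mul_transvection_apply_of_ne _ _ _ _ hb _ _

lemma rootGL_mul_apply (g : GL (Fin n) F) (c : F) (a b : Fin n) :
    (rootGL hij c * g).1 a b = g.1 a b + if a = i then c * g.1 j b else 0 := by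
  rw [Units.val_mul]
  by_cases ha : a = i
  · rw [if_pos ha, ha]
    exact Matrix.transvection_mul_apply_same _ _ _ _ _
  · rw [if_neg ha, add_zero]
    exact Matrix.transvection_mul_apply_of_ne _ _ _ _ ha _ _

lemma rootGL_mem_upperU (h : i < j) (c : F) : rootGL h.ne c ∈ upperU F n := by
  refine mem_upperU.2 ⟨fun a b hba => ?_, fun a => ?_⟩
  · rw [rootGL_apply, if_neg hba.ne', if_neg, add_zero]
    rintro ⟨rfl, rfl⟩
    exact lt_asymm h hba
  · rw [rootGL_apply, if_pos rfl, if_neg, add_zero]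
    rintro ⟨e, e'⟩
    exact h.ne (e.symm.trans e')

lemma permGL_conj_rootGL (w : Equiv.Perm (Fin n)) (c : F) :
    permGL F n w * rootGL hij c * (permGL F n w)⁻¹ = rootGL (w.injective.ne hij) c := by
  refine gl_ext fun a b => ?_
  have h1 := permGL_conj_apply (rootGL hij c) w⁻¹ a b
  rw [map_inv, inv_inv] at h1
  rw [h1, rootGL_apply, rootGL_apply]
  simp only [Equiv.Perm.inv_eq_iff_eq, EmbeddingLike.apply_eq_iff_eq]

lemma permGL_conj_mem_upperU {w : Equiv.Perm (Fin n)} {u : GL (Fin n) F} (hu : u ∈ upperU F n)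
    (h : ∀ a b, b < a → w a < w b → u.1 (w a) (w b) = 0) :
    (permGL F n w)⁻¹ * u * permGL F n w ∈ upperU F n := by
  have hu' := mem_upperU.1 hu
  refine mem_upperU.2 ⟨fun a b hba => ?_, fun a => ?_⟩
  · rw [permGL_conj_apply]
    rcases lt_trichotomy (w a) (w b) with h1 | h1 | h1
    · exact h a b hba h1
    · exact absurd (w.injective h1) hba.ne'
    · exact hu'.1 _ _ h1
  · rw [permGL_conj_apply]
    exact hu'.2 _

end Roots

/-! ### Relations in the Hecke algebra -/

section HeckeRelations

variable {G : Type*} [Group G] [Fintype G] {V : Type*} [AddCommGroup V] [Module ℂ V]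
  (ρ : Representation ℂ G V) {U : Subgroup G}

lemma mul_avgOp_mul_eq {K : Subgroup G} {A B C : V →ₗ[ℂ] V}
    (h : ∀ u ∈ K, A * ρ u * B = C) : A * avgOp ρ K * B = C := by
  classical
  rw [mul_avgOp, smul_mul_assoc, Finset.sum_mul]
  have := avg_const K (fun u => A * ρ u * B) C h
  rw [← this]
  congr 1
  refine Finset.sum_congr rfl fun u _ => ?_
  split_ifs
  · rfl
  · rw [zero_mul]

/-- The operator of the double coset of `g`, normalized. -/
def heckeOp (U : Subgroup G) (g : G) : V →ₗ[ℂ] V := avgOp ρ U * ρ g * avgOp ρ U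

lemma heckeOp_mul_mul {a b : G} (ha : a ∈ U) (hb : b ∈ U) (g : G) :
    heckeOp ρ U (a * g * b) = heckeOp ρ U g := by
  rw [heckeOp, map_mul, map_mul, ← mul_assoc, ← mul_assoc, avgOp_mul_rho ρ ha, mul_assoc _ (ρ b),
    rho_mul_avgOp ρ hb, heckeOp]

lemma avgOp_mul_heckeOp (g : G) : avgOp ρ U * heckeOp ρ U g = heckeOp ρ U g := by
  rw [heckeOp, ← mul_assoc, ← mul_assoc, avgOp_idem]

lemma heckeOp_mul_avgOp (g : G) : heckeOp ρ U g * avgOp ρ U = heckeOp ρ U g := by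
  rw [heckeOp, mul_assoc, avgOp_idem]

lemma heckeOp_one : heckeOp ρ U 1 = avgOp ρ U := by
  rw [heckeOp, map_one, mul_one, avgOp_idem]

/-- Expand the middle average over `U`. Since the operators are normalized by averaging projections,
no power of `q` appears in the product. -/
lemma heckeOp_mul_heckeOp {g h k : G} (hu : ∀ u ∈ U, heckeOp ρ U (g * u * h) = heckeOp ρ U k) :
    heckeOp ρ U g * heckeOp ρ U h = heckeOp ρ U k := by
  have h1 : heckeOp ρ U g * heckeOp ρ U h =
      avgOp ρ U * ρ g * avgOp ρ U * (ρ h * avgOp ρ U) := by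
    rw [heckeOp, heckeOp, ← mul_assoc, ← mul_assoc, mul_assoc _ (avgOp ρ U) (avgOp ρ U),
      avgOp_idem, mul_assoc]
  rw [h1]
  refine mul_avgOp_mul_eq ρ fun u hu' => ?_
  rw [← hu u hu', heckeOp, map_mul, map_mul]
  simp only [mul_assoc]

end HeckeRelations

/-! ### Multiplication by a simple reflection when lengths add. -/

section AdjacentRelations

variable {F : Type*} [Field F] {n : ℕ} {k : ℕ} (hk : k + 1 < n)

/-- The index `k`. -/
abbrev leftIdx : Fin n := ⟨k, k.lt_succ_self.trans hk⟩

/-- The index `k + 1`. -/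
abbrev rightIdx : Fin n := ⟨k + 1, hk⟩

lemma leftIdx_lt : leftIdx hk < rightIdx hk := Fin.lt_def.2 (Nat.lt_succ_self k)

/-- The root subgroup at `(k, k + 1)`. -/
abbrev posRoot (c : F) : GL (Fin n) F := rootGL (leftIdx_lt hk).ne c

/-- The root subgroup at `(k + 1, k)`. -/
abbrev negRoot (c : F) : GL (Fin n) F := rootGL (leftIdx_lt hk).ne' c

/-- The simple reflection as a matrix. -/
abbrev adjGL (F : Type*) [Field F] {n k : ℕ} (hk : k + 1 < n) : GL (Fin n) F :=
  permGL F n (adjSwap hk)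

lemma adjGL_inv : (adjGL F hk)⁻¹ = adjGL F hk := by
  rw [← map_inv, inv_eq_of_mul_eq_one_left (adjSwap_mul_self hk)]

lemma adjGL_conj_posRoot (c : F) : adjGL F hk * posRoot hk c * adjGL F hk = negRoot hk c := by
  have h1 := permGL_conj_rootGL (leftIdx_lt hk).ne (adjSwap hk) c
  rw [adjGL_inv hk] at h1
  rw [h1]
  congr 1
  · exact adjSwap_apply_left hk
  · exact adjSwap_apply_right hk

lemma adjGL_conj_mem {u : GL (Fin n) F} (hu : u ∈ upperU F n)
    (h : u.1 (leftIdx hk) (rightIdx hk) = 0) : adjGL F hk * u * adjGL F hk ∈ upperU F n := by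
  have h1 := permGL_conj_mem_upperU (w := adjSwap hk) hu fun a b hba hlt => ?_
  · rwa [adjGL_inv] at h1
  · by_cases hab : (b : ℕ) = k ∧ (a : ℕ) = k + 1
    · have hb : b = leftIdx hk := Fin.ext hab.1
      have ha : a = rightIdx hk := Fin.ext hab.2
      rw [ha, hb, adjSwap_apply_left, adjSwap_apply_right]
      exact h
    · exact absurd hlt (lt_asymm (adjSwap_lt hk hba hab))

variable [Fintype F] [DecidableEq F] {V : Type*} [AddCommGroup V] [Module ℂ V]
  (ρ : Representation ℂ (GL (Fin n) F) V)

/-- Split off from `u` its root element at (k, k + 1). That factor stays in `U` when moved to the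
left past `x`, because `x` preserves the order of `k` and `k + 1`; the remaining factor stays in `U`
after conjugation by the reflection. -/
lemma heckeOp_mul_adjSwap (x : Equiv.Perm (Fin n)) (hx : x (leftIdx hk) < x (rightIdx hk)) :
    heckeOp ρ (upperU F n) (permGL F n x) * heckeOp ρ (upperU F n) (adjGL F hk) =
      heckeOp ρ (upperU F n) (permGL F n (x * adjSwap hk)) := by
  refine heckeOp_mul_heckeOp ρ fun u hu => ?_
  have hu' := mem_upperU.1 hu
  let c := u.1 (leftIdx hk) (rightIdx hk)
  have h1 : posRoot hk (-c) * u ∈ upperU F n :=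
    mul_mem (rootGL_mem_upperU (leftIdx_lt hk) _) hu
  have h2 : (posRoot hk (-c) * u).1 (leftIdx hk) (rightIdx hk) = 0 := by
    rw [rootGL_mul_apply, if_pos rfl, hu'.2]
    simp [c]
  have h3 : permGL F n x * posRoot hk c * (permGL F n x)⁻¹ ∈ upperU F n := by
    rw [permGL_conj_rootGL]
    exact rootGL_mem_upperU hx c
  have h4 : permGL F n x * u * adjGL F hk =
      (permGL F n x * posRoot hk c * (permGL F n x)⁻¹) * permGL F n (x * adjSwap hk) *
        (adjGL F hk * (posRoot hk (-c) * u) * adjGL F hk) := by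
    have h5 : posRoot hk (-c) = (posRoot hk c)⁻¹ := (rootGL_inv _ c).symm
    have h6 : adjGL F hk * adjGL F hk = 1 := by rw [← map_mul, adjSwap_mul_self, map_one]
    rw [map_mul, h5]
    simp only [mul_assoc, inv_mul_cancel_left]
    rw [← mul_assoc (adjGL F hk) (adjGL F hk), h6, one_mul, mul_inv_cancel_left]
  rw [h4, heckeOp_mul_mul ρ h3 (adjGL_conj_mem hk h1 h2)]

lemma adjSwap_mul_heckeOp (x : Equiv.Perm (Fin n)) (hx : x⁻¹ (leftIdx hk) < x⁻¹ (rightIdx hk)) :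
    heckeOp ρ (upperU F n) (adjGL F hk) * heckeOp ρ (upperU F n) (permGL F n x) =
      heckeOp ρ (upperU F n) (permGL F n (adjSwap hk * x)) := by
  refine heckeOp_mul_heckeOp ρ fun u hu => ?_
  have hu' := mem_upperU.1 hu
  let c := u.1 (leftIdx hk) (rightIdx hk)
  have h1 : u * posRoot hk (-c) ∈ upperU F n :=
    mul_mem hu (rootGL_mem_upperU (leftIdx_lt hk) _)
  have h2 : (u * posRoot hk (-c)).1 (leftIdx hk) (rightIdx hk) = 0 := by
    rw [mul_rootGL_apply, if_pos rfl, hu'.2]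
    simp [c]
  have h3 : (permGL F n x)⁻¹ * posRoot hk c * permGL F n x ∈ upperU F n := by
    have := permGL_conj_rootGL (leftIdx_lt hk).ne x⁻¹ c
    rw [map_inv, inv_inv] at this
    rw [this]
    exact rootGL_mem_upperU hx c
  have h4 : adjGL F hk * u * permGL F n x =
      (adjGL F hk * (u * posRoot hk (-c)) * adjGL F hk) * permGL F n (adjSwap hk * x) *
        ((permGL F n x)⁻¹ * posRoot hk c * permGL F n x) := by
    have h5 : posRoot hk (-c) = (posRoot hk c)⁻¹ := (rootGL_inv _ c).symm
    have h6 : adjGL F hk * adjGL F hk = 1 := by rw [← map_mul, adjSwap_mul_self, map_one]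
    rw [map_mul, h5]
    simp only [mul_assoc, mul_inv_cancel_left]
    rw [← mul_assoc (adjGL F hk) (adjGL F hk), h6, one_mul, inv_mul_cancel_left]
  rw [h4, heckeOp_mul_mul ρ (adjGL_conj_mem hk h1 h2) h3]

end AdjacentRelations

/-! ### The quadratic relation of a simple reflection. -/

section Quadratic

variable {F : Type*} [Field F] {n : ℕ} {k : ℕ} (hk : k + 1 < n)

/-- The unipotent matrices that a simple reflection maps to unipotent matrices. -/
def reflU (F : Type*) [Field F] {n k : ℕ} (hk : k + 1 < n) : Subgroup (GL (Fin n) F) :=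
  upperU F n ⊓ (upperU F n).comap (MulAut.conj (adjGL F hk)).toMonoidHom

lemma mem_reflU {g : GL (Fin n) F} :
    g ∈ reflU F hk ↔ g ∈ upperU F n ∧ g.1 (leftIdx hk) (rightIdx hk) = 0 := by
  rw [reflU, Subgroup.mem_inf, Subgroup.mem_comap]
  refine and_congr_right fun hg => ?_
  change adjGL F hk * g * (adjGL F hk)⁻¹ ∈ _ ↔ _
  constructor
  · intro h
    have h1 := (mem_upperU.1 h).1 (rightIdx hk) (leftIdx hk) (leftIdx_lt hk)
    nth_rewrite 1 [← adjGL_inv hk] at h1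
    rw [adjGL_inv hk] at h1
    have h2 := permGL_conj_apply g (adjSwap hk) (rightIdx hk) (leftIdx hk)
    rw [adjGL_inv] at h2
    rw [h2, adjSwap_apply_left, adjSwap_apply_right] at h1
    exact h1
  · intro h
    rw [adjGL_inv]
    exact adjGL_conj_mem hk hg h

lemma blockDet_eq_prod_diag {α : Type*} [LinearOrder α] (b : Fin n → α) (v : α)
    (g : GL (Fin n) F)
    (hg : (∀ i j, j < i → g.1 i j = 0) ∨ ∀ i j, i < j → g.1 i j = 0) :
    blockDet b v g = ∏ a : {a // b a = v}, g.1 a a := by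
  rcases hg with hg | hg
  · exact Matrix.det_of_isUpperTriangular fun i j hij => hg _ _ hij
  · exact Matrix.det_of_isLowerTriangular _ fun i j hij => hg _ _ hij

lemma mem_detGroup_of_diag {α : Type*} [LinearOrder α] {b : Fin n → α} {g : GL (Fin n) F}
    (hb : g ∈ blockGroup F b) (hg : (∀ i j, j < i → g.1 i j = 0) ∨ ∀ i j, i < j → g.1 i j = 0)
    (h1 : ∀ a, g.1 a a = 1) : g ∈ detGroup F b := by
  refine ⟨hb, fun v _ => ?_⟩
  rw [blockDet_eq_prod_diag b v g hg]
  exact Finset.prod_eq_one fun a _ => h1 a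

lemma prod_mergeIdx (f : Fin n → F) (v : ℕ) :
    ∏ a : {a : Fin n // mergeIdx k a = v}, f a =
      ∏ a : Fin n, if mergeIdx k a = v then f a else 1 := by
  rw [← Finset.prod_filter]
  exact (Finset.prod_subtype _ (by simp) _).symm

lemma mem_detGroup_upper {g : GL (Fin n) F} (hg : ∀ i j, j < i → g.1 i j = 0) :
    g ∈ detGroup F (mergeIdx k) ↔ g.1 (leftIdx hk) (leftIdx hk) * g.1 (rightIdx hk) (rightIdx hk)
      = 1 ∧ ∀ a, a ≠ leftIdx hk → a ≠ rightIdx hk → g.1 a a = 1 := by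
  have hb : g ∈ blockGroup F (mergeIdx (n := n) k) := by
    intro i j hij
    refine hg i j (lt_of_not_ge fun hle => ?_)
    exact absurd (mergeIdx_monotone k hle) (not_le.2 hij)
  have hml : mergeIdx k (leftIdx hk) = k := by simp [mergeIdx]
  have hmr : mergeIdx k (rightIdx hk) = k := by simp [mergeIdx]
  have hk1 : blockDet (mergeIdx k) k g =
      g.1 (leftIdx hk) (leftIdx hk) * g.1 (rightIdx hk) (rightIdx hk) := by
    rw [blockDet_eq_prod_diag _ _ _ (Or.inl hg), prod_mergeIdx (fun a => g.1 a a),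
      Finset.prod_eq_mul_of_mem (leftIdx hk) (rightIdx hk) (Finset.mem_univ _) (Finset.mem_univ _)
        (leftIdx_lt hk).ne]
    · rw [if_pos hml, if_pos hmr]
    · rintro a - ⟨ha, ha'⟩
      refine if_neg fun e => ?_
      rcases mergeIdx_eq_iff.1 (e.trans hml.symm) with e | ⟨-, e⟩ | ⟨-, e⟩
      · exact ha e
      · simp at e
      · exact ha' (Fin.ext e)
  have hne : ∀ a, a ≠ leftIdx hk → a ≠ rightIdx hk →
      blockDet (mergeIdx k) (mergeIdx k a) g = g.1 a a := by
    intro a ha ha'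
    rw [blockDet_eq_prod_diag _ _ _ (Or.inl hg), prod_mergeIdx (fun a => g.1 a a),
      Finset.prod_eq_single_of_mem a (Finset.mem_univ _)]
    · rw [if_pos rfl]
    · intro c _ hc
      refine if_neg fun e => ?_
      rcases mergeIdx_eq_iff.1 e with e | ⟨-, e⟩ | ⟨e, -⟩
      · exact hc e
      · exact ha' (Fin.ext e)
      · exact ha (Fin.ext e)
  constructor
  · intro h
    refine ⟨?_, fun a ha ha' => ?_⟩
    · rw [← hk1]
      exact h.2 k (Finset.mem_image.2 ⟨leftIdx hk, Finset.mem_univ _, hml⟩)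
    · rw [← hne a ha ha']
      exact h.2 _ (Finset.mem_image.2 ⟨a, Finset.mem_univ _, rfl⟩)
  · rintro ⟨h1, h2⟩
    refine ⟨hb, fun v hv => ?_⟩
    obtain ⟨a, -, rfl⟩ := Finset.mem_image.1 hv
    by_cases ha : a = leftIdx hk
    · rw [ha, hml, hk1, h1]
    by_cases ha' : a = rightIdx hk
    · rw [ha', hmr, hk1, h1]
    · rw [hne a ha ha', h2 a ha ha']

lemma upperU_le_detGroup {α : Type*} [LinearOrder α] {b : Fin n → α} (hb : Monotone b) :
    upperU F n ≤ detGroup F b := fun _ hg =>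
  mem_detGroup_of_diag (upperU_le_blockGroup hb hg) (Or.inl (mem_upperU.1 hg).1)
    (mem_upperU.1 hg).2

lemma negRoot_mem_detGroup (c : F) : negRoot hk c ∈ detGroup F (mergeIdx k) := by
  refine mem_detGroup_of_diag ?_ (Or.inr fun i j hij => ?_) fun a => ?_
  · intro i j hij
    rw [rootGL_apply, if_neg, if_neg, add_zero]
    · rintro ⟨rfl, rfl⟩
      simp [mergeIdx] at hij
    · rintro rfl
      exact lt_irrefl _ hij
  · rw [rootGL_apply, if_neg hij.ne, if_neg, add_zero]
    rintro ⟨rfl, rfl⟩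
    exact lt_asymm hij (leftIdx_lt hk)
  · rw [rootGL_apply, if_pos rfl, if_neg, add_zero]
    rintro ⟨e, e'⟩
    exact (leftIdx_lt hk).ne (e'.symm.trans e)

/-- The coroot of the simple reflection. -/
def corootGL (t : Fˣ) : GL (Fin n) F :=
  torusGL F n fun a => if a = leftIdx hk then t else if a = rightIdx hk then t⁻¹ else 1

lemma mem_upperTri_detGroup {g : GL (Fin n) F} :
    g ∈ blockGroup F (id : Fin n → Fin n) ⊓ detGroup F (mergeIdx k) ↔
      g ∈ detGroup F (mergeIdx k) ∧ g.1 (rightIdx hk) (leftIdx hk) = 0 := by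
  rw [Subgroup.mem_inf, and_comm]
  refine and_congr_right fun hg => ⟨fun h => h (leftIdx_lt hk), fun h i j hij => ?_⟩
  change j < i at hij
  rcases lt_or_eq_of_le (mergeIdx_monotone k hij.le) with h1 | h1
  · exact hg.1 h1
  · rcases mergeIdx_eq_iff.1 h1 with e | ⟨e, e'⟩ | ⟨e, e'⟩
    · exact absurd e hij.ne
    · have hj : j = leftIdx hk := Fin.ext e
      have hi : i = rightIdx hk := Fin.ext e'
      rw [hi, hj, h]
    · rw [Fin.lt_def] at hij
      omega

lemma mul_corootGL_inv_mem_upperU {g : GL (Fin n) F} (t : Fˣ) :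
    g * (corootGL hk t)⁻¹ ∈ upperU F n ↔
      g ∈ blockGroup F (id : Fin n → Fin n) ⊓ detGroup F (mergeIdx k) ∧
        g.1 (leftIdx hk) (leftIdx hk) = t := by
  have hne : rightIdx hk ≠ leftIdx hk := (leftIdx_lt hk).ne'
  rw [corootGL, ← map_inv, mem_upperU]
  simp only [mul_torusGL_apply, Pi.inv_apply]
  constructor
  · rintro ⟨h1, h2⟩
    have h1' : ∀ i j, j < i → g.1 i j = 0 := fun i j hij =>
      (mul_eq_zero.1 (h1 i j hij)).resolve_right (Units.ne_zero _)
    have hl := h2 (leftIdx hk)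
    have hr := h2 (rightIdx hk)
    rw [if_pos rfl, Units.mul_inv_eq_one] at hl
    rw [if_neg hne, if_pos rfl, inv_inv] at hr
    refine ⟨⟨fun i j hij => h1' i j hij, (mem_detGroup_upper hk h1').2 ⟨?_, fun a ha ha' => ?_⟩⟩, hl⟩
    · rw [hl, mul_comm, hr]
    · have := h2 a
      rwa [if_neg ha, if_neg ha', inv_one, Units.val_one, mul_one] at this
  · rintro ⟨hg, ht⟩
    have h1 : ∀ i j, j < i → g.1 i j = 0 := fun i j hij => hg.1 hij
    obtain ⟨h3, h4⟩ := (mem_detGroup_upper hk h1).1 hg.2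
    refine ⟨fun i j hij => by rw [h1 i j hij, zero_mul], fun a => ?_⟩
    by_cases ha : a = leftIdx hk
    · rw [if_pos ha, ha, Units.mul_inv_eq_one, ht]
    by_cases ha' : a = rightIdx hk
    · rw [if_neg ha, if_pos ha', ha', inv_inv, mul_comm, ← ht, h3]
    · rw [if_neg ha, if_neg ha', inv_one, Units.val_one, mul_one, h4 a ha ha']

/-- The 2 × 2 block of `g` at k, k + 1 has determinant one. Left multiplication by `U` does not
change the bottom row of this block, which is (x, 1 + x y) for the given representative. -/
lemma mul_inv_rootGL_mem_upperU {g : GL (Fin n) F} (x : Fˣ) (y : F) :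
    g * (negRoot hk (x : F) * posRoot hk y)⁻¹ ∈ upperU F n ↔
      g ∈ detGroup F (mergeIdx k) ∧ g.1 (rightIdx hk) (leftIdx hk) = x ∧
        g.1 (rightIdx hk) (rightIdx hk) = 1 + x * y := by
  have hne : rightIdx hk ≠ leftIdx hk := (leftIdx_lt hk).ne'
  have hr : negRoot hk (x : F) * posRoot hk y ∈ detGroup F (mergeIdx (n := n) k) :=
    mul_mem (negRoot_mem_detGroup hk _)
      (upperU_le_detGroup (mergeIdx_monotone k) (rootGL_mem_upperU (leftIdx_lt hk) y))
  constructor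
  · intro hu
    have hu' := mem_upperU.1 hu
    set u := g * (negRoot hk (x : F) * posRoot hk y)⁻¹ with hudef
    have hg : g = u * negRoot hk (x : F) * posRoot hk y := by rw [hudef]; group
    refine ⟨?_, ?_, ?_⟩
    · rw [hg, mul_assoc]
      exact mul_mem (upperU_le_detGroup (mergeIdx_monotone k) hu) hr
    · rw [hg, mul_rootGL_apply, mul_rootGL_apply, if_neg hne.symm, if_pos rfl,
        hu'.1 _ _ (leftIdx_lt hk), hu'.2]
      simp
    · rw [hg, mul_rootGL_apply, if_pos rfl, mul_rootGL_apply, mul_rootGL_apply, if_neg hne,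
        if_pos rfl, hu'.1 _ _ (leftIdx_lt hk), hu'.2]
      simp
  · rintro ⟨hg, hx, hy⟩
    have hQ : g * (negRoot hk (x : F) * posRoot hk y)⁻¹ ∈ detGroup F (mergeIdx (n := n) k) :=
      mul_mem hg (inv_mem hr)
    have he : g * (negRoot hk (x : F) * posRoot hk y)⁻¹ =
        g * posRoot hk (-y) * negRoot hk (-(x : F)) := by
      rw [mul_inv_rev, rootGL_inv, rootGL_inv, mul_assoc]
    set u := g * (negRoot hk (x : F) * posRoot hk y)⁻¹ with hudef
    have h1 : u.1 (rightIdx hk) (leftIdx hk) = 0 := by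
      rw [he, mul_rootGL_apply, if_pos rfl, mul_rootGL_apply, mul_rootGL_apply, if_neg hne.symm,
        if_pos rfl, hx, hy]
      ring
    have h2 : u.1 (rightIdx hk) (rightIdx hk) = 1 := by
      rw [he, mul_rootGL_apply, if_neg hne, mul_rootGL_apply, if_pos rfl, hx, hy]
      ring
    have h3 := (mem_upperTri_detGroup hk).2 ⟨hQ, h1⟩
    have h4 : ∀ i j, j < i → u.1 i j = 0 := fun i j hij => h3.1 hij
    obtain ⟨h5, h6⟩ := (mem_detGroup_upper hk h4).1 hQ
    refine mem_upperU.2 ⟨h4, fun a => ?_⟩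
    by_cases ha : a = leftIdx hk
    · rw [ha]
      rwa [h2, mul_one] at h5
    by_cases ha' : a = rightIdx hk
    · rw [ha', h2]
    · exact h6 a ha ha'

lemma existsUnique_corootGL {g : GL (Fin n) F}
    (hg : g ∈ blockGroup F (id : Fin n → Fin n) ⊓ detGroup F (mergeIdx k)) :
    ∃! t : Fˣ, g * (corootGL hk t)⁻¹ ∈ upperU F n := by
  have h1 : ∀ i j, j < i → g.1 i j = 0 := fun i j hij => hg.1 hij
  obtain ⟨h3, -⟩ := (mem_detGroup_upper hk h1).1 hg.2
  refine ⟨Units.mk0 _ (left_ne_zero_of_mul_eq_one h3), ?_, fun t ht => ?_⟩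
  · exact (mul_corootGL_inv_mem_upperU hk _).2 ⟨hg, rfl⟩
  · exact Units.ext ((mul_corootGL_inv_mem_upperU hk _).1 ht).2.symm

/-- Representatives for the unipotent group in the determinant group of a simple reflection. -/
def detRep : Fˣ ⊕ (Fˣ × F) → GL (Fin n) F :=
  Sum.elim (corootGL hk) fun p => negRoot hk (p.1 : F) * posRoot hk p.2

lemma mem_of_mul_detRep_inv {g : GL (Fin n) F} {i : Fˣ ⊕ (Fˣ × F)}
    (h : g * (detRep hk i)⁻¹ ∈ upperU F n) : g ∈ detGroup F (mergeIdx k) := by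
  rcases i with t | ⟨x, y⟩
  · exact ((mul_corootGL_inv_mem_upperU hk t).1 h).1.2
  · exact ((mul_inv_rootGL_mem_upperU hk x y).1 h).1

/-- The two kinds of representatives are the two Bruhat cells of SL₂, told apart by the lower left
entry. Together they give (q - 1) + (q - 1) q = q² - 1 cosets. -/
lemma existsUnique_detRep {g : GL (Fin n) F} (hg : g ∈ detGroup F (mergeIdx k)) :
    ∃! i, g * (detRep hk i)⁻¹ ∈ upperU F n := by
  by_cases h0 : g.1 (rightIdx hk) (leftIdx hk) = 0
  · have hg' := (mem_upperTri_detGroup hk).2 ⟨hg, h0⟩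
    obtain ⟨t, ht, hu⟩ := existsUnique_corootGL hk hg'
    refine ⟨Sum.inl t, ht, ?_⟩
    rintro (t' | ⟨x, y⟩) h
    · rw [hu t' h]
    · have := ((mul_inv_rootGL_mem_upperU hk x y).1 h).2.1
      rw [h0] at this
      exact absurd this.symm x.ne_zero
  · refine ⟨Sum.inr (Units.mk0 _ h0, (g.1 (rightIdx hk) (rightIdx hk) - 1) /
      g.1 (rightIdx hk) (leftIdx hk)), ?_, ?_⟩
    · refine (mul_inv_rootGL_mem_upperU hk _ _).2 ⟨hg, rfl, ?_⟩
      rw [Units.val_mk0]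
      field_simp
      ring
    · rintro (t' | ⟨x, y⟩) h
      · have := ((mul_corootGL_inv_mem_upperU hk t').1 h).1
        exact absurd ((mem_upperTri_detGroup hk).1 this).2 h0
      · obtain ⟨-, hx, hy⟩ := (mul_inv_rootGL_mem_upperU hk x y).1 h
        have hx' : x = Units.mk0 _ h0 := Units.ext hx.symm
        refine congrArg Sum.inr (Prod.ext hx' ?_)
        change y = (g.1 (rightIdx hk) (rightIdx hk) - 1) / g.1 (rightIdx hk) (leftIdx hk)
        rw [hx, hy, add_sub_cancel_left, mul_div_cancel_left₀ _ x.ne_zero]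

lemma mul_posRoot_inv_mem_reflU {g : GL (Fin n) F} (y : F) :
    g * (posRoot hk y)⁻¹ ∈ reflU F hk ↔
      g ∈ upperU F n ∧ g.1 (leftIdx hk) (rightIdx hk) = y := by
  have hr := rootGL_mem_upperU (leftIdx_lt hk) y
  rw [mem_reflU, (upperU F n).mul_mem_cancel_right (inv_mem hr)]
  refine and_congr_right fun hg => ?_
  rw [rootGL_inv, mul_rootGL_apply, if_pos rfl, (mem_upperU.1 hg).2, one_mul, ← sub_eq_add_neg,
    sub_eq_zero]

variable [Fintype F] [DecidableEq F] {V : Type*} [AddCommGroup V] [Module ℂ V]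
  (ρ : Representation ℂ (GL (Fin n) F) V)

/-- In the middle average write `U` as the union of the cosets of `reflU` by the root subgroup.
Conjugation by the reflection keeps `reflU` inside `U`, so its average is absorbed, and it turns the
root elements into their negatives. -/
lemma heckeOp_adj_sq : (Fintype.card F : ℂ) • (heckeOp ρ (upperU F n) (adjGL F hk) *
    heckeOp ρ (upperU F n) (adjGL F hk)) = ∑ y : F, heckeOp ρ (upperU F n) (negRoot hk y) := by
  have h1 := card_smul_avgOp ρ (U := reflU F hk) (K := upperU F n) (fun y : F => posRoot hk y)
    (fun g y h => ((mul_posRoot_inv_mem_reflU hk y).1 h).1)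
    (fun g hg => ⟨_, (mul_posRoot_inv_mem_reflU hk _).2 ⟨hg, rfl⟩, fun y h =>
      ((mul_posRoot_inv_mem_reflU hk y).1 h).2.symm⟩)
  have h2 := card_transversal (U := reflU F hk) (K := upperU F n) (fun y : F => posRoot hk y)
    (fun g y h => ((mul_posRoot_inv_mem_reflU hk y).1 h).1)
    (fun g hg => ⟨_, (mul_posRoot_inv_mem_reflU hk _).2 ⟨hg, rfl⟩, fun y h =>
      ((mul_posRoot_inv_mem_reflU hk y).1 h).2.symm⟩)
  have hc : (Nat.card (reflU F hk) : ℂ) ≠ 0 := card_subgroup_ne_zero _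
  rw [h2, mul_smul] at h1
  have h3 := smul_right_injective (V →ₗ[ℂ] V) hc h1
  have h4 : avgOp ρ (upperU F n) * ρ (adjGL F hk) * avgOp ρ (reflU F hk) =
      avgOp ρ (upperU F n) * ρ (adjGL F hk) := by
    rw [← mul_one (avgOp ρ (upperU F n) * ρ (adjGL F hk) * avgOp ρ (reflU F hk))]
    refine mul_avgOp_mul_eq ρ fun u hu => ?_
    have hu' := mem_reflU hk |>.1 hu
    have h5 := adjGL_conj_mem hk hu'.1 hu'.2
    have h6 : adjGL F hk * adjGL F hk = 1 := by rw [← map_mul, adjSwap_mul_self, map_one]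
    have h7 : adjGL F hk * u = adjGL F hk * u * adjGL F hk * adjGL F hk := by
      rw [mul_assoc _ (adjGL F hk), h6, mul_one]
    rw [mul_one, mul_assoc, ← map_mul, h7, map_mul, ← mul_assoc, avgOp_mul_rho ρ h5]
  have h8 : heckeOp ρ (upperU F n) (adjGL F hk) * heckeOp ρ (upperU F n) (adjGL F hk) =
      avgOp ρ (upperU F n) * ρ (adjGL F hk) * avgOp ρ (upperU F n) *
        (ρ (adjGL F hk) * avgOp ρ (upperU F n)) := by
    rw [heckeOp, ← mul_assoc, ← mul_assoc, mul_assoc _ (avgOp ρ (upperU F n)) (avgOp ρ (upperU F n)),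
      avgOp_idem, mul_assoc]
  rw [h8, ← smul_mul_assoc, ← mul_smul_comm]
  rw [h3, Finset.mul_sum, Finset.sum_mul]
  refine Finset.sum_congr rfl fun y _ => ?_
  rw [← mul_assoc _ (avgOp ρ (reflU F hk)), h4, heckeOp, ← adjGL_conj_posRoot, map_mul, map_mul]
  simp only [mul_assoc]

/-- The quadratic relation. -/
lemma heckeOp_adj_sq_eq :
    (Fintype.card F : ℂ) ^ 2 • (heckeOp ρ (upperU F n) (adjGL F hk) *
      heckeOp ρ (upperU F n) (adjGL F hk)) =
    (Fintype.card F : ℂ) • avgOp ρ (upperU F n) +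
      ((Fintype.card F : ℂ) ^ 2 - 1) • avgOp ρ (detGroup F (mergeIdx k)) -
      ((Fintype.card F : ℂ) - 1) •
        avgOp ρ (blockGroup F (id : Fin n → Fin n) ⊓ detGroup F (mergeIdx k)) := by
  classical
  set e := avgOp ρ (upperU F n) with he
  set eQ := avgOp ρ (detGroup F (mergeIdx (n := n) k)) with heQ
  set eH := avgOp ρ (blockGroup F (id : Fin n → Fin n) ⊓ detGroup F (mergeIdx k)) with heH
  have hcU : (Nat.card (upperU F n) : ℂ) ≠ 0 := card_subgroup_ne_zero _
  have hF : (Fintype.card Fˣ : ℂ) = Fintype.card F - 1 := by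
    rw [Fintype.card_units, Nat.cast_sub Fintype.card_pos, Nat.cast_one]
  have hUQ : upperU F n ≤ detGroup F (mergeIdx k) := upperU_le_detGroup (mergeIdx_monotone k)
  have hUH : upperU F n ≤ blockGroup F (id : Fin n → Fin n) ⊓ detGroup F (mergeIdx k) :=
    le_inf (upperU_le_blockGroup monotone_id) hUQ
  have hQ : ((Fintype.card F : ℂ) ^ 2 - 1) • eQ = ∑ i, e * ρ (detRep hk i) := by
    have h1 := card_smul_avgOp ρ (U := upperU F n) (detRep hk)
      (fun g i h => mem_of_mul_detRep_inv hk h) (fun g hg => existsUnique_detRep hk hg)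
    rw [card_transversal (U := upperU F n) (detRep hk)
      (fun g i h => mem_of_mul_detRep_inv hk h) (fun g hg => existsUnique_detRep hk hg),
      mul_smul] at h1
    rw [← smul_right_injective (V →ₗ[ℂ] V) hcU h1]
    congr 1
    rw [Fintype.card_sum, Fintype.card_prod]
    push_cast
    rw [hF]
    ring
  have hH : ((Fintype.card F : ℂ) - 1) • eH = ∑ t, e * ρ (corootGL hk t) := by
    have h1 := card_smul_avgOp ρ (U := upperU F n) (corootGL hk)
      (fun g i h => ((mul_corootGL_inv_mem_upperU hk i).1 h).1)
      (fun g hg => existsUnique_corootGL hk hg)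
    rw [card_transversal (U := upperU F n) (corootGL hk)
      (fun g i h => ((mul_corootGL_inv_mem_upperU hk i).1 h).1)
      (fun g hg => existsUnique_corootGL hk hg), mul_smul] at h1
    rw [← smul_right_injective (V →ₗ[ℂ] V) hcU h1, hF]
  have hQe : eQ * e = eQ := avgOp_mul_avgOp ρ hUQ
  have hHe : eH * e = eH := avgOp_mul_avgOp ρ hUH
  -- Multiply the coset expansion by `e` on the right. The representatives of the big cell lose
  -- their factor in the positive root group, so each negative root element is counted `q` times.
  have hQ' : ((Fintype.card F : ℂ) ^ 2 - 1) • eQ = ((Fintype.card F : ℂ) - 1) • eH +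
      (Fintype.card F : ℂ) • ∑ x : Fˣ, heckeOp ρ (upperU F n) (negRoot hk (x : F)) := by
    rw [← hQe, ← smul_mul_assoc, hQ, Fintype.sum_sum_type, add_mul]
    congr 1
    · rw [← hHe, ← smul_mul_assoc, hH]
      rfl
    · rw [Fintype.sum_prod_type, Finset.sum_mul, Finset.smul_sum]
      refine Finset.sum_congr rfl fun x _ => ?_
      have h2 : ∀ y : F, e * ρ (detRep hk (Sum.inr (x, y))) * e =
          heckeOp ρ (upperU F n) (negRoot hk (x : F)) := by
        intro y
        have h3 := heckeOp_mul_mul ρ (one_mem _) (rootGL_mem_upperU (leftIdx_lt hk) y)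
          (negRoot hk (x : F))
        rw [one_mul] at h3
        rw [← h3]
        rfl
      rw [Finset.sum_mul, Finset.sum_congr rfl fun y _ => h2 y, Finset.sum_const, Finset.card_univ,
        ← Nat.cast_smul_eq_nsmul ℂ]
  -- The term `y = 0` is `e`. The nonzero terms are those just expressed through `eQ` and `eH`.
  have hsum : ∑ y : F, heckeOp ρ (upperU F n) (negRoot hk y) =
      e + ∑ x : Fˣ, heckeOp ρ (upperU F n) (negRoot hk (x : F)) := by
    rw [← Finset.add_sum_erase _ _ (Finset.mem_univ (0 : F)), show negRoot hk (0 : F) = 1 from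
      rootGL_zero _, heckeOp_one]
    congr 1
    symm
    refine Finset.sum_bij (fun (x : Fˣ) _ => (x : F)) ?_ ?_ ?_ ?_
    · intro x _
      simp
    · intro x _ y _ h
      exact Units.ext h
    · intro y hy
      exact ⟨Units.mk0 y (Finset.ne_of_mem_erase hy), Finset.mem_univ _, rfl⟩
    · intro x _
      rfl
  rw [hQ', pow_two, mul_smul, heckeOp_adj_sq, hsum, smul_add]
  abel

end Quadratic

end WildCount

end

noncomputable section

namespace WildCount

/-! ### The square of the longest element -/

section Longest

variable {F : Type*} [Field F] [Fintype F] [DecidableEq F] {n : ℕ}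
  {V : Type*} [AddCommGroup V] [Module ℂ V] (ρ : Representation ℂ (GL (Fin n) F) V)

/-- The Hecke operator of a permutation. -/
abbrev permOp (w : Equiv.Perm (Fin n)) : V →ₗ[ℂ] V := heckeOp ρ (upperU F n) (permGL F n w)

lemma revPerm_mul_adjSwap {k : ℕ} (hk : k + 1 < n) (hk' : (n - 2 - k) + 1 < n) :
    (Fin.revPerm : Equiv.Perm (Fin n)) * adjSwap hk = adjSwap hk' * Fin.revPerm := by
  have h1 : Fin.rev (leftIdx hk) = rightIdx hk' := by
    ext
    simp only [Fin.val_rev]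
    omega
  have h2 : Fin.rev (rightIdx hk) = leftIdx hk' := by
    ext
    simp only [Fin.val_rev]
    omega
  have h3 := Equiv.mul_swap_eq_swap_mul (Fin.revPerm : Equiv.Perm (Fin n)) (leftIdx hk)
    (rightIdx hk)
  rw [adjSwap, h3, Fin.revPerm_apply, Fin.revPerm_apply, h1, h2, Equiv.swap_comm, adjSwap]

lemma revPerm_mul_self : (Fin.revPerm : Equiv.Perm (Fin n)) * Fin.revPerm = 1 := by
  ext a
  simp

/-- With y = w₀ s, both w₀ = y s and w₀ = s' y are reduced. Hence T_{w₀} T_s = T_{s'} T_y T_s =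
T_{s'} T_{w₀}. -/
lemma permOp_rev_mul_adj {k : ℕ} (hk : k + 1 < n) (hk' : (n - 2 - k) + 1 < n) :
    permOp ρ Fin.revPerm * permOp ρ (adjSwap hk) =
      permOp ρ (adjSwap hk') * permOp ρ Fin.revPerm := by
  set y : Equiv.Perm (Fin n) := Fin.revPerm * adjSwap hk with hy
  have hrev : y * adjSwap hk = Fin.revPerm := by rw [hy, mul_assoc, adjSwap_mul_self, mul_one]
  have hrev' : adjSwap hk' * y = Fin.revPerm := by
    rw [hy, revPerm_mul_adjSwap hk hk', ← mul_assoc, adjSwap_mul_self, one_mul]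
  have hl : y (leftIdx hk) < y (rightIdx hk) := by
    rw [hy, Equiv.Perm.mul_apply, Equiv.Perm.mul_apply, adjSwap_apply_left, adjSwap_apply_right,
      Fin.revPerm_apply, Fin.revPerm_apply, Fin.rev_lt_rev]
    exact leftIdx_lt hk
  have hr : y⁻¹ (leftIdx hk') < y⁻¹ (rightIdx hk') := by
    have h1 : y (leftIdx hk) = leftIdx hk' := by
      rw [hy, Equiv.Perm.mul_apply, adjSwap_apply_left]
      ext
      simp only [Fin.revPerm_apply, Fin.val_rev]
      omega
    have h2 : y (rightIdx hk) = rightIdx hk' := by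
      rw [hy, Equiv.Perm.mul_apply, adjSwap_apply_right]
      ext
      simp only [Fin.revPerm_apply, Fin.val_rev]
      omega
    rw [← h1, ← h2]
    change y.symm (y _) < y.symm (y _)
    rw [Equiv.symm_apply_apply, Equiv.symm_apply_apply]
    exact leftIdx_lt hk
  have h1 := heckeOp_mul_adjSwap hk ρ y hl
  have h2 := adjSwap_mul_heckeOp hk' ρ y hr
  rw [hrev] at h1
  rw [hrev'] at h2
  rw [permOp, ← h2, mul_assoc, h1, h2]

/-- Passing w₀ reverses the order of the simple reflections, and passing it twice restores each of
them. -/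
lemma permOp_rev_sq_comm_adj {k : ℕ} (hk : k + 1 < n) :
    permOp ρ Fin.revPerm * permOp ρ Fin.revPerm * permOp ρ (adjSwap hk) =
      permOp ρ (adjSwap hk) * (permOp ρ Fin.revPerm * permOp ρ Fin.revPerm) := by
  have hk' : (n - 2 - k) + 1 < n := by omega
  have hk'' : (n - 2 - (n - 2 - k)) + 1 < n := by omega
  have e : adjSwap hk'' = adjSwap hk := by
    have : n - 2 - (n - 2 - k) = k := by omega
    simp only [this]
  rw [mul_assoc, permOp_rev_mul_adj ρ hk hk', ← mul_assoc, permOp_rev_mul_adj ρ hk' hk'', e,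
    mul_assoc]

lemma permOp_rev_sq_comm (w : Equiv.Perm (Fin n)) :
    permOp ρ Fin.revPerm * permOp ρ Fin.revPerm * permOp ρ w =
      permOp ρ w * (permOp ρ Fin.revPerm * permOp ρ Fin.revPerm) := by
  induction w using perm_induction with
  | h1 =>
    rw [permOp, permOp, map_one, heckeOp_one, mul_assoc, heckeOp_mul_avgOp, ← mul_assoc,
      avgOp_mul_heckeOp]
  | hs k hk x hx ih =>
    have h1 := heckeOp_mul_adjSwap hk ρ x hx
    rw [show permOp ρ (x * adjSwap hk) = permOp ρ x * permOp ρ (adjSwap hk) from h1.symm,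
      ← mul_assoc, ih, mul_assoc, permOp_rev_sq_comm_adj, mul_assoc]

omit [Fintype F] [DecidableEq F] in
lemma torusGL_conj_mem_upperU (t : Fin n → Fˣ) (u : GL (Fin n) F) :
    u ∈ upperU F n ↔ torusGL F n t * u * (torusGL F n t)⁻¹ ∈ upperU F n := by
  rw [← map_inv, mem_upperU, mem_upperU]
  simp only [mul_torusGL_apply, torusGL_mul_apply, Pi.inv_apply]
  refine and_congr (forall_congr' fun i => forall_congr' fun j => imp_congr_right fun _ => ?_)
    (forall_congr' fun i => ?_)
  · simp
  · rw [mul_comm, Units.inv_mul_eq_iff_eq_mul]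
    simp

lemma torusGL_comm (t : Fin n → Fˣ) :
    avgOp ρ (upperU F n) * ρ (torusGL F n t) = ρ (torusGL F n t) * avgOp ρ (upperU F n) :=
  avgOp_comm_of_normalizes ρ (torusGL_conj_mem_upperU t)

omit [Fintype F] [DecidableEq F] in
lemma permGL_mul_torusGL (w : Equiv.Perm (Fin n)) (t : Fin n → Fˣ) :
    permGL F n w * torusGL F n t = torusGL F n (t ∘ w.symm) * permGL F n w := by
  refine gl_ext fun i j => ?_
  rw [mul_torusGL_apply, torusGL_mul_apply]
  by_cases h : w j = i
  · subst h
    simp [mul_comm]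
  · have h1 : (permGL F n w).1 i j = 0 := by
      have := mul_permGL_apply (1 : GL (Fin n) F) w i j
      rw [one_mul] at this
      rw [this, Units.val_one, Matrix.one_apply_ne (Ne.symm h)]
    rw [h1, zero_mul, mul_zero]

lemma permOp_mul_torus (w : Equiv.Perm (Fin n)) (t : Fin n → Fˣ) :
    permOp ρ w * ρ (torusGL F n t) = ρ (torusGL F n (t ∘ w.symm)) * permOp ρ w := by
  rw [permOp, heckeOp, mul_assoc, torusGL_comm, ← mul_assoc, mul_assoc _ (ρ (permGL F n w)),
    ← map_mul, permGL_mul_torusGL, map_mul, ← mul_assoc, torusGL_comm]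
  simp only [mul_assoc]

/-- The square of the operator of the longest element is central. -/
lemma permOp_rev_sq_central (g : GL (Fin n) F) :
    permOp ρ Fin.revPerm * permOp ρ Fin.revPerm * heckeOp ρ (upperU F n) g =
      heckeOp ρ (upperU F n) g * (permOp ρ Fin.revPerm * permOp ρ Fin.revPerm) := by
  obtain ⟨u, hu, u', hu', t, w, rfl⟩ := exists_bruhat g
  rw [heckeOp_mul_mul ρ hu hu']
  have h1 : heckeOp ρ (upperU F n) (torusGL F n t * permGL F n w) =
      ρ (torusGL F n t) * permOp ρ w := by
    rw [permOp, heckeOp, heckeOp, map_mul, ← mul_assoc, torusGL_comm]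
    simp only [mul_assoc]
  have h2 : (t ∘ (Fin.revPerm : Equiv.Perm (Fin n)).symm) ∘ (Fin.revPerm : Equiv.Perm (Fin n)).symm
      = t := by
    ext a
    simp
  have h3 : permOp ρ Fin.revPerm * permOp ρ Fin.revPerm * ρ (torusGL F n t) =
      ρ (torusGL F n t) * (permOp ρ Fin.revPerm * permOp ρ Fin.revPerm) := by
    rw [mul_assoc, permOp_mul_torus, ← mul_assoc, permOp_mul_torus, h2, mul_assoc]
  rw [h1, ← mul_assoc, h3, mul_assoc, permOp_rev_sq_comm]
  simp only [mul_assoc]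

variable [FiniteDimensional ℂ V]

/-- The determinant of the operator of a simple reflection on the `U`-invariants. -/
lemma cornerDet_adj_sq {k : ℕ} (hk : k + 1 < n) : ∃ d a m : ℕ,
    LinearMap.trace ℂ V (avgOp ρ (upperU F n)) = d ∧
    LinearMap.trace ℂ V (avgOp ρ (detGroup F (mergeIdx (n := n) k))) = a ∧
    LinearMap.trace ℂ V (avgOp ρ (blockGroup F (id : Fin n → Fin n) ⊓ detGroup F (mergeIdx k))) =
      m ∧
    cornerDet (avgOp ρ (upperU F n)) ((Fintype.card F : ℂ) ^ 2 •
      (permOp ρ (adjSwap hk) * permOp ρ (adjSwap hk))) * (Fintype.card F : ℂ) ^ m =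
        (Fintype.card F : ℂ) ^ (d + 2 * a) := by
  have hq : (Fintype.card F : ℂ) ≠ 0 := by exact_mod_cast Fintype.card_ne_zero
  rw [permOp, heckeOp_adj_sq_eq]
  have hUQ : upperU F n ≤ detGroup F (mergeIdx k) := upperU_le_detGroup (mergeIdx_monotone k)
  have hUH : upperU F n ≤ blockGroup F (id : Fin n → Fin n) ⊓ detGroup F (mergeIdx k) :=
    le_inf (upperU_le_blockGroup monotone_id) hUQ
  have hHQ : blockGroup F (id : Fin n → Fin n) ⊓ detGroup F (mergeIdx k) ≤
      detGroup F (mergeIdx k) := inf_le_right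
  have h1 := avgOp_mul_avgOp' ρ hUQ
  have h2 := avgOp_mul_avgOp' ρ hUH
  have h3 := avgOp_mul_avgOp' ρ hHQ
  obtain ⟨d, hd, hd'⟩ := exists_det_of_idempotent _ (avgOp_idem ρ (K := upperU F n))
  obtain ⟨a, ha, ha'⟩ := exists_det_of_idempotent _
    (avgOp_idem ρ (K := detGroup F (mergeIdx (n := n) k)))
  obtain ⟨m, hm, hm'⟩ := exists_det_of_idempotent _
    (avgOp_idem ρ (K := blockGroup F (id : Fin n → Fin n) ⊓ detGroup F (mergeIdx k)))
  refine ⟨d, a, m, hd, ha, hm, ?_⟩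
  set e := avgOp ρ (upperU F n)
  set eQ := avgOp ρ (detGroup F (mergeIdx (n := n) k))
  set eH := avgOp ρ (blockGroup F (id : Fin n → Fin n) ⊓ detGroup F (mergeIdx k))
  set q := (Fintype.card F : ℂ)
  -- On the ranges of `eQ`, of `eH` beyond `eQ`, of `e` beyond `eH`, and on the kernel of `e`, the
  -- operator is q², 1, q and 1. The factors on the right split this into one idempotent each, with
  -- determinants q^d, q^{-m} and q^{2a}.
  have h4 : q • e + (q ^ 2 - 1) • eQ - (q - 1) • eH + (1 - e) =
      (1 + (q - 1) • e) * (1 + (q⁻¹ - 1) • eH) * (1 + (q ^ 2 - 1) • eQ) := by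
    have h5 : (1 + (q - 1) • e) * (1 + (q⁻¹ - 1) • eH) = 1 + (q - 1) • e - (q - 1) • eH := by
      rw [add_mul, one_mul, mul_add, mul_one, smul_mul_smul_comm, h2]
      have : (q - 1) * (q⁻¹ - 1) = -(q - 1) - (q⁻¹ - 1) := by
        field_simp
        ring
      rw [this]
      module
    rw [h5, mul_add, mul_one, mul_smul_comm, sub_mul, add_mul, one_mul, smul_mul_assoc,
      smul_mul_assoc, h1, h3]
    module
  rw [cornerDet, h4, map_mul, map_mul, hd', ha', hm', inv_pow, ← pow_mul]
  field_simp
  rw [pow_add]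

end Longest

end WildCount

end

noncomputable section

namespace WildCount

/-! ### The scalars by which the square of the longest element acts -/

section Scalar

variable {F : Type*} [Field F] [Fintype F] [DecidableEq F] {n : ℕ}

omit [DecidableEq F] in
lemma card_upperU : Nat.card (upperU F n) = Fintype.card F ^ n.choose 2 := by
  classical
  let Φ : upperU F n → ({p : Fin n × Fin n // p.1 < p.2} → F) := fun u p => u.1.1 p.1.1 p.1.2
  have hΦ : Function.Bijective Φ := by
    constructor
    · intro u u' h
      have hu := mem_upperU.1 u.2
      have hu' := mem_upperU.1 u'.2
      refine Subtype.ext (gl_ext fun i j => ?_)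
      rcases lt_trichotomy i j with hij | rfl | hij
      · exact congrFun h ⟨(i, j), hij⟩
      · rw [hu.2, hu'.2]
      · rw [hu.1 _ _ hij, hu'.1 _ _ hij]
    · intro f
      obtain ⟨u, hu, hM⟩ := exists_upperU (Matrix.of fun i j : Fin n =>
        if h : i < j then f ⟨(i, j), h⟩ else if i = j then 1 else 0)
        (fun i j hij => by simp [hij.not_gt, hij.ne']) (fun i => by simp)
      refine ⟨⟨u, hu⟩, funext fun p => ?_⟩
      change u.1 p.1.1 p.1.2 = _
      rw [hM, Matrix.of_apply, dif_pos p.2]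
  rw [Nat.card_eq_of_bijective Φ hΦ, Nat.card_eq_fintype_card, Fintype.card_fun,
    Fintype.card_subtype, card_lt_pairs]

lemma symInd_adjSwap {m : ℕ} (d : Fin m → ℕ) (h : ∑ i, d i = n) (lam : ∀ i, (d i).Partition)
    {k k' : ℕ} (hk : k + 1 < n) (hk' : k' + 1 < n) :
    symInd d h lam (adjSwap hk) = symInd d h lam (adjSwap hk') := by
  obtain ⟨c, hc⟩ := isConj_iff.1 (Equiv.Perm.isConj_swap (leftIdx_lt hk').ne (leftIdx_lt hk).ne)
  rw [adjSwap, ← hc, symInd_conj, adjSwap]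

lemma symInd_one_ne_zero {m : ℕ} (d : Fin m → ℕ) (h : ∑ i, d i = n)
    (lam : ∀ i, (d i).Partition) : symInd d h lam 1 ≠ 0 := by
  rw [symInd_one]
  refine mul_ne_zero (div_ne_zero (by exact_mod_cast n.factorial_ne_zero) ?_)
    (Finset.prod_ne_zero_iff.2 fun i _ => ?_)
  · exact_mod_cast Finset.prod_ne_zero_iff.2 fun i _ => (d i).factorial_ne_zero
  · exact (isIrrChar_character (spechtRep (lam i)) (charPair_symChar_self _)).one_ne_zero

variable (L : QSet F n)

lemma QSet.charPair_repG : charPair L.repG.character L.repG.character = 1 :=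
  (QSet.charPair_chiG L L).trans (if_pos rfl)

lemma QSet.trace_avgOp_upperU : LinearMap.trace ℂ _ (avgOp L.repG (upperU F n)) =
    symInd L.size L.sum_size L.part 1 := by
  classical
  rw [trace_avgOp, ← avg_upperU_levChar (F := F)]
  simp only [← L.chiG_eq]
  rfl

lemma QSet.trace_avgOp_merge {k : ℕ} (hk : k + 1 < n) :
    2 * LinearMap.trace ℂ _ (avgOp L.repG (detGroup F (mergeIdx (n := n) k))) -
      LinearMap.trace ℂ _ (avgOp L.repG (blockGroup F (id : Fin n → Fin n) ⊓
        detGroup F (mergeIdx k))) = symInd L.size L.sum_size L.part (adjSwap hk) := by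
  classical
  rw [trace_avgOp, trace_avgOp, ← avg_mergeIdx_levChar (F := F)]
  simp only [← L.chiG_eq]
  rfl

lemma cornerDet_smul_avgOp {V : Type*} [AddCommGroup V] [Module ℂ V] [FiniteDimensional ℂ V]
    (ρ : Representation ℂ (GL (Fin n) F) V) {d : ℕ}
    (hd : LinearMap.trace ℂ V (avgOp ρ (upperU F n)) = d) (z : ℂ) :
    cornerDet (avgOp ρ (upperU F n)) (z • avgOp ρ (upperU F n)) = z ^ d := by
  obtain ⟨d', h1, h2⟩ := exists_det_of_idempotent _ (avgOp_idem ρ (K := upperU F n))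
  have : d' = d := by exact_mod_cast h1.symm.trans hd
  rw [← this, ← h2 z, cornerDet]
  congr 1
  module

/-- The determinant of the operator of a permutation. -/
lemma cornerDet_permOp {V : Type*} [AddCommGroup V] [Module ℂ V] [FiniteDimensional ℂ V]
    (ρ : Representation ℂ (GL (Fin n) F) V) {d : ℕ} {τ : ℤ}
    (hd : LinearMap.trace ℂ V (avgOp ρ (upperU F n)) = d)
    (hτ : ∀ (k : ℕ), k + 1 < n →
      2 * LinearMap.trace ℂ V (avgOp ρ (detGroup F (mergeIdx (n := n) k))) -
        LinearMap.trace ℂ V (avgOp ρ (blockGroup F (id : Fin n → Fin n) ⊓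
          detGroup F (mergeIdx k))) = τ)
    (w : Equiv.Perm (Fin n)) :
    cornerDet (avgOp ρ (upperU F n)) (permOp ρ w) ^ 2 =
      ((Fintype.card F : ℂ) ^ (τ - d)) ^ (inversions w).card := by
  have hq : (Fintype.card F : ℂ) ≠ 0 := by exact_mod_cast Fintype.card_ne_zero
  have hee := avgOp_idem ρ (K := upperU F n)
  induction w using perm_induction with
  | h1 => rw [permOp, map_one, heckeOp_one, cornerDet_self, inversions_one]; simp
  | hs k hk x hx ih =>
    have h1 := heckeOp_mul_adjSwap hk ρ x hx
    rw [permOp, ← h1, cornerDet_mul hee (heckeOp_mul_avgOp _ _) (avgOp_mul_heckeOp _ _), mul_pow, ih,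
      card_inversions_mul_adjSwap hk x hx, pow_succ _ (inversions x).card]
    congr 1
    obtain ⟨d', a, m, hd', ha, hm, h2⟩ := cornerDet_adj_sq ρ hk
    have hdd : d' = d := by exact_mod_cast hd'.symm.trans hd
    have h3 := hτ k hk
    rw [ha, hm] at h3
    have h4 : 2 * (a : ℤ) - m = τ := by exact_mod_cast h3
    rw [cornerDet_smul _ _ hee (by rw [← mul_assoc, avgOp_mul_heckeOp]),
      cornerDet_smul_avgOp ρ hd, cornerDet_mul hee (heckeOp_mul_avgOp _ _) (avgOp_mul_heckeOp _ _),
      hdd] at h2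
    rw [pow_two (cornerDet _ _)]
    have h5 : ((Fintype.card F : ℂ) ^ 2) ^ d * (Fintype.card F : ℂ) ^ m ≠ 0 :=
      mul_ne_zero (pow_ne_zero _ (pow_ne_zero _ hq)) (pow_ne_zero _ hq)
    refine mul_left_cancel₀ h5 ?_
    -- Removing the factor q² from the d-dimensional corner gives determinant q^{d + 2a - m - 2d},
    -- which is q^{τ - d}.
    calc _ = (Fintype.card F : ℂ) ^ (d + 2 * a) := by rw [← h2]; ring
      _ = _ := by
        rw [← pow_mul, ← pow_add, ← zpow_natCast, ← zpow_natCast, ← zpow_add₀ hq]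
        congr 1
        push_cast
        omega

/-- The square of the operator of the longest element, in the normalization of indicator
functions, acts on `V_Λ^U` by `q ^ f_Λ`. -/
lemma QSet.exists_scalar : ∃ c : ℂ,
    permOp L.repG Fin.revPerm * permOp L.repG Fin.revPerm = c • avgOp L.repG (upperU F n) ∧
    ∀ r : ℕ, ((Nat.card (upperU F n) : ℂ) ^ 2 * c) ^ r = (Fintype.card F : ℂ) ^ ((r : ℂ) * L.f) := by
  have hqN : 0 < Fintype.card F := Fintype.card_pos
  have hq : (Fintype.card F : ℂ) ≠ 0 := by exact_mod_cast Fintype.card_ne_zero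
  have hqR : (0 : ℝ) < Fintype.card F := by exact_mod_cast hqN
  have hee := avgOp_idem L.repG (K := upperU F n)
  obtain ⟨d, hd, -⟩ := exists_det_of_idempotent _ hee
  have hd1 : symInd L.size L.sum_size L.part 1 = d := L.trace_avgOp_upperU.symm.trans hd
  have hd0 : d ≠ 0 := by
    rintro rfl
    exact symInd_one_ne_zero L.size L.sum_size L.part (by rw [hd1, Nat.cast_zero])
  have htr : LinearMap.trace ℂ _ (avgOp L.repG (upperU F n)) ≠ 0 := by
    rw [hd]
    exact_mod_cast hd0
  -- All adjacent transpositions are conjugate, and the common value is an integer because traces of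
  -- projections are. For `n < 2` there is no transposition and any value serves.
  obtain ⟨τ, hτ⟩ : ∃ τ : ℤ, ∀ (k : ℕ) (hk : k + 1 < n),
      symInd L.size L.sum_size L.part (adjSwap hk) = τ := by
    by_cases hn : 0 + 1 < n
    · obtain ⟨d', a, m, hd', ha, hm, -⟩ := cornerDet_adj_sq L.repG hn
      refine ⟨2 * a - m, fun k hk => ?_⟩
      rw [symInd_adjSwap _ _ _ hk hn, ← L.trace_avgOp_merge, ha, hm]
      push_cast
      rfl
    · exact ⟨0, fun k hk => absurd hk (by omega)⟩
  obtain ⟨c, hc⟩ := eq_smul_of_corner_central L.repG L.charPair_repG (upperU F n) htr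
    (permOp L.repG Fin.revPerm * permOp L.repG Fin.revPerm)
    (by rw [← mul_assoc, avgOp_mul_heckeOp]) (by rw [mul_assoc, heckeOp_mul_avgOp])
    (permOp_rev_sq_central L.repG)
  refine ⟨c, hc, ?_⟩
  -- The determinant determines only the `d`-th power of the scalar; being real and nonnegative
  -- makes the root unique.
  obtain ⟨x, hx, rfl⟩ := nonneg_of_sq_eq_smul L.repG (upperU F n) (permGL F n Fin.revPerm)
    (by rw [← map_inv, inv_eq_of_mul_eq_one_left revPerm_mul_self])
    (fun h0 => htr (by rw [h0, map_zero])) c (by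
      rw [← hc, permOp, heckeOp]
      simp only [mul_assoc]
      rw [← mul_assoc (avgOp L.repG (upperU F n)) (avgOp L.repG (upperU F n)), hee])
  have h1 := cornerDet_permOp L.repG hd (fun k hk => (L.trace_avgOp_merge hk).trans (hτ k hk)) Fin.revPerm
  rw [inversions_rev, card_lt_pairs, pow_two, ← cornerDet_mul hee (heckeOp_mul_avgOp _ _)
    (avgOp_mul_heckeOp _ _), hc, cornerDet_smul_avgOp L.repG hd] at h1
  have h2 : x ^ d = ((Fintype.card F : ℝ) ^ (τ - d)) ^ n.choose 2 := by
    refine Complex.ofReal_injective ?_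
    push_cast
    exact h1
  set N := n.choose 2 with hN
  set X : ℝ := (Fintype.card F : ℝ) ^ (2 * N) * x with hX
  have hX0 : 0 ≤ X := mul_nonneg (pow_nonneg hqR.le _) hx
  have h3 : X ^ d = (Fintype.card F : ℝ) ^ ((N : ℝ) * (d + τ)) := by
    rw [hX, mul_pow, h2, ← pow_mul, ← Real.rpow_natCast, ← Real.rpow_intCast, ← Real.rpow_natCast,
      ← Real.rpow_mul hqR.le, ← Real.rpow_add hqR]
    congr 1
    push_cast
    ring
  -- Here `X` is |U|² times the scalar, as |U| = q^N.
  have h4 : X = (Fintype.card F : ℝ) ^ ((N : ℝ) * (1 + τ / d)) := by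
    rw [← Real.pow_rpow_inv_natCast hX0 hd0, h3, ← Real.rpow_mul hqR.le]
    congr 1
    have : (d : ℝ) ≠ 0 := by exact_mod_cast hd0
    field_simp
  have hf : L.f = (((N : ℝ) * (1 + τ / d) : ℝ) : ℂ) := by
    rw [QSet.f]
    split_ifs with hn
    · have hs := hτ 0 (by omega)
      rw [L.chiN_inr, L.chiN_one, hd1]
      rw [show Equiv.swap (⟨0, by omega⟩ : Fin n) ⟨1, by omega⟩ = adjSwap (k := 0) (by omega)
        from rfl, hs]
      push_cast
      rfl
    -- For `n < 2` the value 0 chosen for `f` agrees with the general formula because the binomial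
    -- coefficient vanishes.
    · have : N = 0 := Nat.choose_eq_zero_of_lt (by omega)
      rw [this]
      simp
  intro r
  have h5 : ((Nat.card (upperU F n) : ℂ) ^ 2 * x) = (X : ℂ) := by
    rw [card_upperU, hX]
    push_cast
    ring
  rw [h5, h4, hf, ← Complex.ofReal_pow, ← Real.rpow_natCast, ← Real.rpow_mul hqR.le, mul_comm (r : ℂ),
    Complex.ofReal_cpow hqR.le]
  push_cast
  rfl

end Scalar

end WildCount

end

noncomputable section

namespace WildCount

/-! ### Characters of the Hecke algebra -/

section HeckeCharacters

variable {G : Type*} [Group G] [Fintype G] {V : Type*} [AddCommGroup V] [Module ℂ V]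
  [FiniteDimensional ℂ V] (ρ : Representation ℂ G V) (H : Subgroup G)

/-- The operator maps all of `V` into the invariants, so its trace on `V` is its trace there. -/
lemma invariantsCharacter_eq (φ : heckeAlgebra H) :
    invariantsCharacter H ρ φ = (Nat.card H : ℂ)⁻¹ * ∑ a, φ.1 a * ρ.character a := by
  refine (LinearMap.trace_restrict_eq_of_forall_mem
    (Representation.invariants (ρ.comp H.subtype)) _ ?_).trans ?_
  rotate_left
  · simp only [map_smul, map_sum, smul_eq_mul]
    rfl
  · intro x h
    simp only [LinearMap.smul_apply, LinearMap.sum_apply, MonoidHom.comp_apply, map_smul,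
      map_sum, Subgroup.coe_subtype]
    congr 1
    refine Fintype.sum_equiv (Equiv.mulLeft (h : G)) _ _ fun a => ?_
    have h1 := φ.2 (h : G) h.2 1 H.one_mem a
    rw [mul_one] at h1
    rw [Equiv.coe_mulLeft, h1, map_mul]
    rfl

/-- Frobenius reciprocity: evaluation at `1` of the homomorphisms to `Ind_H^G 1`. -/
def multEval : multSpace H ρ →ₗ[ℂ] Module.Dual ℂ V where
  toFun A :=
    { toFun := fun v => (A.1 v).1 1
      map_add' := fun v w => by rw [map_add]; rfl
      map_smul' := fun c v => by rw [map_smul]; rfl }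
  map_add' A B := rfl
  map_smul' c A := rfl

omit [Fintype G] [FiniteDimensional ℂ V] in
lemma multSpace_apply (A : multSpace H ρ) (v : V) (x : G) :
    (A.1 v).1 x = (A.1 (ρ x v)).1 1 := by
  have h1 := LinearMap.congr_fun (A.2 x) v
  rw [LinearMap.comp_apply, LinearMap.comp_apply] at h1
  rw [h1]
  change _ = (A.1 v).1 (1 * x)
  rw [one_mul]

omit [Fintype G] [FiniteDimensional ℂ V] in
lemma multEval_injective : Function.Injective (multEval ρ H) := by
  intro A B h
  refine Subtype.ext (LinearMap.ext fun v => Subtype.ext (funext fun x => ?_))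
  rw [multSpace_apply ρ H A, multSpace_apply ρ H B]
  exact LinearMap.congr_fun h (ρ x v)

/-- Evaluation at 1 embeds the multiplicity space in the dual of `V`. There `φ` acts as the
transpose of `B`, in which `a⁻¹` occurs because the action on functions involves y⁻¹. This transpose
maps the whole dual into the image of the embedding, so the trace is that of `B`. -/
lemma heckeCharacter_eq (φ : heckeAlgebra H) :
    heckeCharacter H ρ φ = (Nat.card H : ℂ)⁻¹ * ∑ a, φ.1 a * ρ.character a⁻¹ := by
  let B : V →ₗ[ℂ] V := (Nat.card H : ℂ)⁻¹ • ∑ a : G, φ.1 a • ρ a⁻¹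
  have hB : ∀ h ∈ H, B * ρ h = B := by
    intro h hh
    simp only [B, smul_mul_assoc, Finset.sum_mul, ← map_mul]
    congr 1
    refine Fintype.sum_equiv (Equiv.mulLeft h⁻¹) _ _ fun a => ?_
    have h1 := φ.2 h⁻¹ (H.inv_mem hh) 1 H.one_mem a
    rw [mul_one] at h1
    rw [Equiv.coe_mulLeft, h1, mul_inv_rev, inv_inv]
  let E := LinearEquiv.ofInjective (multEval ρ H) (multEval_injective ρ H)
  have hr : ∀ l : Module.Dual ℂ V, Module.Dual.transpose (R := ℂ) B l ∈
      LinearMap.range (multEval ρ H) := by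
    intro l
    let A : V →ₗ[ℂ] Representation.coindV H.subtype (Representation.trivial ℂ H ℂ) :=
      { toFun := fun v => ⟨fun x => l (B (ρ x v)), fun h x => by
          change l (B (ρ (h * x) v)) = l (B (ρ x v))
          rw [map_mul]
          change l ((B * ρ h) (ρ x v)) = _
          rw [hB h h.2]⟩
        map_add' := fun v w => Subtype.ext (funext fun x => by simp)
        map_smul' := fun c v => Subtype.ext (funext fun x => by simp) }
    refine ⟨⟨A, fun g => LinearMap.ext fun v => Subtype.ext (funext fun x => ?_)⟩,
      LinearMap.ext fun v => ?_⟩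
    · change l (B (ρ x (ρ g v))) = l (B (ρ (x * g) v))
      rw [map_mul]
      rfl
    · change l (B (ρ 1 v)) = l (B v)
      rw [map_one]
      rfl
  have h1 : E.conj (heckeOnMult H ρ φ) =
      (Module.Dual.transpose (R := ℂ) B).restrict (fun l _ => hr l) := by
    apply LinearMap.ext
    intro y
    obtain ⟨A, rfl⟩ := E.surjective y
    rw [LinearEquiv.conj_apply_apply, LinearEquiv.symm_apply_apply]
    refine Subtype.ext (LinearMap.ext fun v => ?_)
    change (Nat.card H : ℂ)⁻¹ * ∑ y : G, φ.1 y * (A.1 v).1 (y⁻¹ * 1) = (A.1 (B v)).1 1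
    have h2 : ∀ w, (A.1 w).1 1 = multEval ρ H A w := fun w => rfl
    rw [h2]
    simp only [B, LinearMap.smul_apply, LinearMap.sum_apply, map_smul, map_sum, smul_eq_mul]
    congr 1
    refine Finset.sum_congr rfl fun y _ => ?_
    rw [mul_one, multSpace_apply]
    rfl
  let m : Module ℂ (multSpace H ρ) := inferInstance
  let g : AddCommGroup (multSpace H ρ) := Module.addCommMonoidToAddCommGroup ℂ
  refine (@LinearMap.trace_conj' ℂ _ (multSpace H ρ) g m
    (LinearMap.range (multEval ρ H)) _ _ (heckeOnMult H ρ φ) E).symm.trans ?_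
  rw [h1]
  refine (LinearMap.trace_restrict_eq_of_forall_mem _ _ hr).trans ?_
  refine (LinearMap.trace_transpose' B).trans ?_
  simp only [B, map_smul, map_sum, smul_eq_mul]
  rfl

/-- As `v` normalizes `H`, the double coset H v H is the single coset H v. -/
lemma invariantsCharacter_heckeT {v : G} (hv : ∀ k, k ∈ H ↔ v * k * v⁻¹ ∈ H) :
    invariantsCharacter H ρ (heckeT H v) = LinearMap.trace ℂ V (avgOp ρ H * ρ v) := by
  classical
  rw [invariantsCharacter_eq, trace_avgOp_mul]
  congr 1
  symm
  refine Fintype.sum_equiv (Equiv.mulRight v) _ _ fun k => ?_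
  have h1 : k * v ∈ DoubleCoset.doubleCoset v (H : Set G) (H : Set G) ↔ k ∈ H := by
    rw [DoubleCoset.mem_doubleCoset]
    constructor
    · rintro ⟨x, hx, y, hy, e⟩
      have : k = x * (v * y * v⁻¹) := by
        rw [eq_mul_inv_of_mul_eq e]
        group
      rw [this]
      exact mul_mem hx ((hv y).1 hy)
    · intro hk
      exact ⟨k, hk, 1, one_mem _, by rw [mul_one]⟩
  change _ = (DoubleCoset.doubleCoset v (H : Set G) (H : Set G)).indicator 1 (k * v) *
    ρ.character (k * v)
  by_cases hk : k ∈ H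
  · rw [if_pos hk, Set.indicator_of_mem (h1.2 hk), Pi.one_apply, one_mul]
  · rw [if_neg hk, Set.indicator_of_notMem fun h => hk (h1.1 h), zero_mul]

lemma heckeCharacter_heckeT (v : G) :
    heckeCharacter H ρ (heckeT H v) = invariantsCharacter H ρ (heckeT H v⁻¹) := by
  rw [heckeCharacter_eq, invariantsCharacter_eq]
  congr 1
  refine Fintype.sum_equiv (Equiv.inv G) _ _ fun a => ?_
  rw [Equiv.inv_apply]
  congr 1
  have h1 : a⁻¹ ∈ DoubleCoset.doubleCoset v⁻¹ (H : Set G) (H : Set G) ↔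
      a ∈ DoubleCoset.doubleCoset v (H : Set G) (H : Set G) := by
    rw [DoubleCoset.mem_doubleCoset, DoubleCoset.mem_doubleCoset]
    constructor
    · rintro ⟨x, hx, y, hy, e⟩
      exact ⟨y⁻¹, H.inv_mem hy, x⁻¹, H.inv_mem hx, by rw [← inv_inv a, e]; group⟩
    · rintro ⟨x, hx, y, hy, e⟩
      exact ⟨y⁻¹, H.inv_mem hy, x⁻¹, H.inv_mem hx, by rw [e]; group⟩
  change (DoubleCoset.doubleCoset v (H : Set G) (H : Set G)).indicator 1 a =
    (DoubleCoset.doubleCoset v⁻¹ (H : Set G) (H : Set G)).indicator 1 a⁻¹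
  by_cases ha : a ∈ DoubleCoset.doubleCoset v (H : Set G) (H : Set G)
  · rw [Set.indicator_of_mem ha, Set.indicator_of_mem (h1.2 ha)]
    rfl
  · rw [Set.indicator_of_notMem ha, Set.indicator_of_notMem fun h => ha (h1.1 h)]

end HeckeCharacters

/-! ### Sums over products of Stokes data -/

section Products

lemma sum_prod_ofFn {X R : Type*} [Fintype X] [Ring R] (f : X → R) (r : ℕ) :
    ∑ S : Fin r → X, (List.ofFn fun i => f (S i)).prod = (∑ x, f x) ^ r := by
  induction r with
  | zero => simp
  | succ r ih =>
    rw [← Equiv.sum_comp (Fin.consEquiv fun _ => X), Fintype.sum_prod_type, pow_succ', Finset.sum_mul]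
    refine Finset.sum_congr rfl fun x _ => ?_
    rw [← ih, Finset.mul_sum]
    refine Finset.sum_congr rfl fun S _ => ?_
    rw [List.ofFn_succ, List.prod_cons]
    simp [Fin.consEquiv]

lemma prod_ofFn_rev_inv {G : Type*} [Group G] {r : ℕ} (a : Fin r → G) :
    (List.ofFn fun i => a i.rev).prod⁻¹ = (List.ofFn fun i => (a i)⁻¹).prod := by
  induction r with
  | zero => simp
  | succ r ih =>
    rw [List.ofFn_succ', List.concat_eq_append, List.prod_append, mul_inv_rev, List.ofFn_succ,
      List.prod_cons, List.prod_cons, ← ih fun i => a i.succ]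
    simp [Fin.rev_castSucc]

variable {G : Type*} [Group G] [Fintype G] {V : Type*} [AddCommGroup V] [Module ℂ V]
  (ρ : Representation ℂ G V)

lemma sum_inv_eq_avgOp (K : Subgroup G) [Fintype K] :
    ∑ k : K, ρ ((k : G)⁻¹) = (Nat.card K : ℂ) • avgOp ρ K := by
  classical
  rw [avgOp, smul_inv_smul₀ (card_subgroup_ne_zero K), ← Finset.sum_filter]
  refine (Fintype.sum_equiv (Equiv.inv K) _ (fun k : K => ρ k) fun k => rfl).trans ?_
  exact (Finset.sum_subtype _ (by simp) _).symm

lemma avgOp_of_conj {K K' : Subgroup G} {g : G} (h : ∀ k, k ∈ K' ↔ g * k * g⁻¹ ∈ K) :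
    avgOp ρ K' = ρ g⁻¹ * avgOp ρ K * ρ g ∧ Nat.card K' = Nat.card K := by
  classical
  have hcard : Nat.card K' = Nat.card K :=
    Nat.card_congr ((MulAut.conj g).toEquiv.subtypeEquiv fun k => h k)
  refine ⟨?_, hcard⟩
  rw [avgOp, avgOp, hcard, mul_smul_comm, smul_mul_assoc, Finset.mul_sum, Finset.sum_mul]
  congr 1
  refine Fintype.sum_equiv (MulAut.conj g).toEquiv _ _ fun k => ?_
  change _ = ρ g⁻¹ * (if g * k * g⁻¹ ∈ K then ρ (g * k * g⁻¹) else 0) * ρ g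
  simp only [← h]
  split_ifs
  · rw [← map_mul, ← map_mul]
    congr 1
    group
  · rw [mul_zero, zero_mul]

end Products

end WildCount

end

noncomputable section

namespace WildCount

/-! ### The count -/

section Count

variable {F : Type*} [Field F] {n : ℕ}

lemma exists_torusGL_of_isDiag {v : GL (Fin n) F} (hv : (v : Matrix (Fin n) (Fin n) F).IsDiag) :
    ∃ t, v = torusGL F n t := by
  have h1 : ∀ i, v.1 i i ≠ 0 := by
    intro i h0
    have h2 : IsUnit v.1.det := (Matrix.isUnit_iff_isUnit_det _).1 v.isUnit
    rw [← hv.diagonal_diag, Matrix.det_diagonal] at h2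
    exact h2.ne_zero (Finset.prod_eq_zero (Finset.mem_univ i) h0)
  refine ⟨fun i => Units.mk0 _ (h1 i), gl_ext fun i j => ?_⟩
  rw [torusGL_apply]
  split_ifs with hij
  · rw [hij]
    rfl
  · exact hv hij

lemma mem_lowerU {g : GL (Fin n) F} : g ∈ lowerU F n ↔
    (∀ i j, i < j → (g : Matrix (Fin n) (Fin n) F) i j = 0) ∧
      ∀ i, (g : Matrix (Fin n) (Fin n) F) i i = 1 := by
  constructor
  · rintro ⟨h1, h2⟩
    exact ⟨fun i j hij => h1 (OrderDual.toDual_lt_toDual.2 hij), h2⟩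
  · rintro ⟨h1, h2⟩
    exact ⟨fun i j hij => h1 i j (OrderDual.toDual_lt_toDual.1 hij), h2⟩

/-- The matrix of the longest permutation. -/
abbrev revGL (F : Type*) [Field F] (n : ℕ) : GL (Fin n) F := permGL F n Fin.revPerm

lemma revGL_inv : (revGL F n)⁻¹ = revGL F n := by
  rw [← map_inv, inv_eq_of_mul_eq_one_left revPerm_mul_self]

lemma mem_lowerU_iff (g : GL (Fin n) F) :
    g ∈ lowerU F n ↔ revGL F n * g * (revGL F n)⁻¹ ∈ upperU F n := by
  have h1 : ∀ i j, (revGL F n * g * (revGL F n)⁻¹).1 i j = g.1 i.rev j.rev := by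
    intro i j
    have := permGL_conj_apply g Fin.revPerm i j
    rw [revGL_inv] at this ⊢
    exact this
  rw [mem_lowerU, mem_upperU]
  simp only [h1]
  constructor
  · rintro ⟨h2, h3⟩
    exact ⟨fun i j hij => h2 _ _ (Fin.rev_lt_rev.2 hij), fun i => h3 _⟩
  · rintro ⟨h2, h3⟩
    refine ⟨fun i j hij => ?_, fun i => ?_⟩
    · have := h2 i.rev j.rev (Fin.rev_lt_rev.2 hij)
      rwa [Fin.rev_rev, Fin.rev_rev] at this
    · have := h3 i.rev
      rwa [Fin.rev_rev] at this

/-- The product of Stokes data. -/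
abbrev stokesProd {r : ℕ} (S : Fin r → upperU F n × lowerU F n) : GL (Fin n) F :=
  (List.ofFn fun i : Fin r => ((S i.rev).2 : GL (Fin n) F) * ((S i.rev).1 : GL (Fin n) F)).prod

-- The rightmost factor of the product is S_1, an arbitrary element of `U₊`, so right multiplication
-- by `u` can be absorbed there. This needs at least one pair of factors.
open scoped Classical in
lemma exists_equiv_stokesProd {r : ℕ} (hr : 0 < r) {u : GL (Fin n) F} (hu : u ∈ upperU F n) :
    ∃ e : (Fin r → upperU F n × lowerU F n) ≃ (Fin r → upperU F n × lowerU F n),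
      ∀ S, stokesProd (e S) = stokesProd S * u := by
  obtain ⟨m, rfl⟩ := Nat.exists_eq_succ_of_ne_zero hr.ne'
  -- The product runs through the indices in reverse, so index 0 supplies the last factor.
  refine ⟨Equiv.piCongrRight fun i => if i = 0 then
    (Equiv.mulRight (⟨u, hu⟩ : upperU F n)).prodCongr (Equiv.refl _) else Equiv.refl _, fun S => ?_⟩
  simp only [stokesProd]
  rw [List.ofFn_succ', List.ofFn_succ', List.concat_eq_append, List.concat_eq_append,
    List.prod_append, List.prod_append, mul_assoc]
  congr 1
  · congr 2
    funext i
    have h0 : i.castSucc.rev ≠ 0 := by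
      rw [Fin.rev_castSucc]
      exact Fin.succ_ne_zero _
    simp [Equiv.piCongrRight_apply, h0]
  · simp [Equiv.piCongrRight_apply, mul_assoc]

variable [Fintype F] [DecidableEq F]

/-- The number of Stokes data with a given monodromy. -/
def stokesFun (r : ℕ) (v h : GL (Fin n) F) : ℂ :=
  Nat.card {S : Fin r → upperU F n × lowerU F n // h = v * stokesProd S}

omit [Fintype F] [DecidableEq F] in
lemma stokesFun_mul {r : ℕ} (hr : 0 < r) (v h : GL (Fin n) F) {u : GL (Fin n) F}
    (hu : u ∈ upperU F n) : stokesFun r v (h * u) = stokesFun r v h := by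
  obtain ⟨e, he⟩ := exists_equiv_stokesProd hr hu
  refine congrArg (Nat.cast (R := ℂ)) (Nat.card_congr (e.subtypeEquiv fun S => ?_)).symm
  rw [he, ← mul_assoc, mul_left_inj]

lemma stokesCount_eq_sum (r : ℕ) (v g : GL (Fin n) F) :
    (stokesCount r v g : ℂ) = ∑ x, stokesFun r v (x * g * x⁻¹) := by
  have e : {x : GL (Fin n) F × (Fin r → upperU F n × lowerU F n) //
      x.1 * g * x.1⁻¹ = v * stokesProd x.2} ≃
      Σ x : GL (Fin n) F, {S : Fin r → upperU F n × lowerU F n //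
        x * g * x⁻¹ = v * stokesProd S} :=
    { toFun := fun x => ⟨x.1.1, x.1.2, x.2⟩
      invFun := fun x => ⟨(x.1, x.2.1), x.2.2⟩
      left_inv := fun x => rfl
      right_inv := fun x => rfl }
  have h1 : stokesCount r v g = ∑ x : GL (Fin n) F, Nat.card
      {S : Fin r → upperU F n × lowerU F n // x * g * x⁻¹ = v * stokesProd S} := by
    rw [← Nat.card_sigma]
    exact Nat.card_congr e
  rw [h1]
  push_cast
  rfl

open scoped Classical in
lemma sum_stokesFun_mul (r : ℕ) (v : GL (Fin n) F) (f : GL (Fin n) F → ℂ) :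
    ∑ h, stokesFun r v h * f h = ∑ S : Fin r → upperU F n × lowerU F n, f (v * stokesProd S) := by
  have h1 : ∀ h, stokesFun r v h * f h =
      ∑ S : Fin r → upperU F n × lowerU F n, if h = v * stokesProd S then f h else 0 := by
    intro h
    rw [stokesFun, Nat.card_eq_fintype_card, Fintype.card_subtype, ← Finset.sum_filter,
      Finset.sum_const, nsmul_eq_mul]
  rw [Finset.sum_congr rfl fun h _ => h1 h, Finset.sum_comm]
  refine Finset.sum_congr rfl fun S _ => ?_
  rw [Finset.sum_ite_eq', if_pos (Finset.mem_univ _)]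

variable {V : Type*} [AddCommGroup V] [Module ℂ V] (ρ : Representation ℂ (GL (Fin n) F) V)

-- Inversion undoes the reversed order of the pairs and swaps the two members of each pair, so every
-- pair contributes the average of `U₊` followed on the right by that of `U₋`. These groups are
-- conjugate and have equal order.
open scoped Classical in
lemma sum_stokesProd_inv (r : ℕ) :
    ∑ S : Fin r → upperU F n × lowerU F n, ρ (stokesProd S)⁻¹ =
      ((Nat.card (upperU F n) : ℂ) ^ 2) ^ r •
        (avgOp ρ (upperU F n) * avgOp ρ (lowerU F n)) ^ r := by
  have h1 : ∀ S : Fin r → upperU F n × lowerU F n, ρ (stokesProd S)⁻¹ =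
      (List.ofFn fun i => ρ ((S i).1 : GL (Fin n) F)⁻¹ * ρ ((S i).2 : GL (Fin n) F)⁻¹).prod := by
    intro S
    rw [stokesProd, prod_ofFn_rev_inv fun i => ((S i).2 : GL (Fin n) F) * ((S i).1 : GL (Fin n) F),
      map_list_prod, List.map_ofFn]
    congr 2
    funext i
    simp [mul_inv_rev]
  rw [Finset.sum_congr rfl fun S _ => h1 S, sum_prod_ofFn fun x : upperU F n × lowerU F n =>
    ρ (x.1 : GL (Fin n) F)⁻¹ * ρ (x.2 : GL (Fin n) F)⁻¹, ← smul_pow]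
  congr 1
  rw [Fintype.sum_prod_type]
  dsimp only
  rw [← Finset.sum_mul_sum, sum_inv_eq_avgOp, sum_inv_eq_avgOp, smul_mul_smul_comm,
    (avgOp_of_conj ρ (mem_lowerU_iff (F := F) (n := n))).2, pow_two]

/-- The trace of a product of averages when `T_{w₀}²` acts by a scalar. -/
lemma trace_avgOp_pow {c : ℂ}
    (hc : permOp ρ Fin.revPerm * permOp ρ Fin.revPerm = c • avgOp ρ (upperU F n))
    (t : Fin n → Fˣ) {r : ℕ} (hr : 0 < r) :
    LinearMap.trace ℂ V ((avgOp ρ (upperU F n) * avgOp ρ (lowerU F n)) ^ r * ρ (torusGL F n t)) =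
      c ^ r * LinearMap.trace ℂ V (avgOp ρ (upperU F n) * ρ (torusGL F n t)) := by
  have hee := avgOp_idem ρ (K := upperU F n)
  have hlow : avgOp ρ (lowerU F n) =
      ρ (permGL F n Fin.revPerm) * avgOp ρ (upperU F n) * ρ (permGL F n Fin.revPerm) := by
    have := (avgOp_of_conj ρ (mem_lowerU_iff (F := F) (n := n))).1
    rwa [revGL_inv] at this
  have ht := torusGL_comm ρ t
  have h1 : avgOp ρ (upperU F n) * avgOp ρ (lowerU F n) * avgOp ρ (upperU F n) =
      c • avgOp ρ (upperU F n) := by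
    rw [← hc, hlow, permOp, heckeOp]
    simp only [mul_assoc]
    rw [← mul_assoc (avgOp ρ (upperU F n)) (avgOp ρ (upperU F n)), hee]
  set e := avgOp ρ (upperU F n)
  set f := avgOp ρ (lowerU F n)
  obtain ⟨m, rfl⟩ := Nat.exists_eq_succ_of_ne_zero hr.ne'
  -- Each interior `e * f * e` contributes a factor `c`. The last one is recovered below from the
  -- cyclicity of the trace, since `e` commutes with the torus.
  have h2 : (e * f) ^ (m + 1) = c ^ m • (e * f) := by
    clear hr
    induction m with
    | zero => simp
    | succ m ih =>
      rw [pow_succ, ih, smul_mul_assoc, ← mul_assoc, h1, smul_mul_assoc, smul_smul, pow_succ]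
  rw [Nat.succ_eq_add_one, h2, smul_mul_assoc, map_smul, smul_eq_mul, pow_succ, mul_assoc (c ^ m)]
  refine congrArg (c ^ m * ·) ?_
  calc LinearMap.trace ℂ V (e * f * ρ (torusGL F n t))
      = LinearMap.trace ℂ V (e * (e * f * ρ (torusGL F n t))) := by
        rw [← mul_assoc, ← mul_assoc, hee]
    _ = LinearMap.trace ℂ V (e * f * ρ (torusGL F n t) * e) := LinearMap.trace_mul_comm _ _ _
    _ = LinearMap.trace ℂ V (e * f * e * ρ (torusGL F n t)) := by
        rw [mul_assoc, ← ht, ← mul_assoc]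
    _ = c * LinearMap.trace ℂ V (e * ρ (torusGL F n t)) := by
        rw [h1, smul_mul_assoc, map_smul, smul_eq_mul]

/-- The characters are evaluated at inverses, which is why the inverse of the torus element appears
in the Hecke operator. -/
lemma QSet.sum_stokesFun (L : QSet F n) {r : ℕ} (hr : 0 < r) (t : Fin n → Fˣ) :
    ∑ h, stokesFun r (torusGL F n t) h * L.chiG h⁻¹ =
      L.chiInv (heckeT (upperU F n) (torusGL F n t)⁻¹) *
        (Fintype.card F : ℂ) ^ ((r : ℂ) * L.f) := by
  classical
  obtain ⟨c, hc, hcr⟩ := L.exists_scalar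
  rw [sum_stokesFun_mul r _ fun h => L.chiG h⁻¹, ← hcr, mul_pow]
  have h1 : ∀ S : Fin r → upperU F n × lowerU F n,
      L.chiG (torusGL F n t * stokesProd S)⁻¹ =
        LinearMap.trace ℂ _ (L.repG (stokesProd S)⁻¹ * L.repG (torusGL F n t⁻¹)) := by
    intro S
    rw [mul_inv_rev, ← map_mul, map_inv (torusGL F n)]
    rfl
  have h2 : L.chiInv (heckeT (upperU F n) (torusGL F n t)⁻¹) =
      LinearMap.trace ℂ _ (avgOp L.repG (upperU F n) * L.repG (torusGL F n t⁻¹)) := by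
    rw [QSet.chiInv, ← map_inv]
    exact invariantsCharacter_heckeT L.repG _ (torusGL_conj_mem_upperU t⁻¹)
  rw [Finset.sum_congr rfl fun S _ => h1 S, ← map_sum, ← Finset.sum_mul, sum_stokesProd_inv,
    smul_mul_assoc, map_smul, trace_avgOp_pow L.repG hc t⁻¹ hr, h2, smul_eq_mul]
  ring

lemma stokesCount_eq {r : ℕ} (hr : 0 < r) (t : Fin n → Fˣ) (g : GL (Fin n) F) :
    (stokesCount r (torusGL F n t) g : ℂ) = ∑ L : QSet F n, L.chiG g *
      L.chiInv (heckeT (upperU F n) (torusGL F n t)⁻¹) *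
        (Fintype.card F : ℂ) ^ ((r : ℂ) * L.f) := by
  classical
  rw [stokesCount_eq_sum, sum_conj_eq_sum_irrChar (fun L : QSet F n => L.chiG)
    (fun L => isIrrChar_character L.repG L.charPair_repG)
    (fun L L' hne => (QSet.charPair_chiG L L').trans (if_neg hne))
    (fun L => L.charPair_repG) (upperU F n) QSet.sum_chiG_one_mul _
    (fun h u hu => stokesFun_mul hr _ h hu)]
  refine Finset.sum_congr rfl fun L _ => ?_
  rw [L.sum_stokesFun hr, mul_assoc]

end Count

end WildCount

end

theorem mainTheorem5 {F : Type*} [Field F] [Fintype F] [DecidableEq F] {n r : ℕ} (hr : 0 < r)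
    (v : GL (Fin n) F) (hv : (v : Matrix (Fin n) (Fin n) F).IsDiag) (g : GL (Fin n) F) :
    (WildCount.stokesCount r v g : ℂ) =
        ∑ L : WildCount.QSet F n,
          L.chiG g * L.chiH (WildCount.heckeT (WildCount.upperU F n) v) *
            (Fintype.card F : ℂ) ^ ((r : ℂ) * L.f) ∧
    (WildCount.stokesCount r v g : ℂ) =
        ∑ L : WildCount.QSet F n,
          L.chiG g * L.chiInv (WildCount.heckeT (WildCount.upperU F n) v⁻¹) *
            (Fintype.card F : ℂ) ^ ((r : ℂ) * L.f) := by
  obtain ⟨t, rfl⟩ := WildCount.exists_torusGL_of_isDiag hv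
  have h := WildCount.stokesCount_eq hr t g
  refine ⟨h.trans (Finset.sum_congr rfl fun L _ => ?_), h⟩
  -- Passing to the dual picture of the multiplicity space replaces `v` by its inverse, so the two
  -- formulas agree term by term.
  rw [WildCount.QSet.chiH, WildCount.heckeCharacter_heckeT]
  rfl
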